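/- **Setting.** Let $M$ be a closed, connected, oriented smooth Riemannian manifold of dimension $n$ with Riemannian distance $d$, $x_0\in M$, and $\varepsilon>0$ with $2\varepsilon$ smaller than the injectivity radius. Put $U_{x_0}=\{d(x_0,z)<\varepsilon\}$, $V_{x_0}^c=\{z\in U_{x_0}: d(x_0,z)\ge \varepsilon/2\}$, $U_\Delta=\{(x,y): d(x,y)<\varepsilon\}$, $V_\Delta^c=\{(x,y)\in U_\Delta: d(x,y)\geq\varepsilon/2\}$, $\iota_{x_0}(y)=(x_0,y)$. Let $\mathcal P M$ be the space of piecewise smooth Moore paths $[0,a]\to M$, $a\ge0$, with the $W^{1,1}$ topology; $\Lambda,\Omega,\mathcal P$ are its subspaces of closed paths, of loops at $x_0$, and of paths starting at $x_0$; products are concatenations. Spaces of smooth maps carry the weak $C^\infty$ topology. $C_*(X,A)$ are the real singular cubical chains modulo degenerate cubes and cubes in $A$, with $d\sigma=\sum_{i}(-1)^{i-1}(\sigma|_{v_i=1}-\sigma|_{v_i=0})$. Let $\Theta\colon\mathcal PM\to\mathrm{Diff}(M)$ be a *transitive diffeomorphism lift*: it is continuous, $\Theta=\mathrm{id}$ on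 constant paths (of length $0$), $\Theta(\lambda\delta)=\Theta(\delta)\circ\Theta(\lambda)$, and for a path $\lambda$ from $x$ to $y$: $\Theta(\lambda)(x)=y$, $d(x,z)<\varepsilon\Rightarrow d(y,\Theta(\lambda)z)<\varepsilon$, and $d(x,z)>\varepsilon/2\Rightarrow d(y,\Theta(\lambda)z)>\varepsilon/2$. Put $e_\Omega(t,\gamma)=\gamma(ta)$ on $I\times\Omega$, $e_\Lambda(t,\gamma)=(\gamma(0),\gamma(ta))$ on $I\times\Lambda$, and $\Phi((t,\gamma),\lambda)=(t,\Theta(\lambda)\circ\gamma)$. Let $\mathcal H$ be the set of pairs $(t,\gamma)$ with $t\in\{0,1\}$ or $\gamma$ the constant loop of length $0$. By means of $\Phi$ the algebra $C_*(\Omega)$ acts on $C_*(e_\Omega^{-1}(U_{x_0}),\mathcal H\cup e_\Omega^{-1}(V^c_{x_0}))$ and $C_*(e_\Omega^{-1}(U_{x_0}),\mathcal H)$ from the right. Let $\mathrm{Emb}^+_*$ be the space of smooth orientation-preserving embeddings $U_{x_0}\to U_{x_0}$ that fix $x_0$ and map $V_{x_0}^c$ to itself, and $\mathrm{SOEmb}\subseteq\mathrm{Emb}^+_*$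 the subspace of those of the form $\exp_{x_0}\circ L\circ\exp_{x_0}^{-1}$ with $L$ a linear isometry. Let $\mathrm{hcEmb}^+_*$ be the space of smooth embeddings $y\mapsto(x,\psi(y))$ of $U_{x_0}$ into $U_\Delta$ with $x\in M$, $\psi(x_0)=x$, $\psi$ orientation-preserving, that map $V_{x_0}^c$ to $V_\Delta^c$; those with $\psi=\exp_x\circ L\circ\exp_{x_0}^{-1}$, $L$ a linear isometry, are called orthogonal. Put $\Theta_0(\lambda)=\Theta(\lambda)|_{U_{x_0}}$ for $\lambda\in\Omega$ and $\Theta_1(\lambda)(z)=(\lambda(a),\Theta(\lambda)z)$ for $\lambda\in\mathcal P$. Let $H_1\colon I\times\mathrm{Emb}^+_*\to\mathrm{Emb}^+_*$ be any continuous map with $r(\varphi):=H_1(0,\varphi)\in\mathrm{SOEmb}$, $H_1(1,\varphi)=\varphi$ and $H_1(t,r(\varphi_1)\circ\varphi_2)=r(\varphi_1)\circ H_1(t,\varphi_2)$. For $k\ge2$ put $$H_k(t_1,\dots,t_k,\varphi_1,\dots,\varphi_k)=H_1\bigl(t_1,H_{k-1}(t_2,\dots,t_k,\varphi_2,\dots,\varphi_k)\circ\varphi_1\bigr).$$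 **The maps $q_k$.** Let $\tau_{x_0}\in C^n(U_{x_0},V_{x_0}^c;\mathbb R)$ be a relative cocycle (for instance a Thom class) that is $\mathrm{SOEmb}$-invariant: for all cubes $\sigma\colon I^i\to U_{x_0}$ and $\varphi\colon I^j\to\mathrm{SOEmb}$ it takes the same value on the cubes $(v,w)\mapsto\varphi(w)(\sigma(v))$ and $(v,w)\mapsto\sigma(v)$. Let $q_1$ be the cap product with $e_\Omega^*\tau_{x_0}$, defined by the Serre diagonal $\Delta\sigma=\sum_{J\sqcup K}\mathrm{sgn}(J,K)\,\sigma|_{I^J\times0^K}\otimes\sigma|_{1^J\times I^K}$, $\mathrm{sgn}(J,K)=(-1)^{\#\{(j,k)\in J\times K:\,j>k\}}$. For $k\ge1$ and cubes $\alpha,\lambda_1,\dots,\lambda_k$ with $D$ coordinates in total put $$q_{k+1}(\alpha\otimes\lambda_1\otimes\dots\otimes\lambda_k)=\sum_{J\sqcup K=\{1,\dots,D\}}\mathrm{sgn}(J,K)\,(-1)^{s(J)}\;\tau_{x_0}(F_J)\;\cdot\;\Phi(\alpha,\lambda_1\cdots\lambda_k)|_{1^J\times I^K}.$$ Here $F_J=H_k(t_1,\dots,t_k,\Theta_0\lambda_1',\dots,\Theta_0\lambda_k')(e_\Omega(\alpha'))$,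 where $\alpha',\lambda'_i$ are the faces of $\alpha,\lambda_i$ in $(\alpha\times\lambda_1\times\dots\times\lambda_k)|_{I^J\times0^K}$; it is a cube in the coordinates of $\alpha'$, then $t_1$, then those of $\lambda_1'$, then $t_2$, then those of $\lambda_2'$, and so on. The number $s(J)$ is the sum over $i=1,\dots,k$ of the number of elements of $J$ that are coordinates of $\alpha,\lambda_1,\dots,\lambda_{i-1}$. **Theorem.** (1) $C_*(\Omega)$ is a differential graded algebra, and $\Phi$ makes $C_*(e_\Omega^{-1}(U_{x_0}),\mathcal H\cup e_\Omega^{-1}(V^c_{x_0}))$ and $C_*(e_\Omega^{-1}(U_{x_0}),\mathcal H)$ into strict right differential graded modules over it. (2) The $q_k$, $k\ge1$, are well defined on (normalized, relative) chains, $q_{N+1}$ sends inputs of total degree $i$ to chains of degree $i+N-n$, and they form a morphism of $A_\infty$-modules over $C_*(\Omega)$ $$\boldsymbol q\colon C_*(e_\Omega^{-1}(U_{x_0}),\mathcal H\cup e_\Omega^{-1}(V_{x_0}^c))\to C_{-n+*}(e_\Omega^{-1}(U_{x_0}),\mathcal H),$$ that is, for all $N\ge0$ (where for $N=0$ the right-hand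 side is $0$, and $\mu$ is the product of $C_*(\Omega)$) $$q_{N+1}\circ d+(-1)^{N+1+n}d\circ q_{N+1}=(-1)^{N+1}q_N\circ(\Phi\otimes\mathrm{id}^{\otimes N-1})-\Phi\circ(q_N\otimes\mathrm{id})+\sum_{r=1}^{N-1}(-1)^{N+1+r}q_N\circ(\mathrm{id}^{\otimes r}\otimes\mu\otimes\mathrm{id}^{\otimes N-1-r}).$$ (3) (Free loops.) Let moreover $H_1^\Lambda\colon I\times\mathrm{hcEmb}^+_*\to\mathrm{hcEmb}^+_*$ be continuous with $r(\varphi):=H^\Lambda_1(0,\varphi)$ orthogonal, $H^\Lambda_1(1,\varphi)=\varphi$, $H^\Lambda_1(t,r(\varphi_1)\circ\varphi_2)=r(\varphi_1)\circ H_1(t,\varphi_2)$ for $\varphi_2\in\mathrm{Emb}^+_*$, preserving the constant first component, and with $H_1^\Lambda(t,\iota_{x_0}\circ\varphi)=\iota_{x_0}\circ H_1(t,\varphi)$. Let $\tau_\Delta\in C^n(U_\Delta,V_\Delta^c;\mathbb R)$ be a relative cocycle that takes the same value on $(v,w)\mapsto\varphi(w)(\sigma(v))$ and $(v,w)\mapsto\iota_{x_0}(\sigma(v))$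 for all cubes $\sigma$ of $U_{x_0}$ and all cubes $\varphi$ of orthogonal half-constant embeddings. Put $\tau_{x_0}=\iota_{x_0}^*\tau_\Delta$, and let $q_k$ be the maps above for this $\tau_{x_0}$. Define $H_k^\Lambda$ by $H_k^\Lambda(t_1,\dots,t_k,\varphi_1,\dots,\varphi_k)=H_1^\Lambda(t_1,H_{k-1}^\Lambda(t_2,\dots,t_k,\varphi_2,\dots,\varphi_k)\circ\varphi_1)$, and for $k\ge1$ define $$\eta_{k+1}\colon C_*(e_\Omega^{-1}(U_{x_0}),\mathcal H\cup e_\Omega^{-1}(V_{x_0}^c))\otimes C_*(\Omega)^{\otimes k-1}\otimes C_*(\mathcal P)\to C_{k-n+*}(e_\Lambda^{-1}(U_\Delta),\mathcal H)$$ by the formula for $q_{k+1}$ with $\tau_\Delta$, $H_k^\Lambda$ and $\Theta_1(\lambda_k)$ in place of $\tau_{x_0}$, $H_k$ and $\Theta_0(\lambda_k)$. Then the $q_k$ form a morphism of $A_\infty$-modules as in (2), the $\eta_{k+1}$ are well defined, and they form a coherent chain homotopy for the chain map of degree $-n$ $$\eta_1=e_\Lambda^*\tau_\Delta\cap\colon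 C_*(e_\Lambda^{-1}(U_\Delta),\mathcal H\cup e_\Lambda^{-1}(V_\Delta^c))\to C_{-n+*}(e_\Lambda^{-1}(U_\Delta),\mathcal H).$$ That is, for all $N\geq1$ they satisfy the equation in (2) with $\eta_{N+1}$ for $q_{N+1}$, where on the right the last input lies in $C_*(\mathcal P)$, $q_N$ is used in the term $\Phi\circ(q_N\otimes\mathrm{id})$, and $\eta_N$ in all the other terms; and they restrict to the $q_k$: $\eta_{k+1}=q_{k+1}$ if the last input lies in $C_*(\Omega)$, and $\eta_1=q_1$ on $C_*(e_\Omega^{-1}(U_{x_0}),\mathcal H\cup e_\Omega^{-1}(V_{x_0}^c))$ (after inclusion into the chains for $\Lambda$). -/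

import Mathlib

open Set Manifold Bundle MeasureTheory Topology TopologicalSpace
open scoped ContDiff unitInterval

namespace LoopCap

universe u

set_option linter.unusedSectionVars false

/-! ### Cubical chains -/

section Cubical

/-- A singular cube of `X`. A map `I ^ dim → X` is recorded as a continuous function of a sequence
of coordinates that depends on the first `dim` coordinates only. -/
@[ext] structure Cube (X : Type*) [TopologicalSpace X] where
  dim : ℕ
  toFun : (ℕ → I) → X
  continuous : Continuous toFun
  depends : ∀ v w : ℕ → I, (∀ i < dim, v i = w i) → toFun v = toFun w

variable {X Y Z : Type*} [TopologicalSpace X] [TopologicalSpace Y] [TopologicalSpace Z]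

/-- The cube does not depend on one of its coordinates. -/
def Cube.IsDegenerate (κ : Cube X) : Prop :=
  ∃ i < κ.dim, ∀ v w : ℕ → I, (∀ j, j ≠ i → v j = w j) → κ.toFun v = κ.toFun w

/-- The cubes that vanish in the normalized chains of the pair `(X, A)`. -/
def Cube.IsNull (A : Set X) (κ : Cube X) : Prop :=
  κ.IsDegenerate ∨ ∀ v, κ.toFun v ∈ A

/-- The span of the null cubes. -/
noncomputable def nullChains (A : Set X) : Submodule ℝ (Cube X →₀ ℝ) :=
  Submodule.span ℝ {c | ∃ κ : Cube X, κ.IsNull A ∧ c = Finsupp.single κ 1}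

/-- Normalized real cubical chains of the pair `(X, A)` in all degrees together. Absolute chains
are the case `A = ∅`. -/
abbrev Chains (A : Set X) : Type _ := (Cube X →₀ ℝ) ⧸ nullChains A

/-- The class of a cube. -/
noncomputable def Cube.cls (A : Set X) (κ : Cube X) : Chains A :=
  (nullChains A).mkQ (Finsupp.single κ 1)

open Classical in
/-- The class of the `k`-cube `(v 0, …, v (k-1)) ↦ f v`. -/
noncomputable def cubeClass (A : Set X) (k : ℕ) (f : (ℕ → I) → X) : Chains A :=
  if h : Continuous f ∧ ∀ v w : ℕ → I, (∀ i < k, v i = w i) → f v = f w then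
    Cube.cls A ⟨k, f, h.1, h.2⟩ else 0

/-- The chains of degree `i`. -/
noncomputable def chainsOfDegree (A : Set X) (i : ℤ) : Submodule ℝ (Chains A) :=
  Submodule.span ℝ {c | ∃ κ : Cube X, (κ.dim : ℤ) = i ∧ c = κ.cls A}

/-- Linear extension from cubes. -/
noncomputable def liftChains (A : Set X) {V : Type*} [AddCommGroup V] [Module ℝ V]
    (f : Cube X → V) (hf : ∀ κ, κ.IsNull A → f κ = 0) : Chains A →ₗ[ℝ] V :=
  (nullChains A).liftQ (Finsupp.lift V ℝ (Cube X) f) (by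
    rw [nullChains, Submodule.span_le]
    rintro _ ⟨κ, hκ, rfl⟩
    simp [hf κ hκ])

theorem liftChains_cls (A : Set X) {V : Type*} [AddCommGroup V] [Module ℝ V]
    (f : Cube X → V) (hf : ∀ κ, κ.IsNull A → f κ = 0) (κ : Cube X) :
    liftChains A f hf (κ.cls A) = f κ := by
  simp [liftChains, Cube.cls]

theorem chains_hom_ext {A : Set X} {V : Type*} [AddCommGroup V] [Module ℝ V]
    {f g : Chains A →ₗ[ℝ] V} (h : ∀ κ : Cube X, f (κ.cls A) = g (κ.cls A)) : f = g := by
  refine Submodule.linearMap_qext _ (Finsupp.lhom_ext' fun κ => LinearMap.ext_ring ?_)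
  simpa [Cube.cls] using h κ

theorem cls_eq_zero {A : Set X} {κ : Cube X} (h : κ.IsNull A) : κ.cls A = 0 := by
  rw [Cube.cls, Submodule.mkQ_apply, Submodule.Quotient.mk_eq_zero]
  exact Submodule.subset_span ⟨κ, h, rfl⟩

theorem cubeClass_eq_zero_of_degenerate {A : Set X} {k : ℕ} {f : (ℕ → I) → X} {i : ℕ} (hi : i < k)
    (h : ∀ v w : ℕ → I, (∀ j, j ≠ i → v j = w j) → f v = f w) : cubeClass A k f = 0 := by
  unfold cubeClass
  split_ifs with hc
  · exact cls_eq_zero (Or.inl ⟨i, hi, h⟩)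
  · rfl

theorem cubeClass_eq_zero_of_mem {A : Set X} {k : ℕ} {f : (ℕ → I) → X} (h : ∀ v, f v ∈ A) :
    cubeClass A k f = 0 := by
  unfold cubeClass
  split_ifs with hc
  · exact cls_eq_zero (Or.inr h)
  · rfl

/-- Insert the value `e` as the `i`-th coordinate. -/
def insertCoord (i : ℕ) (e : I) (v : ℕ → I) : ℕ → I :=
  fun j => if j < i then v j else if j = i then e else v (j - 1)

/-- Drop the first `s` coordinates. -/
def shift (s : ℕ) (v : ℕ → I) : ℕ → I := fun j => v (j + s)

/-- The boundary `∑ i, (-1) ^ i (κ(…, 1, …) - κ(…, 0, …))` of a cube. -/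
noncomputable def cubeBoundary (A : Set X) (κ : Cube X) : Chains A :=
  ∑ i ∈ Finset.range κ.dim, (-1 : ℝ) ^ i •
    (cubeClass A (κ.dim - 1) (fun v => κ.toFun (insertCoord i 1 v)) -
      cubeClass A (κ.dim - 1) (fun v => κ.toFun (insertCoord i 0 v)))

theorem face_eq_zero {A : Set X} {κ : Cube X} {l : ℕ} (hl : l < κ.dim)
    (h : ∀ v w : ℕ → I, (∀ j, j ≠ l → v j = w j) → κ.toFun v = κ.toFun w)
    {i : ℕ} (hi : i < κ.dim) (hil : i ≠ l) (e : I) :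
    cubeClass A (κ.dim - 1) (fun v => κ.toFun (insertCoord i e v)) = 0 := by
  rcases lt_or_gt_of_ne hil with hlt | hlt
  · refine cubeClass_eq_zero_of_degenerate (i := l - 1) (by omega) fun v w hvw => h _ _ ?_
    intro j hj
    unfold insertCoord
    split_ifs with h1 h2
    · exact hvw _ (by omega)
    · rfl
    · exact hvw _ (by omega)
  · refine cubeClass_eq_zero_of_degenerate (i := l) (by omega) fun v w hvw => h _ _ ?_
    intro j hj
    unfold insertCoord
    split_ifs with h1 h2
    · exact hvw _ (by omega)
    · rfl
    · exact hvw _ (by omega)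

theorem cubeBoundary_eq_zero {A : Set X} {κ : Cube X} (h : κ.IsNull A) :
    cubeBoundary A κ = 0 := by
  refine Finset.sum_eq_zero fun i hi => ?_
  rw [Finset.mem_range] at hi
  rcases h with ⟨l, hl, h⟩ | h
  · by_cases hil : i = l
    · subst hil
      rw [smul_eq_zero]; right
      rw [sub_eq_zero]
      congr 1
      funext v
      refine h _ _ fun j hj => ?_
      unfold insertCoord
      simp [hj]
    · rw [face_eq_zero hl h hi hil, face_eq_zero hl h hi hil, sub_self, smul_zero]
  · rw [cubeClass_eq_zero_of_mem (fun v => h _), cubeClass_eq_zero_of_mem (fun v => h _),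
      sub_self, smul_zero]

/-- The differential of the normalized cubical chains of `(X, A)`. -/
noncomputable def chainD (A : Set X) : Chains A →ₗ[ℝ] Chains A :=
  liftChains A (cubeBoundary A) fun _ => cubeBoundary_eq_zero

/-- The chain map induced by a map of pairs. -/
noncomputable def pushChains (A : Set X) (B : Set Y) (f : X → Y) (hf : MapsTo f A B) :
    Chains A →ₗ[ℝ] Chains B :=
  liftChains A (fun κ => cubeClass B κ.dim fun v => f (κ.toFun v)) (by
    rintro κ (⟨i, hi, h⟩ | h)
    · exact cubeClass_eq_zero_of_degenerate hi fun v w hvw => congrArg f (h v w hvw)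
    · exact cubeClass_eq_zero_of_mem fun v => hf (h v))

/-- The function underlying the cross product `κ × τ` followed by `f : X × Y → Z`. -/
def crossFun (f : X → Y → Z) (κ : Cube X) (τ : Cube Y) : (ℕ → I) → Z :=
  fun v => f (κ.toFun v) (τ.toFun (shift κ.dim v))

/-- The bilinear map `κ ⊗ τ ↦ f_* (κ × τ)` on chains induced by a map
`f : (X, A) × Y → (Z, C)`. -/
noncomputable def crossChains (A : Set X) (C : Set Z) (f : X → Y → Z)
    (hf : ∀ x ∈ A, ∀ y, f x y ∈ C) :
    Chains A →ₗ[ℝ] Chains (∅ : Set Y) →ₗ[ℝ] Chains C :=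
  liftChains A (fun κ => liftChains ∅
    (fun τ => cubeClass C (κ.dim + τ.dim) (crossFun f κ τ)) (by
      rintro τ (⟨i, hi, h⟩ | h)
      · refine cubeClass_eq_zero_of_degenerate (i := i + κ.dim) (by omega) fun v w hvw => ?_
        unfold crossFun
        rw [κ.depends v w fun j hj => hvw j (by omega),
          h (shift κ.dim v) (shift κ.dim w) fun j hj => hvw _ (by omega)]
      · exact absurd (h fun _ => 0) (by simp))) (by
    intro κ hκ
    refine chains_hom_ext fun τ => ?_
    rw [liftChains_cls, LinearMap.zero_apply]
    rcases hκ with ⟨i, hi, h⟩ | h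
    · refine cubeClass_eq_zero_of_degenerate (i := i) (by omega) fun v w hvw => ?_
      unfold crossFun
      rw [h v w hvw]
      congr 2
      funext j
      exact hvw _ (by omega)
    · exact cubeClass_eq_zero_of_mem fun v => hf _ (h v) _)

/-- Of a cube in the coordinates `0, 1, 2, …`, the face on which the coordinates in `J` are free
(and renumbered in order) and all other coordinates are `0`. -/
def frontFace (J : Finset ℕ) (f : (ℕ → I) → X) : (ℕ → I) → X :=
  fun v => f fun j => if j ∈ J then v (J.filter (· < j)).card else 0

/-- The face on which the coordinates in `K` are free (and renumbered in order) and all other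
coordinates are `1`. -/
def backFace (K : Finset ℕ) (f : (ℕ → I) → X) : (ℕ → I) → X :=
  fun v => f fun j => if j ∈ K then v (K.filter (· < j)).card else 1

/-- The sign `(-1) ^ #{(j, k) ∈ J × K | j > k}` of a shuffle. -/
noncomputable def shuffleSign (J K : Finset ℕ) : ℝ :=
  (-1) ^ ((J ×ˢ K).filter fun p => p.2 < p.1).card

/-- The cap product with `e ^* τ` on a cube, `(τ ∘ e ⊗ id) Δ κ`, where `τ` is a relative cochain of
`(Y, B)` and `Δ` is the Serre diagonal
`Δ κ = ∑ sgn(J, K) κ|_{I ^ J × 0 ^ K} ⊗ κ|_{1 ^ J × I ^ K}`. -/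
noncomputable def capCube {B : Set Y} (τ : Chains B →ₗ[ℝ] ℝ) (e : X → Y) (C : Set X)
    (κ : Cube X) : Chains C :=
  ∑ J ∈ (Finset.range κ.dim).powerset,
    (shuffleSign J (Finset.range κ.dim \ J) *
      τ (cubeClass B J.card fun v => e (frontFace J κ.toFun v))) •
    cubeClass C (κ.dim - J.card) (backFace (Finset.range κ.dim \ J) κ.toFun)

/-- `τ` is a normalized relative cocycle of degree `n` on the pair `(X, A)`. -/
structure IsRelCocycle (n : ℕ) {A : Set X} (τ : Chains A →ₗ[ℝ] ℝ) : Prop where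
  degree : ∀ κ : Cube X, κ.dim ≠ n → τ (κ.cls A) = 0
  cocycle : ∀ c, τ (chainD A c) = 0

end Cubical

/-! ### Differential graded modules and their `A_∞`-morphisms -/

section Algebra

variable {A F G P F₁ E₁ F₂ E₂ : Type*}
  [AddCommGroup A] [Module ℝ A] [AddCommGroup F] [Module ℝ F] [AddCommGroup G] [Module ℝ G]
  [AddCommGroup P] [Module ℝ P] [AddCommGroup F₁] [Module ℝ F₁] [AddCommGroup E₁] [Module ℝ E₁]
  [AddCommGroup F₂] [Module ℝ F₂] [AddCommGroup E₂] [Module ℝ E₂]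

/-- A chain complex: a direct sum decomposition and a differential of degree `-1`. -/
structure IsComplex (gr : ℤ → Submodule ℝ F) (d : F →ₗ[ℝ] F) : Prop where
  internal : DirectSum.IsInternal gr
  degree : ∀ i, ∀ x ∈ gr i, d x ∈ gr (i - 1)
  sq_zero : ∀ x, d (d x) = 0

/-- A differential graded algebra. -/
structure IsDGAlgebra (gr : ℤ → Submodule ℝ A) (d : A →ₗ[ℝ] A) (mul : A →ₗ[ℝ] A →ₗ[ℝ] A)
    (one : A) : Prop extends IsComplex gr d where
  one_mem : one ∈ gr 0
  mul_mem : ∀ i j, ∀ x ∈ gr i, ∀ y ∈ gr j, mul x y ∈ gr (i + j)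
  one_mul : ∀ x, mul one x = x
  mul_one : ∀ x, mul x one = x
  mul_assoc : ∀ x y z, mul (mul x y) z = mul x (mul y z)
  leibniz : ∀ i, ∀ x ∈ gr i, ∀ y, d (mul x y) = mul (d x) y + (-1 : ℝ) ^ i • mul x (d y)

/-- A (strict) right differential graded module over `(A, mul, one)`. -/
structure IsDGModule (grA : ℤ → Submodule ℝ A) (dA : A →ₗ[ℝ] A) (mul : A →ₗ[ℝ] A →ₗ[ℝ] A)
    (one : A) (gr : ℤ → Submodule ℝ F) (d : F →ₗ[ℝ] F) (act : F →ₗ[ℝ] A →ₗ[ℝ] F) : Prop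
    extends IsComplex gr d where
  act_mem : ∀ i j, ∀ x ∈ gr i, ∀ a ∈ grA j, act x a ∈ gr (i + j)
  act_one : ∀ x, act x one = x
  act_mul : ∀ x a b, act (act x a) b = act x (mul a b)
  leibniz : ∀ i, ∀ x ∈ gr i, ∀ a, d (act x a) = act (d x) a + (-1 : ℝ) ^ i • act x (dA a)

/-- The composite of `q` with the differential of `F ⊗ A ^ {⊗ N}`, evaluated on
`x ⊗ a 0 ⊗ … ⊗ a (N - 1)`, where `x` has degree `i` and `a j` has degree `l j`. -/
noncomputable def tensorD (dF : F →ₗ[ℝ] F) (dA : A →ₗ[ℝ] A) {N : ℕ}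
    (q : F →ₗ[ℝ] MultilinearMap ℝ (fun _ : Fin N => A) G) (i : ℤ) (l : Fin N → ℤ)
    (x : F) (a : Fin N → A) : G :=
  q (dF x) a + ∑ r : Fin N, (-1 : ℝ) ^ (i + ∑ s ∈ Finset.univ.filter (· < r), l s) •
    q x (Function.update a r (dA (a r)))

/-- The terms of the `A_∞`-equation without differentials. -/
noncomputable def ainftyRHS (mul : A →ₗ[ℝ] A →ₗ[ℝ] A) (actF : F →ₗ[ℝ] A →ₗ[ℝ] F)
    (actG : G →ₗ[ℝ] A →ₗ[ℝ] G) (q : ∀ k, F →ₗ[ℝ] MultilinearMap ℝ (fun _ : Fin k => A) G) :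
    (N : ℕ) → F → (Fin N → A) → G
  | 0, _, _ => 0
  | N + 1, x, a =>
      (-1 : ℝ) ^ (N + 2) • q N (actF x (a 0)) (Fin.tail a)
      - actG (q N x (Fin.init a)) (a (Fin.last N))
      + ∑ r : Fin N, (-1 : ℝ) ^ (N + 2 + (r + 1 : ℕ)) •
          q N x (Fin.contractNth r.castSucc (fun b c => mul b c) a)

/-- The maps `q k : F ⊗ A ^ {⊗ k} → G` (the component with `k + 1` inputs) are the components of a
morphism of `A_∞`-modules `F → G` of degree `m`, that is, from `F` to `G` with degrees shifted by
`m` and differential `(-1) ^ m d`. -/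
structure IsAInfinityMorphism (grA : ℤ → Submodule ℝ A) (dA : A →ₗ[ℝ] A)
    (mul : A →ₗ[ℝ] A →ₗ[ℝ] A) (grF : ℤ → Submodule ℝ F) (dF : F →ₗ[ℝ] F)
    (actF : F →ₗ[ℝ] A →ₗ[ℝ] F) (grG : ℤ → Submodule ℝ G) (dG : G →ₗ[ℝ] G)
    (actG : G →ₗ[ℝ] A →ₗ[ℝ] G) (m : ℤ)
    (q : ∀ k, F →ₗ[ℝ] MultilinearMap ℝ (fun _ : Fin k => A) G) : Prop where
  degree : ∀ (N : ℕ) (i : ℤ) (l : Fin N → ℤ), ∀ x ∈ grF i, ∀ a : Fin N → A,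
    (∀ r, a r ∈ grA (l r)) → q N x a ∈ grG (i + ∑ r, l r + N + m)
  equation : ∀ (N : ℕ) (i : ℤ) (l : Fin N → ℤ), ∀ x ∈ grF i, ∀ a : Fin N → A,
    (∀ r, a r ∈ grA (l r)) →
    tensorD dF dA (q N) i l x a + (-1 : ℝ) ^ ((N : ℤ) + 1 + m) • dG (q N x a) =
      ainftyRHS mul actF actG q N x a

/-- The terms without differentials in the equation of a coherent chain homotopy with inputs
`x ∈ F₁`, `a 0, …, a (k - 1) ∈ A` and `p ∈ P`. -/
noncomputable def coherentRHS (mul : A →ₗ[ℝ] A →ₗ[ℝ] A) (mulP : A →ₗ[ℝ] P →ₗ[ℝ] P)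
    (act₁ : F₁ →ₗ[ℝ] A →ₗ[ℝ] F₁) (actP₁ : F₁ →ₗ[ℝ] P →ₗ[ℝ] E₁) (actP₂ : F₂ →ₗ[ℝ] P →ₗ[ℝ] E₂)
    (f : E₁ →ₗ[ℝ] E₂) (q : ∀ k, F₁ →ₗ[ℝ] MultilinearMap ℝ (fun _ : Fin k => A) F₂)
    (η : ∀ k, F₁ →ₗ[ℝ] MultilinearMap ℝ (fun _ : Fin k => A) (P →ₗ[ℝ] E₂)) :
    (k : ℕ) → F₁ → (Fin k → A) → P → E₂
  | 0, x, a, p => f (actP₁ x p) - actP₂ (q 0 x a) p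
  | k + 1, x, a, p =>
      (-1 : ℝ) ^ (k + 3) • η k (act₁ x (a 0)) (Fin.tail a) p
      - actP₂ (q (k + 1) x a) p
      + (∑ r : Fin k, (-1 : ℝ) ^ (k + 3 + (r + 1 : ℕ)) •
          η k x (Fin.contractNth r.castSucc (fun b c => mul b c) a) p
        + (-1 : ℝ) ^ (k + 3 + (k + 1)) • η k x (Fin.init a) (mulP (a (Fin.last k)) p))

/-- The maps `η k : F₁ ⊗ A ^ {⊗ k} ⊗ P → E₂` (the component with `k + 2` inputs) form a coherent
chain homotopy for the map `f : E₁ → E₂` of degree `m`, with restriction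
`q k : F₁ ⊗ A ^ {⊗ k} → F₂` to the fibres. -/
structure IsCoherentChainHomotopy (grA : ℤ → Submodule ℝ A) (dA : A →ₗ[ℝ] A)
    (mul : A →ₗ[ℝ] A →ₗ[ℝ] A) (grP : ℤ → Submodule ℝ P) (dP : P →ₗ[ℝ] P)
    (mulP : A →ₗ[ℝ] P →ₗ[ℝ] P) (iP : A →ₗ[ℝ] P)
    (grF₁ : ℤ → Submodule ℝ F₁) (dF₁ : F₁ →ₗ[ℝ] F₁) (act₁ : F₁ →ₗ[ℝ] A →ₗ[ℝ] F₁)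
    (grE₁ : ℤ → Submodule ℝ E₁) (dE₁ : E₁ →ₗ[ℝ] E₁) (actP₁ : F₁ →ₗ[ℝ] P →ₗ[ℝ] E₁)
    (i₁ : F₁ →ₗ[ℝ] E₁) (grE₂ : ℤ → Submodule ℝ E₂) (dE₂ : E₂ →ₗ[ℝ] E₂)
    (actP₂ : F₂ →ₗ[ℝ] P →ₗ[ℝ] E₂) (i₂ : F₂ →ₗ[ℝ] E₂) (m : ℤ) (f : E₁ →ₗ[ℝ] E₂)
    (q : ∀ k, F₁ →ₗ[ℝ] MultilinearMap ℝ (fun _ : Fin k => A) F₂)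
    (η : ∀ k, F₁ →ₗ[ℝ] MultilinearMap ℝ (fun _ : Fin k => A) (P →ₗ[ℝ] E₂)) : Prop where
  map_degree : ∀ i, ∀ x ∈ grE₁ i, f x ∈ grE₂ (i + m)
  chain_map : ∀ x, f (dE₁ x) = (-1 : ℝ) ^ m • dE₂ (f x)
  degree : ∀ (k : ℕ) (i : ℤ) (l : Fin k → ℤ) (j : ℤ), ∀ x ∈ grF₁ i, ∀ a : Fin k → A,
    (∀ r, a r ∈ grA (l r)) → ∀ p ∈ grP j, η k x a p ∈ grE₂ (i + ∑ r, l r + j + (k + 1) + m)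
  equation : ∀ (k : ℕ) (i : ℤ) (l : Fin k → ℤ), ∀ x ∈ grF₁ i, ∀ a : Fin k → A,
    (∀ r, a r ∈ grA (l r)) → ∀ p : P,
    tensorD dF₁ dA (η k) i l x a p + (-1 : ℝ) ^ (i + ∑ r, l r) • η k x a (dP p)
        + (-1 : ℝ) ^ ((k : ℤ) + 2 + m) • dE₂ (η k x a p) =
      coherentRHS mul mulP act₁ actP₁ actP₂ f q η k x a p
  restrict_map : ∀ x, f (i₁ x) = i₂ (q 0 x Fin.elim0)
  restrict : ∀ (k : ℕ) (x : F₁) (a : Fin k → A) (b : A),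
    η k x a (iP b) = i₂ (q (k + 1) x (Fin.snoc a b))

end Algebra


/-! ### Spaces of smooth maps -/

section SmoothMaps

/-- A smooth manifold together with its model. -/
structure MfdData where
  E : Type
  [normedAddCommGroup : NormedAddCommGroup E]
  [normedSpace : NormedSpace ℝ E]
  H : Type
  [topologicalSpaceModel : TopologicalSpace H]
  model : ModelWithCorners ℝ E H
  X : Type u
  [topologicalSpace : TopologicalSpace X]
  [chartedSpace : ChartedSpace H X]
  [isManifold : IsManifold model ∞ X]

attribute [instance] MfdData.normedAddCommGroup MfdData.normedSpace MfdData.topologicalSpaceModel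
  MfdData.topologicalSpace MfdData.chartedSpace MfdData.isManifold

/-- The tangent bundle as a manifold. -/
noncomputable def MfdData.tangent (Z : MfdData.{u}) : MfdData.{u} :=
  haveI : IsManifold Z.model (∞ + 1) Z.X := Z.isManifold
  { E := Z.E × Z.E
    H := ModelProd Z.H Z.E
    model := Z.model.tangent
    X := TangentBundle Z.model Z.X }

/-- The `k`-fold iterated tangent bundle. -/
noncomputable def MfdData.iterTangent : ℕ → MfdData.{u} → MfdData.{u}
  | 0, Z => Z
  | k + 1, Z => iterTangent k Z.tangent

/-- The `k`-fold iterated tangent map of `f`. -/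
noncomputable def iterTangentMap : (k : ℕ) → (Z W : MfdData.{u}) → (Z.X → W.X) →
    (Z.iterTangent k).X → (W.iterTangent k).X
  | 0, _, _, f => f
  | k + 1, Z, W, f => iterTangentMap k Z.tangent W.tangent (tangentMap Z.model W.model f)

variable {E F : Type} [NormedAddCommGroup E] [NormedSpace ℝ E] [NormedAddCommGroup F]
  [NormedSpace ℝ F] {H G : Type} [TopologicalSpace H] [TopologicalSpace G]
  {J : ModelWithCorners ℝ E H} {J' : ModelWithCorners ℝ F G} {X Y : Type u}
  [TopologicalSpace X] [TopologicalSpace Y] [ChartedSpace H X] [ChartedSpace G Y]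
  [IsManifold J ∞ X] [IsManifold J' ∞ Y]

/-- The weak (compact-open) `C^∞` topology: a subbasis is given by the conditions that the `k`-fold
tangent map sends a compact set into an open set. -/
instance smoothTopology : TopologicalSpace C^∞⟮J, X; J', Y⟯ :=
  generateFrom {B | ∃ (k : ℕ) (K : Set ((MfdData.mk E H J X).iterTangent k).X)
    (W : Set ((MfdData.mk F G J' Y).iterTangent k).X), IsCompact K ∧ IsOpen W ∧
    B = {f : C^∞⟮J, X; J', Y⟯ |
      MapsTo (iterTangentMap k (.mk E H J X) (.mk F G J' Y) f) K W}}

end SmoothMaps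

/-! ### Moore paths -/

section Paths

variable {n : ℕ} {M : Type u} [TopologicalSpace M] [ChartedSpace (EuclideanSpace ℝ (Fin n)) M]

variable (n M) in
/-- A piecewise smooth path `[0, len] → M`, extended to the real line by constants. -/
@[ext] structure MoorePath where
  len : ℝ
  len_nonneg : 0 ≤ len
  toFun : ℝ → M
  continuous : Continuous toFun
  piecewise : ∃ S : Finset ℝ, ∀ s t, s ≤ t → Disjoint (Ioo s t) (S : Set ℝ) →
    ContMDiffOn 𝓘(ℝ, ℝ) (𝓡 n) ∞ toFun (Icc s t)
  left : ∀ t ≤ 0, toFun t = toFun 0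
  right : ∀ t, len ≤ t → toFun t = toFun len

namespace MoorePath

/-- The starting point. -/
def src (γ : MoorePath n M) : M := γ.toFun 0

/-- The endpoint. -/
def tgt (γ : MoorePath n M) : M := γ.toFun γ.len

/-- The constant path of length `0`. -/
def const (x : M) : MoorePath n M where
  len := 0
  len_nonneg := le_rfl
  toFun := fun _ => x
  continuous := continuous_const
  piecewise := ⟨∅, fun _ _ _ _ => contMDiffOn_const⟩
  left := fun _ _ => rfl
  right := fun _ _ => rfl

/-- The image of a path under a smooth map. -/
noncomputable def map (f : C^∞⟮𝓡 n, M; 𝓡 n, M⟯) (γ : MoorePath n M) : MoorePath n M where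
  len := γ.len
  len_nonneg := γ.len_nonneg
  toFun := fun t => f (γ.toFun t)
  continuous := f.contMDiff.continuous.comp γ.continuous
  piecewise := by
    obtain ⟨S, hS⟩ := γ.piecewise
    exact ⟨S, fun s t hst hd => f.contMDiff.comp_contMDiffOn (hS s t hst hd)⟩
  left := fun t ht => congrArg f (γ.left t ht)
  right := fun t ht => congrArg f (γ.right t ht)

/-- Concatenation of composable paths; the lengths add up. -/
noncomputable def concat (γ δ : MoorePath n M) (h : γ.tgt = δ.src) : MoorePath n M where
  len := γ.len + δ.len
  len_nonneg := add_nonneg γ.len_nonneg δ.len_nonneg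
  toFun := fun t => if t ≤ γ.len then γ.toFun t else δ.toFun (t - γ.len)
  continuous := by
    refine Continuous.if_le γ.continuous (δ.continuous.comp (continuous_id.sub continuous_const))
      continuous_id continuous_const fun t ht => ?_
    have ht' : t = γ.len := ht
    simpa [ht', src, tgt] using h
  piecewise := by
    classical
    obtain ⟨S, hS⟩ := γ.piecewise
    obtain ⟨T, hT⟩ := δ.piecewise
    refine ⟨S ∪ {γ.len} ∪ T.image (· + γ.len), fun s t hst hd => ?_⟩
    simp only [Finset.coe_union, Finset.coe_singleton, Finset.coe_image, disjoint_union_right]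
      at hd
    obtain ⟨⟨hd1, hd2⟩, hd3⟩ := hd
    rcases le_or_gt t γ.len with htl | htl
    · refine (hS s t hst hd1).congr fun u hu => ?_
      simp [hu.2.trans htl]
    · have hsl : γ.len ≤ s := by
        by_contra hlt
        exact disjoint_singleton_right.1 hd2 ⟨not_le.1 hlt, htl⟩
      have hδ : ContMDiffOn 𝓘(ℝ, ℝ) (𝓡 n) ∞ δ.toFun (Icc (s - γ.len) (t - γ.len)) := by
        refine hT _ _ (by linarith) (disjoint_left.2 fun u hu huT => ?_)
        exact disjoint_left.1 hd3 (show u + γ.len ∈ Ioo s t from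
          ⟨by linarith [hu.1], by linarith [hu.2]⟩) ⟨u, huT, rfl⟩
      have hsub : ContMDiff 𝓘(ℝ, ℝ) 𝓘(ℝ, ℝ) ∞ fun u : ℝ => u - γ.len :=
        (contDiff_id.sub contDiff_const).contMDiff
      refine (hδ.comp hsub.contMDiffOn fun u hu => ⟨by linarith [hu.1], by linarith [hu.2]⟩).congr
        fun u hu => ?_
      split_ifs with hul
      · have : u = γ.len := le_antisymm hul (hsl.trans hu.1)
        simpa [this, src, tgt] using h
      · rfl
  left := by
    intro t ht
    simp only [ht.trans γ.len_nonneg, γ.len_nonneg, if_true]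
    exact γ.left t ht
  right := by
    intro t ht
    have hδ := δ.len_nonneg
    have key : ∀ u, γ.len + δ.len ≤ u →
        (if u ≤ γ.len then γ.toFun u else δ.toFun (u - γ.len)) = δ.toFun δ.len := by
      intro u hu
      split_ifs with hul
      · have h1 : u = γ.len := by linarith
        have h2 : δ.len = 0 := by linarith
        simpa [h1, h2, src, tgt] using h
      · exact δ.right _ (by linarith)
    rw [key t ht, key _ le_rfl]

theorem src_concat (γ δ : MoorePath n M) (h : γ.tgt = δ.src) : (γ.concat δ h).src = γ.src := by
  simp [src, concat, γ.len_nonneg]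

theorem tgt_concat (γ δ : MoorePath n M) (h : γ.tgt = δ.src) : (γ.concat δ h).tgt = δ.tgt := by
  simp only [tgt, concat]
  split_ifs with hl
  · have h2 : δ.len = 0 := le_antisymm (by linarith) δ.len_nonneg
    simpa [h2, src, tgt] using h
  · simp

/-- The velocity, with its base point. -/
noncomputable def velocity (γ : ℝ → M) (t : ℝ) : TangentBundle (𝓡 n) M :=
  tangentMap 𝓘(ℝ, ℝ) (𝓡 n) γ ⟨t, (1 : ℝ)⟩

end MoorePath

variable [IsManifold (𝓡 n) ∞ M]

/-- The `W^{1,1}` topology on piecewise smooth paths: lengths converge, the paths converge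
uniformly, and so do, in `L^1`, their velocities, tested by continuous positively homogeneous
functions on the tangent bundle. -/
instance MoorePath.topology : TopologicalSpace (MoorePath n M) :=
  induced MoorePath.len inferInstance ⊓
  induced (fun γ => (⟨γ.toFun, γ.continuous⟩ : C(ℝ, M))) inferInstance ⊓
  generateFrom {B | ∃ F : TangentBundle (𝓡 n) M → ℝ, Continuous F ∧
    (∀ (c : ℝ) (x : M) (v : TangentSpace (𝓡 n) x), 0 ≤ c → F ⟨x, c • v⟩ = c * F ⟨x, v⟩) ∧
    ∃ (γ₀ : MoorePath n M) (r : ENNReal), B = {γ | ∫⁻ t,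
      ‖F (MoorePath.velocity γ.toFun t) - F (MoorePath.velocity γ₀.toFun t)‖ₑ < r}}

variable (n) in
/-- The based loop space. -/
abbrev BasedLoops (x₀ : M) : Type u := {γ : MoorePath n M // γ.src = x₀ ∧ γ.tgt = x₀}

variable (n M) in
/-- The free loop space. -/
abbrev FreeLoops : Type u := {γ : MoorePath n M // γ.src = γ.tgt}

variable (n) in
/-- The space of paths that start at `x₀`. -/
abbrev PathsFrom (x₀ : M) : Type u := {γ : MoorePath n M // γ.src = x₀}

/-- Multiplication of based loops. -/
noncomputable def loopMul {x₀ : M} (γ δ : BasedLoops n x₀) : BasedLoops n x₀ :=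
  ⟨γ.1.concat δ.1 (γ.2.2.trans δ.2.1.symm),
    (γ.1.src_concat _ _).trans γ.2.1, (γ.1.tgt_concat _ _).trans δ.2.2⟩

/-- A based loop followed by a path. -/
noncomputable def loopPath {x₀ : M} (γ : BasedLoops n x₀) (p : PathsFrom n x₀) : PathsFrom n x₀ :=
  ⟨γ.1.concat p.1 (γ.2.2.trans p.2.symm), (γ.1.src_concat _ _).trans γ.2.1⟩

/-- The constant loop. -/
def loopOne (x₀ : M) : BasedLoops n x₀ := ⟨MoorePath.const x₀, rfl, rfl⟩

/-- Based loops are paths. -/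
def loopToPath {x₀ : M} (γ : BasedLoops n x₀) : PathsFrom n x₀ := ⟨γ.1, γ.2.1⟩

end Paths

/-! ### Riemannian geometry -/

section Geometry

variable {n : ℕ} {M : Type u} [MetricSpace M] [ChartedSpace (EuclideanSpace ℝ (Fin n)) M]
  [IsManifold (𝓡 n) ∞ M]

/-- An orientation, given by a continuous nowhere vanishing alternating `n`-form. -/
structure OrientationForm (n : ℕ) (M : Type u) [MetricSpace M]
    [ChartedSpace (EuclideanSpace ℝ (Fin n)) M] [IsManifold (𝓡 n) ∞ M] where
  form : ∀ x : M, (TangentSpace (𝓡 n) x) [⋀^Fin n]→ₗ[ℝ] ℝ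
  ne_zero : ∀ x, form x ≠ 0
  continuous : ∀ (T : Type u) [TopologicalSpace T] (x : T → M)
    (v : ∀ (_ : Fin n) (t : T), TangentSpace (𝓡 n) (x t)), Continuous x →
    (∀ i, Continuous fun t => (⟨x t, v i t⟩ : TangentBundle (𝓡 n) M)) →
    Continuous fun t => form (x t) fun i => v i t

/-- A map from an open subset of `M` to `M` preserves the orientation. -/
def PreservesOrientation (o : OrientationForm n M) {U : Opens M} (f : U → M) : Prop :=
  ∀ (z : U) (v : Fin n → TangentSpace (𝓡 n) z),
    0 < o.form z (fun i => mfderiv (𝓡 n) (𝓡 n) (Subtype.val : U → M) z (v i)) →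
    0 < o.form (f z) (fun i => mfderiv (𝓡 n) (𝓡 n) f z (v i))

/-- A geodesic: a smooth curve that locally minimizes length, with constant speed. -/
def IsGeodesic (n : ℕ) {M : Type u} [MetricSpace M] [ChartedSpace (EuclideanSpace ℝ (Fin n)) M]
    (γ : ℝ → M) : Prop :=
  ContMDiff 𝓘(ℝ, ℝ) (𝓡 n) ∞ γ ∧ ∃ c : ℝ, 0 ≤ c ∧ ∀ t, ∃ δ > 0, ∀ s s', |s - t| < δ → |s' - t| < δ →
    dist (γ s) (γ s') = c * |s - s'|

/-- The relation `exp_x v = y`. -/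
def IsExp (x : M) (v : TangentSpace (𝓡 n) x) (y : M) : Prop :=
  ∃ γ : ℝ → M, IsGeodesic n γ ∧
    MoorePath.velocity γ 0 = (⟨x, v⟩ : TangentBundle (𝓡 n) M) ∧ γ 1 = y

variable [RiemannianBundle (fun x : M => TangentSpace (𝓡 n) x)]

variable (n M) in
/-- For all `x`, the exponential map is a bijection from the open `r`-ball of `T_x M` to the open
`r`-ball around `x`, and `d(x, exp_x v) = ‖v‖` on it. -/
def IsExpBall (r : ℝ) : Prop :=
  ∀ x : M, (∀ v : TangentSpace (𝓡 n) x, ‖v‖ < r → ∃! y, IsExp x v y) ∧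
    (∀ (v : TangentSpace (𝓡 n) x) (y : M), ‖v‖ < r → IsExp x v y → dist x y = ‖v‖) ∧
    ∀ y, dist x y < r → ∃! v : TangentSpace (𝓡 n) x, ‖v‖ < r ∧ IsExp x v y

variable (n M) in
/-- The injectivity radius. -/
noncomputable def injRadius : ENNReal := sSup {ρ | ∃ r : ℝ, IsExpBall n M r ∧ ρ = ENNReal.ofReal r}

theorem IsGeodesic.comp_mul {γ : ℝ → M} (h : IsGeodesic n γ) (c : ℝ) :
    IsGeodesic n fun t => γ (c * t) := by
  obtain ⟨hs, k, hk, hd⟩ := h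
  refine ⟨hs.comp (contDiff_const.mul contDiff_id).contMDiff, k * |c|, by positivity,
    fun t => ?_⟩
  obtain ⟨δ, hδ, hd⟩ := hd (c * t)
  have hpos : (0 : ℝ) < |c| + 1 := by positivity
  have aux : ∀ s, |s - t| < δ / (|c| + 1) → |c * s - c * t| < δ := by
    intro s hs
    rw [← mul_sub, abs_mul]
    rw [lt_div_iff₀ hpos] at hs
    nlinarith [abs_nonneg (s - t), abs_nonneg c]
  refine ⟨δ / (|c| + 1), by positivity, fun s s' h1 h2 => ?_⟩
  rw [hd _ _ (aux s h1) (aux s' h2), ← mul_sub, abs_mul, mul_assoc]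

theorem velocity_comp_mul {γ : ℝ → M} (hγ : ContMDiff 𝓘(ℝ, ℝ) (𝓡 n) ∞ γ) (c : ℝ) {x : M}
    {v : TangentSpace (𝓡 n) x}
    (h : MoorePath.velocity γ 0 = (⟨x, v⟩ : TangentBundle (𝓡 n) M)) :
    MoorePath.velocity (fun t => γ (c * t)) 0 = (⟨x, c • v⟩ : TangentBundle (𝓡 n) M) := by
  have hγ0 : MDifferentiableAt 𝓘(ℝ, ℝ) (𝓡 n) γ (c * 0) :=
    hγ.mdifferentiable (by simp) _
  have hm : HasDerivAt (fun t : ℝ => c * t) c 0 := by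
    simpa using (hasDerivAt_id (0 : ℝ)).const_mul c
  have hm' : MDifferentiableAt 𝓘(ℝ, ℝ) 𝓘(ℝ, ℝ) (fun t : ℝ => c * t) 0 :=
    hm.differentiableAt.mdifferentiableAt
  have key : MoorePath.velocity (n := n) (fun t => γ (c * t)) 0 =
      tangentMap 𝓘(ℝ, ℝ) (𝓡 n) γ ⟨c * 0, c • (1 : ℝ)⟩ := by
    have : tangentMap 𝓘(ℝ, ℝ) (𝓡 n) (γ ∘ fun t : ℝ => c * t) ⟨0, (1 : ℝ)⟩ =
        tangentMap 𝓘(ℝ, ℝ) (𝓡 n) γ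
          (tangentMap 𝓘(ℝ, ℝ) 𝓘(ℝ, ℝ) (fun t : ℝ => c * t) ⟨0, (1 : ℝ)⟩) :=
      tangentMap_comp_at _ hγ0 hm'
    refine this.trans (congrArg _ ?_)
    simp only [tangentMap, mfderiv_eq_fderiv]
    congr 1
    change fderiv ℝ (fun t : ℝ => c * t) 0 1 = c • 1
    rw [fderiv_apply_one_eq_deriv, hm.deriv, smul_eq_mul, mul_one]
  rw [key, mul_zero]
  change (⟨γ 0, mfderiv 𝓘(ℝ, ℝ) (𝓡 n) γ 0 (1 : ℝ)⟩ : TangentBundle (𝓡 n) M) = ⟨x, v⟩ at h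
  change (⟨γ 0, mfderiv 𝓘(ℝ, ℝ) (𝓡 n) γ 0 (c • (1 : ℝ))⟩ : TangentBundle (𝓡 n) M) = ⟨x, c • v⟩
  cases h
  exact congrArg (fun w => (⟨γ 0, w⟩ : TangentBundle (𝓡 n) M))
    ((mfderiv 𝓘(ℝ, ℝ) (𝓡 n) γ 0).map_smul c (1 : ℝ))

theorem dist_le_of_dist_le {ε : ℝ} (hε : 0 < ε) (hr : ENNReal.ofReal (2 * ε) < injRadius n M)
    {x y : M} {f : M → M} (hf : Continuous f)
    (h : ∀ z, ε / 2 < dist x z → ε / 2 < dist y (f z)) {z : M} (hz : ε / 2 ≤ dist x z) :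
    ε / 2 ≤ dist y (f z) := by
  rcases hz.lt_or_eq with hz | hz
  · exact (h z hz).le
  obtain ⟨_, ⟨r, hr, rfl⟩, hεr⟩ := lt_sSup_iff.1 hr
  have hεr : 2 * ε < r := (ENNReal.ofReal_lt_ofReal_iff_of_nonneg (by positivity)).1 hεr
  obtain ⟨h1, h2, h3⟩ := hr x
  obtain ⟨v, ⟨hv, γ, hγ, hγ0, hγ1⟩, -⟩ := h3 z (by linarith)
  have hvz : ‖v‖ = ε / 2 := by rw [hz, h2 v z hv ⟨γ, hγ, hγ0, hγ1⟩]
  have hev : ∀ᶠ s in 𝓝[>] (1 : ℝ), ε / 2 ≤ dist y (f (γ s)) := by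
    have : Ioo (1 : ℝ) 2 ∈ 𝓝[>] (1 : ℝ) := Ioo_mem_nhdsGT (by norm_num)
    filter_upwards [this] with s hs
    have hs0 : 0 < s := by linarith [hs.1]
    have hn : ‖s • v‖ = s * (ε / 2) := by rw [norm_smul, hvz, Real.norm_of_nonneg hs0.le]
    have := h2 (s • v) (γ s) (by rw [hn]; nlinarith [hs.2])
      ⟨fun t => γ (s * t), hγ.comp_mul s, velocity_comp_mul hγ.1 s hγ0, by simp⟩
    refine (h _ ?_).le
    rw [this, hn]
    nlinarith [hs.1]
  have hc : Continuous fun s => dist y (f (γ s)) :=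
    continuous_const.dist (hf.comp hγ.1.continuous)
  have := ge_of_tendsto (hc.continuousWithinAt (s := Ioi 1) (x := 1)) hev
  simpa only [hγ1] using this

end Geometry

/-! ### Tubular neighbourhoods, embeddings and homotopies of embeddings -/

section Embeddings

variable {n : ℕ} {M : Type u} [MetricSpace M] [ChartedSpace (EuclideanSpace ℝ (Fin n)) M]
  [IsManifold (𝓡 n) ∞ M]

/-- The neighbourhood `U_{x₀}`. -/
def nbhd (x₀ : M) (ε : ℝ) : Opens M :=
  ⟨{z | dist x₀ z < ε}, isOpen_lt (continuous_const.dist continuous_id) continuous_const⟩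

/-- The subset `V_{x₀}ᶜ` of `U_{x₀}`. -/
def nbhdFar (x₀ : M) (ε : ℝ) : Set (nbhd x₀ ε) := {z | ε / 2 ≤ dist x₀ z}

variable (M) in
/-- The neighbourhood `U_Δ` of the diagonal. -/
def diagNbhd (ε : ℝ) : Opens (M × M) :=
  ⟨{p | dist p.1 p.2 < ε}, isOpen_lt (continuous_fst.dist continuous_snd) continuous_const⟩

variable (M) in
/-- The subset `V_Δᶜ` of `U_Δ`. -/
def diagFar (ε : ℝ) : Set (diagNbhd M ε) := {p | ε / 2 ≤ dist p.1.1 p.1.2}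

variable (n) in
/-- The space of smooth maps `U_{x₀} → U_{x₀}`. -/
abbrev SelfMaps (x₀ : M) (ε : ℝ) : Type u := C^∞⟮𝓡 n, nbhd x₀ ε; 𝓡 n, nbhd x₀ ε⟯

variable (n) in
/-- The space of smooth maps `U_{x₀} → U_Δ`. -/
abbrev DiagMaps (x₀ : M) (ε : ℝ) : Type u :=
  C^∞⟮𝓡 n, nbhd x₀ ε; (𝓡 n).prod (𝓡 n), diagNbhd M ε⟯

/-- The inclusion `ι_{x₀} : U_{x₀} → U_Δ`, `y ↦ (x₀, y)`. -/
def iotaMap (x₀ : M) (ε : ℝ) : DiagMaps n x₀ ε :=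
  ⟨fun z => ⟨(x₀, z.1), z.2⟩, (ContMDiff.subtypeVal_comp_iff _ _).1
    (contMDiff_const.prodMk contMDiff_subtype_val)⟩

/-- The space `Emb_*^+((U_{x₀}, V_{x₀}ᶜ), (U_{x₀}, V_{x₀}ᶜ))` of pointed, orientation-preserving
smooth embeddings of pairs. -/
def EmbPlus (o : OrientationForm n M) (x₀ : M) (ε : ℝ) : Set (SelfMaps n x₀ ε) :=
  {φ | IsEmbedding φ ∧ (∀ z, Function.Injective (mfderiv (𝓡 n) (𝓡 n) φ z)) ∧
    (∀ z : nbhd x₀ ε, (z : M) = x₀ → (φ z : M) = x₀) ∧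
    MapsTo φ (nbhdFar x₀ ε) (nbhdFar x₀ ε) ∧ PreservesOrientation o fun z => (φ z : M)}

/-- The space `hcEmb_*^+((U_{x₀}, V_{x₀}ᶜ), (U_Δ, V_Δᶜ))` of half-constant embeddings, that is,
those of the form `y ↦ (x, ψ y)` where `ψ` is an orientation-preserving embedding with
`ψ x₀ = x`. -/
def HCEmb (o : OrientationForm n M) (x₀ : M) (ε : ℝ) : Set (DiagMaps n x₀ ε) :=
  {φ | IsEmbedding φ ∧
    (∀ z, Function.Injective (mfderiv (𝓡 n) ((𝓡 n).prod (𝓡 n)) φ z)) ∧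
    (∃ x, (∀ z, (φ z).1.1 = x) ∧ ∀ z : nbhd x₀ ε, (z : M) = x₀ → (φ z).1.2 = x) ∧
    MapsTo φ (nbhdFar x₀ ε) (diagFar M ε) ∧ PreservesOrientation o fun z => (φ z).1.2}

variable [RiemannianBundle (fun x : M => TangentSpace (𝓡 n) x)]

/-- The space `SOEmb(U_{x₀}, U_{x₀})` of the embeddings that are linear isometries in the
coordinates given by the exponential map. -/
def SOEmb (o : OrientationForm n M) (x₀ : M) (ε : ℝ) : Set (SelfMaps n x₀ ε) :=
  {φ | φ ∈ EmbPlus o x₀ ε ∧ ∃ L : TangentSpace (𝓡 n) x₀ →ₗ[ℝ] TangentSpace (𝓡 n) x₀,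
    (∀ v, ‖L v‖ = ‖v‖) ∧ ∀ (v : TangentSpace (𝓡 n) x₀) (z : nbhd x₀ ε), ‖v‖ < ε →
      IsExp x₀ v (z : M) → IsExp x₀ (L v) (φ z : M)}

/-- The space `SOEmb(U_{x₀}, U_Δ)` of orthogonal half-constant embeddings. -/
def HCSOEmb (o : OrientationForm n M) (x₀ : M) (ε : ℝ) : Set (DiagMaps n x₀ ε) :=
  {φ | φ ∈ HCEmb o x₀ ε ∧ ∃ x, (∀ z, (φ z).1.1 = x) ∧
    ∃ L : TangentSpace (𝓡 n) x₀ →ₗ[ℝ] TangentSpace (𝓡 n) x,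
      (∀ v, ‖L v‖ = ‖v‖) ∧ ∀ (v : TangentSpace (𝓡 n) x₀) (z : nbhd x₀ ε), ‖v‖ < ε →
        IsExp x₀ v (z : M) → IsExp x (L v) (φ z).1.2}

/-- A homotopy `H_1` on `Emb_*^+` from a retraction `r` onto `SOEmb` to the identity that commutes
with `r`. Only the values on `Emb_*^+` matter. -/
structure EmbHomotopy (o : OrientationForm n M) (x₀ : M) (ε : ℝ) where
  toFun : I → SelfMaps n x₀ ε → SelfMaps n x₀ ε
  continuousOn : ContinuousOn (fun p : I × SelfMaps n x₀ ε => toFun p.1 p.2)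
    (univ ×ˢ EmbPlus o x₀ ε)
  mem : ∀ t, ∀ φ ∈ EmbPlus o x₀ ε, toFun t φ ∈ EmbPlus o x₀ ε
  zero : ∀ φ ∈ EmbPlus o x₀ ε, toFun 0 φ ∈ SOEmb o x₀ ε
  one : ∀ φ ∈ EmbPlus o x₀ ε, toFun 1 φ = φ
  comp : ∀ t, ∀ φ₁ ∈ EmbPlus o x₀ ε, ∀ φ₂ ∈ EmbPlus o x₀ ε,
    toFun t ((toFun 0 φ₁).comp φ₂) = (toFun 0 φ₁).comp (toFun t φ₂)

/-- A homotopy `H_1` on `hcEmb_*^+` from a retraction `r` onto the orthogonal half-constant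
embeddings to the identity that commutes with `r`, preserves the first component and extends a
given homotopy on `Emb_*^+`. -/
structure HCHomotopy {o : OrientationForm n M} {x₀ : M} {ε : ℝ} (H : EmbHomotopy o x₀ ε) where
  toFun : I → DiagMaps n x₀ ε → DiagMaps n x₀ ε
  continuousOn : ContinuousOn (fun p : I × DiagMaps n x₀ ε => toFun p.1 p.2)
    (univ ×ˢ HCEmb o x₀ ε)
  mem : ∀ t, ∀ φ ∈ HCEmb o x₀ ε, toFun t φ ∈ HCEmb o x₀ ε
  zero : ∀ φ ∈ HCEmb o x₀ ε, toFun 0 φ ∈ HCSOEmb o x₀ ε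
  one : ∀ φ ∈ HCEmb o x₀ ε, toFun 1 φ = φ
  comp : ∀ t, ∀ φ₁ ∈ HCEmb o x₀ ε, ∀ φ₂ ∈ EmbPlus o x₀ ε,
    toFun t ((toFun 0 φ₁).comp φ₂) = (toFun 0 φ₁).comp (H.toFun t φ₂)
  fst : ∀ t, ∀ φ ∈ HCEmb o x₀ ε, ∀ z, (toFun t φ z).1.1 = (φ z).1.1
  extends_base : ∀ t, ∀ φ ∈ EmbPlus o x₀ ε,
    toFun t ((iotaMap x₀ ε).comp φ) = (iotaMap x₀ ε).comp (H.toFun t φ)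

/-- The cochain `τ` on `(U_{x₀}, V_{x₀}ᶜ)` is invariant under `SOEmb(U_{x₀}, U_{x₀})`: the cochains
`τ ∘ η ∘ ×` and `τ ∘ pr₁ ∘ ×` agree, where `η(x, φ) = φ x`. -/
def IsSOInvariant (o : OrientationForm n M) {x₀ : M} {ε : ℝ}
    (τ : Chains (nbhdFar x₀ ε) →ₗ[ℝ] ℝ) : Prop :=
  ∀ (κ : Cube (nbhd x₀ ε)) (ψ : Cube (SelfMaps n x₀ ε)), (∀ v, ψ.toFun v ∈ SOEmb o x₀ ε) →
    τ (cubeClass _ (κ.dim + ψ.dim) fun v => ψ.toFun (shift κ.dim v) (κ.toFun v)) =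
      τ (cubeClass _ (κ.dim + ψ.dim) κ.toFun)

/-- The cochain `τ` on `(U_Δ, V_Δᶜ)` is invariant under orthogonal half-constant embeddings. -/
def IsHCInvariant (o : OrientationForm n M) {x₀ : M} {ε : ℝ}
    (τ : Chains (diagFar M ε) →ₗ[ℝ] ℝ) : Prop :=
  ∀ (κ : Cube (nbhd x₀ ε)) (ψ : Cube (DiagMaps n x₀ ε)), (∀ v, ψ.toFun v ∈ HCSOEmb o x₀ ε) →
    τ (cubeClass _ (κ.dim + ψ.dim) fun v => ψ.toFun (shift κ.dim v) (κ.toFun v)) =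
      τ (cubeClass _ (κ.dim + ψ.dim) fun v => iotaMap (n := n) x₀ ε (κ.toFun v))

end Embeddings

/-! ### The action of a transitive diffeomorphism lift -/

section Lift

variable {n : ℕ} {M : Type u} [MetricSpace M] [ChartedSpace (EuclideanSpace ℝ (Fin n)) M]
  [IsManifold (𝓡 n) ∞ M]

/-- A transitive diffeomorphism lift `Θ : 𝓟M → Diff(M)`. -/
structure TransitiveDiffeoLift (n : ℕ) (M : Type u) [MetricSpace M]
    [ChartedSpace (EuclideanSpace ℝ (Fin n)) M] [IsManifold (𝓡 n) ∞ M] (ε : ℝ) where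
  toFun : MoorePath n M → (M ≃ₘ^∞⟮𝓡 n, 𝓡 n⟯ M)
  continuous : Continuous fun p => (toFun p : C^∞⟮𝓡 n, M; 𝓡 n, M⟯)
  const : ∀ x z, toFun (.const x) z = z
  concat : ∀ (p q : MoorePath n M) (h : p.tgt = q.src) (z : M),
    toFun (p.concat q h) z = toFun q (toFun p z)
  endpoint : ∀ p, toFun p p.src = p.tgt
  near : ∀ (p : MoorePath n M) (z : M), dist p.src z < ε → dist p.tgt (toFun p z) < ε
  far : ∀ (p : MoorePath n M) (z : M), ε / 2 < dist p.src z → ε / 2 < dist p.tgt (toFun p z)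

variable (n) in
/-- The space `e_Ω⁻¹(U_{x₀}) ⊆ I × Ω`. -/
abbrev BasedPairs (x₀ : M) (ε : ℝ) : Type u :=
  {p : I × BasedLoops n x₀ // dist x₀ (p.2.1.toFun (p.1 * p.2.1.len)) < ε}

variable (n M) in
/-- The space `e_Λ⁻¹(U_Δ) ⊆ I × Λ`. -/
abbrev FreePairs (ε : ℝ) : Type u :=
  {p : I × FreeLoops n M // dist p.2.1.src (p.2.1.toFun (p.1 * p.2.1.len)) < ε}

variable {x₀ : M} {ε : ℝ}

/-- The evaluation `e_Ω(t, γ) = γ(t a)`, where `a` is the length of `γ`. -/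
def evBased (p : BasedPairs n x₀ ε) : nbhd x₀ ε := ⟨p.1.2.1.toFun (p.1.1 * p.1.2.1.len), p.2⟩

/-- The evaluation `e_Λ(t, γ) = (γ(0), γ(t a))`, where `a` is the length of `γ`. -/
def evFree (p : FreePairs n M ε) : diagNbhd M ε :=
  ⟨(p.1.2.1.src, p.1.2.1.toFun (p.1.1 * p.1.2.1.len)), p.2⟩

variable (n) in
/-- The subset `𝓗` of `e_Ω⁻¹(U_{x₀})`: the pairs `(t, γ)` such that `t ∈ ∂I` or `γ` is the constant
loop. -/
def hBased (x₀ : M) (ε : ℝ) : Set (BasedPairs n x₀ ε) :=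
  {p | p.1.1 = 0 ∨ p.1.1 = 1 ∨ p.1.2.1.len = 0}

variable (n) in
/-- The subset `𝓗 ∪ e_Ω⁻¹(V_{x₀}ᶜ)`. -/
def aBased (x₀ : M) (ε : ℝ) : Set (BasedPairs n x₀ ε) :=
  hBased n x₀ ε ∪ evBased ⁻¹' nbhdFar x₀ ε

variable (n M) in
/-- The subset `𝓗` of `e_Λ⁻¹(U_Δ)`: the pairs `(t, γ)` such that `t ∈ ∂I` or `γ` is a constant
loop. -/
def hFree (ε : ℝ) : Set (FreePairs n M ε) := {p | p.1.1 = 0 ∨ p.1.1 = 1 ∨ p.1.2.1.len = 0}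

variable (n M) in
/-- The subset `𝓗 ∪ e_Λ⁻¹(V_Δᶜ)`. -/
def aFree (ε : ℝ) : Set (FreePairs n M ε) := hFree n M ε ∪ evFree ⁻¹' diagFar M ε

/-- The inclusion `e_Ω⁻¹(U_{x₀}) → e_Λ⁻¹(U_Δ)`. -/
def pairIncl (p : BasedPairs n x₀ ε) : FreePairs n M ε :=
  ⟨(p.1.1, ⟨p.1.2.1, p.1.2.2.1.trans p.1.2.2.2.symm⟩), by
    have h := p.1.2.2.1
    simpa only [h] using p.2⟩

theorem mapsTo_pairIncl_h : MapsTo pairIncl (hBased n x₀ ε) (hFree n M ε) := fun _ hp => hp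

theorem mapsTo_pairIncl_a : MapsTo pairIncl (aBased n x₀ ε) (aFree n M ε) := by
  rintro p (hp | hp)
  · exact Or.inl hp
  · refine Or.inr ?_
    have h : ε / 2 ≤ dist x₀ (p.1.2.1.toFun (p.1.1 * p.1.2.1.len)) := hp
    change ε / 2 ≤ dist p.1.2.1.src (p.1.2.1.toFun (p.1.1 * p.1.2.1.len))
    rwa [p.1.2.2.1]

theorem mapsTo_iota : MapsTo (iotaMap (n := n) x₀ ε) (nbhdFar x₀ ε) (diagFar M ε) :=
  fun _ hz => hz

variable (Θ : TransitiveDiffeoLift n M ε)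

/-- The action `((t, γ), p) ↦ (t, Θ(p) ∘ γ)` of paths that start at `x₀`. -/
noncomputable def actPath (a : BasedPairs n x₀ ε) (p : PathsFrom n x₀) : FreePairs n M ε :=
  ⟨(a.1.1, ⟨a.1.2.1.map (Θ.toFun p.1), congrArg (Θ.toFun p.1) (a.1.2.2.1.trans a.1.2.2.2.symm)⟩), by
    have h1 : (a.1.2.1.map (Θ.toFun p.1)).src = p.1.tgt :=
      (congrArg (Θ.toFun p.1) (a.1.2.2.1.trans p.2.symm)).trans (Θ.endpoint p.1)
    have h2 := Θ.near p.1 (a.1.2.1.toFun (a.1.1 * a.1.2.1.len)) (by rw [p.2]; exact a.2)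
    rw [h1]
    exact h2⟩

/-- The action `((t, γ), p) ↦ (t, Θ(p) ∘ γ)` of based loops. -/
noncomputable def actLoop (a : BasedPairs n x₀ ε) (p : BasedLoops n x₀) : BasedPairs n x₀ ε :=
  ⟨(a.1.1, ⟨a.1.2.1.map (Θ.toFun p.1), by
      have h : Θ.toFun p.1 x₀ = x₀ := by
        have := Θ.endpoint p.1
        rwa [p.2.1, p.2.2] at this
      exact ⟨(congrArg (Θ.toFun p.1) a.1.2.2.1).trans h,
        (congrArg (Θ.toFun p.1) a.1.2.2.2).trans h⟩⟩), by
    have h2 := Θ.near p.1 (a.1.2.1.toFun (a.1.1 * a.1.2.1.len)) (by rw [p.2.1]; exact a.2)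
    rw [p.2.2] at h2
    exact h2⟩

theorem actLoop_mem_h : ∀ a ∈ hBased n x₀ ε, ∀ p, actLoop Θ a p ∈ hBased n x₀ ε :=
  fun _ ha _ => ha

theorem actPath_mem_h : ∀ a ∈ hBased n x₀ ε, ∀ p, actPath Θ a p ∈ hFree n M ε :=
  fun _ ha _ => ha

/-- The map `Θ₀`: the restriction of `Θ(p)` to `U_{x₀}` for a based loop `p`. -/
noncomputable def thetaZero (p : BasedLoops n x₀) : SelfMaps n x₀ ε :=
  ⟨fun z => ⟨Θ.toFun p.1 z, by
      have h := Θ.near p.1 z (by rw [p.2.1]; exact z.2)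
      rw [p.2.2] at h
      exact h⟩,
    (ContMDiff.subtypeVal_comp_iff _ _).1
      ((Θ.toFun p.1).contMDiff.comp contMDiff_subtype_val)⟩

/-- The map `Θ₁`: for a path `p` that starts at `x₀`, the embedding `x ↦ (p(a), Θ(p) x)` of
`U_{x₀}` into `U_Δ`. -/
noncomputable def thetaOne (p : PathsFrom n x₀) : DiagMaps n x₀ ε :=
  ⟨fun z => ⟨(p.1.tgt, Θ.toFun p.1 z), Θ.near p.1 z (by rw [p.2]; exact z.2)⟩,
    (ContMDiff.subtypeVal_comp_iff _ _).1
      (contMDiff_const.prodMk ((Θ.toFun p.1).contMDiff.comp contMDiff_subtype_val))⟩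

variable [RiemannianBundle (fun x : M => TangentSpace (𝓡 n) x)]

theorem actPath_mem_a (hε : 0 < ε) (hr : ENNReal.ofReal (2 * ε) < injRadius n M) :
    ∀ a ∈ aBased n x₀ ε, ∀ p, actPath Θ a p ∈ aFree n M ε := by
  rintro a (ha | ha) p
  · exact Or.inl ha
  · refine Or.inr ?_
    have h1 : (a.1.2.1.map (Θ.toFun p.1)).src = p.1.tgt :=
      (congrArg (Θ.toFun p.1) (a.1.2.2.1.trans p.2.symm)).trans (Θ.endpoint p.1)
    have h2 := dist_le_of_dist_le hε hr (Θ.toFun p.1).continuous (Θ.far p.1)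
      (z := a.1.2.1.toFun (a.1.1 * a.1.2.1.len)) (by rw [p.2]; exact ha)
    change ε / 2 ≤ dist (a.1.2.1.map (Θ.toFun p.1)).src _
    rw [h1]
    exact h2

theorem actLoop_mem_a (hε : 0 < ε) (hr : ENNReal.ofReal (2 * ε) < injRadius n M) :
    ∀ a ∈ aBased n x₀ ε, ∀ p, actLoop Θ a p ∈ aBased n x₀ ε := by
  rintro a (ha | ha) p
  · exact Or.inl ha
  · refine Or.inr ?_
    have h2 := dist_le_of_dist_le hε hr (Θ.toFun p.1).continuous (Θ.far p.1)
      (z := a.1.2.1.toFun (a.1.1 * a.1.2.1.len)) (by rw [p.2.1]; exact ha)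
    rw [p.2.2] at h2
    exact h2

end Lift

/-! ### The higher maps -/

section HigherMaps

variable {n : ℕ} {M : Type u} [MetricSpace M] [ChartedSpace (EuclideanSpace ℝ (Fin n)) M]
  [IsManifold (𝓡 n) ∞ M] [RiemannianBundle (fun x : M => TangentSpace (𝓡 n) x)]
  {o : OrientationForm n M} {x₀ : M} {ε : ℝ}

/-- The higher homotopy of a list of cubes `φ_i` of dimensions `m_i` of embeddings, as a function
of the coordinates `t_1, s_1, t_2, s_2, …`, where `s_i` are the `m_i` coordinates of `φ_i`:
`H_k(t_1, …, t_k, φ_1, …, φ_k) = H_1(t_1, H_{k-1}(t_2, …, t_k, φ_2, …, φ_k) ∘ φ_1)`. -/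
noncomputable def homotopyCube (H : EmbHomotopy o x₀ ε) :
    List (ℕ × ((ℕ → I) → SelfMaps n x₀ ε)) → (ℕ → I) → SelfMaps n x₀ ε
  | [], _ => ContMDiffMap.id
  | (m, φ) :: L, v => H.toFun (v 0) ((homotopyCube H L (shift (m + 1) v)).comp (φ (shift 1 v)))

/-- The higher homotopy where the last cube consists of half-constant embeddings. -/
noncomputable def hcHomotopyCube {H : EmbHomotopy o x₀ ε} (K : HCHomotopy H)
    (φ : (ℕ → I) → DiagMaps n x₀ ε) :
    List (ℕ × ((ℕ → I) → SelfMaps n x₀ ε)) → (ℕ → I) → DiagMaps n x₀ ε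
  | [], v => K.toFun (v 0) (φ (shift 1 v))
  | (m, ψ) :: L, v =>
      K.toFun (v 0) ((hcHomotopyCube K φ L (shift (m + 1) v)).comp (ψ (shift 1 v)))

/-- The part of `J` in the block of coordinates `s, …, s + d - 1`, renumbered from `0`. -/
def block (J : Finset ℕ) (s d : ℕ) : Finset ℕ := (Finset.range d).filter fun j => j + s ∈ J

/-- The number of coordinates of a list of cubes. -/
def totalDim {X : Type*} [TopologicalSpace X] : List (Cube X) → ℕ
  | [] => 0
  | κ :: L => κ.dim + totalDim L

/-- The images under `Θ₀` of the front faces of a list of cubes of loops whose coordinates start at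
`s`. -/
noncomputable def frontFaces (Θ : TransitiveDiffeoLift n M ε) (J : Finset ℕ) :
    ℕ → List (Cube (BasedLoops n x₀)) → List (ℕ × ((ℕ → I) → SelfMaps n x₀ ε))
  | _, [] => []
  | s, κ :: L => ((block J s κ.dim).card,
      fun v => thetaZero Θ (frontFace (block J s κ.dim) κ.toFun v)) :: frontFaces Θ J (s + κ.dim) L

/-- The sum over the cubes of a list of the number of elements of `J` that precede its block of
coordinates. -/
def signExponent {X : Type*} [TopologicalSpace X] (J : Finset ℕ) : ℕ → List (Cube X) → ℕ
  | _, [] => 0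
  | s, κ :: L => (J.filter (· < s)).card + signExponent J (s + κ.dim) L

/-- The product of a list of cubes of loops. -/
noncomputable def prodLoops : List (Cube (BasedLoops n x₀)) → (ℕ → I) → BasedLoops n x₀
  | [], _ => loopOne x₀
  | κ :: L, v => loopMul (κ.toFun v) (prodLoops L (shift κ.dim v))

/-- The product of a list of cubes of loops and a cube of paths. -/
noncomputable def prodPath (p : Cube (PathsFrom n x₀)) :
    List (Cube (BasedLoops n x₀)) → (ℕ → I) → PathsFrom n x₀
  | [], v => p.toFun v
  | κ :: L, v => loopPath (κ.toFun v) (prodPath p L (shift κ.dim v))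

/-- The map `q_{k+1}` on a cube `α` of `e_Ω⁻¹(U_{x₀})` and a list of `k` cubes `λ_i` of loops:
`((τ ∘ η ∘ (e_Ω × (h_k ∘ Θ₀^k))) ⊗ Φ) ∘ Δ (α × λ_1 × … × λ_k)`. The parameter `t_i` of the higher
homotopy is inserted in front of the coordinates of `λ_i`, with the Koszul sign of moving it past
the coordinates before it. -/
noncomputable def higherMap (Θ : TransitiveDiffeoLift n M ε) (H : EmbHomotopy o x₀ ε)
    (τ : Chains (nbhdFar x₀ ε) →ₗ[ℝ] ℝ) (α : Cube (BasedPairs n x₀ ε))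
    (L : List (Cube (BasedLoops n x₀))) : Chains (hBased n x₀ ε) :=
  ∑ J ∈ (Finset.range (α.dim + totalDim L)).powerset,
    (shuffleSign J (Finset.range (α.dim + totalDim L) \ J) *
      (-1) ^ signExponent J α.dim L *
      τ (cubeClass _ (J.card + L.length) fun v =>
        homotopyCube H (frontFaces Θ J α.dim L) (shift (block J 0 α.dim).card v)
          (evBased (frontFace (block J 0 α.dim) α.toFun v)))) •
    cubeClass _ (α.dim + totalDim L - J.card)
      (backFace (Finset.range (α.dim + totalDim L) \ J) fun v =>
        actLoop Θ (α.toFun v) (prodLoops L (shift α.dim v)))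

/-- The map `q_{k+2}` of the free loop space, on a cube `α` of `e_Ω⁻¹(U_{x₀})`, a list of `k` cubes
of loops and a cube of paths that start at `x₀`. -/
noncomputable def freeHigherMap (Θ : TransitiveDiffeoLift n M ε) {H : EmbHomotopy o x₀ ε}
    (K : HCHomotopy H) (τ : Chains (diagFar M ε) →ₗ[ℝ] ℝ) (α : Cube (BasedPairs n x₀ ε))
    (L : List (Cube (BasedLoops n x₀))) (p : Cube (PathsFrom n x₀)) : Chains (hFree n M ε) :=
  ∑ J ∈ (Finset.range (α.dim + totalDim L + p.dim)).powerset,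
    (shuffleSign J (Finset.range (α.dim + totalDim L + p.dim) \ J) *
      (-1) ^ (signExponent J α.dim L + signExponent J (α.dim + totalDim L) [p]) *
      τ (cubeClass _ (J.card + (L.length + 1)) fun v =>
        hcHomotopyCube K
          (fun w => thetaOne Θ (frontFace (block J (α.dim + totalDim L) p.dim) p.toFun w))
          (frontFaces Θ J α.dim L) (shift (block J 0 α.dim).card v)
          (evBased (frontFace (block J 0 α.dim) α.toFun v)))) •
    cubeClass _ (α.dim + totalDim L + p.dim - J.card)
      (backFace (Finset.range (α.dim + totalDim L + p.dim) \ J) fun v =>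
        actPath Θ (α.toFun v) (prodPath p L (shift α.dim v)))

end HigherMaps

/-! ### Chain algebras and modules -/

section Modules

variable {n : ℕ} {M : Type u} [MetricSpace M] [ChartedSpace (EuclideanSpace ℝ (Fin n)) M]
  [IsManifold (𝓡 n) ∞ M]

variable (n) in
/-- The product of `C_*(Ω)`. -/
noncomputable def loopMulC (x₀ : M) : Chains (∅ : Set (BasedLoops n x₀)) →ₗ[ℝ]
    Chains (∅ : Set (BasedLoops n x₀)) →ₗ[ℝ] Chains (∅ : Set (BasedLoops n x₀)) :=
  crossChains ∅ ∅ loopMul fun _ h => h.elim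

variable (n) in
/-- The unit of `C_*(Ω)`. -/
noncomputable def loopOneC (x₀ : M) : Chains (∅ : Set (BasedLoops n x₀)) :=
  cubeClass ∅ 0 fun _ => loopOne x₀

variable (n) in
/-- The left action of `C_*(Ω)` on the chains of paths that start at `x₀`. -/
noncomputable def loopPathC (x₀ : M) : Chains (∅ : Set (BasedLoops n x₀)) →ₗ[ℝ]
    Chains (∅ : Set (PathsFrom n x₀)) →ₗ[ℝ] Chains (∅ : Set (PathsFrom n x₀)) :=
  crossChains ∅ ∅ loopPath fun _ h => h.elim

variable (n) in
/-- The inclusion of loops into paths, on chains. -/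
noncomputable def loopToPathC (x₀ : M) :
    Chains (∅ : Set (BasedLoops n x₀)) →ₗ[ℝ] Chains (∅ : Set (PathsFrom n x₀)) :=
  pushChains ∅ ∅ loopToPath fun _ h => h.elim

variable {x₀ : M} {ε : ℝ} (Θ : TransitiveDiffeoLift n M ε)

/-- The action of `C_*(Ω)` on `C_*(e_Ω⁻¹(U_{x₀}), 𝓗)`. -/
noncomputable def actLoopH : Chains (hBased n x₀ ε) →ₗ[ℝ]
    Chains (∅ : Set (BasedLoops n x₀)) →ₗ[ℝ] Chains (hBased n x₀ ε) :=
  crossChains _ _ (actLoop Θ) (actLoop_mem_h Θ)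

/-- The map `C_*(e_Ω⁻¹(U_{x₀}), 𝓗) ⊗ C_*(𝓟) → C_*(e_Λ⁻¹(U_Δ), 𝓗)`. -/
noncomputable def actPathH : Chains (hBased n x₀ ε) →ₗ[ℝ]
    Chains (∅ : Set (PathsFrom n x₀)) →ₗ[ℝ] Chains (hFree n M ε) :=
  crossChains _ _ (actPath Θ) (actPath_mem_h Θ)

variable [RiemannianBundle (fun x : M => TangentSpace (𝓡 n) x)]
  (hε : 0 < ε) (hr : ENNReal.ofReal (2 * ε) < injRadius n M)

/-- The action of `C_*(Ω)` on `C_*(e_Ω⁻¹(U_{x₀}), 𝓗 ∪ e_Ω⁻¹(V_{x₀}ᶜ))`. -/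
noncomputable def actLoopA : Chains (aBased n x₀ ε) →ₗ[ℝ]
    Chains (∅ : Set (BasedLoops n x₀)) →ₗ[ℝ] Chains (aBased n x₀ ε) :=
  crossChains _ _ (actLoop Θ) (actLoop_mem_a Θ hε hr)

/-- The map
`C_*(e_Ω⁻¹(U_{x₀}), 𝓗 ∪ e_Ω⁻¹(V_{x₀}ᶜ)) ⊗ C_*(𝓟) → C_*(e_Λ⁻¹(U_Δ), 𝓗 ∪ e_Λ⁻¹(V_Δᶜ))`. -/
noncomputable def actPathA : Chains (aBased n x₀ ε) →ₗ[ℝ]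
    Chains (∅ : Set (PathsFrom n x₀)) →ₗ[ℝ] Chains (aFree n M ε) :=
  crossChains _ _ (actPath Θ) (actPath_mem_a Θ hε hr)

end Modules

end LoopCap

open LoopCap

/-! All maps of the theorem are cap products $\sum_J \pm\,\tau(F|_J)\,P|_K$ of a cocycle with a pair
of functions $F$, $P$ of the same coordinates, and the equations in (2) and (3) are boundary
formulas for such products. `chainD_capPair` proves the boundary formula without assuming any
relation between $F$ and $P$: differentiating the back faces gives the correct faces of $P$, and the
faces of $F$ that are in excess add up to values of $\tau$ on boundaries, which vanish.

The homotopy parameters $t_1,\dots,t_k$ are treated as ordinary coordinates. In `higher`, $F$ is the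
higher homotopy applied to $e(\alpha)$, and $P$ is the action of the product, which does not depend
on the $t_i$. A set $J$ that omits a parameter therefore leaves a degenerate back face; only sets
containing all parameters contribute, and `capPair_params` turns the sum over them into the formula
of the theorem, including the sign $s(J)$. The boundary of the enlarged cube has three kinds of
faces.

Faces in the coordinates of the inputs are the differentials of the inputs; `higher_boundary`
cancels them.

Faces $t_i=1$: since $H_1(1,\cdot)$ is the identity, two neighbouring blocks merge. This is the
action of the first loop on $\alpha$ (`higher_act`) or the product of two neighbouring inputs
(`higher_mul`, `higher_mul_last`).

Faces $t_i=0$: the relation $H_1(t,r(\varphi_1)\circ\varphi_2)=r(\varphi_1)\circ H_1(t,\varphi_2)$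
carries a value of the retraction $r$ out of all homotopies (`hom_zero`), and the invariance of
$\tau$ removes it (`faceCap_zero`). The rest of $F$ involves no later input. If a further parameter
follows, neither $F$ nor $P$ depends on it and the term is zero (`faceCap_zero_eq_zero`); if $t_i$
is the last parameter, the face is the preceding $q$ followed by the action of the last input
(`cross_higher`). `higher_rhs` collects the surviving faces.

The computation is done once, for abstract data `FibreData` and `PathData`. The based case is the
case `FibreData.self`, in which the paths are the loops: after the last input is split off, the
equation of an $A_\infty$-morphism is the equation of a coherent chain homotopy
(`ainftyRHS_eq_coherentRHS`). The passage from cubes to chains uses that both sides are multilinear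
and that all maps kill null cubes. For relative null cubes this needs connectedness: $\mathcal H$
and the preimage of the far set are closed and disjoint, so a cube in their union lies in one of
them.

The rest is topology. Weak $C^\infty$ continuity is reduced to joint continuity of iterated tangent
maps. In the $W^{1,1}$ topology, concatenation is continuous because translations are continuous in
$L^1$, and $(f,\gamma)\mapsto f\circ\gamma$ is continuous by an estimate for homogeneous test
functions that is uniform on the compact manifold. Finally, $\Theta(\lambda)$ preserves the
orientation because truncations of $\lambda$ connect it to the identity (`lift_form_pos`). -/

namespace LoopCap

universe u

set_option linter.unusedSectionVars false

/-! ### Faces of cubes indexed by finite sets of coordinates -/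

section Faces

variable {X Y Z : Type*} [TopologicalSpace X] [TopologicalSpace Y] [TopologicalSpace Z]

/-- The number of elements of `S` below `i`. -/
def rank (S : Finset ℕ) (i : ℕ) : ℕ := (S.filter (· < i)).card

theorem rank_lt_card {S : Finset ℕ} {i : ℕ} (hi : i ∈ S) : rank S i < S.card :=
  Finset.card_lt_card (Finset.filter_ssubset.2 ⟨i, hi, lt_irrefl i⟩)

theorem rank_mono (S : Finset ℕ) {i j : ℕ} (h : i ≤ j) : rank S i ≤ rank S j :=
  Finset.card_le_card fun k hk => by
    simp only [Finset.mem_filter] at hk ⊢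
    exact ⟨hk.1, by omega⟩

theorem rank_lt_rank {S : Finset ℕ} {i j : ℕ} (hi : i ∈ S) (h : i < j) : rank S i < rank S j :=
  Finset.card_lt_card ⟨fun k hk => by
    simp only [Finset.mem_filter] at hk ⊢
    exact ⟨hk.1, by omega⟩, fun hs => by
    have := hs (Finset.mem_filter.2 ⟨hi, h⟩)
    simp at this⟩

theorem rank_succ_of_mem {S : Finset ℕ} {i : ℕ} (hi : i ∈ S) : rank S (i + 1) = rank S i + 1 := by
  rw [rank, rank, ← Finset.card_insert_of_notMem (a := i) (by simp)]
  congr 1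
  ext k
  simp only [Finset.mem_filter, Finset.mem_insert]
  refine ⟨fun h => ?_, ?_⟩
  · rcases Nat.lt_succ_iff_lt_or_eq.1 h.2 with h' | h'
    · exact Or.inr ⟨h.1, h'⟩
    · exact Or.inl h'
  · rintro (rfl | h)
    · exact ⟨hi, by omega⟩
    · exact ⟨h.1, by omega⟩

theorem rank_zero (S : Finset ℕ) : rank S 0 = 0 := by simp [rank]

theorem rank_range {d i : ℕ} (h : i ≤ d) : rank (Finset.range d) i = i := by
  have : (Finset.range d).filter (· < i) = Finset.range i := by
    ext k
    simp only [Finset.mem_filter, Finset.mem_range]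
    omega
  rw [rank, this, Finset.card_range]

theorem rank_erase_of_le {S : Finset ℕ} {i j : ℕ} (h : j ≤ i) :
    rank (S.erase i) j = rank S j := by
  rw [rank, rank]
  congr 1
  ext k
  simp only [Finset.mem_filter, Finset.mem_erase]
  exact ⟨fun h => ⟨h.1.2, h.2⟩, fun h => ⟨⟨by omega, h.1⟩, h.2⟩⟩

theorem rank_erase_of_lt {S : Finset ℕ} {i j : ℕ} (hi : i ∈ S) (h : i < j) :
    rank (S.erase i) j = rank S j - 1 := by
  rw [rank, Finset.filter_erase, Finset.card_erase_of_mem (by simp [hi, h]), rank]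

theorem rank_insert_of_lt {S : Finset ℕ} {i j : ℕ} (hi : i ∉ S) (h : i < j) :
    rank (insert i S) j = rank S j + 1 := by
  rw [rank, Finset.filter_insert, if_pos h, Finset.card_insert_of_notMem (by simp [hi]), rank]

theorem rank_insert_of_le {S : Finset ℕ} {i j : ℕ} (h : j ≤ i) :
    rank (insert i S) j = rank S j := by
  rw [rank, Finset.filter_insert, if_neg (by omega), rank]

theorem rank_disjUnion {S T : Finset ℕ} (h : Disjoint S T) (i : ℕ) :
    rank (S ∪ T) i = rank S i + rank T i := by
  rw [rank, Finset.filter_union, Finset.card_union_of_disjoint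
    (Finset.disjoint_filter_filter h), rank, rank]

/-- The point whose coordinates in `S` are given by `v` in order and whose other coordinates are
given by `c`. -/
def expand (S : Finset ℕ) (c v : ℕ → I) : ℕ → I :=
  fun j => if j ∈ S then v (rank S j) else c j

theorem continuous_expand (S : Finset ℕ) (c : ℕ → I) : Continuous (expand S c) := by
  refine continuous_pi fun j => ?_
  unfold expand
  split_ifs
  · exact continuous_apply _
  · exact continuous_const

theorem continuous_insertCoord (i : ℕ) (e : I) : Continuous (insertCoord i e) := by
  refine continuous_pi fun j => ?_
  unfold insertCoord
  split_ifs
  · exact continuous_apply _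
  · exact continuous_const
  · exact continuous_apply _

theorem continuous_shift (s : ℕ) : Continuous (shift s) :=
  continuous_pi fun _ => continuous_apply _

theorem expand_congr {S : Finset ℕ} {c v w : ℕ → I} (h : ∀ i < S.card, v i = w i) :
    expand S c v = expand S c w := by
  funext j
  unfold expand
  split_ifs with hj
  · exact h _ (rank_lt_card hj)
  · rfl

/-- Fixing the coordinate at position `rank S i` of a face amounts to removing `i` from the free set
and recording the value in `c`. Faces of faces can thus be indexed by the original coordinates,
without renumbering. -/
theorem expand_insertCoord {S : Finset ℕ} {i : ℕ} (hi : i ∈ S) (c : ℕ → I) (e : I) (v : ℕ → I) :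
    expand S c (insertCoord (rank S i) e v) = expand (S.erase i) (Function.update c i e) v := by
  funext j
  unfold expand insertCoord
  rcases lt_trichotomy j i with h | rfl | h
  · simp only [Finset.mem_erase, h.ne, ne_eq, not_false_eq_true, true_and, rank_erase_of_le h.le,
      Function.update_of_ne]
    split_ifs with hj h1 h2
    · rfl
    · exact absurd (rank_lt_rank hj h) (by omega)
    · exact absurd (rank_lt_rank hj h) (by omega)
    · rfl
  · simp [hi]
  · simp only [Finset.mem_erase, h.ne', ne_eq, not_false_eq_true, true_and, rank_erase_of_lt hi h,
      Function.update_of_ne]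
    have := rank_lt_rank hi h
    split_ifs with hj h1 h2
    · omega
    · omega
    · rfl
    · rfl

theorem expand_range (d : ℕ) (c v : ℕ → I) {j : ℕ} (hj : j < d) :
    expand (Finset.range d) c v j = v j := by
  simp [expand, hj, rank_range hj.le]

theorem frontFace_eq (J : Finset ℕ) (f : (ℕ → I) → X) :
    frontFace J f = fun v => f (expand J 0 v) := rfl

/-- The cube obtained from `f` by letting the coordinates in `S` vary and fixing the others at
`c`. -/
def faceCube (S : Finset ℕ) (c : ℕ → I) (f : (ℕ → I) → X) (hf : Continuous f) : Cube X where
  dim := S.card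
  toFun v := f (expand S c v)
  continuous := hf.comp (continuous_expand S c)
  depends _ _ h := congrArg f (expand_congr h)

theorem cubeClass_of {A : Set X} {k : ℕ} {f : (ℕ → I) → X} (hf : Continuous f)
    (h : ∀ v w : ℕ → I, (∀ i < k, v i = w i) → f v = f w) :
    cubeClass A k f = Cube.cls A ⟨k, f, hf, h⟩ := by
  rw [cubeClass, dif_pos ⟨hf, h⟩]

theorem Cube.cubeClass_eq (A : Set X) (κ : Cube X) : cubeClass A κ.dim κ.toFun = κ.cls A :=
  cubeClass_of κ.continuous κ.depends

/-- The class of `faceCube`. -/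
noncomputable def faceClass (A : Set X) (S : Finset ℕ) (c : ℕ → I) (f : (ℕ → I) → X) : Chains A :=
  cubeClass A S.card fun v => f (expand S c v)

theorem faceClass_eq (A : Set X) (S : Finset ℕ) (c : ℕ → I) {f : (ℕ → I) → X}
    (hf : Continuous f) : faceClass A S c f = (faceCube S c f hf).cls A :=
  (faceCube S c f hf).cubeClass_eq A

theorem Cube.cls_eq_faceClass (A : Set X) (κ : Cube X) :
    κ.cls A = faceClass A (Finset.range κ.dim) 0 κ.toFun := by
  rw [← κ.cubeClass_eq, faceClass, Finset.card_range]
  congr 1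
  funext v
  exact κ.depends _ _ fun i hi => (expand_range _ _ _ hi).symm

/-- The ranks number the elements of `S` in increasing order, so `rank S` is a bijection from `S`
onto the range. -/
theorem sum_range_card_rank {V : Type*} [AddCommMonoid V] (S : Finset ℕ) (g : ℕ → V) :
    ∑ k ∈ Finset.range S.card, g k = ∑ i ∈ S, g (rank S i) := by
  have hinj : InjOn (rank S) S := by
    intro i hi j hj h
    rcases lt_trichotomy i j with hlt | h' | hlt
    · exact absurd (rank_lt_rank hi hlt) (by omega)
    · exact h'
    · exact absurd (rank_lt_rank hj hlt) (by omega)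
  rw [← Finset.sum_image (f := g) hinj]
  congr 1
  symm
  refine Finset.eq_of_subset_of_card_le (fun k hk => ?_) ?_
  · obtain ⟨i, hi, rfl⟩ := Finset.mem_image.1 hk
    exact Finset.mem_range.2 (rank_lt_card hi)
  · rw [Finset.card_image_of_injOn hinj, Finset.card_range]

theorem chainD_cls (A : Set X) (κ : Cube X) : chainD A (κ.cls A) = cubeBoundary A κ :=
  liftChains_cls _ _ _ κ

theorem chainD_faceClass (A : Set X) (S : Finset ℕ) (c : ℕ → I) {f : (ℕ → I) → X}
    (hf : Continuous f) : chainD A (faceClass A S c f) =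
      ∑ i ∈ S, (-1 : ℝ) ^ rank S i • (faceClass A (S.erase i) (Function.update c i 1) f -
        faceClass A (S.erase i) (Function.update c i 0) f) := by
  rw [faceClass_eq A S c hf, chainD_cls, cubeBoundary]
  change ∑ i ∈ Finset.range S.card, _ = _
  rw [sum_range_card_rank]
  refine Finset.sum_congr rfl fun i hi => ?_
  simp only [faceCube, faceClass, expand_insertCoord hi, Finset.card_erase_of_mem hi]

/-- Exchanging the two removed coordinates changes the sign of a term, so the double sum equals its
own negative. -/
theorem chainD_chainD (A : Set X) (x : Chains A) : chainD A (chainD A x) = 0 := by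
  suffices h : chainD A ∘ₗ chainD A = 0 from LinearMap.congr_fun h x
  refine chains_hom_ext fun κ => ?_
  rw [LinearMap.comp_apply, LinearMap.zero_apply, κ.cls_eq_faceClass,
    chainD_faceClass A _ _ κ.continuous, map_sum]
  set S := Finset.range κ.dim
  set fc := fun (i j : ℕ) (e e' : I) => faceClass A ((S.erase i).erase j)
    (Function.update (Function.update 0 i e) j e') κ.toFun with hfc
  set g : ℕ → ℕ → Chains A := fun i j => (-1 : ℝ) ^ (rank S i + rank (S.erase i) j) •
    (fc i j 1 1 - fc i j 1 0 - fc i j 0 1 + fc i j 0 0) with hg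
  have h1 : ∀ i ∈ S, chainD A ((-1 : ℝ) ^ rank S i •
      (faceClass A (S.erase i) (Function.update 0 i 1) κ.toFun -
        faceClass A (S.erase i) (Function.update 0 i 0) κ.toFun)) = ∑ j ∈ S.erase i, g i j := by
    intro i _
    rw [map_smul, map_sub, chainD_faceClass A _ _ κ.continuous,
      chainD_faceClass A _ _ κ.continuous, ← Finset.sum_sub_distrib, Finset.smul_sum]
    refine Finset.sum_congr rfl fun j _ => ?_
    simp only [hg, hfc, pow_add, mul_smul, ← smul_sub]
    congr 2
    abel
  rw [Finset.sum_congr rfl h1]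
  have hsw : ∀ i ∈ S, ∀ j ∈ S.erase i, g i j = -g j i := by
    intro i hi j hj
    have hij : j ≠ i := Finset.ne_of_mem_erase hj
    have hjS := Finset.mem_of_mem_erase hj
    have hf : ∀ e e', fc i j e e' = fc j i e' e := fun e e' => by
      simp only [hfc, Finset.erase_right_comm (a := i), Function.update_comm hij.symm]
    -- Removing the smaller of two coordinates lowers the rank of the larger by one; removing the
    -- larger leaves the rank of the smaller unchanged. This is the source of the sign.
    have hr : (-1 : ℝ) ^ (rank S i + rank (S.erase i) j) =
        -(-1 : ℝ) ^ (rank S j + rank (S.erase j) i) := by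
      rcases lt_or_gt_of_ne hij with h | h
      · rw [rank_erase_of_le h.le, rank_erase_of_lt hjS h]
        have := rank_lt_rank hjS h
        obtain ⟨m, hm⟩ : ∃ m, rank S i = m + 1 := ⟨rank S i - 1, by omega⟩
        rw [hm, Nat.add_sub_cancel]
        ring
      · rw [rank_erase_of_le h.le, rank_erase_of_lt hi h]
        have := rank_lt_rank hi h
        obtain ⟨m, hm⟩ : ∃ m, rank S j = m + 1 := ⟨rank S j - 1, by omega⟩
        rw [hm, Nat.add_sub_cancel]
        ring
    simp only [hg, hf, hr, neg_smul]
    congr 2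
    abel
  have h2 : ∑ i ∈ S, ∑ j ∈ S.erase i, g i j = -∑ i ∈ S, ∑ j ∈ S.erase i, g i j := by
    conv_lhs => rw [Finset.sum_congr rfl fun i hi => Finset.sum_congr rfl (hsw i hi)]
    simp only [Finset.sum_neg_distrib]
    congr 1
    refine Finset.sum_comm' fun i j => ?_
    simp only [Finset.mem_erase]
    tauto
  have h3 := eq_neg_iff_add_eq_zero.1 h2
  rw [← two_smul ℝ] at h3
  exact (smul_eq_zero.1 h3).resolve_left two_ne_zero

theorem cls_mem_chainsOfDegree (A : Set X) (κ : Cube X) : κ.cls A ∈ chainsOfDegree A κ.dim :=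
  Submodule.subset_span ⟨κ, rfl, rfl⟩

theorem cubeClass_mem_chainsOfDegree (A : Set X) (k : ℕ) (f : (ℕ → I) → X) :
    cubeClass A k f ∈ chainsOfDegree A k := by
  unfold cubeClass
  split_ifs with h
  · exact cls_mem_chainsOfDegree A ⟨k, f, h.1, h.2⟩
  · exact zero_mem _

theorem chainD_mem (A : Set X) (i : ℤ) (x : Chains A) (hx : x ∈ chainsOfDegree A i) :
    chainD A x ∈ chainsOfDegree A (i - 1) := by
  suffices h : chainsOfDegree A i ≤ (chainsOfDegree A (i - 1)).comap (chainD A) from h hx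
  rw [chainsOfDegree, Submodule.span_le]
  rintro _ ⟨κ, rfl, rfl⟩
  rw [SetLike.mem_coe, Submodule.mem_comap, chainD_cls, cubeBoundary]
  refine Submodule.sum_mem _ fun j hj => Submodule.smul_mem _ _ ?_
  have : ((κ.dim - 1 : ℕ) : ℤ) = (κ.dim : ℤ) - 1 := by
    have := Finset.mem_range.1 hj
    omega
  rw [← this]
  exact Submodule.sub_mem _ (cubeClass_mem_chainsOfDegree _ _ _)
    (cubeClass_mem_chainsOfDegree _ _ _)

open Classical in
/-- The projection of chains onto those of degree `i`. -/
noncomputable def chainsProj (A : Set X) (i : ℤ) : Chains A →ₗ[ℝ] Chains A :=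
  liftChains A (fun κ => if (κ.dim : ℤ) = i then κ.cls A else 0) fun κ hκ => by
    simp [cls_eq_zero hκ]

theorem chainsProj_of_mem {A : Set X} {i : ℤ} {x : Chains A} (hx : x ∈ chainsOfDegree A i) :
    chainsProj A i x = x := by
  suffices h : chainsOfDegree A i ≤ LinearMap.eqLocus (chainsProj A i) LinearMap.id from h hx
  rw [chainsOfDegree, Submodule.span_le]
  rintro _ ⟨κ, hκ, rfl⟩
  simp [LinearMap.mem_eqLocus, chainsProj, liftChains_cls, hκ]

theorem chainsProj_of_mem_ne {A : Set X} {i j : ℤ} (hij : j ≠ i) {x : Chains A}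
    (hx : x ∈ chainsOfDegree A j) : chainsProj A i x = 0 := by
  suffices h : chainsOfDegree A j ≤ LinearMap.ker (chainsProj A i) from h hx
  rw [chainsOfDegree, Submodule.span_le]
  rintro _ ⟨κ, hκ, rfl⟩
  simp [chainsProj, liftChains_cls, hκ, hij]

/-- The projections `chainsProj` are defined on the quotient because the null chains are spanned by
single cubes. They give independence of the degrees, and the cubes span. -/
theorem isInternal_chainsOfDegree (A : Set X) : DirectSum.IsInternal (chainsOfDegree A) := by
  rw [DirectSum.isInternal_submodule_iff_iSupIndep_and_iSup_eq_top]
  constructor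
  · rw [iSupIndep_def]
    intro i
    rw [Submodule.disjoint_def]
    intro x hx hx'
    rw [← chainsProj_of_mem hx]
    have : (⨆ j, ⨆ (_ : j ≠ i), chainsOfDegree A j) ≤ LinearMap.ker (chainsProj A i) :=
      iSup₂_le fun j hj y hy => chainsProj_of_mem_ne hj hy
    exact this hx'
  · rw [eq_top_iff]
    rintro x -
    obtain ⟨y, rfl⟩ := (nullChains A).mkQ_surjective x
    induction y using Finsupp.induction_linear with
    | zero => simp
    | add a b ha hb => rw [map_add]; exact Submodule.add_mem _ ha hb
    | single κ r =>
      rw [← mul_one r, ← smul_eq_mul, ← Finsupp.smul_single, map_smul]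
      exact Submodule.smul_mem _ _
        (Submodule.mem_iSup_of_mem (κ.dim : ℤ) (cls_mem_chainsOfDegree A κ))

theorem isComplex_chains (A : Set X) : IsComplex (chainsOfDegree A) (chainD A) :=
  ⟨isInternal_chainsOfDegree A, chainD_mem A, chainD_chainD A⟩

/-! ### Cross products -/

/-- The cube `(v, w) ↦ f (κ v) (τ w)`. -/
def crossCube (f : X → Y → Z) (hf : Continuous fun p : X × Y => f p.1 p.2) (κ : Cube X)
    (τ : Cube Y) : Cube Z where
  dim := κ.dim + τ.dim
  toFun := crossFun f κ τ
  continuous := hf.comp (κ.continuous.prodMk (τ.continuous.comp (continuous_shift _)))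
  depends v w h := by
    unfold crossFun
    rw [κ.depends v w fun i hi => h i (by omega), τ.depends (shift κ.dim v) (shift κ.dim w)
      fun i hi => h _ (by omega)]

theorem crossChains_cls {A : Set X} {C : Set Z} {f : X → Y → Z}
    (hfc : Continuous fun p : X × Y => f p.1 p.2) (hf : ∀ x ∈ A, ∀ y, f x y ∈ C) (κ : Cube X)
    (τ : Cube Y) :
    crossChains A C f hf (κ.cls A) (τ.cls ∅) = (crossCube f hfc κ τ).cls C := by
  rw [crossChains, liftChains_cls, liftChains_cls]
  exact (crossCube f hfc κ τ).cubeClass_eq C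

theorem pushChains_cls {A : Set X} {B : Set Y} {f : X → Y} (hf : MapsTo f A B) (κ : Cube X) :
    pushChains A B f hf (κ.cls A) = cubeClass B κ.dim fun v => f (κ.toFun v) :=
  liftChains_cls _ _ _ κ

theorem crossChains_mem {A : Set X} {C : Set Z} {f : X → Y → Z}
    (hf : ∀ x ∈ A, ∀ y, f x y ∈ C) (i j : ℤ) (x : Chains A) (hx : x ∈ chainsOfDegree A i)
    (y : Chains (∅ : Set Y)) (hy : y ∈ chainsOfDegree ∅ j) :
    crossChains A C f hf x y ∈ chainsOfDegree C (i + j) := by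
  have h : chainsOfDegree A i ≤
      (chainsOfDegree C (i + j)).comap ((crossChains A C f hf).flip y) := by
    rw [chainsOfDegree, Submodule.span_le]
    rintro _ ⟨κ, rfl, rfl⟩
    have h' : chainsOfDegree (∅ : Set Y) j ≤
        (chainsOfDegree C (κ.dim + j)).comap (crossChains A C f hf (κ.cls A)) := by
      rw [chainsOfDegree, Submodule.span_le]
      rintro _ ⟨τ, rfl, rfl⟩
      rw [SetLike.mem_coe, Submodule.mem_comap, crossChains, liftChains_cls, liftChains_cls]
      exact_mod_cast cubeClass_mem_chainsOfDegree C _ _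
    exact h' hy
  exact h hx

theorem insertCoord_apply_of_lt {i j : ℕ} (h : j < i) (e : I) (v : ℕ → I) :
    insertCoord i e v j = v j := by simp [insertCoord, h]

theorem insertCoord_apply_self (i : ℕ) (e : I) (v : ℕ → I) : insertCoord i e v i = e := by
  simp [insertCoord]

theorem insertCoord_apply_of_gt {i j : ℕ} (h : i < j) (e : I) (v : ℕ → I) :
    insertCoord i e v j = v (j - 1) := by
  simp [insertCoord, h.ne', h.le]

theorem shift_insertCoord_of_lt {i s : ℕ} (h : i < s) (e : I) (v : ℕ → I) :
    shift s (insertCoord i e v) = shift (s - 1) v := by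
  funext j
  rw [shift, insertCoord_apply_of_gt (by omega), shift]
  congr 1
  omega

theorem shift_insertCoord_add (s i : ℕ) (e : I) (v : ℕ → I) :
    shift s (insertCoord (s + i) e v) = insertCoord i e (shift s v) := by
  funext j
  simp only [shift, insertCoord]
  split_ifs with h1 h2 h3 h4 h5 <;> first | omega | rfl | (congr 1; omega)

theorem shift_shift (s t : ℕ) (v : ℕ → I) : shift s (shift t v) = shift (s + t) v := by
  funext j
  simp [shift, add_assoc]

theorem shift_zero (v : ℕ → I) : shift 0 v = v := rfl

theorem Cube.toFun_insertCoord_add (κ : Cube X) (i : ℕ) (e : I) (v : ℕ → I) :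
    κ.toFun (insertCoord (κ.dim + i) e v) = κ.toFun v :=
  κ.depends _ _ fun j hj => insertCoord_apply_of_lt (by omega) e v

/-- The face of a cube on which the `i`-th coordinate is `e`. -/
def Cube.face (κ : Cube X) (i : ℕ) (hi : i < κ.dim) (e : I) : Cube X where
  dim := κ.dim - 1
  toFun v := κ.toFun (insertCoord i e v)
  continuous := κ.continuous.comp (continuous_insertCoord i e)
  depends v w h := κ.depends _ _ fun j hj => by
    unfold insertCoord
    split_ifs with h1 h2
    · exact h _ (by omega)
    · rfl
    · exact h _ (by omega)

theorem Cube.face_cls (A : Set X) (κ : Cube X) {i : ℕ} (hi : i < κ.dim) (e : I) :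
    cubeClass A (κ.dim - 1) (fun v => κ.toFun (insertCoord i e v)) = (κ.face i hi e).cls A :=
  (κ.face i hi e).cubeClass_eq A

/-- The first `κ.dim` coordinates give the faces of `κ`, the others those of `τ`. The latter are
numbered from `κ.dim` on, which accounts for the sign. -/
theorem crossChains_leibniz_cls {A : Set X} {C : Set Z} {f : X → Y → Z}
    (hfc : Continuous fun p : X × Y => f p.1 p.2) (hf : ∀ x ∈ A, ∀ y, f x y ∈ C) (κ : Cube X)
    (τ : Cube Y) :
    chainD C (crossChains A C f hf (κ.cls A) (τ.cls ∅)) =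
      crossChains A C f hf (chainD A (κ.cls A)) (τ.cls ∅) +
        (-1 : ℝ) ^ κ.dim • crossChains A C f hf (κ.cls A) (chainD ∅ (τ.cls ∅)) := by
  rw [crossChains_cls hfc, chainD_cls, chainD_cls, chainD_cls, cubeBoundary, cubeBoundary,
    cubeBoundary]
  change ∑ i ∈ Finset.range (κ.dim + τ.dim), _ = _
  rw [Finset.sum_range_add, map_sum, map_sum, LinearMap.sum_apply, Finset.smul_sum]
  congr 1
  · refine Finset.sum_congr rfl fun i hi => ?_
    rw [Finset.mem_range] at hi
    rw [map_smul, LinearMap.smul_apply, map_sub, LinearMap.sub_apply, κ.face_cls A hi,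
      κ.face_cls A hi, crossChains_cls hfc, crossChains_cls hfc, ← Cube.cubeClass_eq,
      ← Cube.cubeClass_eq]
    have hd : κ.dim + τ.dim - 1 = κ.dim - 1 + τ.dim := by omega
    have key : ∀ e v, (crossCube f hfc κ τ).toFun (insertCoord i e v) =
        (crossCube f hfc (κ.face i hi e) τ).toFun v := fun e v => by
      simp only [crossCube, crossFun, shift_insertCoord_of_lt hi, Cube.face]
    simp only [key]
    simp only [crossCube, hd, Cube.face]
  · refine Finset.sum_congr rfl fun i hi => ?_
    rw [Finset.mem_range] at hi
    rw [map_smul, map_sub, τ.face_cls ∅ hi, τ.face_cls ∅ hi, crossChains_cls hfc,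
      crossChains_cls hfc, ← Cube.cubeClass_eq, ← Cube.cubeClass_eq, smul_smul, ← pow_add]
    have hd : κ.dim + τ.dim - 1 = κ.dim + (τ.dim - 1) := by omega
    have key : ∀ e v, (crossCube f hfc κ τ).toFun (insertCoord (κ.dim + i) e v) =
        (crossCube f hfc κ (τ.face i hi e)).toFun v := fun e v => by
      simp only [crossCube, crossFun, Cube.toFun_insertCoord_add, shift_insertCoord_add, Cube.face]
    simp only [key]
    simp only [crossCube, hd, Cube.face]

theorem crossChains_leibniz {A : Set X} {C : Set Z} {f : X → Y → Z}
    (hfc : Continuous fun p : X × Y => f p.1 p.2) (hf : ∀ x ∈ A, ∀ y, f x y ∈ C) (i : ℤ)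
    (x : Chains A) (hx : x ∈ chainsOfDegree A i) (y : Chains (∅ : Set Y)) :
    chainD C (crossChains A C f hf x y) = crossChains A C f hf (chainD A x) y +
      (-1 : ℝ) ^ i • crossChains A C f hf x (chainD ∅ y) := by
  have h : chainsOfDegree A i ≤ LinearMap.eqLocus
      (chainD C ∘ₗ (crossChains A C f hf).flip y)
      ((crossChains A C f hf).flip y ∘ₗ chainD A +
        (-1 : ℝ) ^ i • (crossChains A C f hf).flip (chainD ∅ y)) := by
    rw [chainsOfDegree, Submodule.span_le]
    rintro _ ⟨κ, rfl, rfl⟩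
    have h' : chainD C ∘ₗ crossChains A C f hf (κ.cls A) =
        crossChains A C f hf (chainD A (κ.cls A)) +
          (-1 : ℝ) ^ κ.dim • (crossChains A C f hf (κ.cls A) ∘ₗ chainD ∅) :=
      chains_hom_ext fun τ => crossChains_leibniz_cls hfc hf κ τ
    simpa using LinearMap.congr_fun h' y
  exact h hx

/-- On cubes both sides are the class of the same function. The spaces are kept apart so that one
statement covers both the algebra and its modules. -/
theorem crossChains_assoc {X₁ X₂ X₃ X₁₂ X₂₃ W : Type*} [TopologicalSpace X₁] [TopologicalSpace X₂]
    [TopologicalSpace X₃] [TopologicalSpace X₁₂] [TopologicalSpace X₂₃] [TopologicalSpace W]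
    {A₁ : Set X₁} {A₁₂ : Set X₁₂} {C : Set W} {f : X₁ → X₂ → X₁₂} {g : X₁₂ → X₃ → W}
    {f' : X₂ → X₃ → X₂₃} {g' : X₁ → X₂₃ → W}
    (hfc : Continuous fun p : X₁ × X₂ => f p.1 p.2) (hgc : Continuous fun p : X₁₂ × X₃ => g p.1 p.2)
    (hfc' : Continuous fun p : X₂ × X₃ => f' p.1 p.2)
    (hgc' : Continuous fun p : X₁ × X₂₃ => g' p.1 p.2)
    (hf : ∀ x ∈ A₁, ∀ y, f x y ∈ A₁₂) (hg : ∀ x ∈ A₁₂, ∀ y, g x y ∈ C)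
    (hf' : ∀ x ∈ (∅ : Set X₂), ∀ y, f' x y ∈ (∅ : Set X₂₃)) (hg' : ∀ x ∈ A₁, ∀ y, g' x y ∈ C)
    (h : ∀ x y z, g (f x y) z = g' x (f' y z)) (x : Chains A₁) (y : Chains (∅ : Set X₂))
    (z : Chains (∅ : Set X₃)) :
    crossChains A₁₂ C g hg (crossChains A₁ A₁₂ f hf x y) z =
      crossChains A₁ C g' hg' x (crossChains ∅ ∅ f' hf' y z) := by
  have h1 : (crossChains A₁₂ C g hg).flip z ∘ₗ (crossChains A₁ A₁₂ f hf).flip y =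
      (crossChains A₁ C g' hg').flip (crossChains ∅ ∅ f' hf' y z) := by
    refine chains_hom_ext fun κ => ?_
    have h2 : (crossChains A₁₂ C g hg).flip z ∘ₗ crossChains A₁ A₁₂ f hf (κ.cls A₁) =
        crossChains A₁ C g' hg' (κ.cls A₁) ∘ₗ (crossChains ∅ ∅ f' hf').flip z := by
      refine chains_hom_ext fun τ => ?_
      have h3 : crossChains A₁₂ C g hg (crossChains A₁ A₁₂ f hf (κ.cls A₁) (τ.cls ∅)) =
          crossChains A₁ C g' hg' (κ.cls A₁) ∘ₗ crossChains ∅ ∅ f' hf' (τ.cls ∅) := by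
        refine chains_hom_ext fun ρ => ?_
        rw [LinearMap.comp_apply, crossChains_cls hfc, crossChains_cls hgc, crossChains_cls hfc',
          crossChains_cls hgc', ← Cube.cubeClass_eq, ← Cube.cubeClass_eq]
        change cubeClass C (κ.dim + τ.dim + ρ.dim) (fun v => g (f (κ.toFun v)
            (τ.toFun (shift κ.dim v))) (ρ.toFun (shift (κ.dim + τ.dim) v))) =
          cubeClass C (κ.dim + (τ.dim + ρ.dim)) fun v => g' (κ.toFun v)
            (f' (τ.toFun (shift κ.dim v)) (ρ.toFun (shift τ.dim (shift κ.dim v))))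
        simp only [h, shift_shift, add_assoc, add_comm τ.dim κ.dim]
      exact LinearMap.congr_fun h3 z
    exact LinearMap.congr_fun h2 y
  exact LinearMap.congr_fun h1 x

end Faces

/-! ### Cap products of pairs of functions -/

section Cap

variable {U X Y Z : Type*} [TopologicalSpace U] [TopologicalSpace X] [TopologicalSpace Y]
  [TopologicalSpace Z]

/-- The increasing injection of `ℕ` that omits `i`. -/
def succAt (i j : ℕ) : ℕ := if j < i then j else j + 1

theorem succAt_strictMono (i : ℕ) : StrictMono (succAt i) := fun a b h => by
  unfold succAt
  split_ifs <;> omega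

theorem succAt_ne (i j : ℕ) : succAt i j ≠ i := by
  unfold succAt
  split_ifs <;> omega

theorem exists_succAt {i j : ℕ} (h : j ≠ i) : ∃ k, succAt i k = j := by
  rcases lt_or_gt_of_ne h with h | h
  · exact ⟨j, by simp [succAt, h]⟩
  · refine ⟨j - 1, ?_⟩
    unfold succAt
    split_ifs <;> omega

theorem insertCoord_succAt (i : ℕ) (e : I) (v : ℕ → I) (j : ℕ) :
    insertCoord i e v (succAt i j) = v j := by
  unfold insertCoord succAt
  split_ifs <;> first | omega | rfl

theorem rank_image_apply {ρ : ℕ → ℕ} (hρ : StrictMono ρ) (S : Finset ℕ) (j : ℕ) :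
    rank (S.image ρ) (ρ j) = rank S j := by
  rw [rank, Finset.filter_image, Finset.card_image_of_injective _ hρ.injective]
  simp only [hρ.lt_iff_lt, rank]

theorem shuffleSign_image {ρ : ℕ → ℕ} (hρ : StrictMono ρ) (J K : Finset ℕ) :
    shuffleSign (J.image ρ) (K.image ρ) = shuffleSign J K := by
  rw [shuffleSign, shuffleSign, ← Finset.prodMap_image_product, Finset.filter_image,
    Finset.card_image_of_injective _ (hρ.injective.prodMap hρ.injective)]
  simp only [Prod.map, hρ.lt_iff_lt]

/-- The new inversions are the pairs of `i` with elements of `J` above it. In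
`shuffleSign_insert_left` they are the pairs of `i` with elements of `K` below it. -/
theorem shuffleSign_insert_right {J K : Finset ℕ} {i : ℕ} (hi : i ∉ K) :
    shuffleSign J (insert i K) = shuffleSign J K * (-1) ^ (J.filter (i < ·)).card := by
  rw [shuffleSign, shuffleSign, ← pow_add]
  congr 1
  rw [Finset.insert_eq, Finset.product_union, Finset.filter_union, Finset.card_union_of_disjoint,
    add_comm]
  · congr 1
    rw [Finset.product_singleton, Finset.filter_map, Finset.card_map]
    rfl
  · rw [Finset.disjoint_left]
    intro p hp hp'
    simp only [Finset.mem_filter, Finset.mem_product, Finset.mem_singleton] at hp hp'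
    exact hi (hp.1.2 ▸ hp'.1.2)

theorem shuffleSign_insert_left {J K : Finset ℕ} {i : ℕ} (hi : i ∉ J) :
    shuffleSign (insert i J) K = shuffleSign J K * (-1) ^ rank K i := by
  rw [shuffleSign, shuffleSign, ← pow_add]
  congr 1
  rw [Finset.insert_eq, Finset.union_product, Finset.filter_union, Finset.card_union_of_disjoint,
    add_comm]
  · congr 1
    rw [Finset.singleton_product, Finset.filter_map, Finset.card_map]
    rfl
  · rw [Finset.disjoint_left]
    intro p hp hp'
    simp only [Finset.mem_filter, Finset.mem_product, Finset.mem_singleton] at hp hp'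
    exact hi (hp.1.1 ▸ hp'.1.1)

theorem card_filter_gt {J : Finset ℕ} {i : ℕ} (hi : i ∉ J) :
    (J.filter (i < ·)).card + rank J i = J.card := by
  rw [rank, ← Finset.card_filter_add_card_filter_not (s := J) (i < ·)]
  congr 2
  ext j
  simp only [Finset.mem_filter, and_congr_right_iff]
  intro hj
  have : j ≠ i := fun h => hi (h ▸ hj)
  omega

theorem rank_add_rank_sdiff {D i : ℕ} (hi : i < D) {J : Finset ℕ}
    (hJ : J ⊆ (Finset.range D).erase i) :
    rank J i + rank ((Finset.range D).erase i \ J) i = i := by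
  rw [← rank_disjUnion Finset.disjoint_sdiff, Finset.union_sdiff_of_subset hJ,
    rank_erase_of_le le_rfl, rank_range hi.le]

/-- The cap product `∑ sgn(J, K) τ(F|_{I ^ J × 0 ^ K}) P|_{1 ^ J × I ^ K}` of a cochain with a pair
of functions of `D` coordinates. -/
noncomputable def capPair {B : Set U} (τ : Chains B →ₗ[ℝ] ℝ) (C : Set X) (D : ℕ)
    (F : (ℕ → I) → U) (P : (ℕ → I) → X) : Chains C :=
  ∑ J ∈ (Finset.range D).powerset,
    (shuffleSign J (Finset.range D \ J) * τ (cubeClass B J.card (frontFace J F))) •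
      cubeClass C (D - J.card) (backFace (Finset.range D \ J) P)

theorem capCube_eq_capPair {B : Set Y} (τ : Chains B →ₗ[ℝ] ℝ) (e : X → Y) (C : Set X)
    (κ : Cube X) : capCube τ e C κ = capPair τ C κ.dim (fun v => e (κ.toFun v)) κ.toFun := rfl

theorem capPair_eq_sum {B : Set U} (τ : Chains B →ₗ[ℝ] ℝ) (C : Set X) (D : ℕ)
    (F : (ℕ → I) → U) (P : (ℕ → I) → X) : capPair τ C D F P =
    ∑ J ∈ (Finset.range D).powerset, (shuffleSign J (Finset.range D \ J) *
      τ (faceClass B J 0 F)) • faceClass C (Finset.range D \ J) 1 P := by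
  refine Finset.sum_congr rfl fun J hJ => ?_
  rw [faceClass, faceClass, Finset.card_sdiff_of_subset (Finset.mem_powerset.1 hJ),
    Finset.card_range]
  rfl

theorem expand_image_succAt (i : ℕ) (J : Finset ℕ) (c v : ℕ → I) :
    expand (J.image (succAt i)) c v =
      insertCoord i (c i) (expand J (fun j => c (succAt i j)) v) := by
  funext j
  by_cases hj : j = i
  · subst hj
    rw [insertCoord_apply_self, expand, if_neg]
    simp [succAt_ne]
  · obtain ⟨k, rfl⟩ := exists_succAt hj
    rw [insertCoord_succAt, expand, expand, rank_image_apply (succAt_strictMono i)]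
    simp [(succAt_strictMono i).injective.eq_iff]

theorem faceClass_image_succAt (A : Set X) (i : ℕ) (J : Finset ℕ) (c : ℕ → I)
    (f : (ℕ → I) → X) : faceClass A (J.image (succAt i)) c f =
      faceClass A J (fun j => c (succAt i j)) fun v => f (insertCoord i (c i) v) := by
  rw [faceClass, faceClass, Finset.card_image_of_injective _ (succAt_strictMono i).injective]
  simp only [expand_image_succAt]

theorem range_erase_eq_image {D i : ℕ} (hi : i < D) :
    (Finset.range D).erase i = (Finset.range (D - 1)).image (succAt i) := by
  ext j
  simp only [Finset.mem_erase, Finset.mem_range, Finset.mem_image]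
  constructor
  · rintro ⟨h, hj⟩
    obtain ⟨k, rfl⟩ := exists_succAt h
    refine ⟨k, ?_, rfl⟩
    unfold succAt at hj
    split_ifs at hj <;> omega
  · rintro ⟨k, hk, rfl⟩
    refine ⟨succAt_ne i k, ?_⟩
    unfold succAt
    split_ifs <;> omega

theorem sum_powerset_image {V : Type*} [AddCommMonoid V] {ρ : ℕ → ℕ}
    (hρ : Function.Injective ρ) (S : Finset ℕ) (g : Finset ℕ → V) :
    ∑ J ∈ (S.image ρ).powerset, g J = ∑ J ∈ S.powerset, g (J.image ρ) := by
  rw [Finset.powerset_image, Finset.sum_image]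
  exact fun _ _ _ _ h => Finset.image_injective hρ h

/-- The cap product of a face, as a sum over sets of coordinates other than `i`. -/
theorem capPair_face {B : Set U} (τ : Chains B →ₗ[ℝ] ℝ) (C : Set X) {D i : ℕ} (hi : i < D)
    (e : I) (F : (ℕ → I) → U) (P : (ℕ → I) → X) :
    capPair τ C (D - 1) (fun v => F (insertCoord i e v)) (fun v => P (insertCoord i e v)) =
      ∑ J ∈ ((Finset.range D).erase i).powerset,
        (shuffleSign J ((Finset.range D).erase i \ J) *
          τ (faceClass B J (Function.update 0 i e) F)) •
          faceClass C ((Finset.range D).erase i \ J) (Function.update 1 i e) P := by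
  rw [range_erase_eq_image hi, sum_powerset_image (succAt_strictMono i).injective, capPair_eq_sum]
  refine Finset.sum_congr rfl fun J _ => ?_
  rw [← Finset.image_sdiff _ _ (succAt_strictMono i).injective,
    shuffleSign_image (succAt_strictMono i), faceClass_image_succAt, faceClass_image_succAt]
  simp only [ne_eq, succAt_ne, not_false_eq_true, Function.update_of_ne, Function.update_self]
  rfl

theorem IsRelCocycle.faceClass_eq_zero {n : ℕ} {B : Set U} {τ : Chains B →ₗ[ℝ] ℝ}
    (hτ : IsRelCocycle n τ) {J : Finset ℕ} (hJ : J.card ≠ n) (c : ℕ → I) {F : (ℕ → I) → U}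
    (hF : Continuous F) : τ (faceClass B J c F) = 0 := by
  rw [faceClass_eq _ _ _ hF]
  exact hτ.degree _ hJ

/-- The cocycle condition on the front face `J`. Its face at `i = 0` is again a front face, which
makes the terms comparable with those of a cap product. -/
theorem IsRelCocycle.sum_faceClass {n : ℕ} {B : Set U} {τ : Chains B →ₗ[ℝ] ℝ}
    (hτ : IsRelCocycle n τ) (J : Finset ℕ) {F : (ℕ → I) → U}
    (hF : Continuous F) : ∑ i ∈ J, (-1 : ℝ) ^ rank J i *
      (τ (faceClass B (J.erase i) (Function.update 0 i 1) F) -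
        τ (faceClass B (J.erase i) 0 F)) = 0 := by
  have := hτ.cocycle (faceClass B J 0 F)
  rw [chainD_faceClass _ _ _ hF, map_sum] at this
  rw [← this]
  refine Finset.sum_congr rfl fun i _ => ?_
  rw [map_smul, map_sub, smul_eq_mul, show Function.update (0 : ℕ → I) i 0 = 0 from
    Function.update_eq_self i 0]

/-- The terms with `P` at `i = 0` agree on both sides. Those with `P` at `i = 1` differ only in that
`τ` is evaluated on the face of `F` with `i = 1` instead of `i = 0`. Grouped by `J ∪ {i}`, these
differences cancel by the cocycle condition; no relation between `F` and `P` is used. -/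
theorem chainD_capPair {n : ℕ} {B : Set U} {τ : Chains B →ₗ[ℝ] ℝ} (hτ : IsRelCocycle n τ)
    (C : Set X) (D : ℕ) {F : (ℕ → I) → U} {P : (ℕ → I) → X} (hF : Continuous F)
    (hP : Continuous P) :
    chainD C (capPair τ C D F P) = (-1 : ℝ) ^ n • ∑ i ∈ Finset.range D, (-1 : ℝ) ^ i •
      (capPair τ C (D - 1) (fun v => F (insertCoord i 1 v)) (fun v => P (insertCoord i 1 v)) -
        capPair τ C (D - 1) (fun v => F (insertCoord i 0 v))
          (fun v => P (insertCoord i 0 v))) := by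
  set R := Finset.range D with hR
  have u0 : ∀ i, Function.update (0 : ℕ → I) i 0 = 0 := fun i => Function.update_eq_self i 0
  have u1 : ∀ i, Function.update (1 : ℕ → I) i 1 = 1 := fun i => Function.update_eq_self i 1
  -- both sides as sums over pairs `(i, J)` with `i ∉ J`
  have hl : chainD C (capPair τ C D F P) = ∑ i ∈ R, ∑ J ∈ (R.erase i).powerset,
      ((-1 : ℝ) ^ n * (-1) ^ i * shuffleSign J (R.erase i \ J) * τ (faceClass B J 0 F)) •
        (faceClass C (R.erase i \ J) 1 P -
          faceClass C (R.erase i \ J) (Function.update 1 i 0) P) := by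
    rw [capPair_eq_sum, map_sum]
    simp only [map_smul, chainD_faceClass C _ _ hP, Finset.smul_sum]
    rw [Finset.sum_comm' (t' := R) (s' := fun i => (R.erase i).powerset)]
    · refine Finset.sum_congr rfl fun i hi => Finset.sum_congr rfl fun J hJ => ?_
      rw [Finset.mem_powerset] at hJ
      have hiJ : i ∉ J := fun h => Finset.notMem_erase i R (hJ h)
      have h1 : R \ J = insert i (R.erase i \ J) := by
        rw [Finset.erase_sdiff_comm, Finset.insert_erase (by simp [hi, hiJ])]
      have h2 : (R \ J).erase i = R.erase i \ J := (Finset.erase_sdiff_comm _ _ _).symm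
      rw [h2, u1, smul_smul]
      -- The elements of `J` above `i` and the elements of the complement below `i` together number
      -- `J.card + i` modulo 2. This is where `(-1) ^ n` comes from; sets of another cardinality
      -- contribute nothing.
      by_cases hn : J.card = n
      · congr 1
        rw [h1, shuffleSign_insert_right (by simp), rank_insert_of_le le_rfl]
        have e1 := card_filter_gt hiJ
        have e2 := rank_add_rank_sdiff (Finset.mem_range.1 hi) hJ
        have e3 : (-1 : ℝ) ^ (J.filter (i < ·)).card * (-1) ^ rank (R.erase i \ J) i =
            (-1) ^ n * (-1) ^ i := by
          have p1 := congrArg ((-1 : ℝ) ^ ·) e1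
          have p2 := congrArg ((-1 : ℝ) ^ ·) e2
          simp only [hn, pow_add] at p1 p2
          rw [← p1, ← p2]
          have : (-1 : ℝ) ^ rank J i * (-1) ^ rank J i = 1 := by
            rw [← mul_pow]; simp
          linear_combination (-(-1 : ℝ) ^ (J.filter (i < ·)).card *
            (-1) ^ rank (R.erase i \ J) i) * this
        linear_combination (shuffleSign J (R.erase i \ J) * τ (faceClass B J 0 F)) * e3
      · simp [hτ.faceClass_eq_zero hn _ hF]
    · intro J i
      simp only [Finset.mem_powerset, Finset.mem_sdiff, Finset.subset_erase]
      tauto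
  have hr : ∑ i ∈ R, (-1 : ℝ) ^ i •
      (capPair τ C (D - 1) (fun v => F (insertCoord i 1 v)) (fun v => P (insertCoord i 1 v)) -
        capPair τ C (D - 1) (fun v => F (insertCoord i 0 v)) (fun v => P (insertCoord i 0 v))) =
      ∑ i ∈ R, ∑ J ∈ (R.erase i).powerset, ((-1) ^ i * shuffleSign J (R.erase i \ J)) •
        (τ (faceClass B J (Function.update 0 i 1) F) • faceClass C (R.erase i \ J) 1 P -
          τ (faceClass B J 0 F) • faceClass C (R.erase i \ J) (Function.update 1 i 0) P) := by
    refine Finset.sum_congr rfl fun i hi => ?_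
    rw [capPair_face τ C (Finset.mem_range.1 hi), capPair_face τ C (Finset.mem_range.1 hi), u1, u0,
      ← Finset.sum_sub_distrib, Finset.smul_sum]
    refine Finset.sum_congr rfl fun J _ => ?_
    rw [mul_smul, mul_smul, mul_smul, ← smul_sub]
  -- The excess terms. A pair `(i, J)` with `i ∉ J` corresponds to the set `J ∪ {i}` with a marked
  -- element; for a fixed set, the sum over the marked element is `τ` of a boundary.
  have key : ∑ i ∈ R, ∑ J ∈ (R.erase i).powerset, ((-1) ^ i * shuffleSign J (R.erase i \ J) *
      (τ (faceClass B J (Function.update 0 i 1) F) - τ (faceClass B J 0 F))) •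
        faceClass C (R.erase i \ J) 1 P = 0 := by
    have h1 : ∀ J ∈ R.powerset, ∑ i ∈ J, ((-1 : ℝ) ^ rank J i *
        (τ (faceClass B (J.erase i) (Function.update 0 i 1) F) -
          τ (faceClass B (J.erase i) 0 F))) • (shuffleSign J (R \ J) •
            faceClass C (R \ J) 1 P) = 0 := fun J _ => by
      rw [← Finset.sum_smul, hτ.sum_faceClass J hF, zero_smul]
    rw [← Finset.sum_eq_zero h1, Finset.sum_sigma', Finset.sum_sigma']
    refine Finset.sum_bij' (fun p _ => ⟨insert p.1 p.2, p.1⟩) (fun p _ => ⟨p.2, p.1.erase p.2⟩)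
      ?_ ?_ ?_ ?_ ?_
    · rintro ⟨i, J⟩ h
      simp only [Finset.mem_sigma, Finset.mem_powerset, Finset.subset_erase] at h ⊢
      exact ⟨Finset.insert_subset h.1 h.2.1, Finset.mem_insert_self _ _⟩
    · rintro ⟨J, i⟩ h
      simp only [Finset.mem_sigma, Finset.mem_powerset] at h ⊢
      exact ⟨h.1 h.2, Finset.erase_subset_erase _ h.1⟩
    · rintro ⟨i, J⟩ h
      simp only [Finset.mem_sigma, Finset.mem_powerset, Finset.subset_erase] at h
      simp [Finset.erase_insert h.2.2]
    · rintro ⟨J, i⟩ h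
      simp only [Finset.mem_sigma, Finset.mem_powerset] at h
      simp [Finset.insert_erase h.2]
    · rintro ⟨i, J⟩ h
      simp only [Finset.mem_sigma, Finset.mem_powerset] at h
      obtain ⟨hi, hJ⟩ := h
      have hiJ := (Finset.subset_erase.1 hJ).2
      have h2 : R \ insert i J = R.erase i \ J := by
        rw [Finset.sdiff_insert, Finset.erase_sdiff_comm]
      have e2 := rank_add_rank_sdiff (Finset.mem_range.1 hi) hJ
      simp only [Finset.erase_insert hiJ, h2, smul_smul]
      congr 1
      rw [rank_insert_of_le le_rfl, shuffleSign_insert_left hiJ]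
      have e3 : (-1 : ℝ) ^ i = (-1) ^ rank J i * (-1) ^ rank (R.erase i \ J) i := by
        conv_lhs => rw [← e2]
        rw [pow_add]
      rw [e3]
      ring
  -- The zero is written as a multiple of the sum in `key`, so that all three double sums can be
  -- compared term by term.
  have hz : (0 : Chains C) = (-(-1 : ℝ) ^ n) • 0 := (smul_zero _).symm
  rw [hl, hr, Finset.smul_sum, ← sub_eq_zero, ← Finset.sum_sub_distrib, hz, ← key,
    Finset.smul_sum]
  refine Finset.sum_congr rfl fun i _ => ?_
  rw [Finset.smul_sum, Finset.smul_sum, ← Finset.sum_sub_distrib]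
  refine Finset.sum_congr rfl fun J _ => ?_
  module

theorem faceClass_eq_zero_of_indep (A : Set X) {S : Finset ℕ} {i : ℕ} (hi : i ∈ S) (c : ℕ → I)
    {f : (ℕ → I) → X} (h : ∀ v w : ℕ → I, (∀ j, j ≠ i → v j = w j) → f v = f w) :
    faceClass A S c f = 0 := by
  refine cubeClass_eq_zero_of_degenerate (rank_lt_card hi) fun v w hvw => h _ _ fun j hj => ?_
  unfold expand
  split_ifs with hjS
  · refine hvw _ fun h => ?_
    rcases lt_or_gt_of_ne hj with hlt | hlt
    · exact absurd (rank_lt_rank hjS hlt) (by omega)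
    · exact absurd (rank_lt_rank hi hlt) (by omega)
  · rfl

/-- Each coordinate is free in the front face or in the back face, so every summand has a degenerate
factor. -/
theorem capPair_eq_zero_of_indep {B : Set U} (τ : Chains B →ₗ[ℝ] ℝ) (C : Set X) {D i : ℕ}
    (hi : i < D) {F : (ℕ → I) → U} {P : (ℕ → I) → X}
    (hF : ∀ v w : ℕ → I, (∀ j, j ≠ i → v j = w j) → F v = F w)
    (hP : ∀ v w : ℕ → I, (∀ j, j ≠ i → v j = w j) → P v = P w) : capPair τ C D F P = 0 := by
  rw [capPair_eq_sum]
  refine Finset.sum_eq_zero fun J _ => ?_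
  by_cases hiJ : i ∈ J
  · rw [faceClass_eq_zero_of_indep B hiJ _ hF, map_zero, mul_zero, zero_smul]
  · rw [faceClass_eq_zero_of_indep C (by simp [hi, hiJ]) _ hP, smul_zero]

theorem capPair_eq_zero_of_front_mem {B : Set U} (τ : Chains B →ₗ[ℝ] ℝ) (C : Set X) (D : ℕ)
    {F : (ℕ → I) → U} (P : (ℕ → I) → X) (hF : ∀ v, F v ∈ B) : capPair τ C D F P = 0 := by
  rw [capPair]
  refine Finset.sum_eq_zero fun J _ => ?_
  rw [cubeClass_eq_zero_of_mem (f := frontFace J F) fun v => hF _, map_zero, mul_zero, zero_smul]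

theorem capPair_eq_zero_of_back_mem {B : Set U} (τ : Chains B →ₗ[ℝ] ℝ) (C : Set X) (D : ℕ)
    (F : (ℕ → I) → U) {P : (ℕ → I) → X} (hP : ∀ v, P v ∈ C) : capPair τ C D F P = 0 := by
  rw [capPair]
  refine Finset.sum_eq_zero fun J _ => ?_
  rw [cubeClass_eq_zero_of_mem (f := backFace _ P) fun v => hP _, smul_zero]

theorem capPair_mem {n : ℕ} {B : Set U} {τ : Chains B →ₗ[ℝ] ℝ} (hτ : IsRelCocycle n τ)
    (C : Set X) (D : ℕ) {F : (ℕ → I) → U} (hF : Continuous F) (P : (ℕ → I) → X) :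
    capPair τ C D F P ∈ chainsOfDegree C ((D : ℤ) - n) := by
  rw [capPair]
  refine Submodule.sum_mem _ fun J hJ => ?_
  by_cases hn : J.card = n
  · refine Submodule.smul_mem _ _ ?_
    have hle := Finset.card_le_card (Finset.mem_powerset.1 hJ)
    rw [Finset.card_range] at hle
    have : ((D - J.card : ℕ) : ℤ) = D - n := by omega
    rw [← this]
    exact cubeClass_mem_chainsOfDegree _ _ _
  · have := hτ.faceClass_eq_zero hn 0 hF
    rw [frontFace_eq]
    change τ (cubeClass _ _ _) = 0 at this
    rw [this, mul_zero, zero_smul]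
    exact zero_mem _

theorem pushChains_faceClass {A : Set X} {B : Set Y} {f : X → Y} (hf : MapsTo f A B)
    {g : (ℕ → I) → X} (hg : Continuous g) (S : Finset ℕ) (c : ℕ → I) :
    pushChains A B f hf (faceClass A S c g) = faceClass B S c fun v => f (g v) := by
  rw [faceClass_eq _ _ _ hg, pushChains_cls]
  rfl

theorem pushChains_capPair {B : Set U} (τ : Chains B →ₗ[ℝ] ℝ) {C : Set X} {C' : Set Y}
    {f : X → Y} (hf : MapsTo f C C') (D : ℕ) (F : (ℕ → I) → U) {P : (ℕ → I) → X}
    (hP : Continuous P) :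
    pushChains C C' f hf (capPair τ C D F P) = capPair τ C' D F fun v => f (P v) := by
  simp only [capPair_eq_sum, map_sum, map_smul, pushChains_faceClass hf hP]

theorem capPair_comp_pushChains {B : Set U} {B' : Set Z} (τ : Chains B' →ₗ[ℝ] ℝ) {f : U → Z}
    (hf : MapsTo f B B') (C : Set X) (D : ℕ) {F : (ℕ → I) → U} (hF : Continuous F)
    (P : (ℕ → I) → X) :
    capPair (τ ∘ₗ pushChains B B' f hf) C D F P = capPair τ C D (fun v => f (F v)) P := by
  simp only [capPair_eq_sum, LinearMap.comp_apply, pushChains_faceClass hf hF]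

theorem rank_add_block {J : Finset ℕ} (m d : ℕ) {j : ℕ} (hj : j ≤ d) :
    rank J (m + j) = rank J m + rank (block J m d) j := by
  have h1 : J.filter (· < m + j) = J.filter (· < m) ∪ ((block J m d).filter (· < j)).image
      (· + m) := by
    ext k
    simp only [block, Finset.mem_filter, Finset.mem_union, Finset.mem_image, Finset.mem_range]
    constructor
    · rintro ⟨h, h'⟩
      rcases lt_or_ge k m with hk | hk
      · exact Or.inl ⟨h, hk⟩
      · exact Or.inr ⟨k - m, ⟨⟨by omega, by rwa [Nat.sub_add_cancel hk]⟩, by omega⟩, by omega⟩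
    · rintro (⟨h, h'⟩ | ⟨k, ⟨⟨h, h'⟩, h''⟩, rfl⟩)
      · exact ⟨h, by omega⟩
      · exact ⟨h', by omega⟩
  rw [rank, h1, Finset.card_union_of_disjoint, Finset.card_image_of_injective _
    (add_left_injective m)]
  · rfl
  · rw [Finset.disjoint_left]
    intro k hk hk'
    simp only [Finset.mem_filter, Finset.mem_image] at hk hk'
    omega

theorem rank_of_subset_range {J : Finset ℕ} {d : ℕ} (h : J ⊆ Finset.range d) :
    rank J d = J.card := by
  rw [rank, Finset.filter_true_of_mem fun k hk => Finset.mem_range.1 (h hk)]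

theorem block_subset (J : Finset ℕ) (m d : ℕ) : block J m d ⊆ Finset.range d :=
  Finset.filter_subset _ _

theorem card_block (J : Finset ℕ) (m d : ℕ) : rank J m + (block J m d).card = rank J (m + d) := by
  rw [rank_add_block m d le_rfl, rank_of_subset_range (block_subset J m d)]

/-- On a block of consecutive coordinates, a face is the face given by the part of `J` in that
block; its free coordinates are read from position `rank J m` on. -/
theorem shift_expand {J : Finset ℕ} (m d : ℕ) (c v : ℕ → I) {j : ℕ} (hj : j < d) :
    shift m (expand J c v) j = expand (block J m d) (shift m c) (shift (rank J m) v) j := by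
  have : m + j ∈ J ↔ j ∈ block J m d := by simp [block, hj, add_comm]
  simp only [shift, expand, add_comm j m, this, rank_add_block m d hj.le]
  simp only [add_comm]

/-- A face of a product cube is the product of faces of the factors, so invariance for products of
cubes can be applied to the faces. General `ev` and `ι` cover both the self-maps of `U_{x₀}` and the
half-constant embeddings. -/
theorem faceClass_invariant {T : Type*} [TopologicalSpace T] {B : Set Z} {τ : Chains B →ₗ[ℝ] ℝ}
    {ev : T → U → Z} {ι : U → Z} {T₀ : Set T}
    (hinv : ∀ (κ : Cube U) (ψ : Cube T), (∀ v, ψ.toFun v ∈ T₀) →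
      τ (cubeClass B (κ.dim + ψ.dim) fun v => ev (ψ.toFun (shift κ.dim v)) (κ.toFun v)) =
        τ (cubeClass B (κ.dim + ψ.dim) fun v => ι (κ.toFun v)))
    {m d : ℕ} {ρ : (ℕ → I) → U} (hρ : Continuous ρ)
    (hρm : ∀ v w : ℕ → I, (∀ i < m, v i = w i) → ρ v = ρ w)
    {ψ : (ℕ → I) → T} (hψ : Continuous ψ)
    (hψd : ∀ v w : ℕ → I, (∀ i < d, v i = w i) → ψ v = ψ w) (hψT : ∀ v, ψ v ∈ T₀)
    {J : Finset ℕ} (hJ : J ⊆ Finset.range (m + d)) :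
    τ (faceClass B J 0 fun v => ev (ψ (shift m v)) (ρ v)) =
      τ (faceClass B J 0 fun v => ι (ρ v)) := by
  let κ : Cube U := ⟨rank J m, fun v => ρ (expand J 0 v), hρ.comp (continuous_expand _ _),
    fun v w h => hρm _ _ fun i hi => by
      unfold expand
      split_ifs with hiJ
      · exact h _ (rank_lt_rank hiJ hi)
      · rfl⟩
  let ψ' : Cube T := ⟨(block J m d).card, fun v => ψ (expand (block J m d) 0 v),
    hψ.comp (continuous_expand _ _), fun v w h => congrArg ψ (expand_congr h)⟩
  have hd : κ.dim + ψ'.dim = J.card := by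
    rw [← rank_of_subset_range hJ, ← card_block]
  have := hinv κ ψ' fun v => hψT _
  rw [hd] at this
  rw [faceClass, faceClass, ← this]
  congr 2
  funext v
  congr 1
  exact hψd _ _ fun i hi => shift_expand m d 0 v hi

theorem capPair_invariant {T : Type*} [TopologicalSpace T] {B : Set Z} {τ : Chains B →ₗ[ℝ] ℝ}
    {ev : T → U → Z} {ι : U → Z} {T₀ : Set T}
    (hinv : ∀ (κ : Cube U) (ψ : Cube T), (∀ v, ψ.toFun v ∈ T₀) →
      τ (cubeClass B (κ.dim + ψ.dim) fun v => ev (ψ.toFun (shift κ.dim v)) (κ.toFun v)) =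
        τ (cubeClass B (κ.dim + ψ.dim) fun v => ι (κ.toFun v)))
    {m d : ℕ} {ρ : (ℕ → I) → U} (hρ : Continuous ρ)
    (hρm : ∀ v w : ℕ → I, (∀ i < m, v i = w i) → ρ v = ρ w)
    {ψ : (ℕ → I) → T} (hψ : Continuous ψ)
    (hψd : ∀ v w : ℕ → I, (∀ i < d, v i = w i) → ψ v = ψ w) (hψT : ∀ v, ψ v ∈ T₀)
    (C : Set X) (P : (ℕ → I) → X) :
    capPair τ C (m + d) (fun v => ev (ψ (shift m v)) (ρ v)) P =
      capPair τ C (m + d) (fun v => ι (ρ v)) P := by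
  rw [capPair_eq_sum, capPair_eq_sum]
  refine Finset.sum_congr rfl fun J hJ => ?_
  rw [faceClass_invariant hinv hρ hρm hψ hψd hψT (Finset.mem_powerset.1 hJ)]

/-- Because `ρ` depends on the first `m` coordinates only, a set `J` that reaches into the
coordinates of `p` gives a degenerate front face. For the other sets the complement contains all
coordinates of `p`; they come after all elements of `J` and cost no sign. -/
theorem capPair_cross {W : Type*} [TopologicalSpace W] {B : Set Z} (τ : Chains B →ₗ[ℝ] ℝ)
    {C : Set X} {C' : Set W} {act : X → Y → W} (hact : Continuous fun p : X × Y => act p.1 p.2)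
    (hC : ∀ x ∈ C, ∀ y, act x y ∈ C') {m : ℕ} {ρ : (ℕ → I) → Z}
    (hρm : ∀ v w : ℕ → I, (∀ i < m, v i = w i) → ρ v = ρ w) {P : (ℕ → I) → X} (hP : Continuous P)
    (hPm : ∀ v w : ℕ → I, (∀ i < m, v i = w i) → P v = P w) (p : Cube Y) :
    capPair τ C' (m + p.dim) ρ (fun v => act (P v) (p.toFun (shift m v))) =
      crossChains C C' act hC (capPair τ C m ρ P) (p.cls ∅) := by
  rw [capPair_eq_sum, capPair_eq_sum, map_sum, LinearMap.sum_apply]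
  have hsub : Finset.range m ⊆ Finset.range (m + p.dim) :=
    Finset.range_subset_range.2 (by omega)
  rw [← Finset.sum_subset (Finset.powerset_mono.2 hsub)]
  · refine Finset.sum_congr rfl fun J hJ => ?_
    rw [Finset.mem_powerset] at hJ
    rw [map_smul, LinearMap.smul_apply]
    have hsgn : shuffleSign J (Finset.range (m + p.dim) \ J) =
        shuffleSign J (Finset.range m \ J) := by
      rw [shuffleSign, shuffleSign]
      congr 2
      ext ⟨j, k⟩
      simp only [Finset.mem_filter, Finset.mem_product, Finset.mem_sdiff, Finset.mem_range]
      constructor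
      · rintro ⟨⟨hj, hk, hkJ⟩, hlt⟩
        exact ⟨⟨hj, (hlt.trans (Finset.mem_range.1 (hJ hj))), hkJ⟩, hlt⟩
      · rintro ⟨⟨hj, hk, hkJ⟩, hlt⟩
        exact ⟨⟨hj, by omega, hkJ⟩, hlt⟩
    rw [hsgn]
    congr 1
    set K := Finset.range m \ J with hK
    set K' := Finset.range (m + p.dim) \ J with hK'
    have hcard : K'.card = K.card + p.dim := by
      have := Finset.card_le_card hJ
      rw [Finset.card_range] at this
      rw [hK', hK, Finset.card_sdiff_of_subset (hJ.trans hsub), Finset.card_sdiff_of_subset hJ,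
        Finset.card_range, Finset.card_range]
      omega
    have hrank : ∀ i ≤ m, rank K' i = rank K i := by
      intro i hi
      rw [rank, rank]
      congr 1
      ext k
      simp only [hK, hK', Finset.mem_filter, Finset.mem_sdiff, Finset.mem_range]
      constructor
      · rintro ⟨⟨h1, h2⟩, h3⟩
        exact ⟨⟨by omega, h2⟩, h3⟩
      · rintro ⟨⟨h1, h2⟩, h3⟩
        exact ⟨⟨by omega, h2⟩, h3⟩
    have hKm : rank K m = K.card := rank_of_subset_range Finset.sdiff_subset
    have hmem : ∀ i, m ≤ i → i < m + p.dim → i ∈ K' := fun i h1 h2 =>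
      Finset.mem_sdiff.2 ⟨Finset.mem_range.2 h2, fun h => by
        have := Finset.mem_range.1 (hJ h)
        omega⟩
    -- The coordinates of `p` follow those of the back face of `P` and keep their order.
    have hrank2 : ∀ i ≤ p.dim, rank K' (m + i) = K.card + i := by
      intro i
      induction i with
      | zero => intro _; rw [add_zero, hrank m le_rfl, hKm, add_zero]
      | succ i ih =>
        intro hi
        rw [← add_assoc, rank_succ_of_mem (hmem _ (by omega) (by omega)), ih (by omega)]
        rfl
    rw [faceClass_eq C _ _ hP, crossChains_cls hact, ← Cube.cubeClass_eq, faceClass, hcard]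
    change cubeClass C' (K.card + p.dim) _ = cubeClass C' (K.card + p.dim) fun v =>
      act (P (expand K 1 v)) (p.toFun (shift K.card v))
    congr 1
    funext v
    congr 1
    · refine hPm _ _ fun i hi => ?_
      have : i ∈ K' ↔ i ∈ K := by
        simp only [hK, hK', Finset.mem_sdiff, Finset.mem_range]
        exact ⟨fun h => ⟨hi, h.2⟩, fun h => ⟨by omega, h.2⟩⟩
      simp only [expand, this, hrank i hi.le]
    · refine p.depends _ _ fun i hi => ?_
      simp only [shift, expand]
      rw [if_pos (hmem _ (by omega) (by omega)), add_comm i m, hrank2 i hi.le, add_comm]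
  · intro J hJ hJ'
    rw [Finset.mem_powerset] at hJ hJ'
    obtain ⟨i, hiJ, him⟩ := Finset.not_subset.1 hJ'
    rw [Finset.mem_range] at him
    rw [faceClass_eq_zero_of_indep B hiJ, map_zero, mul_zero, zero_smul]
    exact fun v w h => hρm _ _ fun j hj => h j (by omega)

end Cap

/-! ### Abstract transport data -/

section Transport

variable {X Ω U S P Y Z T : Type*} [TopologicalSpace X] [TopologicalSpace Ω] [TopologicalSpace U]
  [TopologicalSpace S] [TopologicalSpace P] [TopologicalSpace Y] [TopologicalSpace Z]
  [TopologicalSpace T]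

/-- A topological monoid `Ω` acting on a space `X` over a space `U`, where the action on `U` factors
through a space `S` of self-maps of `U` that carries a homotopy `H` from a retraction to the
identity. -/
structure FibreData (X Ω U S : Type*) [TopologicalSpace X] [TopologicalSpace Ω]
    [TopologicalSpace U] [TopologicalSpace S] where
  mul : Ω → Ω → Ω
  one : Ω
  act : X → Ω → X
  e : X → U
  θ : Ω → S
  ev : S → U → U
  comp : S → S → S
  id : S
  H : I → S → S
  continuous_mul : Continuous fun p : Ω × Ω => mul p.1 p.2
  continuous_act : Continuous fun p : X × Ω => act p.1 p.2
  continuous_e : Continuous e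
  continuous_θ : Continuous θ
  continuous_ev : Continuous fun p : S × U => ev p.1 p.2
  continuous_comp : Continuous fun p : S × S => comp p.1 p.2
  continuous_H : Continuous fun p : I × S => H p.1 p.2
  mul_assoc : ∀ a b c, mul (mul a b) c = mul a (mul b c)
  mul_one : ∀ a, mul a one = a
  act_one : ∀ x, act x one = x
  act_mul : ∀ x a b, act (act x a) b = act x (mul a b)
  e_act : ∀ x a, e (act x a) = ev (θ a) (e x)
  θ_mul : ∀ a b, θ (mul a b) = comp (θ b) (θ a)
  ev_id : ∀ u, ev id u = u
  ev_comp : ∀ f g u, ev (comp f g) u = ev f (ev g u)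
  id_comp : ∀ f, comp id f = f
  comp_id : ∀ f, comp f id = f
  comp_assoc : ∀ f g h, comp (comp f g) h = comp f (comp g h)
  H_one : ∀ f, H 1 f = f
  H_comp : ∀ t f g, H t (comp (H 0 f) g) = comp (H 0 f) (H t g)

/-- A space `P` over which the action of `FibreData` extends to a map from `X × P` to a space `Y`
over `Z`, which factors through a space `T` of maps from `U` to `Z`. -/
structure PathData (d : FibreData X Ω U S) (P Y Z T : Type*) [TopologicalSpace P]
    [TopologicalSpace Y] [TopologicalSpace Z] [TopologicalSpace T] where
  mul : Ω → P → P
  act : X → P → Y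
  e : Y → Z
  θ : P → T
  ev : T → U → Z
  comp : T → S → T
  H : I → T → T
  ι : U → Z
  continuous_mul : Continuous fun p : Ω × P => mul p.1 p.2
  continuous_act : Continuous fun p : X × P => act p.1 p.2
  continuous_e : Continuous e
  continuous_θ : Continuous θ
  continuous_ev : Continuous fun p : T × U => ev p.1 p.2
  continuous_comp : Continuous fun p : T × S => comp p.1 p.2
  continuous_H : Continuous fun p : I × T => H p.1 p.2
  mul_assoc : ∀ a b p, mul (d.mul a b) p = mul a (mul b p)
  one_mul : ∀ p, mul d.one p = p
  act_mul : ∀ x a p, act (d.act x a) p = act x (mul a p)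
  e_act : ∀ x p, e (act x p) = ev (θ p) (d.e x)
  θ_mul : ∀ a p, θ (mul a p) = comp (θ p) (d.θ a)
  ev_comp : ∀ f g u, ev (comp f g) u = ev f (d.ev g u)
  comp_id : ∀ f, comp f d.id = f
  comp_assoc : ∀ f g h, comp (comp f g) h = comp f (d.comp g h)
  H_one : ∀ f, H 1 f = f
  H_comp : ∀ t f g, H t (comp (H 0 f) g) = comp (H 0 f) (d.H t g)

/-- The monoid acting on itself. -/
def FibreData.self (d : FibreData X Ω U S) (h : ∀ a, d.mul d.one a = a) :
    PathData d Ω X U S where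
  mul := d.mul
  act := d.act
  e := d.e
  θ := d.θ
  ev := d.ev
  comp := d.comp
  H := d.H
  ι := _root_.id
  continuous_mul := d.continuous_mul
  continuous_act := d.continuous_act
  continuous_e := d.continuous_e
  continuous_θ := d.continuous_θ
  continuous_ev := d.continuous_ev
  continuous_comp := d.continuous_comp
  continuous_H := d.continuous_H
  mul_assoc := d.mul_assoc
  one_mul := h
  act_mul := d.act_mul
  e_act := d.e_act
  θ_mul := d.θ_mul
  ev_comp := d.ev_comp
  comp_id := d.comp_id
  comp_assoc := d.comp_assoc
  H_one := d.H_one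
  H_comp := d.H_comp

theorem shift_insertCoord_self (s : ℕ) (c : I) (v : ℕ → I) :
    shift s (insertCoord s c v) = insertCoord 0 c (shift s v) :=
  shift_insertCoord_add s 0 c v

theorem Cube.toFun_shift_one_insertCoord (κ : Cube X) {i : ℕ} (h : κ.dim + 1 ≤ i) (c : I)
    (v : ℕ → I) : κ.toFun (shift 1 (insertCoord i c v)) = κ.toFun (shift 1 v) :=
  κ.depends _ _ fun _ _ => insertCoord_apply_of_lt (by omega) c v

/-- The number of coordinates of a list of cubes with an additional parameter for each cube. -/
def paramDim : List (Cube Ω) → ℕ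
  | [] => 0
  | κ :: L => κ.dim + 1 + paramDim L

theorem paramDim_append (L L' : List (Cube Ω)) :
    paramDim (L ++ L') = paramDim L + paramDim L' := by
  induction L with
  | nil => simp [paramDim]
  | cons κ L ih => simp [paramDim, ih, add_assoc]

theorem totalDim_append (L L' : List (Cube Ω)) :
    totalDim (L ++ L') = totalDim L + totalDim L' := by
  induction L with
  | nil => simp [totalDim]
  | cons κ L ih => simp [totalDim, ih, add_assoc]

theorem paramDim_eq (L : List (Cube Ω)) : paramDim L = totalDim L + L.length := by
  induction L with
  | nil => simp [paramDim, totalDim]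
  | cons κ L ih => simp [paramDim, totalDim, ih]; ring

namespace FibreData

variable (d : FibreData X Ω U S)

/-- The higher homotopy of a list of cubes, as a function of the parameters and coordinates. -/
def hom : List (Cube Ω) → (ℕ → I) → S
  | [], _ => d.id
  | κ :: L, v => d.H (v 0) (d.comp (hom L (shift (κ.dim + 1) v)) (d.θ (κ.toFun (shift 1 v))))

/-- The product of a list of cubes, as a function of the parameters and coordinates. -/
def prod : List (Cube Ω) → (ℕ → I) → Ω
  | [], _ => d.one
  | κ :: L, v => d.mul (κ.toFun (shift 1 v)) (prod L (shift (κ.dim + 1) v))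

/-- The product of two cubes. -/
def mulCube (κ κ' : Cube Ω) : Cube Ω := crossCube d.mul d.continuous_mul κ κ'

/-- The action of a cube on a cube. -/
def actCube (α : Cube X) (κ : Cube Ω) : Cube X := crossCube d.act d.continuous_act α κ

theorem mulCube_dim (κ κ' : Cube Ω) : (d.mulCube κ κ').dim = κ.dim + κ'.dim := rfl

theorem mulCube_shift (κ κ' : Cube Ω) (v : ℕ → I) : (d.mulCube κ κ').toFun (shift 1 v) =
    d.mul (κ.toFun (shift 1 v)) (κ'.toFun (shift (κ.dim + 1) v)) := by
  rw [← shift_shift]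
  rfl

theorem continuous_hom (L : List (Cube Ω)) : Continuous (d.hom L) := by
  induction L with
  | nil => exact continuous_const
  | cons κ L ih =>
    exact d.continuous_H.comp ((continuous_apply 0).prodMk (d.continuous_comp.comp
      ((ih.comp (continuous_shift _)).prodMk
        (d.continuous_θ.comp (κ.continuous.comp (continuous_shift _))))))

theorem continuous_prod (L : List (Cube Ω)) : Continuous (d.prod L) := by
  induction L with
  | nil => exact continuous_const
  | cons κ L ih =>
    exact d.continuous_mul.comp ((κ.continuous.comp (continuous_shift _)).prodMk
      (ih.comp (continuous_shift _)))

theorem hom_depends (L : List (Cube Ω)) (v w : ℕ → I) (h : ∀ i < paramDim L, v i = w i) :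
    d.hom L v = d.hom L w := by
  induction L generalizing v w with
  | nil => rfl
  | cons κ L ih =>
    simp only [paramDim] at h
    rw [hom, hom, h 0 (by omega), ih (shift (κ.dim + 1) v) (shift (κ.dim + 1) w) fun i hi => h _ (by omega),
      κ.depends (shift 1 v) (shift 1 w) fun i hi => h _ (by omega)]

theorem prod_depends (L : List (Cube Ω)) (v w : ℕ → I) (h : ∀ i < paramDim L, v i = w i) :
    d.prod L v = d.prod L w := by
  induction L generalizing v w with
  | nil => rfl
  | cons κ L ih =>
    simp only [paramDim] at h
    rw [prod, prod, ih (shift (κ.dim + 1) v) (shift (κ.dim + 1) w) fun i hi => h _ (by omega),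
      κ.depends (shift 1 v) (shift 1 w) fun i hi => h _ (by omega)]

/-- The point of `U` moved by the higher homotopy. -/
def frontFun (α : Cube X) (L : List (Cube Ω)) (v : ℕ → I) : U :=
  d.ev (d.hom L (shift α.dim v)) (d.e (α.toFun v))

/-- The point of `X` moved by the product. -/
def backFun (α : Cube X) (L : List (Cube Ω)) (v : ℕ → I) : X :=
  d.act (α.toFun v) (d.prod L (shift α.dim v))

theorem continuous_frontFun (α : Cube X) (L : List (Cube Ω)) : Continuous (d.frontFun α L) :=
  d.continuous_ev.comp (((d.continuous_hom L).comp (continuous_shift _)).prodMk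
    (d.continuous_e.comp α.continuous))

theorem continuous_backFun (α : Cube X) (L : List (Cube Ω)) : Continuous (d.backFun α L) :=
  d.continuous_act.comp (α.continuous.prodMk ((d.continuous_prod L).comp (continuous_shift _)))

theorem frontFun_depends (α : Cube X) (L : List (Cube Ω)) (v w : ℕ → I)
    (h : ∀ i < α.dim + paramDim L, v i = w i) : d.frontFun α L v = d.frontFun α L w := by
  rw [frontFun, frontFun, α.depends v w fun i hi => h i (by omega),
    d.hom_depends L (shift α.dim v) (shift α.dim w) fun i hi => h _ (by omega)]

theorem backFun_depends (α : Cube X) (L : List (Cube Ω)) (v w : ℕ → I)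
    (h : ∀ i < α.dim + paramDim L, v i = w i) : d.backFun α L v = d.backFun α L w := by
  rw [backFun, backFun, α.depends v w fun i hi => h i (by omega),
    d.prod_depends L (shift α.dim v) (shift α.dim w) fun i hi => h _ (by omega)]

end FibreData

namespace PathData

variable {d : FibreData X Ω U S} (D : PathData d P Y Z T)

/-- The higher homotopy of a list of cubes and a cube of paths. -/
def hom : List (Cube Ω) → Cube P → (ℕ → I) → T
  | [], p, v => D.H (v 0) (D.θ (p.toFun (shift 1 v)))
  | κ :: L, p, v =>
      D.H (v 0) (D.comp (hom L p (shift (κ.dim + 1) v)) (d.θ (κ.toFun (shift 1 v))))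

/-- The higher homotopy before the application of the outermost homotopy. -/
def inner : List (Cube Ω) → Cube P → (ℕ → I) → T
  | [], p, v => D.θ (p.toFun v)
  | κ :: L, p, v => D.comp (D.hom L p (shift κ.dim v)) (d.θ (κ.toFun v))

/-- The product of a list of cubes and a cube of paths. -/
def prod : List (Cube Ω) → Cube P → (ℕ → I) → P
  | [], p, v => p.toFun (shift 1 v)
  | κ :: L, p, v => D.mul (κ.toFun (shift 1 v)) (prod L p (shift (κ.dim + 1) v))

/-- The product of a cube and a cube of paths. -/
def mulCube (κ : Cube Ω) (p : Cube P) : Cube P := crossCube D.mul D.continuous_mul κ p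

/-- The action of a cube of paths on a cube. -/
def actCube (α : Cube X) (p : Cube P) : Cube Y := crossCube D.act D.continuous_act α p

theorem mulCube_shift (κ : Cube Ω) (p : Cube P) (v : ℕ → I) :
    (D.mulCube κ p).toFun (shift 1 v) =
      D.mul (κ.toFun (shift 1 v)) (p.toFun (shift (κ.dim + 1) v)) := by
  rw [← shift_shift]
  rfl

/-- Isolates the outermost parameter, the one that is set to `0` or `1` when a parameter face is
computed. -/
theorem hom_eq_inner (L : List (Cube Ω)) (p : Cube P) (v : ℕ → I) :
    D.hom L p v = D.H (v 0) (D.inner L p (shift 1 v)) := by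
  cases L with
  | nil => rfl
  | cons κ L => simp only [hom, inner, shift_shift]

theorem continuous_hom (L : List (Cube Ω)) (p : Cube P) : Continuous (D.hom L p) := by
  induction L with
  | nil =>
    exact D.continuous_H.comp ((continuous_apply 0).prodMk
      (D.continuous_θ.comp (p.continuous.comp (continuous_shift _))))
  | cons κ L ih =>
    exact D.continuous_H.comp ((continuous_apply 0).prodMk (D.continuous_comp.comp
      ((ih.comp (continuous_shift _)).prodMk
        (d.continuous_θ.comp (κ.continuous.comp (continuous_shift _))))))

theorem continuous_inner (L : List (Cube Ω)) (p : Cube P) : Continuous (D.inner L p) := by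
  cases L with
  | nil => exact D.continuous_θ.comp p.continuous
  | cons κ L =>
    exact D.continuous_comp.comp (((D.continuous_hom L p).comp (continuous_shift _)).prodMk
        (d.continuous_θ.comp κ.continuous))

theorem continuous_prod (L : List (Cube Ω)) (p : Cube P) : Continuous (D.prod L p) := by
  induction L with
  | nil => exact p.continuous.comp (continuous_shift _)
  | cons κ L ih =>
    exact D.continuous_mul.comp ((κ.continuous.comp (continuous_shift _)).prodMk
      (ih.comp (continuous_shift _)))

theorem hom_depends (L : List (Cube Ω)) (p : Cube P) (v w : ℕ → I)
    (h : ∀ i < paramDim L + (p.dim + 1), v i = w i) : D.hom L p v = D.hom L p w := by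
  induction L generalizing v w with
  | nil =>
    simp only [paramDim] at h
    rw [hom, hom, h 0 (by omega), p.depends (shift 1 v) (shift 1 w) fun i hi => h _ (by omega)]
  | cons κ L ih =>
    simp only [paramDim] at h
    rw [hom, hom, h 0 (by omega), ih (shift (κ.dim + 1) v) (shift (κ.dim + 1) w) fun i hi => h _ (by omega),
      κ.depends (shift 1 v) (shift 1 w) fun i hi => h _ (by omega)]

theorem inner_depends (L : List (Cube Ω)) (p : Cube P) (v w : ℕ → I)
    (h : ∀ i < paramDim L + p.dim, v i = w i) : D.inner L p v = D.inner L p w := by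
  cases L with
  | nil =>
    simp only [paramDim] at h
    rw [inner, inner, p.depends v w fun i hi => h _ (by omega)]
  | cons κ L =>
    simp only [paramDim] at h
    rw [inner, inner, D.hom_depends L p (shift κ.dim v) (shift κ.dim w) fun i hi => h _ (by omega),
      κ.depends v w fun i hi => h _ (by omega)]

/-- The point of `Z` moved by the higher homotopy. -/
def frontFun (α : Cube X) (L : List (Cube Ω)) (p : Cube P) (v : ℕ → I) : Z :=
  D.ev (D.hom L p (shift α.dim v)) (d.e (α.toFun v))

/-- The point of `Y` moved by the product. -/
def backFun (α : Cube X) (L : List (Cube Ω)) (p : Cube P) (v : ℕ → I) : Y :=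
  D.act (α.toFun v) (D.prod L p (shift α.dim v))

theorem continuous_frontFun (α : Cube X) (L : List (Cube Ω)) (p : Cube P) :
    Continuous (D.frontFun α L p) :=
  D.continuous_ev.comp (((D.continuous_hom L p).comp (continuous_shift _)).prodMk
    (d.continuous_e.comp α.continuous))

theorem continuous_backFun (α : Cube X) (L : List (Cube Ω)) (p : Cube P) :
    Continuous (D.backFun α L p) :=
  D.continuous_act.comp (α.continuous.prodMk ((D.continuous_prod L p).comp (continuous_shift _)))

/-! ### Faces in the coordinates of the cubes -/

/-- The parameter of a block precedes its coordinates, so coordinate `j` of `κ` has position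
`paramDim L + (1 + j)`. -/
theorem hom_face (L L' : List (Cube Ω)) (κ : Cube Ω) (p : Cube P) {j : ℕ} (hj : j < κ.dim) (c : I)
    (v : ℕ → I) : D.hom (L ++ κ :: L') p (insertCoord (paramDim L + (1 + j)) c v) =
      D.hom (L ++ κ.face j hj c :: L') p v := by
  induction L generalizing v with
  | nil =>
    simp only [List.nil_append, hom, paramDim, zero_add, shift_insertCoord_add,
      shift_insertCoord_of_lt (show 1 + j < κ.dim + 1 by omega),
      insertCoord_apply_of_lt (show 0 < 1 + j by omega)]
    simp only [Cube.face, Nat.sub_add_cancel (show 1 ≤ κ.dim by omega), Nat.add_sub_cancel]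
  | cons μ L ih =>
    simp only [List.cons_append, hom, paramDim]
    rw [add_assoc (μ.dim + 1), shift_insertCoord_add, ih, insertCoord_apply_of_lt (by omega), Cube.toFun_shift_one_insertCoord _ (by omega)]

theorem prod_face (L L' : List (Cube Ω)) (κ : Cube Ω) (p : Cube P) {j : ℕ} (hj : j < κ.dim)
    (c : I) (v : ℕ → I) : D.prod (L ++ κ :: L') p (insertCoord (paramDim L + (1 + j)) c v) =
      D.prod (L ++ κ.face j hj c :: L') p v := by
  induction L generalizing v with
  | nil =>
    simp only [List.nil_append, prod, paramDim, zero_add, shift_insertCoord_add,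
      shift_insertCoord_of_lt (show 1 + j < κ.dim + 1 by omega)]
    simp only [Cube.face, Nat.sub_add_cancel (show 1 ≤ κ.dim by omega), Nat.add_sub_cancel]
  | cons μ L ih =>
    simp only [List.cons_append, prod, paramDim]
    rw [add_assoc (μ.dim + 1), shift_insertCoord_add, ih, Cube.toFun_shift_one_insertCoord _ (by omega)]

theorem hom_face_last (L : List (Cube Ω)) (p : Cube P) {j : ℕ} (hj : j < p.dim) (c : I)
    (v : ℕ → I) : D.hom L p (insertCoord (paramDim L + (1 + j)) c v) =
      D.hom L (p.face j hj c) v := by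
  induction L generalizing v with
  | nil =>
    simp only [hom, paramDim, zero_add, shift_insertCoord_add,
      insertCoord_apply_of_lt (show 0 < 1 + j by omega), Cube.face]
  | cons μ L ih =>
    simp only [hom, paramDim]
    rw [add_assoc (μ.dim + 1), shift_insertCoord_add, ih, insertCoord_apply_of_lt (by omega), Cube.toFun_shift_one_insertCoord _ (by omega)]

theorem prod_face_last (L : List (Cube Ω)) (p : Cube P) {j : ℕ} (hj : j < p.dim) (c : I)
    (v : ℕ → I) : D.prod L p (insertCoord (paramDim L + (1 + j)) c v) =
      D.prod L (p.face j hj c) v := by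
  induction L generalizing v with
  | nil => simp only [prod, paramDim, zero_add, shift_insertCoord_add, Cube.face]
  | cons μ L ih =>
    simp only [prod, paramDim]
    rw [add_assoc (μ.dim + 1), shift_insertCoord_add, ih, Cube.toFun_shift_one_insertCoord _ (by omega)]

/-! ### Faces in the parameters -/

/-- The coordinate set to `1` is the parameter of `κ'`. There the inner homotopy is the identity,
and the composition rule for `θ` fuses the two blocks into that of the product. -/
theorem hom_one_mul (L L' : List (Cube Ω)) (κ κ' : Cube Ω) (p : Cube P) (v : ℕ → I) :
    D.hom (L ++ κ :: κ' :: L') p (insertCoord (paramDim L + (κ.dim + 1)) 1 v) =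
      D.hom (L ++ d.mulCube κ κ' :: L') p v := by
  induction L generalizing v with
  | nil =>
    simp only [List.nil_append, paramDim, zero_add]
    rw [hom, insertCoord_apply_of_lt (by omega), shift_insertCoord_self, hom_eq_inner,
      insertCoord_apply_self, D.H_one, shift_insertCoord_of_lt (i := 0) (s := 1) (by omega),
      Cube.toFun_shift_one_insertCoord _ le_rfl, inner, hom, d.mulCube_shift, D.comp_assoc,
      ← d.θ_mul, Nat.sub_self, shift_zero, shift_shift, d.mulCube_dim,
      show κ'.dim + (κ.dim + 1) = κ.dim + κ'.dim + 1 by ring]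
  | cons μ L ih =>
    simp only [List.cons_append, hom, paramDim]
    rw [add_assoc (μ.dim + 1), shift_insertCoord_add, ih, insertCoord_apply_of_lt (by omega), Cube.toFun_shift_one_insertCoord _ (by omega)]

theorem prod_param_mul (L L' : List (Cube Ω)) (κ κ' : Cube Ω) (p : Cube P) (c : I) (v : ℕ → I) :
    D.prod (L ++ κ :: κ' :: L') p (insertCoord (paramDim L + (κ.dim + 1)) c v) =
      D.prod (L ++ d.mulCube κ κ' :: L') p v := by
  induction L generalizing v with
  | nil =>
    simp only [List.nil_append, paramDim, zero_add]
    rw [prod, shift_insertCoord_self, prod, shift_insertCoord_of_lt (i := 0) (by omega),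
      shift_insertCoord_of_lt (i := 0) (by omega), Cube.toFun_shift_one_insertCoord _ le_rfl,
      prod, d.mulCube_shift, ← D.mul_assoc, Nat.sub_self, shift_zero, Nat.add_sub_cancel,
      shift_shift, d.mulCube_dim, show κ'.dim + (κ.dim + 1) = κ.dim + κ'.dim + 1 by ring]
  | cons μ L ih =>
    simp only [List.cons_append, prod, paramDim]
    rw [add_assoc (μ.dim + 1), shift_insertCoord_add, ih, Cube.toFun_shift_one_insertCoord _ (by omega)]

theorem hom_one_mul_last (L : List (Cube Ω)) (κ : Cube Ω) (p : Cube P) (v : ℕ → I) :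
    D.hom (L ++ [κ]) p (insertCoord (paramDim L + (κ.dim + 1)) 1 v) =
      D.hom L (D.mulCube κ p) v := by
  induction L generalizing v with
  | nil =>
    simp only [List.nil_append, paramDim, zero_add]
    rw [hom.eq_2, insertCoord_apply_of_lt (by omega), shift_insertCoord_self, hom_eq_inner,
      insertCoord_apply_self, D.H_one, shift_insertCoord_of_lt (i := 0) (s := 1) (by omega),
      Cube.toFun_shift_one_insertCoord _ le_rfl, inner, hom, D.mulCube_shift, ← D.θ_mul,
      Nat.sub_self, shift_zero]
  | cons μ L ih =>
    simp only [List.cons_append, hom, paramDim]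
    rw [add_assoc (μ.dim + 1), shift_insertCoord_add, ih, insertCoord_apply_of_lt (by omega), Cube.toFun_shift_one_insertCoord _ (by omega)]

theorem prod_param_mul_last (L : List (Cube Ω)) (κ : Cube Ω) (p : Cube P) (c : I) (v : ℕ → I) :
    D.prod (L ++ [κ]) p (insertCoord (paramDim L + (κ.dim + 1)) c v) =
      D.prod L (D.mulCube κ p) v := by
  induction L generalizing v with
  | nil =>
    simp only [List.nil_append, paramDim, zero_add]
    rw [prod.eq_2, shift_insertCoord_self, prod, shift_insertCoord_of_lt (i := 0) (by omega),
      Cube.toFun_shift_one_insertCoord _ le_rfl, prod, D.mulCube_shift, Nat.sub_self, shift_zero]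
  | cons μ L ih =>
    simp only [List.cons_append, prod, paramDim]
    rw [add_assoc (μ.dim + 1), shift_insertCoord_add, ih, Cube.toFun_shift_one_insertCoord _ (by omega)]

/-- The parameter of the first block after `L` is set to `0`, so a value of the retraction appears.
By `H_comp` it moves outwards through all homotopies of `L`, and what stays inside is the higher
homotopy of `L` alone. -/
theorem hom_zero (L L' : List (Cube Ω)) (p : Cube P) (v : ℕ → I) :
    D.hom (L ++ L') p (insertCoord (paramDim L) 0 v) =
      D.comp (D.H 0 (D.inner L' p (shift (paramDim L) v))) (d.hom L v) := by
  induction L generalizing v with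
  | nil =>
    rw [List.nil_append, hom_eq_inner, paramDim, insertCoord_apply_self,
      shift_insertCoord_of_lt (by omega), FibreData.hom, D.comp_id]
  | cons μ L ih =>
    simp only [List.cons_append, hom, paramDim, FibreData.hom]
    rw [shift_insertCoord_add, ih, insertCoord_apply_of_lt (by omega), Cube.toFun_shift_one_insertCoord _ (by omega), D.comp_assoc, D.H_comp, shift_shift,
      add_comm (paramDim L)]

/-- Products ignore the parameters; this is the instance for the parameter of the first block after
`L`. -/
theorem prod_param (L L' : List (Cube Ω)) (p : Cube P) {v w : ℕ → I}
    (h : ∀ j, j ≠ paramDim L → v j = w j) : D.prod (L ++ L') p v = D.prod (L ++ L') p w := by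
  induction L generalizing v w with
  | nil =>
    have h' : ∀ s, shift (s + 1) v = shift (s + 1) w := fun s => by
      funext j
      exact h _ (by simp only [paramDim]; omega)
    cases L' with
    | nil => exact congrArg p.toFun (h' 0)
    | cons κ L' =>
      rw [List.nil_append, prod, prod, h' κ.dim]
      exact congrArg (fun u => D.mul (κ.toFun u) _) (h' 0)
  | cons μ L ih =>
    simp only [List.cons_append, prod, paramDim] at h ⊢
    rw [ih (v := shift (μ.dim + 1) v) (w := shift (μ.dim + 1) w) fun j hj => h _ (by omega),
      μ.depends (shift 1 v) (shift 1 w) fun j hj => h _ (by omega)]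

theorem prod_param_last (L : List (Cube Ω)) (p : Cube P) (c : I) (v : ℕ → I) :
    D.prod L p (insertCoord (paramDim L) c v) =
      D.mul (d.prod L v) (p.toFun (shift (paramDim L) v)) := by
  induction L generalizing v with
  | nil =>
    rw [prod, paramDim, shift_insertCoord_of_lt (by omega), FibreData.prod, D.one_mul]
  | cons μ L ih =>
    simp only [prod, paramDim, FibreData.prod]
    rw [shift_insertCoord_add, ih, Cube.toFun_shift_one_insertCoord _ (by omega), D.mul_assoc, shift_shift,
      add_comm (paramDim L)]

/-! ### Degenerate inputs -/

/-- A degenerate input makes homotopy and product independent of the same coordinate, as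
`capPair_eq_zero_of_indep` requires. -/
theorem exists_indep_of_mem {L : List (Cube Ω)} {κ : Cube Ω} (hκ : κ ∈ L) (h : κ.IsDegenerate)
    (p : Cube P) : ∃ i < paramDim L, ∀ v w : ℕ → I, (∀ j, j ≠ i → v j = w j) →
      D.hom L p v = D.hom L p w ∧ D.prod L p v = D.prod L p w := by
  induction L with
  | nil => simp at hκ
  | cons μ L ih =>
    rcases List.mem_cons.1 hκ with rfl | hκ
    · obtain ⟨i, hi, h⟩ := h
      refine ⟨1 + i, by simp only [paramDim]; omega, fun v w hvw => ?_⟩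
      simp only [hom, prod]
      rw [hvw 0 (by omega), h (shift 1 v) (shift 1 w) fun j hj => hvw _ (by omega),
        show shift (κ.dim + 1) v = shift (κ.dim + 1) w from
          funext fun j => hvw _ (by omega)]
      exact ⟨rfl, rfl⟩
    · obtain ⟨i, hi, h⟩ := ih hκ
      refine ⟨μ.dim + 1 + i, by simp only [paramDim]; omega, fun v w hvw => ?_⟩
      simp only [hom, prod]
      obtain ⟨h1, h2⟩ := h (shift (μ.dim + 1) v) (shift (μ.dim + 1) w) fun j hj =>
        hvw _ (by omega)
      rw [hvw 0 (by omega), h1, h2,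
        μ.depends (shift 1 v) (shift 1 w) fun j hj => hvw _ (by omega)]
      exact ⟨rfl, rfl⟩

theorem exists_indep_of_last (L : List (Cube Ω)) {p : Cube P} (h : p.IsDegenerate) :
    ∃ i < paramDim L + (p.dim + 1), ∀ v w : ℕ → I, (∀ j, j ≠ i → v j = w j) →
      D.hom L p v = D.hom L p w ∧ D.prod L p v = D.prod L p w := by
  induction L with
  | nil =>
    obtain ⟨i, hi, h⟩ := h
    refine ⟨1 + i, by simp only [paramDim]; omega, fun v w hvw => ?_⟩
    simp only [hom, prod]
    rw [hvw 0 (by omega), h (shift 1 v) (shift 1 w) fun j hj => hvw _ (by omega)]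
    exact ⟨rfl, rfl⟩
  | cons μ L ih =>
    obtain ⟨i, hi, h⟩ := ih
    refine ⟨μ.dim + 1 + i, by simp only [paramDim]; omega, fun v w hvw => ?_⟩
    simp only [hom, prod]
    obtain ⟨h1, h2⟩ := h (shift (μ.dim + 1) v) (shift (μ.dim + 1) w) fun j hj =>
      hvw _ (by omega)
    rw [hvw 0 (by omega), h1, h2,
      μ.depends (shift 1 v) (shift 1 w) fun j hj => hvw _ (by omega)]
    exact ⟨rfl, rfl⟩

end PathData

/-! ### The monoid acting on itself -/

/-- The recursions differ only at the end, where one applies `H` to `id ∘ θ p` and the other to `θ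
p`. -/
theorem FibreData.hom_append (d : FibreData X Ω U S) (h : ∀ a, d.mul d.one a = a)
    (L : List (Cube Ω)) (p : Cube Ω) (v : ℕ → I) :
    d.hom (L ++ [p]) v = (d.self h).hom L p v := by
  induction L generalizing v with
  | nil => simp only [List.nil_append, hom, PathData.hom, d.id_comp]; rfl
  | cons κ L ih => simp only [List.cons_append, hom, PathData.hom, ih]; rfl

theorem FibreData.prod_append (d : FibreData X Ω U S) (h : ∀ a, d.mul d.one a = a)
    (L : List (Cube Ω)) (p : Cube Ω) (v : ℕ → I) :
    d.prod (L ++ [p]) v = (d.self h).prod L p v := by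
  induction L generalizing v with
  | nil => simp only [List.nil_append, prod, PathData.prod, d.mul_one]
  | cons κ L ih => simp only [List.cons_append, prod, PathData.prod, ih]; rfl

end Transport

/-! ### Insertion of parameters -/

section Params

/-- Insert a parameter in front of each of the blocks of lengths `ds`, which start at `s`, and add
it to the set `J`. -/
def addParams : ℕ → List ℕ → Finset ℕ → Finset ℕ
  | _, [], J => J
  | s, d :: ds, J => insert s ((addParams (s + d) ds J).image (succAt s))

/-- Insert a parameter in front of each of the blocks of lengths `ds`, which start at `s`. -/
def skipParams : ℕ → List ℕ → Finset ℕ → Finset ℕ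
  | _, [], K => K
  | s, d :: ds, K => (skipParams (s + d) ds K).image (succAt s)

/-- The sum over the blocks of the number of elements of `J` in front of the block. -/
def countBefore : ℕ → List ℕ → Finset ℕ → ℕ
  | _, [], _ => 0
  | s, d :: ds, J => rank J s + countBefore (s + d) ds J

/-- The sum of the starting points of the blocks. -/
def sumStarts : ℕ → List ℕ → ℕ
  | _, [] => 0
  | s, d :: ds => s + sumStarts (s + d) ds

theorem succAt_of_lt {i j : ℕ} (h : j < i) : succAt i j = j := by simp [succAt, h]

theorem succAt_of_le {i j : ℕ} (h : i ≤ j) : succAt i j = j + 1 := by simp [succAt, h.not_gt]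

theorem mem_image_succAt_of_lt {i j : ℕ} (h : j < i) (S : Finset ℕ) :
    j ∈ S.image (succAt i) ↔ j ∈ S := by
  conv_lhs => rw [← succAt_of_lt h]
  exact (succAt_strictMono i).injective.mem_finset_image

theorem rank_image_succAt {i j : ℕ} (h : j ≤ i) (S : Finset ℕ) :
    rank (S.image (succAt i)) j = rank S j := by
  rw [rank, rank]
  congr 1
  ext k
  simp only [Finset.mem_filter]
  exact ⟨fun hk => ⟨(mem_image_succAt_of_lt (by omega) S).1 hk.1, hk.2⟩,
    fun hk => ⟨(mem_image_succAt_of_lt (by omega) S).2 hk.1, hk.2⟩⟩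

theorem mem_addParams (s : ℕ) (ds : List ℕ) (J : Finset ℕ) {i : ℕ} (hi : i < s) :
    i ∈ addParams s ds J ↔ i ∈ J := by
  induction ds generalizing s with
  | nil => rfl
  | cons d ds ih =>
    rw [addParams, Finset.mem_insert, mem_image_succAt_of_lt hi, ih (s + d) (by omega)]
    exact ⟨fun h => h.resolve_left hi.ne, Or.inr⟩

theorem mem_skipParams (s : ℕ) (ds : List ℕ) (J : Finset ℕ) {i : ℕ} (hi : i < s) :
    i ∈ skipParams s ds J ↔ i ∈ J := by
  induction ds generalizing s with
  | nil => rfl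
  | cons d ds ih => rw [skipParams, mem_image_succAt_of_lt hi, ih (s + d) (by omega)]

theorem rank_addParams (s : ℕ) (ds : List ℕ) (J : Finset ℕ) {i : ℕ} (hi : i ≤ s) :
    rank (addParams s ds J) i = rank J i := by
  rw [rank, rank]
  congr 1
  ext k
  simp only [Finset.mem_filter]
  exact ⟨fun hk => ⟨(mem_addParams s ds J (by omega)).1 hk.1, hk.2⟩,
    fun hk => ⟨(mem_addParams s ds J (by omega)).2 hk.1, hk.2⟩⟩

theorem rank_skipParams (s : ℕ) (ds : List ℕ) (J : Finset ℕ) {i : ℕ} (hi : i ≤ s) :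
    rank (skipParams s ds J) i = rank J i := by
  rw [rank, rank]
  congr 1
  ext k
  simp only [Finset.mem_filter]
  exact ⟨fun hk => ⟨(mem_skipParams s ds J (by omega)).1 hk.1, hk.2⟩,
    fun hk => ⟨(mem_skipParams s ds J (by omega)).2 hk.1, hk.2⟩⟩

theorem notMem_image_succAt (s : ℕ) (J : Finset ℕ) : s ∉ J.image (succAt s) := by
  simp [succAt_ne]

theorem card_addParams (s : ℕ) (ds : List ℕ) (J : Finset ℕ) :
    (addParams s ds J).card = J.card + ds.length := by
  induction ds generalizing s with
  | nil => rfl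
  | cons d ds ih =>
    rw [addParams, Finset.card_insert_of_notMem (notMem_image_succAt _ _),
      Finset.card_image_of_injective _ (succAt_strictMono s).injective, ih, List.length_cons,
      add_assoc]

theorem card_skipParams (s : ℕ) (ds : List ℕ) (J : Finset ℕ) :
    (skipParams s ds J).card = J.card := by
  induction ds generalizing s with
  | nil => rfl
  | cons d ds ih =>
    rw [skipParams, Finset.card_image_of_injective _ (succAt_strictMono s).injective, ih]

theorem le_of_mem_addParams_empty {s : ℕ} {ds : List ℕ} {t : ℕ} (h : t ∈ addParams s ds ∅) :
    s ≤ t := by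
  by_contra hlt
  simpa using (mem_addParams s ds ∅ (not_le.1 hlt)).1 h

/-- Each parameter forms an inversion with every element of the complement in front of its block.
Parameters form none among themselves, since all of them belong to the first set. -/
theorem shuffleSign_addParams (s : ℕ) (ds : List ℕ) (J K : Finset ℕ) :
    shuffleSign (addParams s ds J) (skipParams s ds K) =
      shuffleSign J K * (-1) ^ countBefore s ds K := by
  induction ds generalizing s with
  | nil => simp [addParams, skipParams, countBefore]
  | cons d ds ih =>
    rw [addParams, skipParams, shuffleSign_insert_left (notMem_image_succAt _ _),
      shuffleSign_image (succAt_strictMono s), ih, rank_image_succAt le_rfl,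
      rank_skipParams _ _ _ (by omega), countBefore, pow_add]
    ring

/-- Each coordinate in front of a block belongs to exactly one of the two sets. This trades the sign
of the shuffle with the parameters for the sign `s(J)` of the theorem. -/
theorem countBefore_add_countBefore {D : ℕ} {J : Finset ℕ} (hJ : J ⊆ Finset.range D) (s : ℕ)
    (ds : List ℕ) (hs : s + ds.sum ≤ D) :
    countBefore s ds J + countBefore s ds (Finset.range D \ J) = sumStarts s ds := by
  induction ds generalizing s with
  | nil => rfl
  | cons d ds ih =>
    rw [List.sum_cons] at hs
    have h := ih (s + d) (by omega)
    have h2 : rank J s + rank (Finset.range D \ J) s = s := by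
      rw [← rank_disjUnion Finset.disjoint_sdiff, Finset.union_sdiff_of_subset hJ,
        rank_range (by omega)]
    simp only [countBefore, sumStarts]
    omega

theorem range_succ_eq_insert {s D : ℕ} (hs : s ≤ D) :
    Finset.range (D + 1) = insert s ((Finset.range D).image (succAt s)) := by
  have := range_erase_eq_image (show s < D + 1 by omega)
  rw [Nat.add_sub_cancel] at this
  rw [← this, Finset.insert_erase (by simp; omega)]

/-- The condition on `g` models that a parameter in the complement makes the back face degenerate.
Hence only sets containing all parameters matter, and these are determined by their other elements.
The induction removes the parameter at `s` and passes to the later blocks. -/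
theorem sum_powerset_addParams {V : Type*} [AddCommMonoid V] (D s : ℕ) (ds : List ℕ)
    (hs : s + ds.sum ≤ D) (g : Finset ℕ → Finset ℕ → V)
    (hg : ∀ J K, (∃ t ∈ addParams s ds ∅, t ∈ K) → g J K = 0) :
    ∑ J ∈ (Finset.range (D + ds.length)).powerset, g J (Finset.range (D + ds.length) \ J) =
      ∑ J ∈ (Finset.range D).powerset, g (addParams s ds J)
        (skipParams s ds (Finset.range D \ J)) := by
  induction ds generalizing s g with
  | nil => rfl
  | cons d ds ih =>
    rw [List.sum_cons] at hs
    rw [List.length_cons, ← add_assoc, range_succ_eq_insert (show s ≤ D + ds.length by omega),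
      Finset.sum_powerset_insert (notMem_image_succAt _ _),
      sum_powerset_image (succAt_strictMono s).injective,
      sum_powerset_image (succAt_strictMono s).injective, Finset.sum_eq_zero, zero_add]
    · refine Eq.trans ?_ (ih (s + d) (by omega) (fun J K => g (insert s (J.image (succAt s)))
        (K.image (succAt s))) ?_)
      · refine Finset.sum_congr rfl fun J _ => ?_
        rw [Finset.insert_sdiff_insert, Finset.sdiff_insert_of_notMem
          (notMem_image_succAt _ _), Finset.image_sdiff _ _ (succAt_strictMono s).injective]
      · rintro J K ⟨t, ht, htK⟩
        exact hg _ _ ⟨succAt s t, Finset.mem_insert_of_mem (Finset.mem_image_of_mem _ ht),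
          Finset.mem_image_of_mem _ htK⟩
    · intro J _
      exact hg _ _ ⟨s, Finset.mem_insert_self _ _, Finset.mem_sdiff.2
        ⟨Finset.mem_insert_self _ _, notMem_image_succAt _ _⟩⟩

/-- Once `s` is a free coordinate, the others read the entries of `v` with the one at `rank J s`
left out. -/
theorem expand_insert_image_succAt (s : ℕ) (J : Finset ℕ) (c v : ℕ → I) (j : ℕ) :
    expand (insert s (J.image (succAt s))) c v (succAt s j) =
      expand J (fun i => c (succAt s i)) (fun i => v (succAt (rank J s) i)) j := by
  have h1 : succAt s j ∈ insert s (J.image (succAt s)) ↔ j ∈ J := by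
    simp [succAt_ne, (succAt_strictMono s).injective.eq_iff]
  have h2 : j ∈ J →
      rank (insert s (J.image (succAt s))) (succAt s j) = succAt (rank J s) (rank J j) := by
    intro hj
    rcases lt_or_ge j s with h | h
    · rw [succAt_of_lt h, rank_insert_of_le h.le, rank_image_succAt h.le,
        succAt_of_lt (rank_lt_rank hj h)]
    · rw [rank_insert_of_lt (notMem_image_succAt _ _) (by rw [succAt_of_le h]; omega),
        rank_image_apply (succAt_strictMono s), succAt_of_le (rank_mono J h)]
  by_cases hj : j ∈ J
  · simp only [expand, if_pos (h1.2 hj), if_pos hj, h2 hj]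
  · simp only [expand, if_neg (mt h1.1 hj), if_neg hj]

theorem expand_insert_self (s : ℕ) (J : Finset ℕ) (c v : ℕ → I) :
    expand (insert s (J.image (succAt s))) c v s = v (rank J s) := by
  rw [expand, if_pos (Finset.mem_insert_self _ _), rank_insert_of_le le_rfl,
    rank_image_succAt le_rfl]

theorem shift_succAt (m : ℕ) {s : ℕ} (hs : m ≤ s) (v : ℕ → I) :
    shift s (fun i => v (succAt m i)) = shift (s + 1) v := by
  funext j
  rw [shift, succAt_of_le (by omega), shift, add_assoc]

/-- Only the sets containing all parameters survive. Their shuffle sign counts elements of the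
complement in front of the blocks; the factor with the sum of the starting points converts this into
a count of elements of `J`. -/
theorem capPair_params {U X : Type*} [TopologicalSpace U] [TopologicalSpace X] {B : Set U}
    (τ : Chains B →ₗ[ℝ] ℝ) (C : Set X) (D s : ℕ) (ds : List ℕ) (hs : s + ds.sum ≤ D)
    (F : (ℕ → I) → U) {P : (ℕ → I) → X}
    (hP : ∀ t ∈ addParams s ds ∅, ∀ v w : ℕ → I, (∀ j, j ≠ t → v j = w j) → P v = P w) :
    (-1 : ℝ) ^ sumStarts s ds • capPair τ C (D + ds.length) F P =
      ∑ J ∈ (Finset.range D).powerset,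
        (shuffleSign J (Finset.range D \ J) * (-1) ^ countBefore s ds J *
          τ (cubeClass B (J.card + ds.length) fun v => F (expand (addParams s ds J) 0 v))) •
          cubeClass C (D - J.card) fun v =>
            P (expand (skipParams s ds (Finset.range D \ J)) 1 v) := by
  rw [capPair_eq_sum, sum_powerset_addParams D s ds hs (fun J K => (shuffleSign J K *
    τ (faceClass B J 0 F)) • faceClass C K 1 P), Finset.smul_sum]
  · refine Finset.sum_congr rfl fun J hJ => ?_
    rw [Finset.mem_powerset] at hJ
    rw [shuffleSign_addParams, faceClass, faceClass, card_addParams, card_skipParams,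
      Finset.card_sdiff_of_subset hJ, Finset.card_range, smul_smul]
    congr 1
    have h := congrArg ((-1 : ℝ) ^ ·) (countBefore_add_countBefore hJ s ds hs)
    simp only [pow_add] at h
    have h' : (-1 : ℝ) ^ countBefore s ds (Finset.range D \ J) *
      (-1) ^ countBefore s ds (Finset.range D \ J) = 1 := by rw [← mul_pow]; simp
    rw [← h]
    linear_combination (shuffleSign J (Finset.range D \ J) * (-1) ^ countBefore s ds J *
      τ (cubeClass B (J.card + ds.length) fun v => F (expand (addParams s ds J) 0 v))) * h'
  · rintro J K ⟨t, ht, htK⟩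
    rw [faceClass_eq_zero_of_indep C htK _ (hP t ht), smul_zero]

end Params

/-! ### Higher maps as sums over sets of coordinates -/

section HigherMaps

variable {X Ω U S P Y Z T : Type*} [TopologicalSpace X] [TopologicalSpace Ω] [TopologicalSpace U]
  [TopologicalSpace S] [TopologicalSpace P] [TopologicalSpace Y] [TopologicalSpace Z]
  [TopologicalSpace T]

/-- The dimensions of a list of cubes. -/
def dims (L : List (Cube Ω)) : List ℕ := L.map Cube.dim

theorem sum_dims (L : List (Cube Ω)) : (dims L).sum = totalDim L := by
  induction L with
  | nil => rfl
  | cons κ L ih => simpa [dims, totalDim] using ih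

theorem length_dims (L : List (Cube Ω)) : (dims L).length = L.length := List.length_map _

theorem signExponent_eq (J : Finset ℕ) (s : ℕ) (L : List (Cube Ω)) :
    signExponent J s L = countBefore s (dims L) J := by
  induction L generalizing s with
  | nil => rfl
  | cons κ L ih => rw [signExponent, ih]; rfl

theorem Cube.toFun_expand_addParams (α : Cube X) (ds : List ℕ) (J : Finset ℕ) (v : ℕ → I) :
    α.toFun (expand (addParams α.dim ds J) 0 v) = frontFace (block J 0 α.dim) α.toFun v := by
  refine α.depends _ _ fun j hj => ?_
  have := shift_expand (J := J) 0 α.dim 0 v hj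
  rw [shift_zero, rank_zero, shift_zero] at this
  refine Eq.trans ?_ this
  simp only [expand, mem_addParams _ _ _ hj, rank_addParams _ _ _ hj.le]

/-- A block of coordinates of a front face after the insertion of parameters. -/
theorem Cube.toFun_shift_expand_addParams (κ : Cube Ω) (ds : List ℕ) (J : Finset ℕ) (s : ℕ)
    (v : ℕ → I) :
    κ.toFun (shift 1 (shift s (expand (addParams s (κ.dim :: ds) J) 0 v))) =
      frontFace (block J s κ.dim) κ.toFun (shift 1 (shift (rank J s) v)) := by
  refine κ.depends _ _ fun j hj => ?_
  have h1 : shift 1 (shift s (expand (addParams s (κ.dim :: ds) J) 0 v)) j =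
      expand (addParams s (κ.dim :: ds) J) 0 v (succAt s (j + s)) := by
    rw [succAt_of_le (by omega), shift_shift, shift]
    congr 1
    omega
  rw [h1, addParams, expand_insert_image_succAt, rank_addParams _ _ _ (by omega)]
  have h2 := shift_expand (J := J) s κ.dim 0 (fun i => v (succAt (rank J s) i)) hj
  rw [shift_succAt _ le_rfl] at h2
  rw [shift_shift, add_comm 1]
  refine Eq.trans ?_ h2
  simp only [shift, expand, mem_addParams (s + κ.dim) ds J (show j + s < s + κ.dim by omega),
    rank_addParams (s + κ.dim) ds J (show j + s ≤ s + κ.dim by omega)]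
  rfl

theorem shift_shift_expand_addParams (d : ℕ) (ds : List ℕ) (J : Finset ℕ) (s : ℕ)
    (v : ℕ → I) : shift (d + 1) (shift s (expand (addParams s (d :: ds) J) 0 v)) =
      shift (s + d) (expand (addParams (s + d) ds J) 0 fun i => v (succAt (rank J s) i)) := by
  funext j
  have h1 : shift (d + 1) (shift s (expand (addParams s (d :: ds) J) 0 v)) j =
      expand (addParams s (d :: ds) J) 0 v (succAt s (j + (s + d))) := by
    rw [succAt_of_le (by omega), shift_shift, shift]
    congr 1
    omega
  rw [h1, addParams, expand_insert_image_succAt, rank_addParams _ _ _ (by omega)]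
  rfl

theorem shift_expand_addParams_zero (d : ℕ) (ds : List ℕ) (J : Finset ℕ) (s : ℕ)
    (v : ℕ → I) : shift s (expand (addParams s (d :: ds) J) 0 v) 0 = shift (rank J s) v 0 := by
  rw [shift, zero_add, addParams, expand_insert_self, rank_addParams _ _ _ (by omega), shift,
    zero_add]

theorem shift_card_block (J : Finset ℕ) (s d : ℕ) (v : ℕ → I) :
    shift (rank J (s + d)) (fun i => v (succAt (rank J s) i)) =
      shift ((block J s d).card + 1) (shift (rank J s) v) := by
  rw [shift_succAt _ (rank_mono J (by omega)), shift_shift, ← card_block]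
  congr 1
  omega

theorem Cube.toFun_shift_expand_skipParams (κ : Cube Ω) (ds : List ℕ) (K : Finset ℕ) (s : ℕ)
    (v : ℕ → I) : κ.toFun (shift 1 (shift s (expand (skipParams s (κ.dim :: ds) K) 1 v))) =
      κ.toFun (shift s (expand K 1 v)) := by
  refine κ.depends _ _ fun j hj => ?_
  have h1 : shift 1 (shift s (expand (skipParams s (κ.dim :: ds) K) 1 v)) j =
      expand (skipParams s (κ.dim :: ds) K) 1 v (succAt s (j + s)) := by
    rw [succAt_of_le (by omega), shift_shift, shift]
    congr 1
    omega
  rw [h1, skipParams, expand_image_succAt, insertCoord_succAt]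
  simp only [shift, expand, mem_skipParams (s + κ.dim) ds K (show j + s < s + κ.dim by omega),
    rank_skipParams (s + κ.dim) ds K (show j + s ≤ s + κ.dim by omega)]
  rfl

theorem shift_shift_expand_skipParams (d : ℕ) (ds : List ℕ) (K : Finset ℕ) (s : ℕ)
    (v : ℕ → I) : shift (d + 1) (shift s (expand (skipParams s (d :: ds) K) 1 v)) =
      shift (s + d) (expand (skipParams (s + d) ds K) 1 v) := by
  funext j
  have h1 : shift (d + 1) (shift s (expand (skipParams s (d :: ds) K) 1 v)) j =
      expand (skipParams s (d :: ds) K) 1 v (succAt s (j + (s + d))) := by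
    rw [succAt_of_le (by omega), shift_shift, shift]
    congr 1
    omega
  rw [h1, skipParams, expand_image_succAt, insertCoord_succAt]
  rfl

theorem Cube.toFun_expand_skipParams (α : Cube X) (ds : List ℕ) (K : Finset ℕ) (v : ℕ → I) :
    α.toFun (expand (skipParams α.dim ds K) 1 v) = α.toFun (expand K 1 v) := by
  refine α.depends _ _ fun j hj => ?_
  simp only [expand, mem_skipParams _ _ _ hj, rank_skipParams _ _ _ hj.le]

namespace FibreData

variable (d : FibreData X Ω U S)

/-- The higher homotopy of the front faces of a list of cubes. -/
def homFront (J : Finset ℕ) : ℕ → List (Cube Ω) → (ℕ → I) → S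
  | _, [], _ => d.id
  | s, κ :: L, v => d.H (v 0) (d.comp
      (homFront J (s + κ.dim) L (shift ((block J s κ.dim).card + 1) v))
      (d.θ (frontFace (block J s κ.dim) κ.toFun (shift 1 v))))

/-- The product of a list of cubes as a function of their coordinates. -/
def prodCoords : List (Cube Ω) → (ℕ → I) → Ω
  | [], _ => d.one
  | κ :: L, v => d.mul (κ.toFun v) (prodCoords L (shift κ.dim v))

/-- In a front face all parameters stay free, and the coordinates of each cube restrict to the part
of `J` in its block. The shift by `rank J s` skips the free coordinates in front of `s`. -/
theorem hom_expand (J : Finset ℕ) (s : ℕ) (L : List (Cube Ω)) (v : ℕ → I) :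
    d.hom L (shift s (expand (addParams s (dims L) J) 0 v)) =
      d.homFront J s L (shift (rank J s) v) := by
  induction L generalizing s v with
  | nil => rfl
  | cons κ L ih =>
    rw [hom, homFront]
    change d.H (shift s (expand (addParams s (κ.dim :: dims L) J) 0 v) 0) (d.comp
      (d.hom L (shift (κ.dim + 1) (shift s (expand (addParams s (κ.dim :: dims L) J) 0 v))))
      (d.θ (κ.toFun (shift 1 (shift s (expand (addParams s (κ.dim :: dims L) J) 0 v)))))) = _
    rw [shift_expand_addParams_zero, Cube.toFun_shift_expand_addParams,
      shift_shift_expand_addParams, ih, shift_card_block]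

theorem prod_expand (K : Finset ℕ) (s : ℕ) (L : List (Cube Ω)) (v : ℕ → I) :
    d.prod L (shift s (expand (skipParams s (dims L) K) 1 v)) =
      d.prodCoords L (shift s (expand K 1 v)) := by
  induction L generalizing s with
  | nil => rfl
  | cons κ L ih =>
    rw [prod, prodCoords]
    change d.mul (κ.toFun (shift 1 (shift s (expand (skipParams s (κ.dim :: dims L) K) 1 v))))
      (d.prod L (shift (κ.dim + 1)
        (shift s (expand (skipParams s (κ.dim :: dims L) K) 1 v)))) = _
    rw [Cube.toFun_shift_expand_skipParams, shift_shift_expand_skipParams, ih, shift_shift,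
      add_comm s]

theorem prod_indep (L : List (Cube Ω)) (s t : ℕ) (ht : t ∈ addParams s (dims L) ∅)
    (v w : ℕ → I) (h : ∀ j, j ≠ t → v j = w j) : d.prod L (shift s v) = d.prod L (shift s w) := by
  induction L generalizing s t v w with
  | nil => rfl
  | cons κ L ih =>
    change t ∈ insert s ((addParams (s + κ.dim) (dims L) ∅).image (succAt s)) at ht
    have e : ∀ u : ℕ → I, shift (κ.dim + 1) (shift s u) = shift (s + κ.dim) (shift 1 u) :=
      fun u => by rw [shift_shift, shift_shift]; congr 1; omega
    rw [prod, prod, e, e]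
    rcases Finset.mem_insert.1 ht with rfl | ht
    · congr 1
      · exact κ.depends _ _ fun j _ => h _ (by omega)
      · congr 1
        funext j
        exact h _ (by omega)
    · obtain ⟨t', ht', rfl⟩ := Finset.mem_image.1 ht
      have hle := le_of_mem_addParams_empty ht'
      rw [succAt_of_le (by omega)] at h
      rw [ih _ t' ht' (shift 1 v) (shift 1 w) fun j hj => h _ (by omega)]
      congr 1
      exact κ.depends _ _ fun j _ => h _ (by omega)

/-- The higher map on cubes, with all parameters treated as coordinates. -/
noncomputable def higher {B : Set U} (τ : Chains B →ₗ[ℝ] ℝ) (C : Set X) (α : Cube X)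
    (L : List (Cube Ω)) : Chains C :=
  (-1 : ℝ) ^ sumStarts α.dim (dims L) •
    capPair τ C (α.dim + paramDim L) (d.frontFun α L) (d.backFun α L)

/-- Recovers the formula of the theorem from the cap product over coordinates and parameters.
`capPair_params` applies because `backFun` does not depend on the parameters. -/
theorem higher_eq_sum {B : Set U} (τ : Chains B →ₗ[ℝ] ℝ) (C : Set X) (α : Cube X)
    (L : List (Cube Ω)) : d.higher τ C α L =
      ∑ J ∈ (Finset.range (α.dim + totalDim L)).powerset,
        (shuffleSign J (Finset.range (α.dim + totalDim L) \ J) *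
          (-1) ^ signExponent J α.dim L *
          τ (cubeClass B (J.card + L.length) fun v =>
            d.ev (d.homFront J α.dim L (shift (block J 0 α.dim).card v))
              (d.e (frontFace (block J 0 α.dim) α.toFun v)))) •
        cubeClass C (α.dim + totalDim L - J.card)
          (backFace (Finset.range (α.dim + totalDim L) \ J) fun v =>
            d.act (α.toFun v) (d.prodCoords L (shift α.dim v))) := by
  rw [higher, paramDim_eq, ← length_dims L, ← add_assoc,
    capPair_params τ C _ α.dim (dims L) (by rw [sum_dims])]
  · refine Finset.sum_congr rfl fun J _ => ?_
    have hr : (block J 0 α.dim).card = rank J α.dim := by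
      have := card_block J 0 α.dim
      rwa [rank_zero, zero_add, zero_add] at this
    simp only [frontFun, backFun, hom_expand, prod_expand, Cube.toFun_expand_addParams,
      Cube.toFun_expand_skipParams, signExponent_eq, hr, length_dims]
    rfl
  · intro t ht v w h
    rw [backFun, backFun, d.prod_indep L _ t ht v w h]
    congr 1
    refine α.depends _ _ fun j hj => h j ?_
    have := le_of_mem_addParams_empty ht
    omega

end FibreData

namespace PathData

variable {d : FibreData X Ω U S} (D : PathData d P Y Z T)

/-- The higher homotopy of the front faces of a list of cubes and a cube of paths. -/
def homFront (J : Finset ℕ) (p : Cube P) : ℕ → List (Cube Ω) → (ℕ → I) → T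
  | s, [], v => D.H (v 0) (D.θ (frontFace (block J s p.dim) p.toFun (shift 1 v)))
  | s, κ :: L, v => D.H (v 0) (D.comp
      (homFront J p (s + κ.dim) L (shift ((block J s κ.dim).card + 1) v))
      (d.θ (frontFace (block J s κ.dim) κ.toFun (shift 1 v))))

/-- The product of a list of cubes and a cube of paths as a function of their coordinates. -/
def prodCoords (p : Cube P) : List (Cube Ω) → (ℕ → I) → P
  | [], v => p.toFun v
  | κ :: L, v => D.mul (κ.toFun v) (prodCoords p L (shift κ.dim v))

theorem hom_expand (J : Finset ℕ) (s : ℕ) (L : List (Cube Ω)) (p : Cube P) (v : ℕ → I) :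
    D.hom L p (shift s (expand (addParams s (dims L ++ [p.dim]) J) 0 v)) =
      D.homFront J p s L (shift (rank J s) v) := by
  induction L generalizing s v with
  | nil =>
    change D.H (shift s (expand (addParams s [p.dim] J) 0 v) 0)
      (D.θ (p.toFun (shift 1 (shift s (expand (addParams s [p.dim] J) 0 v))))) = _
    rw [shift_expand_addParams_zero, Cube.toFun_shift_expand_addParams]
    rfl
  | cons κ L ih =>
    rw [hom, homFront]
    change D.H (shift s (expand (addParams s (κ.dim :: (dims L ++ [p.dim])) J) 0 v) 0) (D.comp
      (D.hom L p (shift (κ.dim + 1)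
        (shift s (expand (addParams s (κ.dim :: (dims L ++ [p.dim])) J) 0 v))))
      (d.θ (κ.toFun (shift 1
        (shift s (expand (addParams s (κ.dim :: (dims L ++ [p.dim])) J) 0 v)))))) = _
    rw [shift_expand_addParams_zero, Cube.toFun_shift_expand_addParams,
      shift_shift_expand_addParams, ih, shift_card_block]

theorem prod_expand (K : Finset ℕ) (s : ℕ) (L : List (Cube Ω)) (p : Cube P) (v : ℕ → I) :
    D.prod L p (shift s (expand (skipParams s (dims L ++ [p.dim]) K) 1 v)) =
      D.prodCoords p L (shift s (expand K 1 v)) := by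
  induction L generalizing s with
  | nil => exact Cube.toFun_shift_expand_skipParams p [] K s v
  | cons κ L ih =>
    rw [prod, prodCoords]
    change D.mul (κ.toFun (shift 1
        (shift s (expand (skipParams s (κ.dim :: (dims L ++ [p.dim])) K) 1 v))))
      (D.prod L p (shift (κ.dim + 1)
        (shift s (expand (skipParams s (κ.dim :: (dims L ++ [p.dim])) K) 1 v)))) = _
    rw [Cube.toFun_shift_expand_skipParams, shift_shift_expand_skipParams, ih, shift_shift,
      add_comm s]

theorem prod_indep (L : List (Cube Ω)) (p : Cube P) (s t : ℕ)
    (ht : t ∈ addParams s (dims L ++ [p.dim]) ∅) (v w : ℕ → I) (h : ∀ j, j ≠ t → v j = w j) :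
    D.prod L p (shift s v) = D.prod L p (shift s w) := by
  induction L generalizing s t v w with
  | nil =>
    have ht' : t = s := by simpa [addParams, dims] using ht
    refine p.depends _ _ fun j _ => h _ (by omega)
  | cons κ L ih =>
    change t ∈ insert s ((addParams (s + κ.dim) (dims L ++ [p.dim]) ∅).image (succAt s)) at ht
    have e : ∀ u : ℕ → I, shift (κ.dim + 1) (shift s u) = shift (s + κ.dim) (shift 1 u) :=
      fun u => by rw [shift_shift, shift_shift]; congr 1; omega
    rw [prod, prod, e, e]
    rcases Finset.mem_insert.1 ht with rfl | ht
    · congr 1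
      · exact κ.depends _ _ fun j _ => h _ (by omega)
      · congr 1
        funext j
        exact h _ (by omega)
    · obtain ⟨t', ht', rfl⟩ := Finset.mem_image.1 ht
      have hle := le_of_mem_addParams_empty ht'
      rw [succAt_of_le (by omega)] at h
      rw [ih _ t' ht' (shift 1 v) (shift 1 w) fun j hj => h _ (by omega)]
      congr 1
      exact κ.depends _ _ fun j _ => h _ (by omega)

/-- The higher map on cubes, with all parameters treated as coordinates. -/
noncomputable def higher {B : Set Z} (τ : Chains B →ₗ[ℝ] ℝ) (C : Set Y) (α : Cube X)
    (L : List (Cube Ω)) (p : Cube P) : Chains C :=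
  (-1 : ℝ) ^ sumStarts α.dim (dims L ++ [p.dim]) •
    capPair τ C (α.dim + (paramDim L + (p.dim + 1))) (D.frontFun α L p) (D.backFun α L p)

theorem higher_eq_sum {B : Set Z} (τ : Chains B →ₗ[ℝ] ℝ) (C : Set Y) (α : Cube X)
    (L : List (Cube Ω)) (p : Cube P) : D.higher τ C α L p =
      ∑ J ∈ (Finset.range (α.dim + totalDim L + p.dim)).powerset,
        (shuffleSign J (Finset.range (α.dim + totalDim L + p.dim) \ J) *
          (-1) ^ countBefore α.dim (dims L ++ [p.dim]) J *
          τ (cubeClass B (J.card + (L.length + 1)) fun v =>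
            D.ev (D.homFront J p α.dim L (shift (block J 0 α.dim).card v))
              (d.e (frontFace (block J 0 α.dim) α.toFun v)))) •
        cubeClass C (α.dim + totalDim L + p.dim - J.card)
          (backFace (Finset.range (α.dim + totalDim L + p.dim) \ J) fun v =>
            D.act (α.toFun v) (D.prodCoords p L (shift α.dim v))) := by
  have hd : α.dim + (paramDim L + (p.dim + 1)) =
      α.dim + totalDim L + p.dim + (dims L ++ [p.dim]).length := by
    rw [List.length_append, length_dims, paramDim_eq, List.length_singleton]
    ring
  rw [higher, hd, capPair_params τ C _ α.dim (dims L ++ [p.dim]) (by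
    rw [List.sum_append, sum_dims, List.sum_singleton]; omega)]
  · refine Finset.sum_congr rfl fun J _ => ?_
    have hr : (block J 0 α.dim).card = rank J α.dim := by
      have := card_block J 0 α.dim
      rwa [rank_zero, zero_add, zero_add] at this
    simp only [frontFun, backFun, hom_expand, prod_expand, Cube.toFun_expand_addParams,
      Cube.toFun_expand_skipParams, hr, List.length_append, length_dims, List.length_singleton]
    rfl
  · intro t ht v w h
    rw [backFun, backFun, D.prod_indep L p _ t ht v w h]
    congr 1
    refine α.depends _ _ fun j hj => h j ?_
    have := le_of_mem_addParams_empty ht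
    omega

end PathData

end HigherMaps

/-! ### Multilinear maps on chains -/

section Multilinear

/-- The passage from generators to spans is made one argument at a time; `m` counts the leading
arguments that may already lie in the span. -/
theorem multilinear_mem_of_mem_span {k : ℕ} {A G : Type*} [AddCommGroup A] [Module ℝ A]
    [AddCommGroup G] [Module ℝ G] (M : MultilinearMap ℝ (fun _ : Fin k => A) G)
    (s : Fin k → Set A) (W : Submodule ℝ G) (h : ∀ a, (∀ r, a r ∈ s r) → M a ∈ W)
    (a : Fin k → A) (ha : ∀ r, a r ∈ Submodule.span ℝ (s r)) : M a ∈ W := by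
  suffices key : ∀ m ≤ k, ∀ a : Fin k → A, (∀ r : Fin k, (r : ℕ) < m → a r ∈
      Submodule.span ℝ (s r)) → (∀ r : Fin k, m ≤ (r : ℕ) → a r ∈ s r) → M a ∈ W from
    key k le_rfl a (fun r _ => ha r) fun r hr => absurd r.2 (by omega)
  intro m
  induction m with
  | zero => exact fun _ a _ h' => h a fun r => h' r (by omega)
  | succ m ih =>
    intro hm a h1 h2
    let i : Fin k := ⟨m, by omega⟩
    have h3 : Submodule.span ℝ (s i) ≤ W.comap (M.toLinearMap a i) := by
      rw [Submodule.span_le]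
      intro x hx
      refine ih (by omega) _ (fun r hr => ?_) fun r hr => ?_
      · rw [Function.update_of_ne (by rintro rfl; simp [i] at hr)]
        exact h1 r (by omega)
      · by_cases hri : r = i
        · rw [hri, Function.update_self]
          exact hx
        · rw [Function.update_of_ne hri]
          refine h2 r ?_
          have : (r : ℕ) ≠ m := fun h => hri (Fin.ext h)
          omega
    have h4 := h3 (h1 i (Nat.lt_succ_self m))
    rwa [Submodule.mem_comap, MultilinearMap.toLinearMap_apply, Function.update_eq_self] at h4

/-- The projection to the quotient by the span vanishes on cubes, hence on all chains. -/
theorem mem_span_cls {X : Type*} [TopologicalSpace X] (A : Set X) (x : Chains A) :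
    x ∈ Submodule.span ℝ (Set.range (Cube.cls A)) := by
  have h : (Submodule.span ℝ (Set.range (Cube.cls A))).mkQ = 0 := chains_hom_ext fun κ => by
    rw [Submodule.mkQ_apply, LinearMap.zero_apply, Submodule.Quotient.mk_eq_zero]
    exact Submodule.subset_span ⟨κ, rfl⟩
  rw [← Submodule.Quotient.mk_eq_zero, ← Submodule.mkQ_apply, h, LinearMap.zero_apply]

variable {X Ω : Type*} [TopologicalSpace X] [TopologicalSpace Ω]

theorem multilinear_ext_cls {k : ℕ} {G : Type*} [AddCommGroup G] [Module ℝ G]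
    {M M' : MultilinearMap ℝ (fun _ : Fin k => Chains (∅ : Set Ω)) G}
    (h : ∀ l : Fin k → Cube Ω, M (fun r => (l r).cls ∅) = M' fun r => (l r).cls ∅) : M = M' := by
  ext a
  rw [← sub_eq_zero, ← sub_apply, ← Submodule.mem_bot ℝ]
  refine multilinear_mem_of_mem_span (M - M') (fun _ => Set.range (Cube.cls ∅)) ⊥ (fun a ha => ?_)
    a fun r => mem_span_cls _ _
  choose l hl using ha
  obtain rfl : (fun r => (l r).cls ∅) = a := funext hl
  simp [h l]

/-- By currying: for a fixed first cube the induction gives a multilinear map of the remaining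
inputs, and this assignment kills null cubes and so descends to chains. -/
theorem exists_multilinear {G : Type*} [AddCommGroup G] [Module ℝ G] (k : ℕ)
    (g : (Fin k → Cube Ω) → G) (hg : ∀ l r, (l r).IsNull ∅ → g l = 0) :
    ∃ M : MultilinearMap ℝ (fun _ : Fin k => Chains (∅ : Set Ω)) G,
      ∀ l, M (fun r => (l r).cls ∅) = g l := by
  induction k with
  | zero =>
    refine ⟨MultilinearMap.constOfIsEmpty ℝ _ (g Fin.elim0), fun l => ?_⟩
    rw [Subsingleton.elim l Fin.elim0]; rfl
  | succ k ih =>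
    have h1 : ∀ κ : Cube Ω, ∃ M : MultilinearMap ℝ (fun _ : Fin k => Chains (∅ : Set Ω)) G,
        ∀ l, M (fun r => (l r).cls ∅) = g (Fin.cons κ l) := fun κ =>
      ih (fun l => g (Fin.cons κ l)) fun l r hr => hg _ r.succ (by simpa using hr)
    choose M hM using h1
    refine ⟨(liftChains ∅ M fun κ hκ => multilinear_ext_cls fun l => ?_).uncurryLeft,
      fun l => ?_⟩
    · rw [hM, hg _ 0 (by simpa using hκ), zero_apply]
    · rw [LinearMap.uncurryLeft_apply, liftChains_cls]
      refine (hM (l 0) (Fin.tail l)).trans ?_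
      rw [Fin.cons_self_tail]

theorem exists_linear_multilinear {G : Type*} [AddCommGroup G] [Module ℝ G] (A : Set X) (k : ℕ)
    (g : Cube X → (Fin k → Cube Ω) → G) (hA : ∀ α l, α.IsNull A → g α l = 0)
    (hg : ∀ α l r, (l r).IsNull ∅ → g α l = 0) :
    ∃ q : Chains A →ₗ[ℝ] MultilinearMap ℝ (fun _ : Fin k => Chains (∅ : Set Ω)) G,
      ∀ α l, q (α.cls A) (fun r => (l r).cls ∅) = g α l := by
  choose M hM using fun α => exists_multilinear k (g α) (hg α)
  refine ⟨liftChains A M fun α hα => multilinear_ext_cls fun l => ?_, fun α l => ?_⟩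
  · rw [hM, hA α l hα, zero_apply]
  · rw [liftChains_cls, hM]

/-- Multiplying two neighbours is linear in every input: a change of one input changes a single
entry of the contracted tuple, through the identity or a multiplication from the left or right. -/
theorem contractNth_update {k : ℕ} {A : Type*} [AddCommGroup A] [Module ℝ A]
    (mul : A →ₗ[ℝ] A →ₗ[ℝ] A) (r : Fin k) (a : Fin (k + 1) → A) (s : Fin (k + 1)) :
    ∃ (r' : Fin k) (f : A →ₗ[ℝ] A), ∀ x,
      Fin.contractNth r.castSucc (fun b c => mul b c) (Function.update a s x) =
        Function.update (Fin.contractNth r.castSucc (fun b c => mul b c) a) r' (f x) := by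
  rcases lt_trichotomy (s : ℕ) r with h | h | h
  · refine ⟨⟨s, by omega⟩, LinearMap.id, fun x => ?_⟩
    funext t
    simp only [Fin.contractNth, Function.update_apply, Fin.ext_iff, Fin.val_castSucc,
      Fin.val_succ, LinearMap.id_apply]
    split_ifs <;> first | rfl | omega
  · refine ⟨r, mul.flip (a r.succ), fun x => ?_⟩
    funext t
    simp only [Fin.contractNth, Function.update_apply, Fin.ext_iff, Fin.val_castSucc,
      Fin.val_succ, LinearMap.flip_apply]
    split_ifs <;> first | rfl | omega | skip
    rename_i h1 h2 h3 h4
    rw [show t = r from Fin.ext h2]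
  · rcases Nat.lt_or_ge (r + 1) s with h' | h'
    · refine ⟨⟨s - 1, by omega⟩, LinearMap.id, fun x => ?_⟩
      funext t
      simp only [Fin.contractNth, Function.update_apply, Fin.ext_iff, Fin.val_castSucc,
        Fin.val_succ, LinearMap.id_apply]
      split_ifs <;> first | rfl | omega
    · refine ⟨r, mul (a r.castSucc), fun x => ?_⟩
      funext t
      simp only [Fin.contractNth, Function.update_apply, Fin.ext_iff, Fin.val_castSucc,
        Fin.val_succ]
      split_ifs <;> first | rfl | omega | skip
      rename_i h1 h2 h3 h4
      rw [show t = r from Fin.ext h2]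

/-- Precomposition of multilinear maps with the product of two neighbouring inputs. -/
def contractₗ {k : ℕ} {A G : Type*} [AddCommGroup A] [Module ℝ A] [AddCommGroup G] [Module ℝ G]
    (mul : A →ₗ[ℝ] A →ₗ[ℝ] A) (r : Fin k) : MultilinearMap ℝ (fun _ : Fin k => A) G →ₗ[ℝ]
      MultilinearMap ℝ (fun _ : Fin (k + 1) => A) G where
  toFun M := MultilinearMap.mk' (fun a => M (Fin.contractNth r.castSucc (fun b c => mul b c) a))
    (fun a s x y => by
      obtain ⟨r', f, hf⟩ := contractNth_update mul r a s
      simp only [hf, map_add, MultilinearMap.map_update_add])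
    (fun a s c x => by
      obtain ⟨r', f, hf⟩ := contractNth_update mul r a s
      simp only [hf, map_smul, MultilinearMap.map_update_smul])
  map_add' _ _ := rfl
  map_smul' _ _ := rfl

end Multilinear

/-! ### The equation of a coherent chain homotopy is multilinear -/

section CoherentMultilinear

variable {A P F₁ E₁ F₂ E₂ : Type*}
  [AddCommGroup A] [Module ℝ A] [AddCommGroup P] [Module ℝ P] [AddCommGroup F₁] [Module ℝ F₁]
  [AddCommGroup E₁] [Module ℝ E₁] [AddCommGroup F₂] [Module ℝ F₂] [AddCommGroup E₂] [Module ℝ E₂]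

/-- Multilinearity of the terms with differentials, needed to test the equation on cubes. The
degrees `i` and `l` enter as fixed numbers in the signs. -/
theorem exists_tensorD_linear {G : Type*} [AddCommGroup G] [Module ℝ G] (dF : F₁ →ₗ[ℝ] F₁)
    (dA : A →ₗ[ℝ] A) {N : ℕ} (q : F₁ →ₗ[ℝ] MultilinearMap ℝ (fun _ : Fin N => A) G) (i : ℤ)
    (l : Fin N → ℤ) : ∃ M : F₁ →ₗ[ℝ] MultilinearMap ℝ (fun _ : Fin N => A) G,
      ∀ x a, M x a = tensorD dF dA q i l x a := by
  refine ⟨q ∘ₗ dF + ∑ r : Fin N, (-1 : ℝ) ^ (i + ∑ s ∈ Finset.univ.filter (· < r), l s) •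
    (MultilinearMap.compLinearMapₗ (fun s : Fin N => if s = r then dA else LinearMap.id) ∘ₗ q),
    fun x a => ?_⟩
  simp only [tensorD, LinearMap.add_apply, LinearMap.comp_apply, MultilinearMap.add_apply,
    LinearMap.sum_apply, MultilinearMap.sum_apply, LinearMap.smul_apply, MultilinearMap.smul_apply,
    MultilinearMap.compLinearMapₗ_apply, MultilinearMap.compLinearMap_apply]
  congr 1
  refine Finset.sum_congr rfl fun r _ => ?_
  congr 2
  funext s
  by_cases h : s = r
  · subst h; simp
  · simp [h]

theorem exists_coherentRHS_linear (mul : A →ₗ[ℝ] A →ₗ[ℝ] A) (mulP : A →ₗ[ℝ] P →ₗ[ℝ] P)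
    (act₁ : F₁ →ₗ[ℝ] A →ₗ[ℝ] F₁) (actP₁ : F₁ →ₗ[ℝ] P →ₗ[ℝ] E₁) (actP₂ : F₂ →ₗ[ℝ] P →ₗ[ℝ] E₂)
    (f : E₁ →ₗ[ℝ] E₂) (q : ∀ k, F₁ →ₗ[ℝ] MultilinearMap ℝ (fun _ : Fin k => A) F₂)
    (η : ∀ k, F₁ →ₗ[ℝ] MultilinearMap ℝ (fun _ : Fin k => A) (P →ₗ[ℝ] E₂)) (k : ℕ) :
    ∃ M : F₁ →ₗ[ℝ] MultilinearMap ℝ (fun _ : Fin k => A) (P →ₗ[ℝ] E₂),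
      ∀ x a p, M x a p = coherentRHS mul mulP act₁ actP₁ actP₂ f q η k x a p := by
  cases k with
  | zero =>
    refine ⟨(MultilinearMap.constLinearEquivOfIsEmpty (R := ℝ) (S := ℝ) (M₁ := fun _ : Fin 0 => A)
        (M₂ := P →ₗ[ℝ] E₂)).toLinearMap ∘ₗ (f.compRight ℝ ∘ₗ actP₁) -
      actP₂.compMultilinearMapₗ ℝ ∘ₗ q 0, fun x a p => ?_⟩
    simp [coherentRHS]
  | succ k =>
    refine ⟨(-1 : ℝ) ^ (k + 3) • ((multilinearCurryLeftEquiv ℝ (fun _ : Fin (k + 1) => A)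
          (P →ₗ[ℝ] E₂)).symm.toLinearMap ∘ₗ (η k).compRight ℝ ∘ₗ act₁) -
      actP₂.compMultilinearMapₗ ℝ ∘ₗ q (k + 1) +
      ((∑ r : Fin k, (-1 : ℝ) ^ (k + 3 + (r + 1 : ℕ)) • (contractₗ mul r ∘ₗ η k)) +
        -- The product of the last loop `b` with the path: the path argument of `η k` is precomposed
        -- with `mulP b`, which is linear in `b`, and `b` is then taken back as the last multilinear
        -- input.
        (-1 : ℝ) ^ (k + 3 + (k + 1)) • ((multilinearCurryRightEquiv ℝ (fun _ : Fin (k + 1) => A)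
          (P →ₗ[ℝ] E₂)).symm.toLinearMap ∘ₗ
            ((LinearMap.lcomp ℝ (P →ₗ[ℝ] E₂) mulP ∘ₗ
              LinearMap.llcomp ℝ P P E₂).compMultilinearMapₗ ℝ) ∘ₗ η k)),
      fun x a p => ?_⟩
    simp only [coherentRHS, LinearMap.add_apply, LinearMap.sub_apply, MultilinearMap.add_apply,
      sub_apply, LinearMap.smul_apply, MultilinearMap.smul_apply,
      LinearMap.sum_apply, MultilinearMap.sum_apply, LinearMap.comp_apply]
    rfl

end CoherentMultilinear

/-! ### Faces of the higher maps -/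

section Faces

/-- Taking a face of an earlier cube moves every later block by one; this records the resulting
sign. -/
theorem sumStarts_succ (s : ℕ) (ds : List ℕ) :
    sumStarts (s + 1) ds = sumStarts s ds + ds.length := by
  induction ds generalizing s with
  | nil => rfl
  | cons d ds ih =>
    rw [sumStarts, sumStarts, show s + 1 + d = s + d + 1 by ring, ih, List.length_cons]
    ring

theorem sumStarts_append (s : ℕ) (ds ds' : List ℕ) :
    sumStarts s (ds ++ ds') = sumStarts s ds + sumStarts (s + ds.sum) ds' := by
  induction ds generalizing s with
  | nil => simp [sumStarts]
  | cons d ds ih => rw [List.cons_append, sumStarts, ih, sumStarts, List.sum_cons, add_assoc,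
      add_assoc s]

theorem countBefore_append (s : ℕ) (ds ds' : List ℕ) (J : Finset ℕ) :
    countBefore s (ds ++ ds') J = countBefore s ds J + countBefore (s + ds.sum) ds' J := by
  induction ds generalizing s with
  | nil => simp [countBefore]
  | cons d ds ih => rw [List.cons_append, countBefore, ih, countBefore, List.sum_cons,
      add_assoc s, add_assoc]

/-- Used to compare the sign exponent `a` of a face with the exponent `E` of the full list; `b` is
the difference. -/
theorem neg_one_pow_eq {a b E : ℕ} (h : E = a + b) : (-1 : ℝ) ^ a = (-1) ^ E * (-1) ^ b := by
  rw [h, pow_add, mul_assoc, ← mul_pow]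
  simp

variable {X Ω U S P Y Z T : Type*} [TopologicalSpace X] [TopologicalSpace Ω] [TopologicalSpace U]
  [TopologicalSpace S] [TopologicalSpace P] [TopologicalSpace Y] [TopologicalSpace Z]
  [TopologicalSpace T]

theorem dims_append (L L' : List (Cube Ω)) : dims (L ++ L') = dims L ++ dims L' :=
  List.map_append

theorem dims_cons (κ : Cube Ω) (L : List (Cube Ω)) : dims (κ :: L) = κ.dim :: dims L := rfl

namespace PathData

variable {d : FibreData X Ω U S} (D : PathData d P Y Z T) {B : Set Z} (τ : Chains B →ₗ[ℝ] ℝ)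
  (C : Set Y) (α : Cube X) (L : List (Cube Ω)) (p : Cube P)

/-- The faces of the cubes in the definition of `PathData.higher`. -/
noncomputable def faceCap (i : ℕ) (c : I) : Chains C :=
  capPair τ C (α.dim + (paramDim L + (p.dim + 1)) - 1)
    (fun v => D.frontFun α L p (insertCoord i c v)) fun v => D.backFun α L p (insertCoord i c v)

theorem higher_face_base {i : ℕ} (hi : i < α.dim) (c : I) :
    D.higher τ C (α.face i hi c) L p =
      ((-1 : ℝ) ^ sumStarts α.dim (dims L ++ [p.dim]) * (-1) ^ (L.length + 1)) •
        D.faceCap τ C α L p i c := by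
  have hE : sumStarts α.dim (dims L ++ [p.dim]) =
      sumStarts (α.face i hi c).dim (dims L ++ [p.dim]) + (L.length + 1) := by
    have := sumStarts_succ (α.dim - 1) (dims L ++ [p.dim])
    rw [show α.dim - 1 + 1 = α.dim by omega, List.length_append, length_dims] at this
    exact this
  have h1 : ∀ v, shift (α.face i hi c).dim v = shift α.dim (insertCoord i c v) := fun v =>
    (shift_insertCoord_of_lt hi c v).symm
  rw [higher, neg_one_pow_eq hE, faceCap]
  congr 1
  have h2 : D.frontFun (α.face i hi c) L p = fun v => D.frontFun α L p (insertCoord i c v) :=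
    funext fun v => by rw [frontFun, h1]; rfl
  have h3 : D.backFun (α.face i hi c) L p = fun v => D.backFun α L p (insertCoord i c v) :=
    funext fun v => by rw [backFun, h1]; rfl
  rw [h2, h3, show (α.face i hi c).dim + (paramDim L + (p.dim + 1)) =
    α.dim + (paramDim L + (p.dim + 1)) - 1 by simp only [Cube.face]; omega]

theorem faceCap_add (i : ℕ) (c : I) : D.faceCap τ C α L p (α.dim + i) c =
    capPair τ C (α.dim + (paramDim L + (p.dim + 1)) - 1)
      (fun v => D.ev (D.hom L p (insertCoord i c (shift α.dim v))) (d.e (α.toFun v)))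
      fun v => D.act (α.toFun v) (D.prod L p (insertCoord i c (shift α.dim v))) := by
  simp only [faceCap, frontFun, backFun, shift_insertCoord_add, Cube.toFun_insertCoord_add]

/-- The face of `κ` moves the start of each later block by one. These are the blocks of `L₂` and the
block of `p`. -/
theorem higher_face (L₁ L₂ : List (Cube Ω)) (κ : Cube Ω) {j : ℕ} (hj : j < κ.dim) (c : I) :
    D.higher τ C α (L₁ ++ κ.face j hj c :: L₂) p =
      ((-1 : ℝ) ^ sumStarts α.dim (dims (L₁ ++ κ :: L₂) ++ [p.dim]) * (-1) ^ (L₂.length + 1)) •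
        D.faceCap τ C α (L₁ ++ κ :: L₂) p (α.dim + (paramDim L₁ + (1 + j))) c := by
  have hE : sumStarts α.dim (dims (L₁ ++ κ :: L₂) ++ [p.dim]) =
      sumStarts α.dim (dims (L₁ ++ κ.face j hj c :: L₂) ++ [p.dim]) + (L₂.length + 1) := by
    simp only [dims_append, dims_cons, List.append_assoc, sumStarts_append, List.cons_append,
      sumStarts]
    have := sumStarts_succ (α.dim + (dims L₁).sum + (κ.face j hj c).dim) (dims L₂)
    rw [show α.dim + (dims L₁).sum + (κ.face j hj c).dim + 1 = α.dim + (dims L₁).sum + κ.dim by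
      simp only [Cube.face]; omega] at this
    rw [this, length_dims]
    simp only [Cube.face]
    omega
  rw [higher, neg_one_pow_eq hE, faceCap_add]
  simp only [D.hom_face L₁ L₂ κ p hj, D.prod_face L₁ L₂ κ p hj]
  congr 1
  simp only [paramDim_append, paramDim]
  rw [show α.dim + (paramDim L₁ + ((κ.face j hj c).dim + 1 + paramDim L₂) + (p.dim + 1)) =
    α.dim + (paramDim L₁ + (κ.dim + 1 + paramDim L₂) + (p.dim + 1)) - 1 by
      simp only [Cube.face]; omega]
  rfl

theorem higher_face_last {j : ℕ} (hj : j < p.dim) (c : I) :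
    D.higher τ C α L (p.face j hj c) = (-1 : ℝ) ^ sumStarts α.dim (dims L ++ [p.dim]) •
      D.faceCap τ C α L p (α.dim + (paramDim L + (1 + j))) c := by
  have hE : sumStarts α.dim (dims L ++ [p.dim]) =
      sumStarts α.dim (dims L ++ [(p.face j hj c).dim]) := by
    simp only [sumStarts_append, sumStarts]
  rw [higher, hE, faceCap_add]
  simp only [D.hom_face_last L p hj, D.prod_face_last L p hj]
  rw [show α.dim + (paramDim L + ((p.face j hj c).dim + 1)) =
    α.dim + (paramDim L + (p.dim + 1)) - 1 by simp only [Cube.face]; omega]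
  rfl

/-- With the first parameter at `1`, the outermost homotopy is the identity and the first loop acts
on `α`. Its block, which started at `α.dim`, drops out of `sumStarts`. -/
theorem higher_act (κ : Cube Ω) : D.higher τ C (d.actCube α κ) L p =
    ((-1 : ℝ) ^ sumStarts α.dim (dims (κ :: L) ++ [p.dim]) * (-1) ^ α.dim) •
      D.faceCap τ C α (κ :: L) p (α.dim + 0) 1 := by
  have hE : sumStarts α.dim (dims (κ :: L) ++ [p.dim]) =
      sumStarts (d.actCube α κ).dim (dims L ++ [p.dim]) + α.dim :=
    add_comm _ _
  rw [higher, neg_one_pow_eq hE, faceCap_add]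
  congr 1
  simp only [paramDim]
  rw [show (d.actCube α κ).dim + (paramDim L + (p.dim + 1)) =
    α.dim + (κ.dim + 1 + paramDim L + (p.dim + 1)) - 1 by
      simp only [FibreData.actCube, crossCube]; omega]
  have hs : ∀ v, shift (d.actCube α κ).dim v = shift κ.dim (shift α.dim v) := fun v => by
    rw [shift_shift, add_comm κ.dim]
    rfl
  congr 1
  · funext v
    rw [frontFun, hom_eq_inner (L := κ :: L), insertCoord_apply_self, D.H_one,
      shift_insertCoord_of_lt (by omega), inner, D.ev_comp, hs, Nat.sub_self, shift_zero,
      ← d.e_act]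
    rfl
  · funext v
    rw [backFun, prod, shift_insertCoord_of_lt (by omega), shift_insertCoord_of_lt (by omega), hs,
      Nat.sub_self, Nat.add_sub_cancel, shift_zero, ← D.act_mul]
    rfl

/-- Merging two blocks removes the starting point of the second, which is `α.dim + totalDim L₁ +
κ.dim`. -/
theorem higher_mul (L₁ L₂ : List (Cube Ω)) (κ κ' : Cube Ω) :
    D.higher τ C α (L₁ ++ d.mulCube κ κ' :: L₂) p =
      ((-1 : ℝ) ^ sumStarts α.dim (dims (L₁ ++ κ :: κ' :: L₂) ++ [p.dim]) *
        (-1) ^ (α.dim + totalDim L₁ + κ.dim)) •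
        D.faceCap τ C α (L₁ ++ κ :: κ' :: L₂) p (α.dim + (paramDim L₁ + (κ.dim + 1))) 1 := by
  have hE : sumStarts α.dim (dims (L₁ ++ κ :: κ' :: L₂) ++ [p.dim]) =
      sumStarts α.dim (dims (L₁ ++ d.mulCube κ κ' :: L₂) ++ [p.dim]) +
        (α.dim + totalDim L₁ + κ.dim) := by
    simp only [dims_append, dims_cons, List.append_assoc, sumStarts_append, List.cons_append,
      sumStarts, sum_dims, d.mulCube_dim, ← add_assoc]
    omega
  rw [higher, neg_one_pow_eq hE, faceCap_add]
  simp only [D.hom_one_mul L₁ L₂ κ κ' p, D.prod_param_mul L₁ L₂ κ κ' p]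
  congr 1
  simp only [paramDim_append, paramDim, d.mulCube_dim]
  rw [show α.dim + (paramDim L₁ + (κ.dim + κ'.dim + 1 + paramDim L₂) + (p.dim + 1)) =
    α.dim + (paramDim L₁ + (κ.dim + 1 + (κ'.dim + 1 + paramDim L₂)) + (p.dim + 1)) - 1 by omega]
  rfl

theorem higher_mul_last (κ : Cube Ω) :
    D.higher τ C α L (D.mulCube κ p) =
      ((-1 : ℝ) ^ sumStarts α.dim (dims (L ++ [κ]) ++ [p.dim]) *
        (-1) ^ (α.dim + totalDim L + κ.dim)) •
        D.faceCap τ C α (L ++ [κ]) p (α.dim + (paramDim L + (κ.dim + 1))) 1 := by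
  have hE : sumStarts α.dim (dims (L ++ [κ]) ++ [p.dim]) =
      sumStarts α.dim (dims L ++ [(D.mulCube κ p).dim]) + (α.dim + totalDim L + κ.dim) := by
    simp only [dims_append, dims_cons, List.append_assoc, sumStarts_append, List.cons_append,
      sumStarts, sum_dims]
    simp only [dims, List.map_nil, sumStarts, totalDim]
    omega
  rw [higher, neg_one_pow_eq hE, faceCap_add]
  simp only [D.hom_one_mul_last L κ p, D.prod_param_mul_last L κ p]
  congr 1
  simp only [paramDim_append, paramDim]
  rw [show α.dim + (paramDim L + ((D.mulCube κ p).dim + 1)) =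
    α.dim + (paramDim L + (κ.dim + 1 + 0) + (p.dim + 1)) - 1 by
      simp only [PathData.mulCube, crossCube]; omega]
  rfl

/-- The case without loops. With the only parameter at `1`, the front function is `e` of the
transported cube, as in the ordinary cap product on `Y`. -/
theorem cap_act : capPair τ C (D.actCube α p).dim (fun v => D.e ((D.actCube α p).toFun v))
    (D.actCube α p).toFun = D.faceCap τ C α [] p (α.dim + 0) 1 := by
  rw [faceCap_add]
  simp only [paramDim]
  rw [show (D.actCube α p).dim = α.dim + (0 + (p.dim + 1)) - 1 by
      simp only [PathData.actCube, crossCube]; omega]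
  congr 1
  · funext v
    rw [hom, insertCoord_apply_self, D.H_one, shift_insertCoord_of_lt (by omega), ← D.e_act]
    rfl

theorem chainD_higher {n : ℕ} (hτ : IsRelCocycle n τ) :
    chainD C (D.higher τ C α L p) = ((-1 : ℝ) ^ sumStarts α.dim (dims L ++ [p.dim]) * (-1) ^ n) •
      ∑ i ∈ Finset.range (α.dim + (paramDim L + (p.dim + 1))), (-1 : ℝ) ^ i •
        (D.faceCap τ C α L p i 1 - D.faceCap τ C α L p i 0) := by
  rw [higher, map_smul, chainD_capPair hτ C _ (D.continuous_frontFun α L p)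
    (D.continuous_backFun α L p), smul_smul]
  rfl

section Invariant

variable {T₀ : Set T} (hT₀ : ∀ f, D.H 0 f ∈ T₀)
  (hinv : ∀ (κ : Cube U) (ψ : Cube T), (∀ v, ψ.toFun v ∈ T₀) →
    τ (cubeClass B (κ.dim + ψ.dim) fun v => D.ev (ψ.toFun (shift κ.dim v)) (κ.toFun v)) =
      τ (cubeClass B (κ.dim + ψ.dim) fun v => D.ι (κ.toFun v)))

include hT₀ hinv in
-- By `hom_zero` the front function is a value of the retraction applied to `frontFun α L₁`, and the
-- invariance of `τ` replaces that value by `ι`. The front function no longer sees `L₂` and `p`.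
theorem faceCap_zero (L₁ L₂ : List (Cube Ω)) :
    D.faceCap τ C α (L₁ ++ L₂) p (α.dim + paramDim L₁) 0 =
      capPair τ C (α.dim + paramDim L₁ + (paramDim L₂ + p.dim))
        (fun v => D.ι (d.frontFun α L₁ v))
        fun v => D.act (α.toFun v)
          (D.prod (L₁ ++ L₂) p (insertCoord (paramDim L₁) 0 (shift α.dim v))) := by
  rw [faceCap_add, paramDim_append,
    show α.dim + (paramDim L₁ + paramDim L₂ + (p.dim + 1)) - 1 =
      α.dim + paramDim L₁ + (paramDim L₂ + p.dim) by omega]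
  rw [← capPair_invariant hinv (d.continuous_frontFun α L₁) (d.frontFun_depends α L₁)
    (ψ := fun v => D.H 0 (D.inner L₂ p v))
    (D.continuous_H.comp (continuous_const.prodMk (D.continuous_inner L₂ p)))
    (fun v w h => by rw [D.inner_depends L₂ p v w h]) (fun v => hT₀ _) C]
  congr 1
  funext v
  rw [D.hom_zero, D.ev_comp, shift_shift, add_comm (paramDim L₁)]
  rfl

include hT₀ hinv in
-- Neither function depends on the parameter of the block behind `κ`: the front function ends with
-- `L₁`, and the product ignores parameters. That parameter now has position `α.dim + (paramDim L₁ +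
-- κ.dim)`, because the parameter of `κ` itself has been fixed.
theorem faceCap_zero_eq_zero (L₁ L₂ : List (Cube Ω)) (κ : Cube Ω) :
    D.faceCap τ C α (L₁ ++ κ :: L₂) p (α.dim + paramDim L₁) 0 = 0 := by
  rw [D.faceCap_zero τ C α p hT₀ hinv]
  refine capPair_eq_zero_of_indep τ C (i := α.dim + (paramDim L₁ + κ.dim))
    (by simp only [paramDim]; omega) (fun v w h => ?_) fun v w h => ?_
  · rw [d.frontFun_depends α L₁ v w fun i hi => h i (by omega)]
  · rw [α.depends v w fun i hi => h i (by omega)]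
    have hL : L₁ ++ κ :: L₂ = (L₁ ++ [κ]) ++ L₂ := by simp
    rw [hL]
    congr 1
    refine D.prod_param _ _ _ fun j hj => ?_
    simp only [paramDim_append, paramDim] at hj
    unfold insertCoord
    split_ifs with h1 h2
    · exact h _ (by omega)
    · rfl
    · exact h _ (by omega)

end Invariant

/-- When the last parameter is `0`, the only coordinates that the front function has lost are those
of `p`. By `capPair_cross` the face is the lower map followed by the cross product with `p`. -/
theorem cross_higher {B' : Set U} (hι : MapsTo D.ι B' B) {C₀ : Set X}
    (hC : ∀ x ∈ C₀, ∀ y, D.act x y ∈ C) {T₀ : Set T} (hT₀ : ∀ f, D.H 0 f ∈ T₀)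
    (hinv : ∀ (κ : Cube U) (ψ : Cube T), (∀ v, ψ.toFun v ∈ T₀) →
      τ (cubeClass B (κ.dim + ψ.dim) fun v => D.ev (ψ.toFun (shift κ.dim v)) (κ.toFun v)) =
        τ (cubeClass B (κ.dim + ψ.dim) fun v => D.ι (κ.toFun v))) :
    crossChains C₀ C D.act hC (d.higher (τ ∘ₗ pushChains B' B D.ι hι) C₀ α L) (p.cls ∅) =
      ((-1 : ℝ) ^ sumStarts α.dim (dims L ++ [p.dim]) * (-1) ^ (α.dim + totalDim L)) •
        D.faceCap τ C α L p (α.dim + paramDim L) 0 := by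
  have hE : sumStarts α.dim (dims L ++ [p.dim]) =
      sumStarts α.dim (dims L) + (α.dim + totalDim L) := by
    rw [sumStarts_append, sum_dims]
    rfl
  have h := D.faceCap_zero τ C α p hT₀ hinv L []
  rw [List.append_nil] at h
  rw [h, FibreData.higher, neg_one_pow_eq hE, map_smul, LinearMap.smul_apply,
    capPair_comp_pushChains τ hι _ _ (d.continuous_frontFun α L)]
  congr 1
  rw [← capPair_cross τ D.continuous_act hC
    (fun v w h => by rw [d.frontFun_depends α L v w h]) (d.continuous_backFun α L)
    (d.backFun_depends α L) p]
  simp only [paramDim, zero_add]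
  congr 1
  funext v
  rw [D.prod_param_last, ← D.act_mul, shift_shift, add_comm (paramDim L)]
  rfl

end PathData

end Faces

/-! ### Lists of cubes from tuples -/

section OfFn

variable {β : Type*}

theorem ofFn_eq_append {k : ℕ} (l : Fin k → β) (r : Fin k) :
    List.ofFn l = (List.ofFn l).take r ++ l r :: (List.ofFn l).drop (r + 1) := by
  conv_lhs => rw [← List.take_append_drop r (List.ofFn l),
    List.drop_eq_getElem_cons (by simp)]
  simp

theorem ofFn_update {k : ℕ} (l : Fin k → β) (r : Fin k) (x : β) :
    List.ofFn (Function.update l r x) =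
      (List.ofFn l).take r ++ x :: (List.ofFn l).drop (r + 1) := by
  have h := List.set_eq_take_append_cons_drop (l := List.ofFn l) (i := r) (a := x)
  rw [if_pos (by simp)] at h
  rw [← h]
  refine List.ext_getElem (by simp) fun i h1 h2 => ?_
  simp only [List.getElem_ofFn, List.getElem_set, Function.update_apply, Fin.ext_iff]
  simp only [eq_comm]

theorem ofFn_eq_append_two {k : ℕ} (l : Fin (k + 1) → β) (r : Fin k) :
    List.ofFn l = (List.ofFn l).take r ++
      l r.castSucc :: l r.succ :: (List.ofFn l).drop (r + 2) := by
  conv_lhs => rw [ofFn_eq_append l r.castSucc, List.drop_eq_getElem_cons (by simp)]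
  simp

theorem ofFn_contractNth {k : ℕ} (l : Fin (k + 1) → β) (r : Fin k) (mul : β → β → β) :
    List.ofFn (Fin.contractNth r.castSucc mul l) = (List.ofFn l).take r ++
      mul (l r.castSucc) (l r.succ) :: (List.ofFn l).drop (r + 2) := by
  refine List.ext_getElem (by simp; omega) fun i h1 h2 => ?_
  rw [List.getElem_ofFn, List.getElem_append]
  simp only [Fin.contractNth, Fin.val_castSucc, List.length_take, List.length_ofFn,
    List.getElem_take, List.getElem_ofFn, List.getElem_cons, List.getElem_drop]
  have hm : min (r : ℕ) (k + 1) = r := by omega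
  simp only [hm]
  split_ifs <;> first | omega | rfl | (congr 1; ext; simp; omega) | skip
  · rename_i _ h4 _
    rw [show (⟨i, by simpa using h1⟩ : Fin k) = r from Fin.ext h4]

end OfFn

/-! ### Counting the coordinates of a tuple of cubes block by block -/

section Sums

variable {Ω : Type*} [TopologicalSpace Ω]

theorem totalDim_take {k : ℕ} (l : Fin k → Cube Ω) (r : ℕ) :
    totalDim ((List.ofFn l).take r) = ∑ s : Fin k with s.val < r, (l s).dim := by
  rw [← sum_dims, dims, List.map_take, List.map_ofFn, List.sum_take_ofFn]
  rfl

theorem totalDim_ofFn {k : ℕ} (l : Fin k → Cube Ω) :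
    totalDim (List.ofFn l) = ∑ s, (l s).dim := by
  rw [← sum_dims, dims, List.map_ofFn, List.sum_ofFn]
  rfl

/-- Each block contributes its parameter and then its coordinates, which explains the offset `1 +
j`. -/
theorem sum_range_paramDim {V : Type*} [AddCommMonoid V] {k : ℕ} (l : Fin k → Cube Ω)
    (h : ℕ → V) : ∑ i ∈ Finset.range (paramDim (List.ofFn l)), h i =
      ∑ r : Fin k, (h (paramDim ((List.ofFn l).take r)) + ∑ j ∈ Finset.range (l r).dim,
        h (paramDim ((List.ofFn l).take r) + (1 + j))) := by
  induction k generalizing h with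
  | zero => simp [paramDim]
  | succ k ih =>
    rw [List.ofFn_succ, paramDim, Fin.sum_univ_succ, Finset.sum_range_add, ih (fun i => l i.succ)]
    congr 1
    · rw [add_comm (l 0).dim, Finset.sum_range_add, Finset.sum_range_one]
      simp [paramDim]
    · refine Finset.sum_congr rfl fun r _ => ?_
      simp only [Fin.val_succ, List.take_succ_cons, paramDim, add_assoc]

end Sums

/-! ### The equation of a coherent chain homotopy on cubes -/

section Equation

variable {X Ω U S P Y Z T : Type*} [TopologicalSpace X] [TopologicalSpace Ω] [TopologicalSpace U]
  [TopologicalSpace S] [TopologicalSpace P] [TopologicalSpace Y] [TopologicalSpace Z]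
  [TopologicalSpace T]

namespace PathData

variable {d : FibreData X Ω U S} (D : PathData d P Y Z T) {B : Set Z} (τ : Chains B →ₗ[ℝ] ℝ)
  {A : Set X} {C : Set Y} {k : ℕ}
  (η : Chains A →ₗ[ℝ] MultilinearMap ℝ (fun _ : Fin k => Chains (∅ : Set Ω))
    (Chains (∅ : Set P) →ₗ[ℝ] Chains C))
  (hη : ∀ α l p, η (α.cls A) (fun r => (l r).cls ∅) (p.cls ∅) =
    D.higher τ C α (List.ofFn l) p)
  (α : Cube X) (l : Fin k → Cube Ω) (p : Cube P)

/-- The contribution of a coordinate to the boundary of a cap product. -/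
noncomputable def faceDiff (C : Set Y) (α : Cube X) (L : List (Cube Ω)) (p : Cube P) (i : ℕ) :
    Chains C :=
  (-1 : ℝ) ^ i • (D.faceCap τ C α L p i 1 - D.faceCap τ C α L p i 0)

include hη in
theorem higher_boundary_base : η (chainD A (α.cls A)) (fun r => (l r).cls ∅) (p.cls ∅) =
    ((-1 : ℝ) ^ sumStarts α.dim (dims (List.ofFn l) ++ [p.dim]) * (-1) ^ (k + 1)) •
      ∑ i ∈ Finset.range α.dim, D.faceDiff τ C α (List.ofFn l) p i := by
  simp only [chainD_cls, cubeBoundary, map_sum, sum_apply, LinearMap.sum_apply]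
  rw [Finset.smul_sum]
  refine Finset.sum_congr rfl fun i hi => ?_
  rw [Finset.mem_range] at hi
  simp only [map_smul, map_sub, smul_apply, sub_apply, LinearMap.smul_apply, LinearMap.sub_apply,
    Cube.face_cls A α hi, hη, higher_face_base, List.length_ofFn, ← smul_sub, faceDiff]
  rw [smul_comm]

include hη in
-- The face of input `r` carries `(-1) ^ (k - r)` from the later blocks, and `r + 1` parameters
-- precede its coordinates. Together they give `(-1) ^ (k + 1)`, the same factor for every input.
theorem higher_boundary_inner (r : Fin k) :
    (-1 : ℝ) ^ (α.dim + totalDim ((List.ofFn l).take r)) •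
      η (α.cls A) (Function.update (fun r => (l r).cls ∅) r (chainD ∅ ((l r).cls ∅))) (p.cls ∅) =
    ((-1 : ℝ) ^ sumStarts α.dim (dims (List.ofFn l) ++ [p.dim]) * (-1) ^ (k + 1)) •
      ∑ j ∈ Finset.range (l r).dim, D.faceDiff τ C α (List.ofFn l) p
        (α.dim + (paramDim ((List.ofFn l).take r) + (1 + j))) := by
  have hlin : ∀ c, η (α.cls A) (Function.update (fun r => (l r).cls ∅) r c) =
      (η (α.cls A)).toLinearMap (fun r => (l r).cls ∅) r c := fun _ => rfl
  have hface : ∀ {j : ℕ} (hj : j < (l r).dim) (c : I),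
      (η (α.cls A)).toLinearMap (fun r => (l r).cls ∅) r (((l r).face j hj c).cls ∅) (p.cls ∅) =
      ((-1 : ℝ) ^ sumStarts α.dim (dims (List.ofFn l) ++ [p.dim]) * (-1) ^ (k - r)) •
        D.faceCap τ C α (List.ofFn l) p (α.dim + (paramDim ((List.ofFn l).take r) + (1 + j))) c := by
    intro j hj c
    have h1 : Function.update (fun r => (l r).cls (∅ : Set Ω)) r (((l r).face j hj c).cls ∅) =
        fun s => (Function.update l r ((l r).face j hj c) s).cls ∅ := by
      funext s
      by_cases hs : s = r
      · subst hs; simp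
      · simp [hs]
    have h2 := D.higher_face τ C α p ((List.ofFn l).take r) ((List.ofFn l).drop (r + 1)) (l r) hj c
    rw [← ofFn_update, ← ofFn_eq_append] at h2
    rw [← hlin, h1, hη, h2, List.length_drop, List.length_ofFn,
      show k - (r + 1) + 1 = k - (r : ℕ) by omega]
  rw [hlin]
  simp only [chainD_cls, cubeBoundary, map_sum, LinearMap.sum_apply]
  rw [Finset.smul_sum, Finset.smul_sum]
  refine Finset.sum_congr rfl fun j hj => ?_
  rw [Finset.mem_range] at hj
  simp only [map_smul, map_sub, LinearMap.smul_apply, LinearMap.sub_apply, Cube.face_cls ∅ _ hj,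
    hface, faceDiff, ← smul_sub, smul_smul]
  congr 1
  rw [paramDim_eq, List.length_take, List.length_ofFn, min_eq_left (by omega)]
  have h3 : (-1 : ℝ) ^ (k + 1) = (-1) ^ (k - (r : ℕ)) * (-1) ^ ((r : ℕ) + 1) := by
    rw [← pow_add]
    congr 1
    omega
  rw [h3, show α.dim + (totalDim ((List.ofFn l).take r) + r + (1 + j)) =
    α.dim + totalDim ((List.ofFn l).take r) + (r + 1) + j by ring, pow_add _ _ j, pow_add _ _ (r + 1 : ℕ)]
  have h4 : (-1 : ℝ) ^ ((r : ℕ) + 1) * (-1) ^ ((r : ℕ) + 1) = 1 := by rw [← mul_pow]; simp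
  linear_combination (-(-1 : ℝ) ^ (α.dim + totalDim ((List.ofFn l).take r)) * (-1) ^ j *
    (-1) ^ sumStarts α.dim (dims (List.ofFn l) ++ [p.dim]) * (-1) ^ (k - (r : ℕ))) * h4

include hη in
theorem higher_boundary_last :
    (-1 : ℝ) ^ (α.dim + totalDim (List.ofFn l)) •
      η (α.cls A) (fun r => (l r).cls ∅) (chainD ∅ (p.cls ∅)) =
    ((-1 : ℝ) ^ sumStarts α.dim (dims (List.ofFn l) ++ [p.dim]) * (-1) ^ (k + 1)) •
      ∑ j ∈ Finset.range p.dim, D.faceDiff τ C α (List.ofFn l) p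
        (α.dim + (paramDim (List.ofFn l) + (1 + j))) := by
  simp only [chainD_cls, cubeBoundary, map_sum]
  rw [Finset.smul_sum, Finset.smul_sum]
  refine Finset.sum_congr rfl fun j hj => ?_
  rw [Finset.mem_range] at hj
  simp only [map_smul, map_sub, Cube.face_cls ∅ _ hj, hη, higher_face_last, faceDiff, ← smul_sub,
    smul_smul]
  congr 1
  rw [paramDim_eq, List.length_ofFn, show α.dim + (totalDim (List.ofFn l) + k + (1 + j)) =
    α.dim + totalDim (List.ofFn l) + (k + 1) + j by ring, pow_add _ _ j, pow_add _ _ (k + 1)]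
  have h4 : (-1 : ℝ) ^ (k + 1) * (-1) ^ (k + 1) = 1 := by rw [← mul_pow]; simp
  linear_combination (-(-1 : ℝ) ^ (α.dim + totalDim (List.ofFn l)) * (-1) ^ j *
    (-1) ^ sumStarts α.dim (dims (List.ofFn l) ++ [p.dim])) * h4

include hη in
-- In the boundary of the cap product, the faces in the coordinates of the inputs appear with the
-- sign opposite to that of the differentials of the inputs. They cancel, and the faces in the
-- parameters remain.
theorem higher_boundary {n : ℕ} (hτ : IsRelCocycle n τ) :
    tensorD (chainD A) (chainD ∅) η α.dim (fun r => ((l r).dim : ℤ)) (α.cls A)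
        (fun r => (l r).cls ∅) (p.cls ∅) +
      (-1 : ℝ) ^ ((α.dim : ℤ) + ∑ r, ((l r).dim : ℤ)) •
        η (α.cls A) (fun r => (l r).cls ∅) (chainD ∅ (p.cls ∅)) +
      (-1 : ℝ) ^ ((k : ℤ) + 2 + -n) •
        chainD C (η (α.cls A) (fun r => (l r).cls ∅) (p.cls ∅)) =
    ((-1 : ℝ) ^ sumStarts α.dim (dims (List.ofFn l) ++ [p.dim]) * (-1) ^ k) •
      (∑ r : Fin k, D.faceDiff τ C α (List.ofFn l) p
          (α.dim + paramDim ((List.ofFn l).take r)) +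
        D.faceDiff τ C α (List.ofFn l) p (α.dim + paramDim (List.ofFn l))) := by
  have hs1 : (-1 : ℝ) ^ ((α.dim : ℤ) + ∑ r, ((l r).dim : ℤ)) =
      (-1) ^ (α.dim + totalDim (List.ofFn l)) := by
    rw [totalDim_ofFn, ← zpow_natCast]
    push_cast
    rfl
  have hs2 : ∀ r : Fin k, (-1 : ℝ) ^ ((α.dim : ℤ) +
      ∑ s ∈ Finset.univ.filter (· < r), ((l s).dim : ℤ)) =
      (-1) ^ (α.dim + totalDim ((List.ofFn l).take r)) := fun r => by
    rw [totalDim_take, ← zpow_natCast]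
    push_cast
    rfl
  have hs3 : (-1 : ℝ) ^ ((k : ℤ) + 2 + -n) = (-1) ^ k * (-1) ^ n := by
    rw [zpow_add₀ (by norm_num), zpow_add₀ (by norm_num), zpow_neg, zpow_natCast, zpow_natCast]
    rcases neg_one_pow_eq_or ℝ n with h | h <;> simp [h]
  rw [tensorD, LinearMap.add_apply, LinearMap.sum_apply, hs1, hs3, higher_boundary_last D τ η hη,
    higher_boundary_base D τ η hη, hη, D.chainD_higher τ C _ _ _ hτ]
  simp only [hs2, LinearMap.smul_apply, higher_boundary_inner D τ η hη]
  -- All coordinates in their order: those of `α`, then for each loop its parameter and its own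
  -- coordinates, and finally those of the path in the same way.
  have hall : ∑ i ∈ Finset.range (α.dim + (paramDim (List.ofFn l) + (p.dim + 1))),
      D.faceDiff τ C α (List.ofFn l) p i =
      ∑ i ∈ Finset.range α.dim, D.faceDiff τ C α (List.ofFn l) p i +
      (∑ r : Fin k, (D.faceDiff τ C α (List.ofFn l) p (α.dim + paramDim ((List.ofFn l).take r)) +
        ∑ j ∈ Finset.range (l r).dim, D.faceDiff τ C α (List.ofFn l) p
          (α.dim + (paramDim ((List.ofFn l).take r) + (1 + j)))) +
      (D.faceDiff τ C α (List.ofFn l) p (α.dim + paramDim (List.ofFn l)) +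
        ∑ j ∈ Finset.range p.dim, D.faceDiff τ C α (List.ofFn l) p
          (α.dim + (paramDim (List.ofFn l) + (1 + j))))) := by
    rw [Finset.sum_range_add, Finset.sum_range_add,
      sum_range_paramDim l fun i => D.faceDiff τ C α (List.ofFn l) p (α.dim + i),
      add_comm p.dim, Finset.sum_range_add, Finset.sum_range_one, add_zero]
  change _ + _ + _ • _ • ∑ i ∈ Finset.range (α.dim + (paramDim (List.ofFn l) + (p.dim + 1))),
      D.faceDiff τ C α (List.ofFn l) p i = _
  rw [hall, ← Finset.smul_sum, Finset.sum_add_distrib]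
  generalize ∑ i ∈ Finset.range α.dim, D.faceDiff τ C α (List.ofFn l) p i = a
  generalize ∑ r : Fin k, D.faceDiff τ C α (List.ofFn l) p
    (α.dim + paramDim ((List.ofFn l).take r)) = b
  generalize ∑ r : Fin k, ∑ j ∈ Finset.range (l r).dim, D.faceDiff τ C α (List.ofFn l) p
    (α.dim + (paramDim ((List.ofFn l).take r) + (1 + j))) = c
  generalize ∑ j ∈ Finset.range p.dim, D.faceDiff τ C α (List.ofFn l) p
    (α.dim + (paramDim (List.ofFn l) + (1 + j))) = e
  generalize D.faceDiff τ C α (List.ofFn l) p (α.dim + paramDim (List.ofFn l)) = f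
  have hn : (-1 : ℝ) ^ n * (-1) ^ n = 1 := by rw [← mul_pow]; simp
  rw [smul_smul, show (-1 : ℝ) ^ k * (-1) ^ n *
    ((-1) ^ sumStarts α.dim (dims (List.ofFn l) ++ [p.dim]) * (-1) ^ n) =
    (-1) ^ sumStarts α.dim (dims (List.ofFn l) ++ [p.dim]) * (-1) ^ k by
      linear_combination ((-1 : ℝ) ^ k *
        (-1) ^ sumStarts α.dim (dims (List.ofFn l) ++ [p.dim])) * hn, pow_succ]
  module

end PathData

end Equation

/-! ### The coherent chain homotopy of transport data -/

section Coherent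

variable {X Ω U S P Y Z T : Type*} [TopologicalSpace X] [TopologicalSpace Ω] [TopologicalSpace U]
  [TopologicalSpace S] [TopologicalSpace P] [TopologicalSpace Y] [TopologicalSpace Z]
  [TopologicalSpace T]

theorem paramDim_take_succ {k : ℕ} (l : Fin (k + 1) → Cube Ω) (r : Fin k) :
    paramDim ((List.ofFn l).take (r.succ : Fin (k + 1))) =
      paramDim ((List.ofFn l).take r) + ((l r.castSucc).dim + 1) := by
  rw [Fin.val_succ, List.take_succ_eq_append_getElem (by simp), paramDim_append,
    List.getElem_ofFn]
  rfl

namespace PathData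

variable {d : FibreData X Ω U S} (D : PathData d P Y Z T) {B : Set U} {B' : Set Z}
  (τ : Chains B' →ₗ[ℝ] ℝ) {A : Set X} {C : Set X} {A' C' : Set Y}

theorem frontFun_backFun_indep (α : Cube X) {L : List (Cube Ω)} {p : Cube P} {i m : ℕ} (hi : i < m)
    (h : ∀ v w : ℕ → I, (∀ j, j ≠ i → v j = w j) →
      D.hom L p v = D.hom L p w ∧ D.prod L p v = D.prod L p w) :
    ∃ i' < α.dim + m, ∀ v w : ℕ → I, (∀ j, j ≠ i' → v j = w j) →
      D.frontFun α L p v = D.frontFun α L p w ∧ D.backFun α L p v = D.backFun α L p w := by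
  refine ⟨α.dim + i, by omega, fun v w hvw => ?_⟩
  obtain ⟨h1, h2⟩ := h (shift α.dim v) (shift α.dim w) fun j hj => hvw _ (by omega)
  have h3 := α.depends v w fun j hj => hvw j (by omega)
  simp only [frontFun, backFun, h1, h2, h3, and_self]

theorem higher_eq_zero_of_indep {α : Cube X} {L : List (Cube Ω)} {p : Cube P} {i : ℕ}
    (hi : i < α.dim + (paramDim L + (p.dim + 1)))
    (h : ∀ v w : ℕ → I, (∀ j, j ≠ i → v j = w j) →
      D.frontFun α L p v = D.frontFun α L p w ∧ D.backFun α L p v = D.backFun α L p w) :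
    D.higher τ C' α L p = 0 := by
  rw [higher, capPair_eq_zero_of_indep τ C' hi (fun v w hvw => (h v w hvw).1)
    fun v w hvw => (h v w hvw).2, smul_zero]

theorem higher_eq_zero_of_last {α : Cube X} {L : List (Cube Ω)} {p : Cube P} (hp : p.IsNull ∅) :
    D.higher τ C' α L p = 0 := by
  rcases hp with hp | hp
  · obtain ⟨i, hi, h⟩ := D.exists_indep_of_last L hp
    obtain ⟨i, hi, h⟩ := D.frontFun_backFun_indep α hi h
    exact D.higher_eq_zero_of_indep τ hi h
  · exact absurd (hp 0) (notMem_empty _)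

theorem higher_eq_zero_of_mem {α : Cube X} {L : List (Cube Ω)} {p : Cube P} {κ : Cube Ω}
    (hL : κ ∈ L) (hκ : κ.IsNull ∅) : D.higher τ C' α L p = 0 := by
  rcases hκ with hκ | hκ
  · obtain ⟨i, hi, h⟩ := D.exists_indep_of_mem hL hκ p
    obtain ⟨i, hi, h⟩ := D.frontFun_backFun_indep α hi h
    exact D.higher_eq_zero_of_indep τ (by omega) h
  · exact absurd (hκ 0) (notMem_empty _)

/-- A cube in the subspace lies wholly in one of its two parts, by `hdich`. In one case all back
faces vanish in the target, in the other `τ` vanishes on all front faces. -/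
theorem higher_eq_zero_of_base {α : Cube X} {L : List (Cube Ω)} {p : Cube P}
    (hdich : ∀ α : Cube X, (∀ v, α.toFun v ∈ A) →
      (∀ v, α.toFun v ∈ C) ∨ ∀ v, d.e (α.toFun v) ∈ B)
    (hC : ∀ x ∈ C, ∀ p, D.act x p ∈ C') (hev : ∀ f, MapsTo (D.ev f) B B') (hα : α.IsNull A) :
    D.higher τ C' α L p = 0 := by
  rcases hα with ⟨i, hi, h⟩ | h
  · refine D.higher_eq_zero_of_indep τ (i := i) (by omega) fun v w hvw => ?_
    have h1 : shift α.dim v = shift α.dim w := funext fun j => hvw _ (by omega)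
    simp only [frontFun, backFun, h1, h v w hvw, and_self]
  · rcases hdich α h with h | h
    · rw [higher, capPair_eq_zero_of_back_mem, smul_zero]
      exact fun v => hC _ (h v) _
    · rw [higher, capPair_eq_zero_of_front_mem, smul_zero]
      exact fun v => hev _ (h v)

theorem higher_mem {n : ℕ} (hτ : IsRelCocycle n τ) (α : Cube X) (L : List (Cube Ω)) (p : Cube P) :
    D.higher τ C' α L p ∈
      chainsOfDegree C' ((α.dim : ℤ) + totalDim L + p.dim + (L.length + 1) + -n) := by
  rw [higher]
  refine Submodule.smul_mem _ _ ?_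
  have := capPair_mem hτ C' (α.dim + (paramDim L + (p.dim + 1))) (D.continuous_frontFun α L p)
    (D.backFun α L p)
  rw [paramDim_eq] at this ⊢
  convert this using 2
  push_cast
  ring

theorem exists_higher
    (hdich : ∀ α : Cube X, (∀ v, α.toFun v ∈ A) →
      (∀ v, α.toFun v ∈ C) ∨ ∀ v, d.e (α.toFun v) ∈ B)
    (hC : ∀ x ∈ C, ∀ p, D.act x p ∈ C') (hev : ∀ f, MapsTo (D.ev f) B B') (k : ℕ) :
    ∃ η : Chains A →ₗ[ℝ] MultilinearMap ℝ (fun _ : Fin k => Chains (∅ : Set Ω))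
        (Chains (∅ : Set P) →ₗ[ℝ] Chains C'),
      ∀ α l p, η (α.cls A) (fun r => (l r).cls ∅) (p.cls ∅) =
        D.higher τ C' α (List.ofFn l) p := by
  obtain ⟨η, hη⟩ := exists_linear_multilinear (Ω := Ω) A k (fun α l =>
      liftChains (∅ : Set P) (fun p => D.higher τ C' α (List.ofFn l) p)
        fun p hp => D.higher_eq_zero_of_last τ hp)
    (fun α l hα => chains_hom_ext fun p => by
      rw [liftChains_cls, LinearMap.zero_apply]
      exact D.higher_eq_zero_of_base τ hdich hC hev hα)
    (fun α l r hr => chains_hom_ext fun p => by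
      rw [liftChains_cls, LinearMap.zero_apply]
      exact D.higher_eq_zero_of_mem τ (List.mem_ofFn.2 ⟨r, rfl⟩) hr)
  exact ⟨η, fun α l p => by rw [hη, liftChains_cls]⟩

theorem capCube_eq_zero {W V : Type*} [TopologicalSpace W] [TopologicalSpace V] {E : Set V}
    (τ : Chains E →ₗ[ℝ] ℝ) {e : W → V} {A C : Set W}
    (hdich : ∀ α : Cube W, (∀ v, α.toFun v ∈ A) →
      (∀ v, α.toFun v ∈ C) ∨ ∀ v, e (α.toFun v) ∈ E) {α : Cube W} (hα : α.IsNull A) :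
    capCube τ e C α = 0 := by
  rw [capCube_eq_capPair]
  rcases hα with ⟨i, hi, h⟩ | h
  · exact capPair_eq_zero_of_indep τ C hi (fun v w hvw => congrArg e (h v w hvw)) h
  · rcases hdich α h with h | h
    · exact capPair_eq_zero_of_back_mem _ _ _ _ h
    · exact capPair_eq_zero_of_front_mem _ _ _ _ h

theorem cap_degree {W V : Type*} [TopologicalSpace W] [TopologicalSpace V] {E : Set V}
    {τ : Chains E →ₗ[ℝ] ℝ} {n : ℕ} (hτ : IsRelCocycle n τ) {e : W → V} (he : Continuous e)
    {A C : Set W} (f : Chains A →ₗ[ℝ] Chains C) (hf : ∀ α, f (α.cls A) = capCube τ e C α)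
    (i : ℤ) (x : Chains A) (hx : x ∈ chainsOfDegree A i) : f x ∈ chainsOfDegree C (i + -n) := by
  suffices h : chainsOfDegree A i ≤ (chainsOfDegree C (i + -n)).comap f from h hx
  refine Submodule.span_le.2 ?_
  rintro _ ⟨α, rfl, rfl⟩
  rw [SetLike.mem_coe, Submodule.mem_comap, hf]
  exact capPair_mem hτ C α.dim (he.comp α.continuous) _

/-- The boundary formula `chainD_capPair` for a cube and its composite with `e`, without homotopies.
-/
theorem cap_chainMap {W V : Type*} [TopologicalSpace W] [TopologicalSpace V] {E : Set V}
    {τ : Chains E →ₗ[ℝ] ℝ} {n : ℕ} (hτ : IsRelCocycle n τ) {e : W → V} (he : Continuous e)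
    {A C : Set W} (f : Chains A →ₗ[ℝ] Chains C) (hf : ∀ α, f (α.cls A) = capCube τ e C α)
    (x : Chains A) : f (chainD A x) = (-1 : ℝ) ^ (-n : ℤ) • chainD C (f x) := by
  have hn : (-1 : ℝ) ^ (-n : ℤ) = (-1) ^ n := by
    rw [zpow_neg, zpow_natCast]
    rcases neg_one_pow_eq_or ℝ n with h | h <;> simp [h]
  suffices h : f ∘ₗ chainD A = (-1 : ℝ) ^ n • (chainD C ∘ₗ f) by
    rw [hn]
    exact LinearMap.congr_fun h x
  refine chains_hom_ext fun α => ?_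
  have hnn : (-1 : ℝ) ^ n * (-1) ^ n = 1 := by rw [← mul_pow]; simp
  rw [LinearMap.smul_apply, LinearMap.comp_apply, LinearMap.comp_apply, hf, capCube_eq_capPair,
    chainD_capPair hτ C _ (F := fun v => e (α.toFun v)) (he.comp α.continuous) α.continuous,
    smul_smul, hnn, one_smul,
    chainD_cls, cubeBoundary, map_sum]
  refine Finset.sum_congr rfl fun i hi => ?_
  rw [Finset.mem_range] at hi
  rw [map_smul, map_sub, Cube.face_cls A α hi, Cube.face_cls A α hi, hf, hf, capCube_eq_capPair,
    capCube_eq_capPair]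
  rfl

variable {T₀ : Set T} (hT₀ : ∀ f, D.H 0 f ∈ T₀)
  (hinv : ∀ (κ : Cube U) (ψ : Cube T), (∀ v, ψ.toFun v ∈ T₀) →
    τ (cubeClass B' (κ.dim + ψ.dim) fun v => D.ev (ψ.toFun (shift κ.dim v)) (κ.toFun v)) =
      τ (cubeClass B' (κ.dim + ψ.dim) fun v => D.ι (κ.toFun v)))
  {n : ℕ} (hτ : IsRelCocycle n τ) (hι : MapsTo D.ι B B')
  (hmul : ∀ x ∈ (∅ : Set Ω), ∀ y, d.mul x y ∈ (∅ : Set Ω))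
  (hmulP : ∀ x ∈ (∅ : Set Ω), ∀ y, D.mul x y ∈ (∅ : Set P))
  (hA : ∀ x ∈ A, ∀ a, d.act x a ∈ A) (hA' : ∀ x ∈ A, ∀ p, D.act x p ∈ A')
  (hC : ∀ x ∈ C, ∀ p, D.act x p ∈ C')
  (f : Chains A' →ₗ[ℝ] Chains C') (hf : ∀ α, f (α.cls A') = capCube τ D.e C' α)
  (q : ∀ k, Chains A →ₗ[ℝ] MultilinearMap ℝ (fun _ : Fin k => Chains (∅ : Set Ω)) (Chains C))
  (hq : ∀ k α l, q k (α.cls A) (fun r => (l r).cls ∅) =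
    d.higher (τ ∘ₗ pushChains B B' D.ι hι) C α (List.ofFn l))
  (η : ∀ k, Chains A →ₗ[ℝ] MultilinearMap ℝ (fun _ : Fin k => Chains (∅ : Set Ω))
    (Chains (∅ : Set P) →ₗ[ℝ] Chains C'))
  (hη : ∀ k α l p, η k (α.cls A) (fun r => (l r).cls ∅) (p.cls ∅) =
    D.higher τ C' α (List.ofFn l) p)

include hT₀ hinv hf hq hη in
-- Matches the surviving parameter faces with the right-hand side. At `1`, the first parameter gives
-- the action on the first input, the others give products of neighbours, and the parameter of the
-- path gives the product with the last input (or `f` when there are no loops). At `0`, only the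
-- parameter of the path contributes, with `q` followed by the action.
theorem higher_rhs (k : ℕ) (α : Cube X) (l : Fin k → Cube Ω) (p : Cube P) :
    ((-1 : ℝ) ^ sumStarts α.dim (dims (List.ofFn l) ++ [p.dim]) * (-1) ^ k) •
      (∑ r : Fin k, D.faceDiff τ C' α (List.ofFn l) p
          (α.dim + paramDim ((List.ofFn l).take r)) +
        D.faceDiff τ C' α (List.ofFn l) p (α.dim + paramDim (List.ofFn l))) =
      coherentRHS (crossChains ∅ ∅ d.mul hmul) (crossChains ∅ ∅ D.mul hmulP)
        (crossChains A A d.act hA) (crossChains A A' D.act hA') (crossChains C C' D.act hC) f q η k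
        (α.cls A) (fun r => (l r).cls ∅) (p.cls ∅) := by
  have hcross := D.cross_higher τ C' α (List.ofFn l) p hι hC hT₀ hinv
  rw [← hq] at hcross
  have hE : ∀ m : ℕ, (-1 : ℝ) ^ m * (-1) ^ m = 1 := fun m => by rw [← mul_pow]; simp
  cases k with
  | zero =>
    rw [coherentRHS, hcross, crossChains_cls D.continuous_act, hf, capCube_eq_capPair]
    have h := D.cap_act τ C' α p
    rw [PathData.actCube] at h
    rw [h]
    simp only [List.ofFn_zero, paramDim, totalDim, add_zero, Finset.univ_eq_empty,
      Finset.sum_empty, zero_add, pow_zero, mul_one, faceDiff, smul_smul]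
    have hs : sumStarts α.dim (dims ([] : List (Cube Ω)) ++ [p.dim]) = α.dim := rfl
    rw [hs, hE, one_smul, one_smul]
  | succ k =>
    rw [coherentRHS, hcross]
    set ε : ℝ := (-1) ^ sumStarts α.dim (dims (List.ofFn l) ++ [p.dim]) with hε
    have hlen : (List.ofFn l).length = k + 1 := by simp
    -- vanishing of the faces at `0`
    have hz : ∀ r : Fin (k + 1),
        D.faceCap τ C' α (List.ofFn l) p (α.dim + paramDim ((List.ofFn l).take r)) 0 = 0 :=
      fun r => by
        have := D.faceCap_zero_eq_zero τ C' α p hT₀ hinv ((List.ofFn l).take r)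
          ((List.ofFn l).drop (r + 1)) (l r)
        rwa [← ofFn_eq_append] at this
    -- the action on the first input
    have h1 : η k (crossChains A A d.act hA (α.cls A) ((l 0).cls ∅))
        (Fin.tail fun r => (l r).cls ∅) (p.cls ∅) =
        (ε * (-1) ^ α.dim) • D.faceCap τ C' α (List.ofFn l) p (α.dim + 0) 1 := by
      rw [crossChains_cls d.continuous_act]
      refine (hη k _ (Fin.tail l) p).trans ?_
      have := D.higher_act τ C' α (List.ofFn (Fin.tail l)) p (l 0)
      have hl : l 0 :: List.ofFn (Fin.tail l) = List.ofFn l := (List.ofFn_succ).symm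
      rw [hl] at this
      exact this
    -- products of neighbouring inputs
    have h2 : ∀ r : Fin k, η k (α.cls A) (Fin.contractNth r.castSucc
        (fun b c => crossChains ∅ ∅ d.mul hmul b c) fun r => (l r).cls ∅) (p.cls ∅) =
        (ε * (-1) ^ (α.dim + totalDim ((List.ofFn l).take r) + (l r.castSucc).dim)) •
          D.faceCap τ C' α (List.ofFn l) p
            (α.dim + paramDim ((List.ofFn l).take (r.succ : Fin (k + 1)))) 1 := fun r => by
      have hc : (Fin.contractNth r.castSucc (fun b c => crossChains ∅ ∅ d.mul hmul b c)
          fun r => (l r).cls (∅ : Set Ω)) =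
          fun s => (Fin.contractNth r.castSucc d.mulCube l s).cls ∅ := by
        funext s
        simp only [Fin.contractNth]
        split_ifs
        · rfl
        · exact crossChains_cls d.continuous_mul _ _ _
        · rfl
      have := D.higher_mul τ C' α p ((List.ofFn l).take r) ((List.ofFn l).drop (r + 2))
        (l r.castSucc) (l r.succ)
      rw [← ofFn_contractNth, ← ofFn_eq_append_two] at this
      rw [hc, hη, this]
      congr 3
      exact (paramDim_take_succ l r).symm
    -- the product with the last input
    have h3 : η k (α.cls A) (Fin.init fun r => (l r).cls ∅)
        (crossChains ∅ ∅ D.mul hmulP ((l (Fin.last k)).cls ∅) (p.cls ∅)) =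
        (ε * (-1) ^ (α.dim + totalDim (List.ofFn l))) •
          D.faceCap τ C' α (List.ofFn l) p (α.dim + paramDim (List.ofFn l)) 1 := by
      rw [crossChains_cls D.continuous_mul]
      refine (hη k _ (Fin.init l) _).trans ?_
      have := D.higher_mul_last τ C' α (List.ofFn (Fin.init l)) p (l (Fin.last k))
      have hl : List.ofFn (Fin.init l) ++ [l (Fin.last k)] = List.ofFn l := by
        rw [List.ofFn_succ_last]
        rfl
      rw [hl] at this
      refine this.trans ?_
      conv_rhs => rw [← hl, paramDim_append, totalDim_append]
      simp only [paramDim, totalDim, add_zero, ← add_assoc]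
      rw [hl]
    rw [h1, h3, Fin.sum_univ_succ]
    simp only [h2, faceDiff, hz, sub_zero, smul_smul, smul_add, Finset.smul_sum, smul_sub]
    have e1 : (-1 : ℝ) ^ (k + 3) * (ε * (-1) ^ α.dim) =
        ε * (-1) ^ (k + 1) * (-1) ^ (α.dim + paramDim ((List.ofFn l).take (0 : Fin (k + 1)))) := by
      simp only [Fin.val_zero, List.take_zero, paramDim, add_zero]
      ring
    have e2 : ∀ r : Fin k, (-1 : ℝ) ^ (k + 3 + (r + 1 : ℕ)) *
        (ε * (-1) ^ (α.dim + totalDim ((List.ofFn l).take r) + (l r.castSucc).dim)) =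
        ε * (-1) ^ (k + 1) *
          (-1) ^ (α.dim + paramDim ((List.ofFn l).take (r.succ : Fin (k + 1)))) := fun r => by
      rw [paramDim_take_succ, paramDim_eq, List.length_take, hlen, min_eq_left (by omega)]
      ring
    have e3 : (-1 : ℝ) ^ (k + 3 + (k + 1)) * (ε * (-1) ^ (α.dim + totalDim (List.ofFn l))) =
        ε * (-1) ^ (k + 1) * (-1) ^ (α.dim + paramDim (List.ofFn l)) := by
      rw [paramDim_eq, hlen]
      ring
    -- The sign of the one nonzero face at `0`: besides the coordinates of `α` and of the loops, `k
    -- + 1` parameters precede the parameter of the path.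
    have e4 : ε * (-1) ^ (k + 1) * (-1) ^ (α.dim + paramDim (List.ofFn l)) =
        ε * (-1) ^ (α.dim + totalDim (List.ofFn l)) := by
      rw [paramDim_eq, hlen, ← add_assoc, pow_add _ _ (k + 1)]
      linear_combination (ε * (-1) ^ (α.dim + totalDim (List.ofFn l))) * hE (k + 1)
    rw [e1, e3]
    simp only [e2]
    rw [e4]
    simp only [Fin.val_zero, List.take_zero, paramDim]
    abel

end PathData

end Coherent

/-! ### From cubes to chains -/

section Ext

variable {X Ω : Type*} [TopologicalSpace X] [TopologicalSpace Ω] {A : Set X} {G : Type*}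
  [AddCommGroup G] [Module ℝ G]

/-- Inputs of prescribed degrees are combinations of cubes of exactly these dimensions, so the
degree-dependent signs of the equations can be kept fixed. -/
theorem multilinear_mem_of_degree {k : ℕ}
    (N : Chains A →ₗ[ℝ] MultilinearMap ℝ (fun _ : Fin k => Chains (∅ : Set Ω)) G)
    (W : Submodule ℝ G) (i : ℤ) (l : Fin k → ℤ)
    (h : ∀ (α : Cube X) (κ : Fin k → Cube Ω), (α.dim : ℤ) = i → (∀ r, ((κ r).dim : ℤ) = l r) →
      N (α.cls A) (fun r => (κ r).cls ∅) ∈ W)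
    (x : Chains A) (hx : x ∈ chainsOfDegree A i) (a : Fin k → Chains (∅ : Set Ω))
    (ha : ∀ r, a r ∈ chainsOfDegree ∅ (l r)) : N x a ∈ W := by
  refine multilinear_mem_of_mem_span (N x)
    (fun r => {c | ∃ κ : Cube Ω, (κ.dim : ℤ) = l r ∧ c = κ.cls ∅}) W (fun a ha => ?_) a ha
  choose κ hκ using ha
  obtain rfl : a = fun r => (κ r).cls ∅ := funext fun r => (hκ r).2
  let ev : MultilinearMap ℝ (fun _ : Fin k => Chains (∅ : Set Ω)) G →ₗ[ℝ] G :=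
    { toFun := fun M => M fun r => (κ r).cls ∅
      map_add' := fun _ _ => rfl
      map_smul' := fun _ _ => rfl }
  suffices hle : chainsOfDegree A i ≤ W.comap (ev ∘ₗ N) from hle hx
  refine Submodule.span_le.2 ?_
  rintro _ ⟨α, hα, rfl⟩
  exact h α κ hα fun r => (hκ r).1

end Ext

/-! ### Morphisms of modules from coherent chain homotopies -/

section AInfinity

variable {A F G : Type*} [AddCommGroup A] [Module ℝ A] [AddCommGroup F] [Module ℝ F]
  [AddCommGroup G] [Module ℝ G]

/-- The last input of a multilinear map as a separate argument. -/
def splitLast {k : ℕ} (q : F →ₗ[ℝ] MultilinearMap ℝ (fun _ : Fin (k + 1) => A) G) :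
    F →ₗ[ℝ] MultilinearMap ℝ (fun _ : Fin k => A) (A →ₗ[ℝ] G) :=
  (multilinearCurryRightEquiv ℝ (fun _ : Fin (k + 1) => A) G).toLinearMap ∘ₗ q

theorem splitLast_apply {k : ℕ} (q : F →ₗ[ℝ] MultilinearMap ℝ (fun _ : Fin (k + 1) => A) G)
    (x : F) (a : Fin k → A) (p : A) : splitLast q x a p = q x (Fin.snoc a p) := rfl

theorem splitLast_init {k : ℕ} (q : F →ₗ[ℝ] MultilinearMap ℝ (fun _ : Fin (k + 1) => A) G)
    (x : F) (a : Fin (k + 1) → A) : splitLast q x (Fin.init a) (a (Fin.last k)) = q x a := by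
  rw [splitLast_apply, Fin.snoc_init_self]

/-- The differential of the last input becomes the separate term in the equation of a coherent chain
homotopy. -/
theorem tensorD_splitLast (dF : F →ₗ[ℝ] F) (dA : A →ₗ[ℝ] A) {k : ℕ}
    (q : F →ₗ[ℝ] MultilinearMap ℝ (fun _ : Fin (k + 1) => A) G) (i : ℤ) (l : Fin (k + 1) → ℤ)
    (x : F) (a : Fin (k + 1) → A) : tensorD dF dA q i l x a =
      tensorD dF dA (splitLast q) i (Fin.init l) x (Fin.init a) (a (Fin.last k)) +
        (-1 : ℝ) ^ (i + ∑ r, Fin.init l r) •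
          splitLast q x (Fin.init a) (dA (a (Fin.last k))) := by
  have h1 : ∀ r : Fin k, ∑ s ∈ Finset.univ.filter (· < r.castSucc), l s =
      ∑ s ∈ Finset.univ.filter (· < r), Fin.init l s := fun r => by
    rw [Finset.sum_filter, Fin.sum_univ_castSucc, Finset.sum_filter,
      if_neg (Fin.castSucc_lt_last r).not_gt, add_zero]
    simp only [Fin.castSucc_lt_castSucc_iff]
    rfl
  have h2 : ∑ s ∈ Finset.univ.filter (· < Fin.last k), l s = ∑ r, Fin.init l r := by
    rw [Finset.sum_filter, Fin.sum_univ_castSucc, if_neg (lt_irrefl _), add_zero]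
    simp only [Fin.castSucc_lt_last, if_true]
    rfl
  rw [tensorD, tensorD, LinearMap.add_apply, LinearMap.sum_apply, splitLast_init,
    Fin.sum_univ_castSucc, add_assoc]
  congr 2
  · refine Finset.sum_congr rfl fun r _ => ?_
    rw [h1, LinearMap.smul_apply, splitLast_apply]
    congr 2
    rw [Fin.snoc_update, Fin.snoc_init_self]
    rfl
  · rw [h2, splitLast_apply]
    congr 2
    rw [← Fin.update_snoc_last (x := a (Fin.last k)), Fin.snoc_init_self]

/-- With loops in place of paths the two right-hand sides agree term by term; the product with the
path is the last of the contractions. -/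
theorem ainftyRHS_eq_coherentRHS (mul : A →ₗ[ℝ] A →ₗ[ℝ] A) (actF : F →ₗ[ℝ] A →ₗ[ℝ] F)
    (actG : G →ₗ[ℝ] A →ₗ[ℝ] G) (q : ∀ k, F →ₗ[ℝ] MultilinearMap ℝ (fun _ : Fin k => A) G)
    (f : F →ₗ[ℝ] G) (hf : ∀ x, f x = q 0 x Fin.elim0) (k : ℕ) (x : F) (a : Fin (k + 1) → A) :
    ainftyRHS mul actF actG q (k + 1) x a = coherentRHS mul mul actF actF actG f q
      (fun k => splitLast (q (k + 1))) k x (Fin.init a) (a (Fin.last k)) := by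
  cases k with
  | zero =>
    simp only [ainftyRHS, coherentRHS, hf, Finset.univ_eq_empty, Finset.sum_empty, add_zero,
      zero_add]
    rw [show (-1 : ℝ) ^ 2 = 1 by norm_num, one_smul]
    congr 2
    exact Subsingleton.elim (α := Fin 0 → A) _ _
  | succ k =>
    simp only [ainftyRHS, coherentRHS, splitLast_apply]
    rw [Fin.sum_univ_castSucc]
    congr 2
    · congr 3
      funext s
      refine Fin.lastCases ?_ (fun s => ?_) s
      · rw [Fin.snoc_last]
        rfl
      · rw [Fin.snoc_castSucc]
        rfl
    · refine Finset.sum_congr rfl fun r _ => ?_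
      congr 2
      funext s
      refine Fin.lastCases ?_ (fun s => ?_) s
      · rw [Fin.snoc_last]
        have h1 : ¬ k < (r : ℕ) := by omega
        have h2 : k ≠ (r : ℕ) := by omega
        simp [Fin.contractNth, h1, h2]
      · rw [Fin.snoc_castSucc]
        simp only [Fin.contractNth, Fin.val_castSucc]
        split_ifs <;> rfl
    · congr 2
      funext s
      refine Fin.lastCases ?_ (fun s => ?_) s
      · rw [Fin.snoc_last]
        simp [Fin.contractNth]
        rfl
      · rw [Fin.snoc_castSucc]
        simp [Fin.contractNth]
        rfl

/-- Reduces the based case to the free one. Only `N = 0` lies outside it, and there the equation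
says that `f = q 0` is a chain map up to sign. -/
theorem isAInfinityMorphism_of_coherent {grA : ℤ → Submodule ℝ A} {dA : A →ₗ[ℝ] A}
    {mul : A →ₗ[ℝ] A →ₗ[ℝ] A} {grF : ℤ → Submodule ℝ F} {dF : F →ₗ[ℝ] F}
    {actF : F →ₗ[ℝ] A →ₗ[ℝ] F} {grG : ℤ → Submodule ℝ G} {dG : G →ₗ[ℝ] G}
    {actG : G →ₗ[ℝ] A →ₗ[ℝ] G} {m : ℤ}
    {q : ∀ k, F →ₗ[ℝ] MultilinearMap ℝ (fun _ : Fin k => A) G}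
    (hdeg : ∀ (N : ℕ) (i : ℤ) (l : Fin N → ℤ), ∀ x ∈ grF i, ∀ a : Fin N → A,
      (∀ r, a r ∈ grA (l r)) → q N x a ∈ grG (i + ∑ r, l r + N + m))
    {f : F →ₗ[ℝ] G} (hf : ∀ x, f x = q 0 x Fin.elim0)
    (hchain : ∀ x, f (dF x) = (-1 : ℝ) ^ m • dG (f x))
    (heq : ∀ (k : ℕ) (i : ℤ) (l : Fin k → ℤ), ∀ x ∈ grF i, ∀ a : Fin k → A,
      (∀ r, a r ∈ grA (l r)) → ∀ p : A,
      tensorD dF dA (splitLast (q (k + 1))) i l x a p +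
          (-1 : ℝ) ^ (i + ∑ r, l r) • splitLast (q (k + 1)) x a (dA p)
          + (-1 : ℝ) ^ ((k : ℤ) + 2 + m) • dG (splitLast (q (k + 1)) x a p) =
        coherentRHS mul mul actF actF actG f q (fun k => splitLast (q (k + 1))) k x a p) :
    IsAInfinityMorphism grA dA mul grF dF actF grG dG actG m q where
  degree := hdeg
  equation N i l x hx a ha := by
    cases N with
    | zero =>
      obtain rfl : a = Fin.elim0 := Subsingleton.elim _ _
      simp only [tensorD, ainftyRHS, Finset.univ_eq_empty, Finset.sum_empty, add_zero, ← hf,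
        hchain]
      rw [show ((0 : ℕ) : ℤ) + 1 + m = 1 + m by push_cast; ring, zpow_one_add₀ (by norm_num)]
      module
    | succ k =>
      have h := heq k i (Fin.init l) x hx (Fin.init a) (fun r => ha _) (a (Fin.last k))
      rw [ainftyRHS_eq_coherentRHS mul actF actG q f hf, ← h, tensorD_splitLast, splitLast_init]
      push_cast
      rw [show (k : ℤ) + 1 + 1 + m = k + 2 + m by ring]

end AInfinity

/-- The difference of the two sides as one multilinear map, which then only has to vanish on cubes.
-/
theorem exists_coherentError_linear {A P F₁ E₁ F₂ E₂ : Type*}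
    [AddCommGroup A] [Module ℝ A] [AddCommGroup P] [Module ℝ P] [AddCommGroup F₁] [Module ℝ F₁]
    [AddCommGroup E₁] [Module ℝ E₁] [AddCommGroup F₂] [Module ℝ F₂] [AddCommGroup E₂] [Module ℝ E₂]
    (dF : F₁ →ₗ[ℝ] F₁) (dA : A →ₗ[ℝ] A) (dP : P →ₗ[ℝ] P) (dE : E₂ →ₗ[ℝ] E₂)
    (mul : A →ₗ[ℝ] A →ₗ[ℝ] A) (mulP : A →ₗ[ℝ] P →ₗ[ℝ] P)
    (act₁ : F₁ →ₗ[ℝ] A →ₗ[ℝ] F₁) (actP₁ : F₁ →ₗ[ℝ] P →ₗ[ℝ] E₁) (actP₂ : F₂ →ₗ[ℝ] P →ₗ[ℝ] E₂)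
    (f : E₁ →ₗ[ℝ] E₂) (q : ∀ k, F₁ →ₗ[ℝ] MultilinearMap ℝ (fun _ : Fin k => A) F₂)
    (η : ∀ k, F₁ →ₗ[ℝ] MultilinearMap ℝ (fun _ : Fin k => A) (P →ₗ[ℝ] E₂)) (k : ℕ) (i : ℤ)
    (l : Fin k → ℤ) (m : ℤ) :
    ∃ N : F₁ →ₗ[ℝ] MultilinearMap ℝ (fun _ : Fin k => A) (P →ₗ[ℝ] E₂),
      ∀ x a p, N x a p = tensorD dF dA (η k) i l x a p +
          (-1 : ℝ) ^ (i + ∑ r, l r) • η k x a (dP p) +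
          (-1 : ℝ) ^ ((k : ℤ) + 2 + m) • dE (η k x a p) -
        coherentRHS mul mulP act₁ actP₁ actP₂ f q η k x a p := by
  obtain ⟨M₁, h₁⟩ := exists_tensorD_linear dF dA (η k) i l
  obtain ⟨M₂, h₂⟩ := exists_coherentRHS_linear mul mulP act₁ actP₁ actP₂ f q η k
  refine ⟨M₁ + (-1 : ℝ) ^ (i + ∑ r, l r) •
        ((LinearMap.lcomp ℝ E₂ dP).compMultilinearMapₗ ℝ ∘ₗ η k) +
      (-1 : ℝ) ^ ((k : ℤ) + 2 + m) • ((dE.compRight ℝ).compMultilinearMapₗ ℝ ∘ₗ η k) - M₂,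
    fun x a p => ?_⟩
  rw [← h₁, ← h₂]
  rfl

/-! ### The coherent chain homotopy of transport data on chains -/

section Coherent

variable {X Ω U S P Y Z T : Type*} [TopologicalSpace X] [TopologicalSpace Ω] [TopologicalSpace U]
  [TopologicalSpace S] [TopologicalSpace P] [TopologicalSpace Y] [TopologicalSpace Z]
  [TopologicalSpace T]

namespace PathData

variable {d : FibreData X Ω U S} (D : PathData d P Y Z T) {B : Set U} {B' : Set Z}
  (τ : Chains B' →ₗ[ℝ] ℝ) {A : Set X} {C : Set X} {A' C' : Set Y}
  {T₀ : Set T} (hT₀ : ∀ f, D.H 0 f ∈ T₀)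
  (hinv : ∀ (κ : Cube U) (ψ : Cube T), (∀ v, ψ.toFun v ∈ T₀) →
    τ (cubeClass B' (κ.dim + ψ.dim) fun v => D.ev (ψ.toFun (shift κ.dim v)) (κ.toFun v)) =
      τ (cubeClass B' (κ.dim + ψ.dim) fun v => D.ι (κ.toFun v)))
  {n : ℕ} (hτ : IsRelCocycle n τ) (hι : MapsTo D.ι B B')
  (hmul : ∀ x ∈ (∅ : Set Ω), ∀ y, d.mul x y ∈ (∅ : Set Ω))
  (hmulP : ∀ x ∈ (∅ : Set Ω), ∀ y, D.mul x y ∈ (∅ : Set P))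
  (hA : ∀ x ∈ A, ∀ a, d.act x a ∈ A) (hA' : ∀ x ∈ A, ∀ p, D.act x p ∈ A')
  (hC : ∀ x ∈ C, ∀ p, D.act x p ∈ C')
  (f : Chains A' →ₗ[ℝ] Chains C') (hf : ∀ α, f (α.cls A') = capCube τ D.e C' α)
  (q : ∀ k, Chains A →ₗ[ℝ] MultilinearMap ℝ (fun _ : Fin k => Chains (∅ : Set Ω)) (Chains C))
  (hq : ∀ k α l, q k (α.cls A) (fun r => (l r).cls ∅) =
    d.higher (τ ∘ₗ pushChains B B' D.ι hι) C α (List.ofFn l))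
  (η : ∀ k, Chains A →ₗ[ℝ] MultilinearMap ℝ (fun _ : Fin k => Chains (∅ : Set Ω))
    (Chains (∅ : Set P) →ₗ[ℝ] Chains C'))
  (hη : ∀ k α l p, η k (α.cls A) (fun r => (l r).cls ∅) (p.cls ∅) =
    D.higher τ C' α (List.ofFn l) p)

include hτ hη in
theorem higher_degree (k : ℕ) (i : ℤ) (l : Fin k → ℤ) (j : ℤ) (x : Chains A)
    (hx : x ∈ chainsOfDegree A i) (a : Fin k → Chains (∅ : Set Ω))
    (ha : ∀ r, a r ∈ chainsOfDegree ∅ (l r)) (p : Chains (∅ : Set P))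
    (hp : p ∈ chainsOfDegree ∅ j) :
    η k x a p ∈ chainsOfDegree C' (i + ∑ r, l r + j + (k + 1) + -n) := by
  refine multilinear_mem_of_degree (η k) ((chainsOfDegree C' _).comap (LinearMap.applyₗ p)) i l
    (fun α κ hα hκ => ?_) x hx a ha
  rw [Submodule.mem_comap, LinearMap.applyₗ_apply_apply]
  suffices h : chainsOfDegree ∅ j ≤ (chainsOfDegree C' (i + ∑ r, l r + j + (k + 1) + -n)).comap
      (η k (α.cls A) fun r => (κ r).cls ∅) from h hp
  refine Submodule.span_le.2 ?_
  rintro _ ⟨p, rfl, rfl⟩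
  rw [SetLike.mem_coe, Submodule.mem_comap, hη]
  have := D.higher_mem τ (C' := C') hτ α (List.ofFn κ) p
  rw [totalDim_ofFn, List.length_ofFn, hα] at this
  simpa only [hκ, Nat.cast_sum] using this

include hT₀ hinv hτ hf hq hη in
theorem higher_equation (k : ℕ) (i : ℤ) (l : Fin k → ℤ) (x : Chains A)
    (hx : x ∈ chainsOfDegree A i) (a : Fin k → Chains (∅ : Set Ω))
    (ha : ∀ r, a r ∈ chainsOfDegree ∅ (l r)) (p : Chains (∅ : Set P)) :
    tensorD (chainD A) (chainD ∅) (η k) i l x a p +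
        (-1 : ℝ) ^ (i + ∑ r, l r) • η k x a (chainD ∅ p) +
        (-1 : ℝ) ^ ((k : ℤ) + 2 + -n) • chainD C' (η k x a p) =
      coherentRHS (crossChains ∅ ∅ d.mul hmul) (crossChains ∅ ∅ D.mul hmulP)
        (crossChains A A d.act hA) (crossChains A A' D.act hA') (crossChains C C' D.act hC) f q η k
        x a p := by
  obtain ⟨N, hN⟩ := exists_coherentError_linear (chainD A) (chainD ∅) (chainD ∅) (chainD C')
    (crossChains ∅ ∅ d.mul hmul) (crossChains ∅ ∅ D.mul hmulP) (crossChains A A d.act hA)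
    (crossChains A A' D.act hA') (crossChains C C' D.act hC) f q η k i l (-n)
  -- Vanishing is phrased as membership in `⊥`, so that the reduction to cubes for submodules
  -- applies.
  have h0 : N x a = 0 := by
    rw [← Submodule.mem_bot ℝ]
    refine multilinear_mem_of_degree N ⊥ i l (fun α κ hα hκ => ?_) x hx a ha
    rw [Submodule.mem_bot]
    refine chains_hom_ext fun p => ?_
    obtain rfl : l = fun r => ((κ r).dim : ℤ) := funext fun r => (hκ r).symm
    subst hα
    rw [hN, LinearMap.zero_apply, D.higher_boundary τ (η k) (hη k) α κ p hτ,
      D.higher_rhs τ hT₀ hinv hι hmul hmulP hA hA' hC f hf q hq η hη k α κ p, sub_self]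
  have := hN x a p
  rw [h0, LinearMap.zero_apply] at this
  exact sub_eq_zero.1 this.symm

end PathData

end Coherent

/-! ### Existence of the higher maps -/

section Existence

variable {X Ω U S P Y Z T : Type*} [TopologicalSpace X] [TopologicalSpace Ω] [TopologicalSpace U]
  [TopologicalSpace S] [TopologicalSpace P] [TopologicalSpace Y] [TopologicalSpace Z]
  [TopologicalSpace T]

/-- The image of a cube under a continuous map. -/
def Cube.map (f : X → Y) (hf : Continuous f) (κ : Cube X) : Cube Y :=
  ⟨κ.dim, fun v => f (κ.toFun v), hf.comp κ.continuous, fun v w h => congrArg f (κ.depends v w h)⟩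

theorem pushChains_cls_map {A : Set X} {B : Set Y} {f : X → Y} (hf : MapsTo f A B)
    (hfc : Continuous f) (κ : Cube X) :
    pushChains A B f hf (κ.cls A) = (κ.map f hfc).cls B :=
  (pushChains_cls hf κ).trans ((κ.map f hfc).cubeClass_eq B)

theorem pushChains_id (A : Set X) : pushChains A A id (mapsTo_id A) = LinearMap.id :=
  chains_hom_ext fun κ => pushChains_cls_map (mapsTo_id A) continuous_id κ

theorem IsRelCocycle.comp_pushChains {n : ℕ} {A : Set X} {B : Set Y} {τ : Chains B →ₗ[ℝ] ℝ}
    (hτ : IsRelCocycle n τ) {f : X → Y} (hf : MapsTo f A B) (hfc : Continuous f) :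
    IsRelCocycle n (τ ∘ₗ pushChains A B f hf) where
  degree κ hκ := by
    rw [LinearMap.comp_apply, pushChains_cls_map hf hfc]
    exact hτ.degree _ hκ
  cocycle c := by
    have h : pushChains A B f hf ∘ₗ chainD A = chainD B ∘ₗ pushChains A B f hf := by
      refine chains_hom_ext fun κ => ?_
      rw [LinearMap.comp_apply, LinearMap.comp_apply, pushChains_cls_map hf hfc, chainD_cls,
        chainD_cls, cubeBoundary, cubeBoundary, map_sum]
      refine Finset.sum_congr rfl fun i hi => ?_
      rw [Finset.mem_range] at hi
      rw [map_smul, map_sub, Cube.face_cls A κ hi, Cube.face_cls A κ hi, pushChains_cls,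
        pushChains_cls]
      rfl
    exact (congrArg τ (LinearMap.congr_fun h c)).trans (hτ.cocycle _)

namespace FibreData

variable (d : FibreData X Ω U S) {B : Set U} (τ : Chains B →ₗ[ℝ] ℝ) {A C : Set X}

/-- Without loops the homotopy is the identity and the product is the unit, so the ordinary cap
product remains. -/
theorem higher_nil (α : Cube X) : d.higher τ C α [] = capCube τ d.e C α := by
  rw [higher, capCube_eq_capPair]
  simp only [dims, List.map_nil, sumStarts, pow_zero, one_smul, paramDim, add_zero]
  congr 1
  · funext v
    exact d.ev_id _
  · funext v
    exact d.act_one _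

/-- Rewrites the maps for loops as those of `FibreData.self`, for which the computations with a
separate last input are available. -/
theorem higher_append (h : ∀ a, d.mul d.one a = a) (α : Cube X) (L : List (Cube Ω))
    (p : Cube Ω) : d.higher τ C α (L ++ [p]) = (d.self h).higher τ C α L p := by
  rw [higher, PathData.higher, dims_append, paramDim_append]
  congr 1
  congr 1
  · funext v
    simp only [frontFun, PathData.frontFun, d.hom_append h]
    rfl
  · funext v
    simp only [backFun, PathData.backFun, d.prod_append h]
    rfl

theorem higher_mem {n : ℕ} {τ : Chains B →ₗ[ℝ] ℝ} (hτ : IsRelCocycle n τ) (α : Cube X)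
    (L : List (Cube Ω)) : d.higher τ C α L ∈
      chainsOfDegree C ((α.dim : ℤ) + totalDim L + L.length + -n) := by
  rw [higher]
  refine Submodule.smul_mem _ _ ?_
  have := capPair_mem hτ C (α.dim + paramDim L) (d.continuous_frontFun α L) (d.backFun α L)
  rw [paramDim_eq] at this ⊢
  convert this using 2
  push_cast
  ring

theorem exists_higher (h : ∀ a, d.mul d.one a = a)
    (hdich : ∀ α : Cube X, (∀ v, α.toFun v ∈ A) →
      (∀ v, α.toFun v ∈ C) ∨ ∀ v, d.e (α.toFun v) ∈ B)
    (hC : ∀ x ∈ C, ∀ p, d.act x p ∈ C) (hev : ∀ f, MapsTo (d.ev f) B B) (k : ℕ) :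
    ∃ q : Chains A →ₗ[ℝ] MultilinearMap ℝ (fun _ : Fin k => Chains (∅ : Set Ω)) (Chains C),
      ∀ α l, q (α.cls A) (fun r => (l r).cls ∅) = d.higher τ C α (List.ofFn l) := by
  refine exists_linear_multilinear A k (fun α l => d.higher τ C α (List.ofFn l)) ?_ ?_
  · intro α l hα
    cases k with
    | zero =>
      rw [List.ofFn_zero, higher_nil]
      exact PathData.capCube_eq_zero τ hdich hα
    | succ k =>
      rw [List.ofFn_succ_last, d.higher_append τ h]
      exact (d.self h).higher_eq_zero_of_base τ hdich hC hev hα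
  · intro α l r hr
    cases k with
    | zero => exact r.elim0
    | succ k =>
      rw [List.ofFn_succ_last, d.higher_append τ h]
      refine Fin.lastCases (fun hr => ?_) (fun r hr => ?_) r hr
      · exact (d.self h).higher_eq_zero_of_last τ hr
      · exact (d.self h).higher_eq_zero_of_mem τ (List.mem_ofFn.2 ⟨r, rfl⟩) hr

theorem higher_degree {n : ℕ} {τ : Chains B →ₗ[ℝ] ℝ} (hτ : IsRelCocycle n τ) {k : ℕ}
    (q : Chains A →ₗ[ℝ] MultilinearMap ℝ (fun _ : Fin k => Chains (∅ : Set Ω)) (Chains C))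
    (hq : ∀ α l, q (α.cls A) (fun r => (l r).cls ∅) = d.higher τ C α (List.ofFn l))
    (i : ℤ) (l : Fin k → ℤ) (x : Chains A)
    (hx : x ∈ chainsOfDegree A i) (a : Fin k → Chains (∅ : Set Ω))
    (ha : ∀ r, a r ∈ chainsOfDegree ∅ (l r)) :
    q x a ∈ chainsOfDegree C (i + ∑ r, l r + k + -n) := by
  refine multilinear_mem_of_degree q _ i l (fun α κ hα hκ => ?_) x hx a ha
  have := d.higher_mem (C := C) hτ α (List.ofFn κ)
  rw [totalDim_ofFn, List.length_ofFn, hα] at this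
  rw [hq]
  simpa only [hκ, Nat.cast_sum] using this

/-- The based maps satisfy the equation of a coherent chain homotopy for `d.self`, where paths are
loops and the two spaces coincide. -/
theorem isAInfinityMorphism (h : ∀ a, d.mul d.one a = a) {S₀ : Set S} (hS₀ : ∀ f, d.H 0 f ∈ S₀)
    (hinv : ∀ (κ : Cube U) (ψ : Cube S), (∀ v, ψ.toFun v ∈ S₀) →
      τ (cubeClass B (κ.dim + ψ.dim) fun v => d.ev (ψ.toFun (shift κ.dim v)) (κ.toFun v)) =
        τ (cubeClass B (κ.dim + ψ.dim) κ.toFun))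
    {n : ℕ} (hτ : IsRelCocycle n τ)
    (hmul : ∀ x ∈ (∅ : Set Ω), ∀ y, d.mul x y ∈ (∅ : Set Ω))
    (hA : ∀ x ∈ A, ∀ a, d.act x a ∈ A) (hC : ∀ x ∈ C, ∀ a, d.act x a ∈ C)
    (q : ∀ k, Chains A →ₗ[ℝ] MultilinearMap ℝ (fun _ : Fin k => Chains (∅ : Set Ω)) (Chains C))
    (hq : ∀ k α l, q k (α.cls A) (fun r => (l r).cls ∅) = d.higher τ C α (List.ofFn l)) :
    IsAInfinityMorphism (chainsOfDegree ∅) (chainD ∅) (crossChains ∅ ∅ d.mul hmul)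
      (chainsOfDegree A) (chainD A) (crossChains A A d.act hA)
      (chainsOfDegree C) (chainD C) (crossChains C C d.act hC) (-n) q := by
  let f : Chains A →ₗ[ℝ] Chains C :=
    (MultilinearMap.constLinearEquivOfIsEmpty (R := ℝ) (S := ℝ)
      (M₁ := fun _ : Fin 0 => Chains (∅ : Set Ω)) (M₂ := Chains C)).symm.toLinearMap ∘ₗ q 0
  have hf0 : ∀ x, f x = q 0 x Fin.elim0 := fun x =>
    congrArg (q 0 x) (Subsingleton.elim (α := Fin 0 → Chains (∅ : Set Ω)) _ _)
  have hf : ∀ α, f (α.cls A) = capCube τ d.e C α := fun α => by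
    rw [hf0, ← d.higher_nil]
    refine Eq.trans ?_ (hq 0 α Fin.elim0)
    exact congrArg (q 0 _) (Subsingleton.elim (α := Fin 0 → Chains (∅ : Set Ω)) _ _)
  refine isAInfinityMorphism_of_coherent
    (fun N i l x hx a ha => d.higher_degree hτ (q N) (hq N) i l x hx a ha) hf0
    (PathData.cap_chainMap hτ d.continuous_e f hf) fun k i l x hx a ha p => ?_
  -- For `d.self` the map `ι` is the identity, so the restricted cochain is `τ` itself.
  have hτ' : τ ∘ₗ pushChains B B (d.self h).ι (mapsTo_id B) = τ := by
    refine (congrArg (τ ∘ₗ ·) (pushChains_id B)).trans (LinearMap.comp_id τ)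
  refine (d.self h).higher_equation τ hS₀ hinv hτ (mapsTo_id B) hmul hmul hA hA hC f hf q
    (fun k α l => by rw [hτ', hq]) (fun k => splitLast (q (k + 1))) (fun k α l p => ?_) k i l x hx
    a ha p
  rw [← d.higher_append]
  have h1 : List.ofFn (Fin.snoc l p : Fin (k + 1) → Cube Ω) = List.ofFn l ++ [p] := by
    rw [List.ofFn_succ_last]
    simp
  rw [← h1, ← hq, splitLast_apply]
  congr 1
  funext s
  refine Fin.lastCases ?_ (fun s => ?_) s
  · rw [Fin.snoc_last, Fin.snoc_last]
  · rw [Fin.snoc_castSucc, Fin.snoc_castSucc]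

end FibreData

namespace PathData

variable {d : FibreData X Ω U S} (D : PathData d P Y Z T)

/-- Maps that identify the loops among the paths of `PathData`. -/
structure Restriction (D : PathData d P Y Z T) where
  incl : X → Y
  loop : Ω → P
  push : S → T
  continuous_incl : Continuous incl
  continuous_loop : Continuous loop
  e_incl : ∀ x, D.e (incl x) = D.ι (d.e x)
  act_loop : ∀ x a, D.act x (loop a) = incl (d.act x a)
  mul_loop : ∀ a b, D.mul a (loop b) = loop (d.mul a b)
  θ_loop : ∀ a, D.θ (loop a) = push (d.θ a)
  comp_push : ∀ f g, D.comp (push f) g = push (d.comp f g)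
  H_push : ∀ t f, D.H t (push f) = push (d.H t f)
  ev_push : ∀ f u, D.ev (push f) u = D.ι (d.ev f u)

variable {D} (R : D.Restriction) {B : Set U} {B' : Set Z}
  (τ : Chains B' →ₗ[ℝ] ℝ) {A : Set X} {C : Set X} {A' C' : Set Y}

theorem Restriction.hom_loop (h : ∀ a, d.mul d.one a = a) (L : List (Cube Ω)) (p : Cube Ω)
    (v : ℕ → I) : D.hom L (p.map R.loop R.continuous_loop) v = R.push ((d.self h).hom L p v) := by
  induction L generalizing v with
  | nil =>
    rw [hom, hom]
    refine (congrArg (D.H (v 0)) (R.θ_loop _)).trans ?_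
    exact R.H_push _ _
  | cons κ L ih =>
    rw [hom, hom, ih, R.comp_push]
    exact R.H_push _ _

theorem Restriction.prod_loop (h : ∀ a, d.mul d.one a = a) (L : List (Cube Ω)) (p : Cube Ω)
    (v : ℕ → I) : D.prod L (p.map R.loop R.continuous_loop) v = R.loop ((d.self h).prod L p v) := by
  induction L generalizing v with
  | nil => rfl
  | cons κ L ih =>
    rw [prod, prod, ih]
    exact R.mul_loop _ _

/-- On loops the homotopy of half-constant maps is `push` of the based one. The front functions
therefore differ by `ι` and the back functions by `incl`. -/
theorem Restriction.higher_loop (h : ∀ a, d.mul d.one a = a) (hι : MapsTo D.ι B B')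
    (hCi : MapsTo R.incl C C') (α : Cube X) (L : List (Cube Ω)) (p : Cube Ω) :
    D.higher τ C' α L (p.map R.loop R.continuous_loop) = pushChains C C' R.incl hCi
      (d.higher (τ ∘ₗ pushChains B B' D.ι hι) C α (L ++ [p])) := by
  rw [d.higher_append _ h, higher, higher, map_smul,
    capPair_comp_pushChains τ hι _ _ ((d.self h).continuous_frontFun α L p),
    pushChains_capPair τ hCi _ _ ((d.self h).continuous_backFun α L p)]
  congr 1
  congr 1
  · funext v
    rw [frontFun, R.hom_loop h, R.ev_push]
    rfl
  · funext v
    rw [backFun, R.prod_loop h, R.act_loop]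
    rfl

theorem Restriction.isCoherentChainHomotopy (h : ∀ a, d.mul d.one a = a)
    {T₀ : Set T} (hT₀ : ∀ f, D.H 0 f ∈ T₀)
    (hinv : ∀ (κ : Cube U) (ψ : Cube T), (∀ v, ψ.toFun v ∈ T₀) →
      τ (cubeClass B' (κ.dim + ψ.dim) fun v => D.ev (ψ.toFun (shift κ.dim v)) (κ.toFun v)) =
        τ (cubeClass B' (κ.dim + ψ.dim) fun v => D.ι (κ.toFun v)))
    {n : ℕ} (hτ : IsRelCocycle n τ) (hι : MapsTo D.ι B B')
    (hmul : ∀ x ∈ (∅ : Set Ω), ∀ y, d.mul x y ∈ (∅ : Set Ω))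
    (hmulP : ∀ x ∈ (∅ : Set Ω), ∀ y, D.mul x y ∈ (∅ : Set P))
    (hloop : MapsTo R.loop (∅ : Set Ω) (∅ : Set P))
    (hA : ∀ x ∈ A, ∀ a, d.act x a ∈ A) (hA' : ∀ x ∈ A, ∀ p, D.act x p ∈ A')
    (hAi : MapsTo R.incl A A') (hC : ∀ x ∈ C, ∀ p, D.act x p ∈ C') (hCi : MapsTo R.incl C C')
    (f : Chains A' →ₗ[ℝ] Chains C') (hf : ∀ α, f (α.cls A') = capCube τ D.e C' α)
    (q : ∀ k, Chains A →ₗ[ℝ] MultilinearMap ℝ (fun _ : Fin k => Chains (∅ : Set Ω)) (Chains C))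
    (hq : ∀ k α l, q k (α.cls A) (fun r => (l r).cls ∅) =
      d.higher (τ ∘ₗ pushChains B B' D.ι hι) C α (List.ofFn l))
    (η : ∀ k, Chains A →ₗ[ℝ] MultilinearMap ℝ (fun _ : Fin k => Chains (∅ : Set Ω))
      (Chains (∅ : Set P) →ₗ[ℝ] Chains C'))
    (hη : ∀ k α l p, η k (α.cls A) (fun r => (l r).cls ∅) (p.cls ∅) =
      D.higher τ C' α (List.ofFn l) p) :
    IsCoherentChainHomotopy (chainsOfDegree ∅) (chainD ∅) (crossChains ∅ ∅ d.mul hmul)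
      (chainsOfDegree ∅) (chainD ∅) (crossChains ∅ ∅ D.mul hmulP)
      (pushChains ∅ ∅ R.loop hloop) (chainsOfDegree A) (chainD A) (crossChains A A d.act hA)
      (chainsOfDegree A') (chainD A') (crossChains A A' D.act hA') (pushChains A A' R.incl hAi)
      (chainsOfDegree C') (chainD C') (crossChains C C' D.act hC) (pushChains C C' R.incl hCi)
      (-n) f q η where
  map_degree := cap_degree hτ D.continuous_e f hf
  chain_map := cap_chainMap hτ D.continuous_e f hf
  degree k i l j x hx a ha p hp := D.higher_degree τ hτ η hη k i l j x hx a ha p hp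
  equation k i l x hx a ha p :=
    D.higher_equation τ hT₀ hinv hτ hι hmul hmulP hA hA' hC f hf q hq η hη k i l x hx a ha p
  restrict_map x := by
    suffices key : ∀ a : Fin 0 → Chains (∅ : Set Ω), f ∘ₗ pushChains A A' R.incl hAi =
        pushChains C C' R.incl hCi ∘ₗ (MultilinearMap.constLinearEquivOfIsEmpty (R := ℝ) (S := ℝ)
          (M₁ := fun _ : Fin 0 => Chains (∅ : Set Ω)) (M₂ := Chains C)).symm.toLinearMap ∘ₗ q 0 by
      refine (LinearMap.congr_fun (key Fin.elim0) x).trans ?_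
      exact congrArg (fun a => pushChains C C' R.incl hCi (q 0 x a))
        (Subsingleton.elim (α := Fin 0 → Chains (∅ : Set Ω)) _ _)
    intro a
    refine chains_hom_ext fun α => ?_
    have h1 : q 0 (α.cls A) 0 = capCube (τ ∘ₗ pushChains B B' D.ι hι) d.e C α := by
      rw [← d.higher_nil]
      refine Eq.trans ?_ (hq 0 α Fin.elim0)
      exact congrArg (q 0 _) (Subsingleton.elim (α := Fin 0 → Chains (∅ : Set Ω)) _ _)
    rw [LinearMap.comp_apply, pushChains_cls_map hAi R.continuous_incl, hf]
    refine Eq.trans ?_ (congrArg (pushChains C C' R.incl hCi) h1.symm)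
    rw [capCube_eq_capPair, capCube_eq_capPair,
      capPair_comp_pushChains τ hι _ _ (F := fun v => d.e (α.toFun v))
        (d.continuous_e.comp α.continuous),
      pushChains_capPair τ hCi _ _ α.continuous]
    simp only [← R.e_incl]
    rfl
  restrict k x a b := by
    suffices key : (LinearMap.lcomp ℝ (Chains C') (pushChains (∅ : Set Ω) (∅ : Set P) R.loop
        hloop)).compMultilinearMapₗ ℝ ∘ₗ η k =
        ((pushChains C C' R.incl hCi).compRight ℝ).compMultilinearMapₗ ℝ ∘ₗ
          splitLast (q (k + 1)) from
      LinearMap.congr_fun (congrArg (fun M => M x a) key) b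
    refine chains_hom_ext fun α => multilinear_ext_cls fun l => chains_hom_ext fun p => ?_
    change η k (α.cls A) (fun r => (l r).cls ∅) (pushChains ∅ ∅ R.loop hloop (p.cls ∅)) =
      pushChains C C' R.incl hCi (splitLast (q (k + 1)) (α.cls A) (fun r => (l r).cls ∅) (p.cls ∅))
    rw [pushChains_cls_map hloop R.continuous_loop, hη, R.higher_loop τ h hι hCi]
    have h1 : List.ofFn (Fin.snoc l p : Fin (k + 1) → Cube Ω) = List.ofFn l ++ [p] := by
      rw [List.ofFn_succ_last]
      simp
    rw [← h1, ← hq, splitLast_apply]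
    congr 2
    funext s
    refine Fin.lastCases ?_ (fun s => ?_) s
    · rw [Fin.snoc_last, Fin.snoc_last]
    · rw [Fin.snoc_castSucc, Fin.snoc_castSucc]

end PathData

end Existence

/-! ### Iterated tangent maps -/

section IterTangent

theorem MfdData.contMDiff_tangentMap {Z W : MfdData.{u}} {f : Z.X → W.X}
    (hf : ContMDiff Z.model W.model ∞ f) :
    ContMDiff Z.tangent.model W.tangent.model ∞
      (show Z.tangent.X → W.tangent.X from tangentMap Z.model W.model f) := by
  have := hf.contMDiff_tangentMap (m := ∞) (by simp)
  exact this

theorem MfdData.contMDiff_mdifferentiable {Z W : MfdData.{u}} {f : Z.X → W.X}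
    (hf : ContMDiff Z.model W.model ∞ f) : MDifferentiable Z.model W.model f :=
  hf.mdifferentiable (by simp)

theorem iterTangentMap_contMDiff (k : ℕ) : ∀ (Z W : MfdData.{u}) {f : Z.X → W.X},
    ContMDiff Z.model W.model ∞ f →
    ContMDiff (Z.iterTangent k).model (W.iterTangent k).model ∞ (iterTangentMap k Z W f) := by
  induction k with
  | zero => exact fun Z W f hf => hf
  | succ k ih => exact fun Z W f hf => ih Z.tangent W.tangent (MfdData.contMDiff_tangentMap hf)

theorem iterTangentMap_comp (k : ℕ) : ∀ (Z W V : MfdData.{u}) {g : W.X → V.X} {f : Z.X → W.X},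
    ContMDiff W.model V.model ∞ g → ContMDiff Z.model W.model ∞ f → ∀ ξ,
    iterTangentMap k Z V (g ∘ f) ξ = iterTangentMap k W V g (iterTangentMap k Z W f ξ) := by
  induction k with
  | zero => exact fun Z W V g f _ _ _ => rfl
  | succ k ih =>
    intro Z W V g f hg hf ξ
    have h : tangentMap Z.model V.model (g ∘ f) =
        tangentMap W.model V.model g ∘ tangentMap Z.model W.model f :=
      tangentMap_comp (MfdData.contMDiff_mdifferentiable hg) (MfdData.contMDiff_mdifferentiable hf)
    unfold iterTangentMap
    rw [h]
    exact ih Z.tangent W.tangent V.tangent (MfdData.contMDiff_tangentMap hg)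
      (MfdData.contMDiff_tangentMap hf) ξ

/-- The model spaces are locally compact. -/
def MfdData.IsLocallyCompact (Z : MfdData.{u}) : Prop :=
  LocallyCompactSpace Z.H ∧ LocallyCompactSpace Z.E

theorem MfdData.IsLocallyCompact.iterTangent (k : ℕ) : ∀ {Z : MfdData.{u}},
    Z.IsLocallyCompact → (Z.iterTangent k).IsLocallyCompact := by
  induction k with
  | zero => exact fun h => h
  | succ k ih =>
    rintro Z ⟨h1, h2⟩
    exact ih (Z := Z.tangent) ⟨inferInstanceAs (LocallyCompactSpace (Z.H × Z.E)),
      inferInstanceAs (LocallyCompactSpace (Z.E × Z.E))⟩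

theorem MfdData.IsLocallyCompact.locallyCompactSpace {Z : MfdData.{u}}
    (h : Z.IsLocallyCompact) : LocallyCompactSpace Z.X :=
  have := h.1
  ChartedSpace.locallyCompactSpace Z.H Z.X

/-- If `h` is smooth, then the iterated tangent maps of `y ↦ h (x, y)` depend continuously
on `x`. -/
theorem continuous_iterTangentMap_param (k : ℕ) : ∀ (N₁ N₂ W : MfdData.{u})
    {h : N₁.X × N₂.X → W.X}, ContMDiff (N₁.model.prod N₂.model) W.model ∞ h →
    Continuous fun p : N₁.X × (N₂.iterTangent k).X =>
      iterTangentMap k N₂ W (fun y => h (p.1, y)) p.2 := by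
  induction k with
  | zero => exact fun N₁ N₂ W h hh => hh.continuous
  | succ k ih =>
    intro N₁ N₂ W h hh
    let h' : N₁.X × N₂.tangent.X → W.tangent.X :=
      fun p => tangentMap (N₁.model.prod N₂.model) W.model h
        ((equivTangentBundleProd N₁.model N₁.X N₂.model N₂.X).symm
          (zeroSection N₁.E (TangentSpace N₁.model) p.1, p.2))
    have hT : ContMDiff (N₁.model.prod N₂.model).tangent W.model.tangent ∞
        (tangentMap (N₁.model.prod N₂.model) W.model h) := hh.contMDiff_tangentMap (by simp)
    have h1 : IsManifold N₁.model (∞ + 1) N₁.X := N₁.isManifold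
    have h2 : IsManifold N₂.model (∞ + 1) N₂.X := N₂.isManifold
    have hz : ContMDiff (N₁.model.prod N₂.model.tangent)
        (N₁.model.tangent.prod N₂.model.tangent) ∞
        (fun p : N₁.X × TangentBundle N₂.model N₂.X =>
          (zeroSection N₁.E (TangentSpace N₁.model) p.1, p.2)) :=
      ((Bundle.contMDiff_zeroSection ℝ (TangentSpace N₁.model : N₁.X → Type _)).comp
        contMDiff_fst).prodMk contMDiff_snd
    have hs : ContMDiff (N₁.model.tangent.prod N₂.model.tangent)
        (N₁.model.prod N₂.model).tangent ∞
        (equivTangentBundleProd N₁.model N₁.X N₂.model N₂.X).symm :=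
      contMDiff_equivTangentBundleProd_symm
    have hh' : ContMDiff (N₁.model.prod N₂.tangent.model) W.tangent.model ∞ h' :=
      hT.comp (hs.comp hz)
    -- The derivative in the second variable is the full tangent map on vectors whose first
    -- component is zero. The new `h'` is smooth, so the induction can continue with it.
    have key : ∀ x, tangentMap N₂.model W.model (fun y => h (x, y)) = fun η => h' (x, η) := by
      intro x
      have hd : MDifferentiable (N₁.model.prod N₂.model) W.model h := hh.mdifferentiable (by simp)
      have hx : MDifferentiable N₂.model (N₁.model.prod N₂.model) fun y : N₂.X => (x, y) :=
        (contMDiff_const.prodMk contMDiff_id : ContMDiff _ _ ∞ _).mdifferentiable (by simp)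
      have := tangentMap_comp hd hx
      change tangentMap N₂.model W.model (h ∘ fun y => (x, y)) = _
      rw [this]
      funext η
      refine congrArg (tangentMap (N₁.model.prod N₂.model) W.model h) ?_
      rcases η with ⟨y, η⟩
      simp only [tangentMap]
      rw [mfderiv_prod_right]
      rfl
    have := ih N₁ N₂.tangent W.tangent hh'
    unfold iterTangentMap
    simp only [key]
    exact this

/-- `f` is smooth and has smooth left inverses near the points of its image. -/
def HasLocalRetraction (Z W : MfdData.{u}) (f : Z.X → W.X) : Prop :=
  ContMDiff Z.model W.model ∞ f ∧ ∀ z, ∃ (V : Set W.X) (g : W.X → Z.X), IsOpen V ∧ f z ∈ V ∧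
    ContMDiffOn W.model Z.model ∞ g V ∧ ∀ x, f x ∈ V → g (f x) = x

/-- By the chain rule, the tangent map of a local left inverse is a local left inverse of the
tangent map. This allows continuity of maps into iterated tangent bundles of an open subset to be
tested in the ambient manifold. -/
theorem HasLocalRetraction.tangent {Z W : MfdData.{u}} {f : Z.X → W.X}
    (h : HasLocalRetraction Z W f) :
    HasLocalRetraction Z.tangent W.tangent (tangentMap Z.model W.model f) := by
  refine ⟨MfdData.contMDiff_tangentMap h.1, fun ζ => ?_⟩
  obtain ⟨V, g, hV, hz, hg, hgf⟩ := h.2 ζ.proj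
  refine ⟨TotalSpace.proj ⁻¹' V, tangentMapWithin W.model Z.model g V, ?_, hz, ?_, ?_⟩
  · exact hV.preimage (FiberBundle.continuous_proj W.E (TangentSpace W.model))
  · exact hg.contMDiffOn_tangentMapWithin (by simp) hV.uniqueMDiffOn
  · intro ξ hξ
    have hξ' : f ξ.proj ∈ V := hξ
    have hg1 : MDifferentiableAt W.model Z.model g (f ξ.proj) :=
      ((hg.contMDiffAt (hV.mem_nhds hξ'))).mdifferentiableAt (by simp)
    have hf1 := MfdData.contMDiff_mdifferentiable h.1 ξ.proj
    rw [tangentMapWithin_eq_tangentMap (hV.uniqueMDiffOn _ hξ) hg1,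
      ← tangentMap_comp_at ξ hg1 hf1]
    have he : g ∘ f =ᶠ[𝓝 ξ.proj] id := by
      filter_upwards [(hV.preimage h.1.continuous).mem_nhds hξ'] with x hx using hgf x hx
    have : tangentMap Z.model Z.model (g ∘ f) ξ = tangentMap Z.model Z.model id ξ := by
      unfold tangentMap
      rw [he.mfderiv_eq, show (g ∘ f) ξ.proj = id ξ.proj from hgf _ hξ']
    rw [this, tangentMap_id]
    rfl

theorem HasLocalRetraction.iterTangentMap (k : ℕ) : ∀ {Z W : MfdData.{u}} {f : Z.X → W.X},
    HasLocalRetraction Z W f →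
    HasLocalRetraction (Z.iterTangent k) (W.iterTangent k) (iterTangentMap k Z W f) := by
  induction k with
  | zero => exact fun h => h
  | succ k ih => exact fun h => ih h.tangent

/-- Locally `F = g ∘ (f ∘ F)` with a continuous `g`. -/
theorem HasLocalRetraction.continuous_of_comp {Z W : MfdData.{u}} {f : Z.X → W.X}
    (h : HasLocalRetraction Z W f) {T : Type*} [TopologicalSpace T] {F : T → Z.X}
    (hF : Continuous fun t => f (F t)) : Continuous F := by
  refine continuous_iff_continuousAt.2 fun t => ?_
  obtain ⟨V, g, hV, hz, hg, hgf⟩ := h.2 (F t)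
  have h1 : ContinuousAt (fun s => g (f (F s))) t :=
    ContinuousAt.comp (f := fun s => f (F s)) (g := g)
      (hg.continuousOn.continuousAt (hV.mem_nhds hz)) hF.continuousAt
  refine h1.congr ?_
  filter_upwards [(hV.preimage hF).mem_nhds hz] with s hs using hgf _ hs

variable {E : Type} [NormedAddCommGroup E] [NormedSpace ℝ E]
  {H : Type} [TopologicalSpace H]
  {J : ModelWithCorners ℝ E H} {X : Type u}
  [TopologicalSpace X] [ChartedSpace H X] [IsManifold J ∞ X]

theorem hasLocalRetraction_subtypeVal (U : Opens X) :
    HasLocalRetraction (.mk E H J U) (.mk E H J X) (Subtype.val : U → X) := by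
  classical
  refine ⟨contMDiff_subtype_val, fun z => ⟨U, fun x => if h : x ∈ U then ⟨x, h⟩ else z, U.2, z.2,
    ?_, fun x _ => ?_⟩⟩
  · intro x hx
    refine (ContMDiffWithinAt.subtypeVal_comp_iff U _ _ x).1 ?_
    refine (contMDiff_id : ContMDiff J J ∞ (id : X → X)).contMDiffAt.contMDiffWithinAt.congr (fun y hy => ?_) ?_
    · have : y ∈ U := hy
      simp [this]
    · have : x ∈ U := hx
      simp [this]
  · exact dif_pos x.2

end IterTangent

/-! ### The topology on spaces of smooth maps -/

section SmoothTopology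

variable {E F G : Type} [NormedAddCommGroup E] [NormedSpace ℝ E] [NormedAddCommGroup F]
  [NormedSpace ℝ F] [NormedAddCommGroup G] [NormedSpace ℝ G] {H H' H'' : Type}
  [TopologicalSpace H] [TopologicalSpace H'] [TopologicalSpace H'']
  {J : ModelWithCorners ℝ E H} {J' : ModelWithCorners ℝ F H'} {J'' : ModelWithCorners ℝ G H''}
  {X Y Z : Type u}
  [TopologicalSpace X] [TopologicalSpace Y] [TopologicalSpace Z] [ChartedSpace H X]
  [ChartedSpace H' Y] [ChartedSpace H'' Z]
  [IsManifold J ∞ X] [IsManifold J' ∞ Y] [IsManifold J'' ∞ Z]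

/-- By currying, and without local compactness, which is used for the converse
`continuous_iterTangentMap_eval`. -/
theorem continuous_smoothMap {T : Type*} [TopologicalSpace T] {g : T → C^∞⟮J, X; J', Y⟯}
    (h : ∀ k, Continuous fun p : T × ((MfdData.mk E H J X).iterTangent k).X =>
      iterTangentMap k (.mk E H J X) (.mk F H' J' Y) (g p.1) p.2) : Continuous g := by
  refine continuous_generateFrom_iff.2 ?_
  rintro _ ⟨k, K, W, hK, hW, rfl⟩
  have := (ContinuousMap.curry ⟨_, h k⟩).continuous
  exact (ContinuousMap.isOpen_setOfPred_mapsTo hK hW).preimage this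

theorem continuous_iterTangentMap_eval [LocallyCompactSpace H] [LocallyCompactSpace E]
    {T : Type*} [TopologicalSpace T] {g : T → C^∞⟮J, X; J', Y⟯} (hg : Continuous g) (k : ℕ) :
    Continuous fun p : T × ((MfdData.mk E H J X).iterTangent k).X =>
      iterTangentMap k (.mk E H J X) (.mk F H' J' Y) (g p.1) p.2 := by
  have : LocallyCompactSpace ((MfdData.mk E H J X).iterTangent k).X :=
    (MfdData.IsLocallyCompact.iterTangent k (Z := .mk E H J X)
      ⟨‹_›, ‹_›⟩).locallyCompactSpace
  let G : T → C(((MfdData.mk E H J X).iterTangent k).X, ((MfdData.mk F H' J' Y).iterTangent k).X) :=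
    fun t => ⟨iterTangentMap k (.mk E H J X) (.mk F H' J' Y) (g t),
      (iterTangentMap_contMDiff k _ _ (g t).contMDiff).continuous⟩
  have hG : Continuous G := by
    refine continuous_generateFrom_iff.2 ?_
    rintro _ ⟨K, hK, W, hW, rfl⟩
    exact (isOpen_generateFrom_of_mem ⟨k, K, W, hK, hW, rfl⟩ :
      IsOpen {f : C^∞⟮J, X; J', Y⟯ | MapsTo (iterTangentMap k (.mk E H J X) (.mk F H' J' Y) f)
        K W}).preimage hg
  exact ContinuousMap.continuous_uncurry_of_continuous ⟨G, hG⟩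

theorem continuous_smoothMap_eval [LocallyCompactSpace H] [LocallyCompactSpace E] :
    Continuous fun p : C^∞⟮J, X; J', Y⟯ × X => p.1 p.2 :=
  continuous_iterTangentMap_eval continuous_id 0

/-- By the chain rule for iterated tangent maps, evaluating a composite is evaluating twice. -/
theorem continuous_smoothMap_comp [LocallyCompactSpace H] [LocallyCompactSpace E]
    [LocallyCompactSpace H'] [LocallyCompactSpace F] :
    Continuous fun p : C^∞⟮J', Y; J'', Z⟯ × C^∞⟮J, X; J', Y⟯ => p.1.comp p.2 := by
  refine continuous_smoothMap fun k => ?_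
  have h2 := continuous_iterTangentMap_eval (J := J) (X := X) (J' := J') (Y := Y)
    (continuous_snd (X := C^∞⟮J', Y; J'', Z⟯)) k
  have h1 := continuous_iterTangentMap_eval (J := J') (X := Y) (J' := J'') (Y := Z)
    (continuous_fst (Y := C^∞⟮J, X; J', Y⟯)) k
  have := h1.comp (continuous_fst.prodMk h2)
  refine this.congr fun p => ?_
  exact (iterTangentMap_comp k (.mk E H J X) (.mk F H' J' Y) (.mk G H'' J'' Z) p.1.1.contMDiff
    p.1.2.contMDiff p.2).symm

end SmoothTopology

/-! ### Continuity of lifts and evaluations -/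

section Evaluation

variable {n : ℕ} {M : Type u} [TopologicalSpace M] [ChartedSpace (EuclideanSpace ℝ (Fin n)) M]
  [IsManifold (𝓡 n) ∞ M]

theorem MoorePath.continuous_len : Continuous (MoorePath.len : MoorePath n M → ℝ) :=
  continuous_iff_le_induced.2 (inf_le_left.trans inf_le_left)

theorem MoorePath.continuous_toContinuousMap :
    Continuous fun γ : MoorePath n M => (⟨γ.toFun, γ.continuous⟩ : C(ℝ, M)) :=
  continuous_iff_le_induced.2 (inf_le_left.trans inf_le_right)

theorem MoorePath.continuous_eval : Continuous fun p : MoorePath n M × ℝ => p.1.toFun p.2 :=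
  ContinuousMap.continuous_uncurry_of_continuous ⟨_, MoorePath.continuous_toContinuousMap⟩

theorem MoorePath.continuous_src : Continuous (MoorePath.src : MoorePath n M → M) :=
  MoorePath.continuous_eval.comp (continuous_id.prodMk continuous_const)

theorem MoorePath.continuous_tgt : Continuous (MoorePath.tgt : MoorePath n M → M) :=
  MoorePath.continuous_eval.comp (continuous_id.prodMk MoorePath.continuous_len)

end Evaluation

section LiftTopology

variable {n : ℕ} {M : Type u} [MetricSpace M] [ChartedSpace (EuclideanSpace ℝ (Fin n)) M]
  [IsManifold (𝓡 n) ∞ M] {x₀ : M} {ε : ℝ} (Θ : TransitiveDiffeoLift n M ε)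

theorem continuous_evBased : Continuous (evBased : BasedPairs n x₀ ε → nbhd x₀ ε) := by
  refine Continuous.subtype_mk (MoorePath.continuous_eval.comp
    (f := fun p : BasedPairs n x₀ ε => (p.1.2.1, p.1.1 * p.1.2.1.len)) ?_) _
  have h1 : Continuous fun p : BasedPairs n x₀ ε => p.1.2.1 := by fun_prop
  have h2 : Continuous fun p : BasedPairs n x₀ ε => (p.1.1 : ℝ) := by fun_prop
  exact h1.prodMk (h2.mul (MoorePath.continuous_len.comp h1))

theorem continuous_evFree : Continuous (evFree : FreePairs n M ε → diagNbhd M ε) := by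
  have h1 : Continuous fun p : FreePairs n M ε => p.1.2.1 := by fun_prop
  have h2 : Continuous fun p : FreePairs n M ε => (p.1.1 : ℝ) := by fun_prop
  exact Continuous.subtype_mk ((MoorePath.continuous_src.comp h1).prodMk
    (MoorePath.continuous_eval.comp (h1.prodMk (h2.mul (MoorePath.continuous_len.comp h1))))) _

/-- After the inclusion into `M`, the iterated tangent maps of `Θ₀` are restrictions of those of
`Θ`, which are jointly continuous; the local retraction brings this back to `U_{x₀}`. -/
theorem continuous_thetaZero : Continuous (thetaZero Θ : BasedLoops n x₀ → SelfMaps n x₀ ε) := by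
  refine continuous_smoothMap fun k => ?_
  have hv := hasLocalRetraction_subtypeVal (J := 𝓡 n) (nbhd x₀ ε)
  refine (hv.iterTangentMap k).continuous_of_comp ?_
  have hΘ : Continuous fun p : BasedLoops n x₀ => (Θ.toFun p.1 : C^∞⟮𝓡 n, M; 𝓡 n, M⟯) :=
    Θ.continuous.comp continuous_subtype_val
  have h1 := continuous_iterTangentMap_eval hΘ k
  have h2 := (iterTangentMap_contMDiff k _ _ hv.1).continuous
  have h3 := h1.comp (continuous_fst.prodMk (h2.comp continuous_snd))
  refine h3.congr fun p => ?_
  have e1 := iterTangentMap_comp k (.mk _ _ (𝓡 n) (nbhd x₀ ε)) (.mk _ _ (𝓡 n) M)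
    (.mk _ _ (𝓡 n) M) (Θ.toFun p.1.1).contMDiff hv.1 p.2
  have e2 := iterTangentMap_comp k (.mk _ _ (𝓡 n) (nbhd x₀ ε)) (.mk _ _ (𝓡 n) (nbhd x₀ ε))
    (.mk _ _ (𝓡 n) M) hv.1 (thetaZero (ε := ε) Θ p.1).contMDiff p.2
  exact e1.symm.trans e2

/-- As for `Θ₀`, with a first component that is constant in the point but varies with the path. Its
effect on iterated tangent maps is controlled by `continuous_iterTangentMap_param`, applied to `y ↦
(x, y)`. -/
theorem continuous_thetaOne : Continuous (thetaOne Θ : PathsFrom n x₀ → DiagMaps n x₀ ε) := by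
  refine continuous_smoothMap fun k => ?_
  have hd := hasLocalRetraction_subtypeVal (J := (𝓡 n).prod (𝓡 n)) (diagNbhd M ε)
  refine (hd.iterTangentMap k).continuous_of_comp ?_
  have hΘ : Continuous fun p : PathsFrom n x₀ => (Θ.toFun p.1 : C^∞⟮𝓡 n, M; 𝓡 n, M⟯) :=
    Θ.continuous.comp continuous_subtype_val
  have hv := hasLocalRetraction_subtypeVal (J := 𝓡 n) (nbhd x₀ ε)
  have h1 := continuous_iterTangentMap_eval hΘ k
  have h2 := (iterTangentMap_contMDiff k _ _ hv.1).continuous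
  have h3 := h1.comp (continuous_fst.prodMk (h2.comp continuous_snd))
  have h4 := continuous_iterTangentMap_param k (.mk _ _ (𝓡 n) M) (.mk _ _ (𝓡 n) M)
    (.mk _ _ ((𝓡 n).prod (𝓡 n)) (M × M)) (h := fun x => x) contMDiff_id
  have htgt : Continuous fun p : PathsFrom n x₀ => p.1.tgt :=
    MoorePath.continuous_tgt.comp continuous_subtype_val
  have h5 := h4.comp ((htgt.comp continuous_fst).prodMk h3)
  refine h5.congr fun p => ?_
  have hj : ContMDiff (𝓡 n) ((𝓡 n).prod (𝓡 n)) ∞ fun y : M => (p.1.1.tgt, y) :=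
    contMDiff_const.prodMk contMDiff_id
  have e1 := iterTangentMap_comp k (.mk _ _ (𝓡 n) (nbhd x₀ ε)) (.mk _ _ (𝓡 n) M)
    (.mk _ _ (𝓡 n) M) (Θ.toFun p.1.1).contMDiff hv.1 p.2
  have e2 := iterTangentMap_comp k (.mk _ _ (𝓡 n) (nbhd x₀ ε)) (.mk _ _ (𝓡 n) M)
    (.mk _ _ ((𝓡 n).prod (𝓡 n)) (M × M)) hj ((Θ.toFun p.1.1).contMDiff.comp hv.1) p.2
  have e3 := iterTangentMap_comp k (.mk _ _ (𝓡 n) (nbhd x₀ ε))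
    (.mk _ _ ((𝓡 n).prod (𝓡 n)) (diagNbhd M ε))
    (.mk _ _ ((𝓡 n).prod (𝓡 n)) (M × M)) hd.1 (thetaOne (ε := ε) Θ p.1).contMDiff p.2
  refine Eq.trans ?_ (e2.symm.trans e3)
  exact congrArg _ e1.symm

theorem continuous_iotaMap_comp :
    Continuous fun φ : SelfMaps n x₀ ε => (iotaMap x₀ ε : DiagMaps n x₀ ε).comp φ :=
  continuous_smoothMap_comp.comp (continuous_const.prodMk continuous_id)

end LiftTopology

/-! ### Velocities of piecewise smooth paths -/

namespace MoorePath

section Velocity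

variable {n : ℕ} {M : Type u} [TopologicalSpace M] [ChartedSpace (EuclideanSpace ℝ (Fin n)) M]

/-- A function on the tangent bundle is positively homogeneous. -/
def IsHom (F : TangentBundle (𝓡 n) M → ℝ) : Prop :=
  ∀ (c : ℝ) (x : M) (v : TangentSpace (𝓡 n) x), 0 ≤ c → F ⟨x, c • v⟩ = c * F ⟨x, v⟩

theorem IsHom.zero {F : TangentBundle (𝓡 n) M → ℝ} (hF : IsHom F) (x : M) :
    F ⟨x, (0 : TangentSpace (𝓡 n) x)⟩ = 0 := by
  simpa using hF 0 x 0 le_rfl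

theorem velocity_congr {γ δ : ℝ → M} {t : ℝ} (h : γ =ᶠ[𝓝 t] δ) :
    velocity (n := n) γ t = velocity δ t := by
  unfold velocity tangentMap
  rw [h.mfderiv_eq, h.eq_of_nhds]

theorem velocity_eq_zero {γ : ℝ → M} {t : ℝ} {x : M} (h : ∀ᶠ s in 𝓝 t, γ s = x) :
    velocity (n := n) γ t = ⟨x, (0 : TangentSpace (𝓡 n) x)⟩ := by
  rw [velocity_congr (δ := fun _ => x) h]
  unfold velocity tangentMap
  rw [mfderiv_const]
  rfl

theorem velocity_of_lt_zero (γ : MoorePath n M) {t : ℝ} (ht : t < 0) :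
    velocity (n := n) γ.toFun t = ⟨γ.src, (0 : TangentSpace (𝓡 n) γ.src)⟩ :=
  velocity_eq_zero (by filter_upwards [gt_mem_nhds ht] with s hs using γ.left s (le_of_lt hs))

theorem velocity_of_len_lt (γ : MoorePath n M) {t : ℝ} (ht : γ.len < t) :
    velocity (n := n) γ.toFun t = ⟨γ.tgt, (0 : TangentSpace (𝓡 n) γ.tgt)⟩ :=
  velocity_eq_zero (by filter_upwards [lt_mem_nhds ht] with s hs using γ.right s (le_of_lt hs))

theorem velocity_comp_sub (γ : ℝ → M) (l t : ℝ) :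
    velocity (n := n) (fun s => γ (s - l)) t = velocity γ (t - l) := by
  unfold velocity tangentMap
  have : mfderiv 𝓘(ℝ, ℝ) (𝓡 n) (fun s => γ (s - l)) t (1 : ℝ) =
      mfderiv 𝓘(ℝ, ℝ) (𝓡 n) γ (t - l) (1 : ℝ) := by
    by_cases hd : MDifferentiableAt 𝓘(ℝ, ℝ) (𝓡 n) γ (t - l)
    · have hs : HasMFDerivAt 𝓘(ℝ, ℝ) 𝓘(ℝ, ℝ) (fun s : ℝ => s - l) t
          (ContinuousLinearMap.id ℝ ℝ) :=
        ((hasFDerivAt_id t).sub_const l).hasMFDerivAt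
      have := (hd.hasMFDerivAt.comp t hs).mfderiv
      change mfderiv 𝓘(ℝ, ℝ) (𝓡 n) (γ ∘ fun s => s - l) t (1 : ℝ) = _
      rw [this]
      rfl
    -- Where there is no derivative, both sides take the default value `0`; hence
    -- non-differentiability must be transported as well.
    · have hd' : ¬ MDifferentiableAt 𝓘(ℝ, ℝ) (𝓡 n) (fun s => γ (s - l)) t := by
        intro h
        apply hd
        have hs : MDifferentiableAt 𝓘(ℝ, ℝ) 𝓘(ℝ, ℝ) (fun s : ℝ => s + l) (t - l) :=
          (differentiableAt_id.add_const l).mdifferentiableAt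
        have h' : MDifferentiableAt 𝓘(ℝ, ℝ) (𝓡 n) (fun s => γ (s - l)) (t - l + l) := by
          rwa [sub_add_cancel]
        have := MDifferentiableAt.comp (t - l) h' hs
        refine this.congr_of_eventuallyEq (Filter.Eventually.of_forall fun s => ?_)
        simp
      rw [mfderiv_zero_of_not_mdifferentiableAt hd, mfderiv_zero_of_not_mdifferentiableAt hd']
      rfl
  exact congrArg (fun w => (⟨γ (t - l), w⟩ : TangentBundle (𝓡 n) M)) this

variable [IsManifold (𝓡 n) ∞ M]

theorem continuousOn_velocity_within {γ : ℝ → M} {s : Set ℝ}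
    (h : ContMDiffOn 𝓘(ℝ, ℝ) (𝓡 n) ∞ γ s) (hs : UniqueDiffOn ℝ s) :
    ContinuousOn (fun t => (tangentMapWithin 𝓘(ℝ, ℝ) (𝓡 n) γ s ⟨t, (1 : ℝ)⟩)) s := by
  have h1 := h.continuousOn_tangentMapWithin (by simp) hs.uniqueMDiffOn
  have h2 : Continuous fun t : ℝ => (⟨t, (1 : ℝ)⟩ : TangentBundle 𝓘(ℝ, ℝ) ℝ) :=
    (tangentBundleModelSpaceHomeomorph 𝓘(ℝ, ℝ)).symm.continuous.comp
      (continuous_id.prodMk continuous_const)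
  exact h1.comp h2.continuousOn fun t ht => ht

theorem velocity_eq_within {γ : ℝ → M} {s : Set ℝ} (hs : UniqueDiffOn ℝ s)
    (h : ContMDiffOn 𝓘(ℝ, ℝ) (𝓡 n) ∞ γ s) {t : ℝ} (ht : s ∈ 𝓝 t) :
    tangentMapWithin 𝓘(ℝ, ℝ) (𝓡 n) γ s ⟨t, (1 : ℝ)⟩ = velocity γ t :=
  tangentMapWithin_eq_tangentMap (hs.uniqueMDiffOn t (mem_of_mem_nhds ht))
    ((h.contMDiffAt ht).mdifferentiableAt (by simp))

theorem exists_finite_contMDiffOn (γ : MoorePath n M) : ∃ S : Set ℝ, S.Finite ∧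
    ∀ t ∉ S, ∃ a < t, ∃ b > t, ContMDiffOn 𝓘(ℝ, ℝ) (𝓡 n) ∞ γ.toFun (Icc a b) := by
  obtain ⟨S, hS⟩ := γ.piecewise
  refine ⟨S, S.finite_toSet, fun t ht => ?_⟩
  obtain ⟨r, hr, hrS⟩ := Metric.isOpen_iff.1 S.finite_toSet.isClosed.isOpen_compl t ht
  rw [Real.ball_eq_Ioo] at hrS
  exact ⟨t - r, by linarith, t + r, by linarith,
    hS _ _ (by linarith) (disjoint_left.2 fun u hu hu' => hrS hu hu')⟩

theorem continuousAt_velocity {γ : ℝ → M} {a b t : ℝ} (hat : a < t) (htb : t < b)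
    (h : ContMDiffOn 𝓘(ℝ, ℝ) (𝓡 n) ∞ γ (Icc a b)) : ContinuousAt (velocity (n := n) γ) t := by
  have hu := uniqueDiffOn_Icc (hat.trans htb)
  have h1 := (continuousOn_velocity_within h hu).continuousAt (Icc_mem_nhds hat htb)
  refine h1.congr ?_
  filter_upwards [Ioo_mem_nhds hat htb] with s hs
  exact velocity_eq_within hu h (Icc_mem_nhds hs.1 hs.2)

theorem ae_continuousAt_velocity (γ : MoorePath n M) :
    ∀ᵐ t, MDifferentiableAt 𝓘(ℝ, ℝ) (𝓡 n) γ.toFun t ∧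
      ContinuousAt (velocity (n := n) γ.toFun) t := by
  obtain ⟨S, hS, h⟩ := γ.exists_finite_contMDiffOn
  filter_upwards [hS.countable.ae_notMem volume] with t ht
  obtain ⟨a, ha, b, hb, h⟩ := h t ht
  exact ⟨(h.contMDiffAt (Icc_mem_nhds ha hb)).mdifferentiableAt (by simp),
    continuousAt_velocity ha hb h⟩

/-- The velocity is continuous off a finite set, which suffices. -/
theorem aemeasurable_velocity (γ : MoorePath n M) {F : TangentBundle (𝓡 n) M → ℝ}
    (hF : Continuous F) : AEMeasurable (fun t => F (velocity γ.toFun t)) := by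
  obtain ⟨S, hS, h⟩ := γ.exists_finite_contMDiffOn
  have h1 : ContinuousOn (fun t => F (velocity γ.toFun t)) Sᶜ := by
    intro t ht
    obtain ⟨a, ha, b, hb, h⟩ := h t ht
    exact (hF.continuousAt.comp (continuousAt_velocity ha hb h)).continuousWithinAt
  have h2 := h1.aemeasurable (μ := volume) hS.measurableSet.compl
  rwa [Measure.restrict_eq_self_of_ae_mem (s := Sᶜ) (hS.countable.ae_notMem volume)] at h2

theorem exists_isCompact_velocity_Icc {γ : ℝ → M} {a b : ℝ} (hab : a < b)
    (h : ContMDiffOn 𝓘(ℝ, ℝ) (𝓡 n) ∞ γ (Icc a b)) :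
    ∃ C : Set (TangentBundle (𝓡 n) M), IsCompact C ∧ ∀ t ∈ Ioo a b, velocity γ t ∈ C := by
  have hu := uniqueDiffOn_Icc hab
  refine ⟨_, isCompact_Icc.image_of_continuousOn (continuousOn_velocity_within h hu),
    fun t ht => ⟨t, Ioo_subset_Icc_self ht, velocity_eq_within hu h (Icc_mem_nhds ht.1 ht.2)⟩⟩

/-- Near each time at most that time itself is a break point, and the path is smooth up to the end
on both sides. Compactness of `[0, len]` leaves finitely many pieces; outside, the velocity is the
zero vector at an endpoint. -/
theorem exists_isCompact_velocity (γ : MoorePath n M) :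
    ∃ C : Set (TangentBundle (𝓡 n) M), IsCompact C ∧ ∀ᵐ t, velocity γ.toFun t ∈ C := by
  obtain ⟨S, hS⟩ := γ.piecewise
  have key : ∃ C : Set (TangentBundle (𝓡 n) M), IsCompact C ∧
      ∀ᵐ t, t ∈ Icc 0 γ.len → velocity γ.toFun t ∈ C := by
    refine isCompact_Icc.induction_on (p := fun s => ∃ C : Set (TangentBundle (𝓡 n) M),
      IsCompact C ∧ ∀ᵐ t, t ∈ s → velocity γ.toFun t ∈ C) ⟨∅, isCompact_empty, by simp⟩ ?_ ?_ ?_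
    · rintro s t hst ⟨C, hC, h⟩
      exact ⟨C, hC, h.mono fun u hu hus => hu (hst hus)⟩
    · rintro s t ⟨C, hC, h⟩ ⟨D, hD, h'⟩
      refine ⟨C ∪ D, hC.union hD, ?_⟩
      filter_upwards [h, h'] with u hu hu'
      rintro (hus | hut)
      · exact Or.inl (hu hus)
      · exact Or.inr (hu' hut)
    · intro t _
      have hfin : ((S : Set ℝ) \ {t}).Finite := S.finite_toSet.subset sdiff_subset
      obtain ⟨r, hr, hrS⟩ := Metric.isOpen_iff.1 hfin.isClosed.isOpen_compl t (by simp)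
      rw [Real.ball_eq_Ioo] at hrS
      obtain ⟨C, hC, h1⟩ := exists_isCompact_velocity_Icc (n := n) (a := t - r) (b := t)
        (by linarith) (hS _ _ (by linarith) (disjoint_left.2 fun u hu hu' =>
          hrS ⟨hu.1, by linarith [hu.2]⟩ ⟨hu', hu.2.ne⟩))
      obtain ⟨D, hD, h2⟩ := exists_isCompact_velocity_Icc (n := n) (a := t) (b := t + r)
        (by linarith) (hS _ _ (by linarith) (disjoint_left.2 fun u hu hu' =>
          hrS ⟨by linarith [hu.1], hu.2⟩ ⟨hu', hu.1.ne'⟩))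
      refine ⟨Ioo (t - r) (t + r), mem_nhdsWithin_of_mem_nhds
        (Ioo_mem_nhds (by linarith) (by linarith)), C ∪ D, hC.union hD, ?_⟩
      filter_upwards [(countable_singleton t).ae_notMem volume] with u hu hu'
      rcases lt_trichotomy u t with h | h | h
      · exact Or.inl (h1 u ⟨hu'.1, h⟩)
      · exact absurd h hu
      · exact Or.inr (h2 u ⟨h, hu'.2⟩)
  obtain ⟨C, hC, h⟩ := key
  refine ⟨C ∪ {⟨γ.src, 0⟩} ∪ {⟨γ.tgt, 0⟩}, (hC.union isCompact_singleton).union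
    isCompact_singleton, ?_⟩
  filter_upwards [h] with t ht
  rcases lt_or_ge t 0 with h0 | h0
  · exact Or.inl (Or.inr (γ.velocity_of_lt_zero h0))
  rcases lt_or_ge γ.len t with h1 | h1
  · exact Or.inr (γ.velocity_of_len_lt h1)
  · exact Or.inl (Or.inl (ht ⟨h0, h1⟩))

/-- The velocity, evaluated with a homogeneous function, is bounded and vanishes outside of
`[0, len]`. -/
theorem exists_bound_velocity (γ : MoorePath n M) {F : TangentBundle (𝓡 n) M → ℝ}
    (hF : Continuous F) (hF' : IsHom F) : ∃ C : NNReal,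
    ∀ᵐ t, ‖F (velocity γ.toFun t)‖ₑ ≤ (Icc 0 γ.len).indicator (fun _ => (C : ENNReal)) t := by
  obtain ⟨K, hK, h⟩ := γ.exists_isCompact_velocity
  obtain ⟨C, hC⟩ := hK.exists_bound_of_continuousOn hF.continuousOn
  refine ⟨C.toNNReal, ?_⟩
  filter_upwards [h] with t ht
  by_cases h0 : t ∈ Icc 0 γ.len
  · rw [indicator_of_mem h0, enorm_le_coe, ← NNReal.coe_le_coe, coe_nnnorm]
    exact (hC _ ht).trans (Real.le_coe_toNNReal C)
  · rw [indicator_of_notMem h0]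
    rw [mem_Icc, not_and_or, not_le, not_le] at h0
    rcases h0 with h0 | h0
    · rw [γ.velocity_of_lt_zero h0, hF'.zero, enorm_zero]
    · rw [γ.velocity_of_len_lt h0, hF'.zero, enorm_zero]

/-- The `L¹`-distance of velocities, tested by `F`. -/
noncomputable def velDist (F : TangentBundle (𝓡 n) M → ℝ) (γ δ : MoorePath n M) : ENNReal :=
  ∫⁻ t, ‖F (velocity γ.toFun t) - F (velocity δ.toFun t)‖ₑ

theorem velDist_triangle {F : TangentBundle (𝓡 n) M → ℝ} (hF : Continuous F)
    (γ δ ζ : MoorePath n M) : velDist F γ ζ ≤ velDist F γ δ + velDist F δ ζ := by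
  unfold velDist
  have hm : AEMeasurable fun t => ‖F (velocity γ.toFun t) - F (velocity δ.toFun t)‖ₑ :=
    ((γ.aemeasurable_velocity hF).sub (δ.aemeasurable_velocity hF)).enorm
  rw [← lintegral_add_left' hm]
  refine lintegral_mono fun t => ?_
  rw [← sub_add_sub_cancel _ (F (velocity δ.toFun t)) _]
  exact enorm_add_le _ _

theorem tendsto_velDist {F : TangentBundle (𝓡 n) M → ℝ} (hF : Continuous F) (hF' : IsHom F)
    (γ : MoorePath n M) : Filter.Tendsto (fun δ => velDist F δ γ) (𝓝 γ) (𝓝 0) := by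
  rw [ENNReal.tendsto_nhds_zero]
  intro r hr
  have ho : IsOpen {δ : MoorePath n M | velDist F δ γ < r} :=
    (inf_le_right : MoorePath.topology ≤ _) _
      (isOpen_generateFrom_of_mem ⟨F, hF, hF', γ, r, rfl⟩)
  have hm : γ ∈ {δ : MoorePath n M | velDist F δ γ < r} := by
    change velDist F γ γ < r
    simpa [velDist] using hr
  filter_upwards [ho.mem_nhds hm] with δ hδ using le_of_lt hδ

/-- The triangle inequality reduces subbasic sets with arbitrary centre to those centred at values
of `g`. -/
theorem continuous_of_velDist {T : Type*} [TopologicalSpace T] {g : T → MoorePath n M}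
    (hl : Continuous fun t => (g t).len) (he : Continuous fun p : T × ℝ => (g p.1).toFun p.2)
    (hv : ∀ F : TangentBundle (𝓡 n) M → ℝ, Continuous F → IsHom F → ∀ t,
      Filter.Tendsto (fun s => velDist F (g s) (g t)) (𝓝 t) (𝓝 0)) : Continuous g := by
  have hc : Continuous fun t => (⟨(g t).toFun, (g t).continuous⟩ : C(ℝ, M)) :=
    (ContinuousMap.curry ⟨_, he⟩).continuous
  refine continuous_inf_rng.2 ⟨continuous_inf_rng.2 ⟨continuous_induced_rng.2 hl,
    continuous_induced_rng.2 hc⟩,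
    continuous_generateFrom_iff.2 ?_⟩
  rintro _ ⟨F, hF, hF', γ, r, rfl⟩
  refine isOpen_iff_mem_nhds.2 fun t ht => ?_
  have ht' : velDist F (g t) γ < r := ht
  have h1 : Filter.Tendsto (fun s => velDist F (g s) (g t) + velDist F (g t) γ) (𝓝 t)
      (𝓝 (0 + velDist F (g t) γ)) := (hv F hF hF' t).add tendsto_const_nhds
  rw [zero_add] at h1
  filter_upwards [h1.eventually (gt_mem_nhds ht')] with s hs
  exact (velDist_triangle hF _ _ _).trans_lt hs

end Velocity

end MoorePath

namespace MoorePath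

/-! ### Concatenation and truncation of paths in the $W^{1,1}$ topology -/

section Concat

variable {n : ℕ} {M : Type u} [TopologicalSpace M] [ChartedSpace (EuclideanSpace ℝ (Fin n)) M]
  [IsManifold (𝓡 n) ∞ M]

/-- Paths are extended by constants, where the velocity is zero and a homogeneous function vanishes.
So one summand is zero on each side of the joint, which is the only excluded time. -/
theorem velocity_concat {F : TangentBundle (𝓡 n) M → ℝ} (hF : IsHom F) (γ δ : MoorePath n M)
    (h : γ.tgt = δ.src) : ∀ᵐ t, F (velocity (γ.concat δ h).toFun t) =
      F (velocity γ.toFun t) + F (velocity δ.toFun (t - γ.len)) := by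
  filter_upwards [(countable_singleton γ.len).ae_notMem volume] with t ht
  rcases lt_or_gt_of_ne ht with hl | hl
  · rw [δ.velocity_of_lt_zero (sub_neg.2 hl), hF.zero, add_zero]
    refine congrArg F (velocity_congr ?_)
    filter_upwards [gt_mem_nhds hl] with s hs
    exact if_pos (le_of_lt hs)
  · rw [γ.velocity_of_len_lt hl, hF.zero, zero_add, ← velocity_comp_sub]
    refine congrArg F (velocity_congr ?_)
    filter_upwards [lt_mem_nhds hl] with s hs
    exact if_neg (not_le.2 hs)

/-- Continuity of translations in $L^1$, by dominated convergence: the tested velocity is continuous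
almost everywhere, essentially bounded, and vanishes outside a bounded interval. -/
theorem tendsto_lintegral_shift {F : TangentBundle (𝓡 n) M → ℝ} (hF : Continuous F)
    (hF' : IsHom F) (γ : MoorePath n M) (l : ℝ) :
    Filter.Tendsto (fun a => ∫⁻ t, ‖F (velocity γ.toFun (t - a)) - F (velocity γ.toFun (t - l))‖ₑ)
      (𝓝 l) (𝓝 0) := by
  have hm : ∀ a : ℝ, AEMeasurable fun t => F (velocity γ.toFun (t - a)) := fun a =>
    (γ.aemeasurable_velocity hF).comp_quasiMeasurePreserving
      (measurePreserving_sub_right volume a).quasiMeasurePreserving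
  obtain ⟨C, hC⟩ := γ.exists_bound_velocity hF hF'
  have hC' : ∀ a : ℝ, ∀ᵐ t, ‖F (velocity γ.toFun (t - a))‖ₑ ≤
      (Icc 0 γ.len).indicator (fun _ => (C : ENNReal)) (t - a) := fun a =>
    (measurePreserving_sub_right volume a).quasiMeasurePreserving.ae hC
  -- A common interval for all translates by `a` with `|a - l| < 1`.
  let J : Set ℝ := Icc (l - 1) (l + 1 + γ.len)
  have hJ : ∀ a, |a - l| < 1 → ∀ t, (Icc 0 γ.len).indicator (fun _ => (C : ENNReal)) (t - a) ≤
      J.indicator (fun _ => (C : ENNReal)) t := by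
    intro a ha t
    by_cases h : t - a ∈ Icc 0 γ.len
    · have : t ∈ J := by
        rw [abs_lt] at ha
        exact ⟨by linarith [h.1], by linarith [h.2]⟩
      rw [indicator_of_mem h, indicator_of_mem this]
    · rw [indicator_of_notMem h]
      exact zero_le
  have := tendsto_lintegral_filter_of_dominated_convergence' (μ := volume) (l := 𝓝 l)
    (F := fun a t => ‖F (velocity γ.toFun (t - a)) - F (velocity γ.toFun (t - l))‖ₑ)
    (f := fun _ => 0) (fun t => 2 * J.indicator (fun _ => (C : ENNReal)) t)
    (Filter.Eventually.of_forall fun a => ((hm a).sub (hm l)).enorm) ?_ ?_ ?_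
  · simpa using this
  · filter_upwards [Metric.ball_mem_nhds l one_pos] with a ha
    rw [Metric.mem_ball, Real.dist_eq] at ha
    filter_upwards [hC' a, hC' l] with t h1 h2
    refine (enorm_sub_le).trans ?_
    rw [two_mul]
    exact add_le_add (h1.trans (hJ a ha t)) (h2.trans (hJ l (by simp) t))
  · rw [lintegral_const_mul' _ _ (by simp), lintegral_indicator measurableSet_Icc]
    simp [ENNReal.mul_eq_top]
  · filter_upwards [(measurePreserving_sub_right volume l).quasiMeasurePreserving.ae
      γ.ae_continuousAt_velocity] with t ht
    have h1 : ContinuousAt (fun a : ℝ => F (velocity γ.toFun (t - a))) l :=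
      hF.continuousAt.comp (ContinuousAt.comp (f := fun a : ℝ => t - a)
        (g := velocity (n := n) γ.toFun) ht.2 (by fun_prop))
    have h2 : ContinuousAt (fun a : ℝ =>
      ‖F (velocity γ.toFun (t - a)) - F (velocity γ.toFun (t - l))‖ₑ) l :=
      (h1.sub continuousAt_const).enorm
    simpa [ContinuousAt] using h2

/-- The distance of two concatenations is bounded by the distance of the first paths, that of the
second paths translated by the same length, and that of two translates of one second path. -/
theorem continuous_concat {T : Type*} [TopologicalSpace T] {g d : T → MoorePath n M}
    (hg : Continuous g) (hd : Continuous d) (h : ∀ t, (g t).tgt = (d t).src) :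
    Continuous fun t => (g t).concat (d t) (h t) := by
  have hl : Continuous fun t => (g t).len := continuous_len.comp hg
  refine continuous_of_velDist (hl.add (continuous_len.comp hd)) ?_ fun F hF hF' t => ?_
  · have hg' : Continuous fun p : T × ℝ => (g p.1).toFun p.2 :=
      continuous_eval.comp ((hg.comp continuous_fst).prodMk continuous_snd)
    have hd' : Continuous fun p : T × ℝ => (d p.1).toFun (p.2 - (g p.1).len) :=
      continuous_eval.comp ((hd.comp continuous_fst).prodMk
        (continuous_snd.sub (hl.comp continuous_fst)))
    refine Continuous.if_le hg' hd' continuous_snd (hl.comp continuous_fst) ?_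
    intro p hp
    have := h p.1
    rw [hp, sub_self]
    exact this
  · have h1 := (tendsto_velDist hF hF' (g t)).comp hg.continuousAt
    have h2 := (tendsto_velDist hF hF' (d t)).comp hd.continuousAt
    have h3 := (tendsto_lintegral_shift hF hF' (d t) (g t).len).comp hl.continuousAt
    have h4 := (h1.add h2).add h3
    rw [add_zero, add_zero] at h4
    refine tendsto_of_tendsto_of_tendsto_of_le_of_le tendsto_const_nhds h4
      (fun _ => zero_le) fun s => ?_
    have hm : ∀ (γ : MoorePath n M) (a : ℝ), AEMeasurable fun u => F (velocity γ.toFun (u - a)) :=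
      fun γ a => (γ.aemeasurable_velocity hF).comp_quasiMeasurePreserving
        (measurePreserving_sub_right volume a).quasiMeasurePreserving
    have hm1 : AEMeasurable fun u => ‖F (velocity (g s).toFun u) - F (velocity (g t).toFun u)‖ₑ :=
      (((g s).aemeasurable_velocity hF).sub ((g t).aemeasurable_velocity hF)).enorm
    have hm2 : AEMeasurable fun u => ‖F (velocity (d s).toFun (u - (g s).len)) -
        F (velocity (d t).toFun (u - (g s).len))‖ₑ :=
      ((hm _ _).sub (hm _ _)).enorm
    have e2 : velDist F (d s) (d t) = ∫⁻ u, ‖F (velocity (d s).toFun (u - (g s).len)) -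
        F (velocity (d t).toFun (u - (g s).len))‖ₑ :=
      (lintegral_sub_right_eq_self (μ := volume) (fun u => ‖F (velocity (d s).toFun u) -
        F (velocity (d t).toFun u)‖ₑ) (g s).len).symm
    change velDist F _ _ ≤ velDist F (g s) (g t) + velDist F (d s) (d t) + ∫⁻ u,
      ‖F (velocity (d t).toFun (u - (g s).len)) - F (velocity (d t).toFun (u - (g t).len))‖ₑ
    rw [e2, add_assoc, ← lintegral_add_left' hm2]
    unfold velDist
    rw [← lintegral_add_left' hm1]
    refine lintegral_mono_ae ?_
    filter_upwards [velocity_concat hF' (g s) (d s) (h s),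
      velocity_concat hF' (g t) (d t) (h t)] with u h1 h2
    rw [h1, h2, add_sub_add_comm]
    refine (enorm_add_le _ _).trans (add_le_add le_rfl ?_)
    rw [← sub_add_sub_cancel _ (F (velocity (d t).toFun (u - (g s).len))) _]
    exact enorm_add_le _ _

theorem concat_assoc (γ δ ζ : MoorePath n M) (h₁ : γ.tgt = δ.src) (h₂ : δ.tgt = ζ.src) :
    (γ.concat δ h₁).concat ζ ((tgt_concat γ δ h₁).trans h₂) =
      γ.concat (δ.concat ζ h₂) (h₁.trans (src_concat δ ζ h₂).symm) := by
  refine MoorePath.ext (add_assoc _ _ _) (funext fun t => ?_)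
  have hδ := δ.len_nonneg
  change (if t ≤ γ.len + δ.len then if t ≤ γ.len then γ.toFun t else δ.toFun (t - γ.len)
    else ζ.toFun (t - (γ.len + δ.len))) = if t ≤ γ.len then γ.toFun t else
      if t - γ.len ≤ δ.len then δ.toFun (t - γ.len) else ζ.toFun (t - γ.len - δ.len)
  by_cases h : t ≤ γ.len
  · rw [if_pos (by linarith), if_pos h, if_pos h]
  · rw [if_neg h, if_neg h]
    by_cases h' : t ≤ γ.len + δ.len
    · rw [if_pos h', if_pos (by linarith)]
    · rw [if_neg h', if_neg (by linarith), sub_sub]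

theorem const_concat (γ : MoorePath n M) (x : M) (h : (const (n := n) x).tgt = γ.src) :
    (const x).concat γ h = γ := by
  refine MoorePath.ext (zero_add _) (funext fun t => ?_)
  have e : x = γ.toFun 0 := h
  change (if t ≤ 0 then x else γ.toFun (t - 0)) = γ.toFun t
  rw [sub_zero]
  split_ifs with ht
  · rw [γ.left t ht, e]
  · rfl

theorem concat_const (γ : MoorePath n M) (x : M) (h : γ.tgt = (const (n := n) x).src) :
    γ.concat (const x) h = γ := by
  refine MoorePath.ext (add_zero _) (funext fun t => ?_)
  have e : γ.toFun γ.len = x := h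
  change (if t ≤ γ.len then γ.toFun t else x) = γ.toFun t
  split_ifs with ht
  · rfl
  · rw [γ.right t (not_le.1 ht).le, e]

/-- The initial segment of a path, of length `s`. -/
noncomputable def trunc (γ : MoorePath n M) (s : NNReal) : MoorePath n M where
  len := s
  len_nonneg := s.2
  toFun := fun t => γ.toFun (min t s)
  continuous := γ.continuous.comp (continuous_id.min continuous_const)
  piecewise := by
    classical
    obtain ⟨S, hS⟩ := γ.piecewise
    refine ⟨insert (s : ℝ) S, fun a b hab hd => ?_⟩
    rw [Finset.coe_insert, disjoint_insert_right] at hd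
    rcases le_or_gt b s with hb | hb
    · refine (hS a b hab hd.2).congr fun t ht => ?_
      rw [min_eq_left (ht.2.trans hb)]
    · have ha : (s : ℝ) ≤ a := by
        by_contra hlt
        exact hd.1 ⟨not_le.1 hlt, hb⟩
      refine (contMDiffOn_const (c := γ.toFun s)).congr fun t ht => ?_
      rw [min_eq_right (ha.trans ht.1)]
  left := fun t ht => by
    rw [min_eq_left s.coe_nonneg, min_eq_left (ht.trans s.coe_nonneg), γ.left t ht]
  right := fun t ht => by rw [min_eq_right ht, min_self]

theorem velocity_trunc {F : TangentBundle (𝓡 n) M → ℝ} (hF : IsHom F) (γ : MoorePath n M)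
    (s : NNReal) {t : ℝ} (ht : t ≠ s) : F (velocity (γ.trunc s).toFun t) =
      if t < s then F (velocity γ.toFun t) else 0 := by
  split_ifs with h
  · refine congrArg F (velocity_congr ?_)
    filter_upwards [gt_mem_nhds h] with a ha
    exact congrArg γ.toFun (min_eq_left (le_of_lt ha))
  · rw [velocity_of_len_lt _ (lt_of_le_of_ne (not_lt.1 h) ht.symm), hF.zero]

/-- This gives a continuous family from the constant path to `γ`, needed for the orientation. Away
from `t = s` the integrand is eventually zero, and dominated convergence applies. -/
theorem continuous_trunc (γ : MoorePath n M) : Continuous γ.trunc := by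
  refine continuous_of_velDist NNReal.continuous_coe ?_ fun F hF hF' s => ?_
  · exact γ.continuous.comp (continuous_snd.min (NNReal.continuous_coe.comp continuous_fst))
  obtain ⟨C, hC⟩ := γ.exists_bound_velocity hF hF'
  have hne : ∀ a : NNReal, ∀ᵐ t : ℝ, t ≠ a := fun a => (countable_singleton (a : ℝ)).ae_notMem volume
  have hb : ∀ a : NNReal, ∀ᵐ t, ‖F (velocity (γ.trunc a).toFun t)‖ₑ ≤
      (Icc 0 γ.len).indicator (fun _ => (C : ENNReal)) t := by
    intro a
    filter_upwards [hC, hne a] with t h1 h2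
    rw [velocity_trunc hF' γ a h2]
    split_ifs
    · exact h1
    · rw [enorm_zero]; exact zero_le
  have := tendsto_lintegral_filter_of_dominated_convergence' (μ := volume) (l := 𝓝 s)
    (F := fun a t => ‖F (velocity (γ.trunc a).toFun t) - F (velocity (γ.trunc s).toFun t)‖ₑ)
    (f := fun _ => 0) (fun t => 2 * (Icc 0 γ.len).indicator (fun _ => (C : ENNReal)) t)
    (Filter.Eventually.of_forall fun a => (((γ.trunc a).aemeasurable_velocity hF).sub
      ((γ.trunc s).aemeasurable_velocity hF)).enorm) ?_ ?_ ?_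
  · simpa [velDist] using this
  · refine Filter.Eventually.of_forall fun a => ?_
    filter_upwards [hb a, hb s] with t h1 h2
    refine (enorm_sub_le).trans ?_
    rw [two_mul]
    exact add_le_add h1 h2
  · rw [lintegral_const_mul' _ _ (by simp), lintegral_indicator measurableSet_Icc]
    simp [ENNReal.mul_eq_top]
  · filter_upwards [hne s] with t ht
    refine tendsto_const_nhds.congr' ?_
    have hc : Filter.Tendsto (fun a : NNReal => (a : ℝ)) (𝓝 s) (𝓝 (s : ℝ)) :=
      NNReal.continuous_coe.continuousAt
    rcases lt_or_gt_of_ne ht with h | h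
    · filter_upwards [hc.eventually (lt_mem_nhds h)] with a ha
      have ha' : t < (a : ℝ) := ha
      rw [velocity_trunc hF' γ a ha'.ne, velocity_trunc hF' γ s ht, if_pos ha', if_pos h, sub_self,
        enorm_zero]
    · filter_upwards [hc.eventually (gt_mem_nhds h)] with a ha
      have ha' : (a : ℝ) < t := ha
      rw [velocity_trunc hF' γ a ha'.ne', velocity_trunc hF' γ s ht, if_neg ha'.not_gt,
        if_neg (not_lt.2 h.le), sub_self, enorm_zero]

theorem trunc_zero (γ : MoorePath n M) : γ.trunc 0 = const γ.src := by
  refine MoorePath.ext rfl (funext fun t => ?_)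
  change γ.toFun (min t ((0 : NNReal) : ℝ)) = γ.toFun 0
  exact γ.left _ (min_le_right _ _)

theorem trunc_len (γ : MoorePath n M) : γ.trunc ⟨γ.len, γ.len_nonneg⟩ = γ := by
  refine MoorePath.ext rfl (funext fun t => ?_)
  change γ.toFun (min t γ.len) = γ.toFun t
  rcases le_total t γ.len with h | h
  · rw [min_eq_left h]
  · rw [min_eq_right h, γ.right t h]

end Concat

end MoorePath

namespace MoorePath

/-! ### Images of paths under smooth maps in the $W^{1,1}$ topology -/

section Map

variable {n : ℕ} {M : Type u} [TopologicalSpace M] [ChartedSpace (EuclideanSpace ℝ (Fin n)) M]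
  [IsManifold (𝓡 n) ∞ M]

theorem velocity_map (f : C^∞⟮𝓡 n, M; 𝓡 n, M⟯) (γ : MoorePath n M) : ∀ᵐ t,
    velocity (γ.map f).toFun t = tangentMap (𝓡 n) (𝓡 n) f (velocity γ.toFun t) := by
  filter_upwards [γ.ae_continuousAt_velocity] with t ht
  exact tangentMap_comp_at (⟨t, (1 : ℝ)⟩ : TangentBundle 𝓘(ℝ, ℝ) ℝ) f.mdifferentiableAt ht.1

theorem IsHom.comp_tangentMap {F : TangentBundle (𝓡 n) M → ℝ} (hF : IsHom F) (f : M → M) :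
    IsHom fun w => F (tangentMap (𝓡 n) (𝓡 n) f w) := by
  intro c x v hc
  have := hF c (f x) (mfderiv (𝓡 n) (𝓡 n) f x v) hc
  rw [← map_smul] at this
  exact this

variable [RiemannianBundle (fun x : M => TangentSpace (𝓡 n) x)]
  [IsContinuousRiemannianBundle (EuclideanSpace ℝ (Fin n)) (fun x : M => TangentSpace (𝓡 n) x)]

theorem continuous_tangent_norm :
    Continuous fun w : TangentBundle (𝓡 n) M => ‖(w.2 : TangentSpace (𝓡 n) w.1)‖ := by
  have h : Continuous fun w : TangentBundle (𝓡 n) M =>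
      inner ℝ (w.2 : TangentSpace (𝓡 n) w.1) (w.2 : TangentSpace (𝓡 n) w.1) :=
    Continuous.inner_bundle (F := EuclideanSpace ℝ (Fin n))
      (E := fun x : M => TangentSpace (𝓡 n) x) (b := fun w : TangentBundle (𝓡 n) M => w.1)
      (v := fun w => w.2) (w := fun w => w.2) continuous_id continuous_id
  refine (Real.continuous_sqrt.comp h).congr fun w => ?_
  exact (norm_eq_sqrt_real_inner _).symm

theorem isHom_tangent_norm :
    IsHom fun w : TangentBundle (𝓡 n) M => ‖(w.2 : TangentSpace (𝓡 n) w.1)‖ := by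
  intro c x v hc
  change ‖c • v‖ = c * ‖v‖
  rw [norm_smul, Real.norm_of_nonneg hc]

/-- By homogeneity it suffices to treat vectors in the unit ball of a local trivialization. This
ball is compact, and the difference `G` is continuous and zero at `f₀`, hence uniformly small
nearby. The constant `C` bounds the norm of the trivialization, so smallness `r / C` is enough. -/
theorem eventually_tangentMap_le_near {F : TangentBundle (𝓡 n) M → ℝ} (hF : Continuous F)
    (hF' : IsHom F) (f₀ : C^∞⟮𝓡 n, M; 𝓡 n, M⟯) {r : ℝ} (hr : 0 < r) (x₀ : M) :
    ∀ᶠ z : C^∞⟮𝓡 n, M; 𝓡 n, M⟯ × M in 𝓝 (f₀, x₀), ∀ v : TangentSpace (𝓡 n) z.2,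
      |F (tangentMap (𝓡 n) (𝓡 n) z.1 ⟨z.2, v⟩) - F (tangentMap (𝓡 n) (𝓡 n) f₀ ⟨z.2, v⟩)| ≤
        r * ‖v‖ := by
  let e := trivializationAt (EuclideanSpace ℝ (Fin n)) (TangentSpace (𝓡 n)) x₀
  obtain ⟨C, hC, hC'⟩ := eventually_norm_trivializationAt_lt (EuclideanSpace ℝ (Fin n))
    (fun x : M => TangentSpace (𝓡 n) x) x₀
  have hx₀ : x₀ ∈ e.baseSet := FiberBundle.mem_baseSet_trivializationAt' x₀
  let G : C^∞⟮𝓡 n, M; 𝓡 n, M⟯ × TangentBundle (𝓡 n) M → ℝ := fun p =>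
    F (tangentMap (𝓡 n) (𝓡 n) p.1 p.2) - F (tangentMap (𝓡 n) (𝓡 n) f₀ p.2)
  have hG : Continuous G := by
    have h1 : Continuous fun p : C^∞⟮𝓡 n, M; 𝓡 n, M⟯ × TangentBundle (𝓡 n) M =>
        tangentMap (𝓡 n) (𝓡 n) p.1 p.2 :=
      continuous_iterTangentMap_eval (J := 𝓡 n) (X := M) (J' := 𝓡 n) (Y := M) continuous_id 1
    have h2 : Continuous (tangentMap (𝓡 n) (𝓡 n) f₀) :=
      f₀.contMDiff.continuous_tangentMap (by simp)
    exact (hF.comp h1).sub (hF.comp (h2.comp continuous_snd))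
  have hK := (isCompact_closedBall (0 : EuclideanSpace ℝ (Fin n)) 1).eventually_forall_of_forall_eventually
    (x₀ := (f₀, x₀)) (P := fun z u => |G (z.1, e.toOpenPartialHomeomorph.symm (z.2, u))| < r / C) (by
      intro u _
      have h1 : ContinuousAt e.toOpenPartialHomeomorph.symm (x₀, u) :=
        e.toOpenPartialHomeomorph.symm.continuousAt (e.mem_target.2 hx₀)
      have h2 : ContinuousAt (fun z : (C^∞⟮𝓡 n, M; 𝓡 n, M⟯ × M) × EuclideanSpace ℝ (Fin n) =>
          |G (z.1.1, e.toOpenPartialHomeomorph.symm (z.1.2, z.2))|) ((f₀, x₀), u) := by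
        refine ContinuousAt.abs (hG.continuousAt.comp (ContinuousAt.prodMk (by fun_prop) ?_))
        exact ContinuousAt.comp (f := fun z : (C^∞⟮𝓡 n, M; 𝓡 n, M⟯ × M) ×
          EuclideanSpace ℝ (Fin n) => (z.1.2, z.2)) h1 (by fun_prop)
      refine h2.eventually (gt_mem_nhds ?_)
      simp only [G, sub_self, abs_zero]
      positivity)
  have hb : ∀ᶠ z : C^∞⟮𝓡 n, M; 𝓡 n, M⟯ × M in 𝓝 (f₀, x₀), z.2 ∈ e.baseSet :=
    continuous_snd.continuousAt.eventually (e.open_baseSet.mem_nhds hx₀)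
  have hc := (continuous_snd (X := C^∞⟮𝓡 n, M; 𝓡 n, M⟯) (Y := M)).continuousAt
    (x := (f₀, x₀)) |>.eventually hC'
  filter_upwards [hK, hb, hc] with z h1 h2 h3 v
  obtain ⟨f, x⟩ := z
  let u := e.continuousLinearMapAt ℝ x v
  have hu : ‖u‖ ≤ C * ‖v‖ := (ContinuousLinearMap.le_opNorm _ _).trans
    (mul_le_mul_of_nonneg_right h3.le (norm_nonneg _))
  let u₁ := ‖u‖⁻¹ • u
  have hu₁ : u₁ ∈ Metric.closedBall (0 : EuclideanSpace ℝ (Fin n)) 1 := by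
    rw [mem_closedBall_zero_iff, norm_smul, norm_inv, norm_norm]
    exact inv_mul_le_one
  -- This also holds for `u = 0`, since then `v = 0`; the default value of the inverse does no harm.
  have hv : v = ‖u‖ • e.symmL ℝ x u₁ := by
    rw [← map_smul, smul_smul]
    by_cases h0 : u = 0
    · have := e.symmL_continuousLinearMapAt (R := ℝ) h2 v
      change e.symmL ℝ x u = v at this
      rw [← this, h0]
      simp
    · rw [mul_inv_cancel₀ (norm_ne_zero_iff.2 h0), one_smul]
      exact (e.symmL_continuousLinearMapAt (R := ℝ) h2 v).symm
  have hs : (⟨x, e.symmL ℝ x u₁⟩ : TangentBundle (𝓡 n) M) =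
      e.toOpenPartialHomeomorph.symm (x, u₁) := by
    rw [e.symmL_apply (R := ℝ) h2]
    exact e.mk_symm h2 u₁
  have key : F (tangentMap (𝓡 n) (𝓡 n) f ⟨x, v⟩) - F (tangentMap (𝓡 n) (𝓡 n) f₀ ⟨x, v⟩) =
      ‖u‖ * G (f, e.toOpenPartialHomeomorph.symm (x, u₁)) := by
    rw [← hs, hv]
    have a1 := hF'.comp_tangentMap f ‖u‖ x (e.symmL ℝ x u₁) (norm_nonneg _)
    have a2 := hF'.comp_tangentMap f₀ ‖u‖ x (e.symmL ℝ x u₁) (norm_nonneg _)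
    rw [mul_sub]
    exact congrArg₂ (· - ·) a1 a2
  change |F (tangentMap (𝓡 n) (𝓡 n) f ⟨x, v⟩) - F (tangentMap (𝓡 n) (𝓡 n) f₀ ⟨x, v⟩)| ≤ r * ‖v‖
  rw [key, abs_mul, abs_norm]
  calc ‖u‖ * |G (f, e.toOpenPartialHomeomorph.symm (x, u₁))| ≤ (C * ‖v‖) * (r / C) :=
        mul_le_mul hu (h1 u₁ hu₁).le (abs_nonneg _) (by positivity)
    _ = r * ‖v‖ := by field_simp

/-- Compactness of `M` makes the local estimate uniform in the base point. -/
theorem eventually_tangentMap_le [CompactSpace M] {F : TangentBundle (𝓡 n) M → ℝ}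
    (hF : Continuous F) (hF' : IsHom F) (f₀ : C^∞⟮𝓡 n, M; 𝓡 n, M⟯) {r : ℝ} (hr : 0 < r) :
    ∀ᶠ f : C^∞⟮𝓡 n, M; 𝓡 n, M⟯ in 𝓝 f₀, ∀ w : TangentBundle (𝓡 n) M,
      |F (tangentMap (𝓡 n) (𝓡 n) f w) - F (tangentMap (𝓡 n) (𝓡 n) f₀ w)| ≤
        r * ‖(w.2 : TangentSpace (𝓡 n) w.1)‖ := by
  have := (isCompact_univ (X := M)).eventually_forall_of_forall_eventually (x₀ := f₀)
    (P := fun f x => ∀ v : TangentSpace (𝓡 n) x,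
      |F (tangentMap (𝓡 n) (𝓡 n) f ⟨x, v⟩) - F (tangentMap (𝓡 n) (𝓡 n) f₀ ⟨x, v⟩)| ≤ r * ‖v‖)
    fun x _ => eventually_tangentMap_le_near hF hF' f₀ hr x
  filter_upwards [this] with f hf w using hf w.1 (mem_univ _) w.2

/-- The difference of tested velocities splits into a change of the map, bounded by a small multiple
of the speed, and a change of the path, tested by `F` composed with the tangent map of `f t`. The
latter is again a continuous homogeneous function. -/
theorem continuous_map [CompactSpace M] {T : Type*} [TopologicalSpace T]
    {f : T → C^∞⟮𝓡 n, M; 𝓡 n, M⟯} {g : T → MoorePath n M} (hf : Continuous f)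
    (hg : Continuous g) : Continuous fun t => (g t).map (f t) := by
  refine continuous_of_velDist (show Continuous fun t => (g t).len from continuous_len.comp hg) ?_
    fun F hF hF' t => ?_
  · exact continuous_smoothMap_eval.comp ((hf.comp continuous_fst).prodMk
      (continuous_eval.comp ((hg.comp continuous_fst).prodMk continuous_snd)))
  let N : TangentBundle (𝓡 n) M → ℝ := fun w => ‖(w.2 : TangentSpace (𝓡 n) w.1)‖
  have hN : Continuous N := continuous_tangent_norm
  have hN' : IsHom N := isHom_tangent_norm
  let F₀ : TangentBundle (𝓡 n) M → ℝ := fun w => F (tangentMap (𝓡 n) (𝓡 n) (f t) w)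
  have hT : ∀ s, Continuous (tangentMap (𝓡 n) (𝓡 n) (f s)) :=
    fun s => (f s).contMDiff.continuous_tangentMap (by simp)
  have hF₀ : Continuous F₀ := hF.comp (hT t)
  have hF₀' : IsHom F₀ := hF'.comp_tangentMap (f t)
  let L : ENNReal := ∫⁻ u, ‖N (velocity (g t).toFun u)‖ₑ
  have hL : L ≠ ⊤ := by
    obtain ⟨C, hC⟩ := (g t).exists_bound_velocity hN hN'
    refine ne_top_of_le_ne_top ?_ (lintegral_mono_ae hC)
    rw [lintegral_indicator measurableSet_Icc]
    simp [ENNReal.mul_eq_top]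
  rw [ENNReal.tendsto_nhds_zero]
  intro r hr
  -- The bound `1 + L` holds for the integrated speed of all nearby paths, so the change of the map
  -- contributes less than `r / 2`.
  obtain ⟨c, hc, hcr⟩ := ENNReal.exists_nnreal_pos_mul_lt (a := 1 + L) (b := r / 2)
    (ENNReal.add_ne_top.2 ⟨ENNReal.one_ne_top, hL⟩) (ENNReal.half_pos hr.ne').ne'
  have h1 := hf.continuousAt.eventually (eventually_tangentMap_le hF hF' (f t)
    (r := (c : ℝ)) (NNReal.coe_pos.2 hc))
  have h2 := ((tendsto_velDist hN hN' (g t)).comp hg.continuousAt).eventually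
    (gt_mem_nhds one_pos)
  have h3 := ((tendsto_velDist hF₀ hF₀' (g t)).comp hg.continuousAt).eventually
    (gt_mem_nhds (ENNReal.half_pos hr.ne'))
  filter_upwards [h1, h2, h3] with s h1 h2 h3
  have hNs : ∫⁻ u, ‖N (velocity (g s).toFun u)‖ₑ ≤ 1 + L := by
    refine le_trans ?_ (add_le_add (le_of_lt h2) le_rfl)
    have hm : AEMeasurable fun u => ‖N (velocity (g s).toFun u) - N (velocity (g t).toFun u)‖ₑ :=
      (((g s).aemeasurable_velocity hN).sub ((g t).aemeasurable_velocity hN)).enorm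
    change _ ≤ velDist N (g s) (g t) + L
    unfold velDist
    rw [← lintegral_add_left' hm]
    refine lintegral_mono fun u => ?_
    conv_lhs => rw [← sub_add_cancel (N (velocity (g s).toFun u)) (N (velocity (g t).toFun u))]
    exact enorm_add_le _ _
  have hm : AEMeasurable fun u => ‖F₀ (velocity (g s).toFun u) - F₀ (velocity (g t).toFun u)‖ₑ :=
    (((g s).aemeasurable_velocity hF₀).sub ((g t).aemeasurable_velocity hF₀)).enorm
  have hb : velDist F ((g s).map (f s)) ((g t).map (f t)) ≤
      velDist F₀ (g s) (g t) + c * ∫⁻ u, ‖N (velocity (g s).toFun u)‖ₑ := by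
    rw [← lintegral_const_mul' _ _ ENNReal.coe_ne_top]
    unfold velDist
    rw [← lintegral_add_left' hm]
    refine lintegral_mono_ae ?_
    filter_upwards [velocity_map (f s) (g s), velocity_map (f t) (g t)] with u e1 e2
    rw [e1, e2, add_comm,
      ← sub_add_sub_cancel _ (F₀ (velocity (g s).toFun u)) (F (tangentMap (𝓡 n) (𝓡 n) (f t) _))]
    refine (enorm_add_le _ _).trans (add_le_add ?_ le_rfl)
    have := h1 (velocity (g s).toFun u)
    rw [← ofReal_norm, ← ofReal_norm, ← ENNReal.ofReal_coe_nnreal, ← ENNReal.ofReal_mul c.coe_nonneg]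
    refine ENNReal.ofReal_le_ofReal ?_
    rw [Real.norm_eq_abs, Real.norm_of_nonneg (norm_nonneg _)]
    exact this
  refine hb.trans ?_
  rw [← ENNReal.add_halves r]
  exact add_le_add h3.le ((mul_le_mul_right hNs _).trans hcr.le)

end Map

end MoorePath

/-! ### Continuity of products and actions -/

section Actions

variable {n : ℕ} {M : Type u} [MetricSpace M] [ChartedSpace (EuclideanSpace ℝ (Fin n)) M]
  [IsManifold (𝓡 n) ∞ M] {x₀ : M} {ε : ℝ}

theorem continuous_loopMul :
    Continuous fun p : BasedLoops n x₀ × BasedLoops n x₀ => loopMul p.1 p.2 :=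
  Continuous.subtype_mk (MoorePath.continuous_concat (continuous_subtype_val.comp continuous_fst)
    (continuous_subtype_val.comp continuous_snd)
    fun p : BasedLoops n x₀ × BasedLoops n x₀ => p.1.2.2.trans p.2.2.1.symm) _

theorem continuous_loopPath :
    Continuous fun p : BasedLoops n x₀ × PathsFrom n x₀ => loopPath p.1 p.2 :=
  Continuous.subtype_mk (MoorePath.continuous_concat (continuous_subtype_val.comp continuous_fst)
    (continuous_subtype_val.comp continuous_snd)
    fun p : BasedLoops n x₀ × PathsFrom n x₀ => p.1.2.2.trans p.2.2.symm) _

theorem continuous_loopToPath :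
    Continuous (loopToPath : BasedLoops n x₀ → PathsFrom n x₀) :=
  Continuous.subtype_mk continuous_subtype_val _

theorem continuous_pairIncl : Continuous (pairIncl : BasedPairs n x₀ ε → FreePairs n M ε) := by
  refine Continuous.subtype_mk (Continuous.prodMk (by fun_prop) (Continuous.subtype_mk ?_ _)) _
  fun_prop

theorem loopMul_assoc (a b c : BasedLoops n x₀) :
    loopMul (loopMul a b) c = loopMul a (loopMul b c) :=
  Subtype.ext (MoorePath.concat_assoc a.1 b.1 c.1 (a.2.2.trans b.2.1.symm)
    (b.2.2.trans c.2.1.symm))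

theorem loopPath_assoc (a b : BasedLoops n x₀) (p : PathsFrom n x₀) :
    loopPath (loopMul a b) p = loopPath a (loopPath b p) :=
  Subtype.ext (MoorePath.concat_assoc a.1 b.1 p.1 (a.2.2.trans b.2.1.symm)
    (b.2.2.trans p.2.symm))

theorem loopMul_one (a : BasedLoops n x₀) : loopMul a (loopOne x₀) = a :=
  Subtype.ext (MoorePath.concat_const a.1 x₀ a.2.2)

theorem one_loopMul (a : BasedLoops n x₀) : loopMul (loopOne x₀) a = a :=
  Subtype.ext (MoorePath.const_concat a.1 x₀ a.2.1.symm)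

variable (Θ : TransitiveDiffeoLift n M ε)

theorem lift_loopMul (a b : BasedLoops n x₀) (z : M) :
    Θ.toFun (loopMul a b).1 z = Θ.toFun b.1 (Θ.toFun a.1 z) :=
  Θ.concat a.1 b.1 (a.2.2.trans b.2.1.symm) z

theorem lift_loopPath (a : BasedLoops n x₀) (p : PathsFrom n x₀) (z : M) :
    Θ.toFun (loopPath a p).1 z = Θ.toFun p.1 (Θ.toFun a.1 z) :=
  Θ.concat a.1 p.1 (a.2.2.trans p.2.symm) z

theorem actLoop_actLoop (x : BasedPairs n x₀ ε) (a b : BasedLoops n x₀) :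
    actLoop Θ (actLoop Θ x a) b = actLoop Θ x (loopMul a b) := by
  refine Subtype.ext (Prod.ext rfl (Subtype.ext (MoorePath.ext rfl (funext fun t => ?_))))
  exact (lift_loopMul Θ a b _).symm

theorem actPath_actLoop (x : BasedPairs n x₀ ε) (a : BasedLoops n x₀) (p : PathsFrom n x₀) :
    actPath Θ (actLoop Θ x a) p = actPath Θ x (loopPath a p) := by
  refine Subtype.ext (Prod.ext rfl (Subtype.ext (MoorePath.ext rfl (funext fun t => ?_))))
  exact (lift_loopPath Θ a p _).symm

theorem actLoop_one (x : BasedPairs n x₀ ε) : actLoop Θ x (loopOne x₀) = x := by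
  refine Subtype.ext (Prod.ext rfl (Subtype.ext (MoorePath.ext rfl (funext fun t => ?_))))
  exact Θ.const _ _

theorem pairIncl_actLoop (x : BasedPairs n x₀ ε) (a : BasedLoops n x₀) :
    actPath Θ x (loopToPath a) = pairIncl (actLoop Θ x a) := rfl

theorem evFree_pairIncl (x : BasedPairs n x₀ ε) :
    evFree (pairIncl x) = iotaMap (n := n) x₀ ε (evBased x) :=
  Subtype.ext (Prod.ext x.1.2.2.1 rfl)

theorem evBased_actLoop (x : BasedPairs n x₀ ε) (a : BasedLoops n x₀) :
    evBased (actLoop Θ x a) = thetaZero Θ a (evBased x) := rfl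

theorem evFree_actPath (x : BasedPairs n x₀ ε) (p : PathsFrom n x₀) :
    evFree (actPath Θ x p) = thetaOne Θ p (evBased x) := by
  refine Subtype.ext (Prod.ext ?_ rfl)
  exact (congrArg (Θ.toFun p.1) (x.1.2.2.1.trans p.2.symm)).trans (Θ.endpoint p.1)

theorem thetaZero_loopMul (a b : BasedLoops n x₀) :
    thetaZero (ε := ε) Θ (loopMul a b) = (thetaZero Θ b).comp (thetaZero Θ a) :=
  ContMDiffMap.ext fun z => Subtype.ext (lift_loopMul Θ a b z)

theorem thetaOne_loopPath (a : BasedLoops n x₀) (p : PathsFrom n x₀) :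
    thetaOne (ε := ε) Θ (loopPath a p) = (thetaOne Θ p).comp (thetaZero Θ a) :=
  ContMDiffMap.ext fun z => Subtype.ext (Prod.ext (MoorePath.tgt_concat a.1 p.1 (a.2.2.trans p.2.symm))
    (lift_loopPath Θ a p z))

theorem thetaOne_loopToPath (a : BasedLoops n x₀) :
    thetaOne (ε := ε) Θ (loopToPath a) = (iotaMap x₀ ε).comp (thetaZero Θ a) :=
  ContMDiffMap.ext fun _ => Subtype.ext (Prod.ext a.2.2 rfl)

theorem thetaZero_one : thetaZero (ε := ε) Θ (loopOne x₀) = ContMDiffMap.id :=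
  ContMDiffMap.ext fun z => Subtype.ext (Θ.const x₀ z)

variable [RiemannianBundle (fun x : M => TangentSpace (𝓡 n) x)]
  [IsContinuousRiemannianBundle (EuclideanSpace ℝ (Fin n)) (fun x : M => TangentSpace (𝓡 n) x)]
  [CompactSpace M]

theorem continuous_actLoop :
    Continuous fun p : BasedPairs n x₀ ε × BasedLoops n x₀ => actLoop Θ p.1 p.2 := by
  refine Continuous.subtype_mk (Continuous.prodMk (by fun_prop) (Continuous.subtype_mk ?_ _)) _
  exact MoorePath.continuous_map
    (f := fun p : BasedPairs n x₀ ε × BasedLoops n x₀ => (Θ.toFun p.2.1 : C^∞⟮𝓡 n, M; 𝓡 n, M⟯))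
    (Θ.continuous.comp (continuous_subtype_val.comp continuous_snd)) (by fun_prop)

theorem continuous_actPath :
    Continuous fun p : BasedPairs n x₀ ε × PathsFrom n x₀ => actPath Θ p.1 p.2 := by
  refine Continuous.subtype_mk (Continuous.prodMk (by fun_prop) (Continuous.subtype_mk ?_ _)) _
  exact MoorePath.continuous_map
    (f := fun p : BasedPairs n x₀ ε × PathsFrom n x₀ => (Θ.toFun p.2.1 : C^∞⟮𝓡 n, M; 𝓡 n, M⟯))
    (Θ.continuous.comp (continuous_subtype_val.comp continuous_snd)) (by fun_prop)

end Actions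

/-! ### Membership in the spaces of embeddings -/

section Membership

variable {n : ℕ} {M : Type u} [MetricSpace M] [ChartedSpace (EuclideanSpace ℝ (Fin n)) M]
  [IsManifold (𝓡 n) ∞ M] (o : OrientationForm n M) {x₀ : M} {ε : ℝ}

/-- An independent family of `n` vectors is a basis, and a nonzero top form does not vanish on
bases. Dimension zero, with its empty family, is treated apart. -/
theorem OrientationForm.form_ne_zero (x : M) (v : Fin n → TangentSpace (𝓡 n) x)
    (hv : LinearIndependent ℝ v) : o.form x v ≠ 0 := by
  have hc : Fintype.card (Fin n) = Module.finrank ℝ (TangentSpace (𝓡 n) x) := by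
    change _ = Module.finrank ℝ (EuclideanSpace ℝ (Fin n))
    simp
  cases isEmpty_or_nonempty (Fin n) with
  | inl h =>
    intro h0
    refine o.ne_zero x (AlternatingMap.ext fun w => ?_)
    rw [Subsingleton.elim w v, h0]
    rfl
  | inr h =>
    have := (o.form x).map_basis_ne_zero_iff (basisOfLinearIndependentOfCardEqFinrank hv hc)
    rw [coe_basisOfLinearIndependentOfCardEqFinrank] at this
    exact this.2 (o.ne_zero x)

theorem OrientationForm.linearIndependent_of_ne_zero (x : M) (v : Fin n → TangentSpace (𝓡 n) x)
    (hv : o.form x v ≠ 0) : LinearIndependent ℝ v := by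
  by_contra h
  exact hv ((o.form x).map_linearDependent v h)

/-- Along the truncations of `γ`, the form on the transported frame varies continuously and is never
zero. It is positive at the constant path, where the lift is the identity, and the half-line of
truncation lengths is connected. -/
theorem lift_form_pos (Θ : TransitiveDiffeoLift n M ε) (γ : MoorePath n M) (z : M)
    (v : Fin n → TangentSpace (𝓡 n) z) (hv : 0 < o.form z v) :
    0 < o.form (Θ.toFun γ z) fun i => mfderiv (𝓡 n) (𝓡 n) (Θ.toFun γ) z (v i) := by
  have hinj : ∀ s : NNReal, Function.Injective
      (mfderiv (𝓡 n) (𝓡 n) (Θ.toFun (γ.trunc s)) z) := fun s =>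
    (((Θ.toFun (γ.trunc s)).mfderivToContinuousLinearEquiv (by simp) z)).injective
  have hne : ∀ s : NNReal, o.form (Θ.toFun (γ.trunc s) z)
      (fun i => mfderiv (𝓡 n) (𝓡 n) (Θ.toFun (γ.trunc s)) z (v i)) ≠ 0 := fun s =>
    o.form_ne_zero _ _ ((o.linearIndependent_of_ne_zero z v hv.ne').map'
      (mfderiv (𝓡 n) (𝓡 n) (Θ.toFun (γ.trunc s)) z).toLinearMap
      (LinearMap.ker_eq_bot.2 (hinj s)))
  -- Continuity of an orientation form is formulated for parameter spaces in the universe of `M`,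
  -- hence `ULift`.
  have hΘ : Continuous fun s : ULift.{u} NNReal =>
      (Θ.toFun (γ.trunc s.down) : C^∞⟮𝓡 n, M; 𝓡 n, M⟯) :=
    Θ.continuous.comp (γ.continuous_trunc.comp continuous_uliftDown)
  have hcont : Continuous fun s : ULift.{u} NNReal => o.form (Θ.toFun (γ.trunc s.down) z)
      (fun i => mfderiv (𝓡 n) (𝓡 n) (Θ.toFun (γ.trunc s.down)) z (v i)) := by
    refine o.continuous (ULift.{u} NNReal) (fun s => Θ.toFun (γ.trunc s.down) z)
      (fun i s => mfderiv (𝓡 n) (𝓡 n) (Θ.toFun (γ.trunc s.down)) z (v i)) ?_ fun i => ?_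
    · exact continuous_smoothMap_eval.comp (hΘ.prodMk continuous_const)
    · exact (continuous_iterTangentMap_eval (J := 𝓡 n) (X := M) (J' := 𝓡 n) (Y := M) hΘ 1).comp
        (continuous_id.prodMk
          (continuous_const (y := (⟨z, v i⟩ : TangentBundle (𝓡 n) M))))
  have h0 : 0 < o.form (Θ.toFun (γ.trunc 0) z)
      (fun i => mfderiv (𝓡 n) (𝓡 n) (Θ.toFun (γ.trunc 0)) z (v i)) := by
    rw [γ.trunc_zero]
    have hid : (Θ.toFun (.const γ.src) : M → M) = id := funext (Θ.const γ.src)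
    rw [hid, mfderiv_id]
    exact hv
  have hpre : IsPreconnected (range fun s : ULift.{u} NNReal =>
      o.form (Θ.toFun (γ.trunc s.down) z)
      (fun i => mfderiv (𝓡 n) (𝓡 n) (Θ.toFun (γ.trunc s.down)) z (v i))) := by
    have : PreconnectedSpace (ULift.{u} NNReal) :=
      Homeomorph.ulift.symm.surjective.denseRange.preconnectedSpace (Homeomorph.ulift.symm.continuous)
    exact isPreconnected_range hcont
  by_contra hneg
  have hend : o.form (Θ.toFun (γ.trunc ⟨γ.len, γ.len_nonneg⟩) z)
      (fun i => mfderiv (𝓡 n) (𝓡 n) (Θ.toFun (γ.trunc ⟨γ.len, γ.len_nonneg⟩)) z (v i)) ≤ 0 := by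
    rw [γ.trunc_len]
    exact not_lt.1 hneg
  obtain ⟨s, hs⟩ := hpre.ordConnected.out ⟨⟨⟨γ.len, γ.len_nonneg⟩⟩, rfl⟩ ⟨⟨0⟩, rfl⟩ ⟨hend, h0.le⟩
  exact hne s.down hs

end Membership

/-! ### Lifts of paths and composites in the spaces of embeddings -/

section Membership

variable {n : ℕ} {M : Type u} [MetricSpace M] [ChartedSpace (EuclideanSpace ℝ (Fin n)) M]
  [IsManifold (𝓡 n) ∞ M] (o : OrientationForm n M) {x₀ : M} {ε : ℝ}

theorem contMDiff_nbhd_val : ContMDiff (𝓡 n) (𝓡 n) ∞ (Subtype.val : nbhd x₀ ε → M) :=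
  contMDiff_subtype_val

theorem contMDiff_val_comp (φ : SelfMaps n x₀ ε) :
    ContMDiff (𝓡 n) (𝓡 n) ∞ fun z => (φ z : M) :=
  contMDiff_nbhd_val.comp φ.contMDiff

theorem contMDiff_snd_comp (φ : DiagMaps n x₀ ε) :
    ContMDiff (𝓡 n) (𝓡 n) ∞ fun z => (φ z).1.2 :=
  contMDiff_snd.comp (contMDiff_subtype_val.comp φ.contMDiff)

theorem mfderiv_comp_selfMap {E : Type} [NormedAddCommGroup E] [NormedSpace ℝ E] {H : Type}
    [TopologicalSpace H] {J : ModelWithCorners ℝ E H} {Y : Type u} [TopologicalSpace Y]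
    [ChartedSpace H Y] {f : nbhd x₀ ε → Y} (hf : ContMDiff (𝓡 n) J ∞ f) (φ : SelfMaps n x₀ ε)
    (z : nbhd x₀ ε) (v : TangentSpace (𝓡 n) z) :
    mfderiv (𝓡 n) J (fun z => f (φ z)) z v =
      mfderiv (𝓡 n) J f (φ z) (mfderiv (𝓡 n) (𝓡 n) φ z v) := by
  have := mfderiv_comp z (hf.mdifferentiable (by simp) (φ z)) (φ.mdifferentiableAt (x := z))
  exact congrArg (fun L => L v) this

theorem preservesOrientation_lift (Θ : TransitiveDiffeoLift n M ε) (γ : MoorePath n M) :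
    PreservesOrientation o fun z : nbhd x₀ ε => Θ.toFun γ z := by
  intro z v hv
  have h := lift_form_pos o Θ γ z _ hv
  have hd : ∀ i, mfderiv (𝓡 n) (𝓡 n) (fun z : nbhd x₀ ε => Θ.toFun γ z) z (v i) =
      mfderiv (𝓡 n) (𝓡 n) (Θ.toFun γ) z
        (mfderiv (𝓡 n) (𝓡 n) (Subtype.val : nbhd x₀ ε → M) z (v i)) := fun i => by
    have := mfderiv_comp z ((Θ.toFun γ).contMDiff.mdifferentiable (by simp) (z : M))
      (contMDiff_nbhd_val.mdifferentiable (by simp) z)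
    exact congrArg (fun L => L (v i)) this
  simp only [hd]
  exact h

theorem isEmbedding_lift (Θ : TransitiveDiffeoLift n M ε) (γ : MoorePath n M) :
    IsEmbedding fun z : nbhd x₀ ε => Θ.toFun γ z :=
  (Θ.toFun γ).toHomeomorph.isEmbedding.comp IsEmbedding.subtypeVal

/-- The derivative of a local smooth left inverse is a left inverse of the derivative. -/
theorem injective_mfderiv_subtypeVal (z : nbhd x₀ ε) :
    Function.Injective (mfderiv (𝓡 n) (𝓡 n) (Subtype.val : nbhd x₀ ε → M) z) := by
  obtain ⟨V, g, hV, hz, hg, hgf⟩ := (hasLocalRetraction_subtypeVal (J := 𝓡 n) (nbhd x₀ ε)).2 z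
  have h1 : MDifferentiableAt (𝓡 n) (𝓡 n) g (z : M) :=
    (hg.contMDiffAt (hV.mem_nhds hz)).mdifferentiableAt (by simp)
  have h2 := mfderiv_comp z h1
    (contMDiff_nbhd_val.mdifferentiable (by simp) z)
  have h3 : g ∘ (Subtype.val : nbhd x₀ ε → M) =ᶠ[𝓝 z] id := by
    filter_upwards [(hV.preimage continuous_subtype_val).mem_nhds hz] with x hx using hgf x hx
  rw [h3.mfderiv_eq, mfderiv_id] at h2
  intro v w hvw
  have e := fun u => congrArg (fun L => L u) h2
  exact (e v).trans ((congrArg (mfderiv (𝓡 n) (𝓡 n) g (z : M)) hvw).trans (e w).symm)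

theorem injective_mfderiv_lift (Θ : TransitiveDiffeoLift n M ε) (γ : MoorePath n M)
    (z : nbhd x₀ ε) :
    Function.Injective (mfderiv (𝓡 n) (𝓡 n) (fun z : nbhd x₀ ε => Θ.toFun γ z) z) := by
  have h := mfderiv_comp z ((Θ.toFun γ).contMDiff.mdifferentiable (by simp) (z : M))
    (contMDiff_nbhd_val.mdifferentiable (by simp) z)
  have h1 : Function.Injective (mfderiv (𝓡 n) (𝓡 n) (Θ.toFun γ) (z : M)) :=
    ((Θ.toFun γ).mfderivToContinuousLinearEquiv (by simp) (z : M)).injective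
  have h2 := h1.comp (injective_mfderiv_subtypeVal z)
  intro v w hvw
  exact h2 ((congrArg (fun L => L v) h).symm.trans (hvw.trans (congrArg (fun L => L w) h)))

/-- Reduces injectivity of the derivatives of `Θ₀` and `Θ₁` to that of the lift with values in `M`.
-/
theorem injective_mfderiv_of_comp {E F : Type} [NormedAddCommGroup E] [NormedSpace ℝ E]
    [NormedAddCommGroup F] [NormedSpace ℝ F] {H H' : Type} [TopologicalSpace H]
    [TopologicalSpace H'] {J : ModelWithCorners ℝ E H} {J' : ModelWithCorners ℝ F H'}
    {X Y : Type u} [TopologicalSpace X] [ChartedSpace H X] [TopologicalSpace Y]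
    [ChartedSpace H' Y] {f : nbhd x₀ ε → X} {g : X → Y} {z : nbhd x₀ ε}
    (hg : MDifferentiableAt J J' g (f z)) (hf : MDifferentiableAt (𝓡 n) J f z)
    (h : Function.Injective (mfderiv (𝓡 n) J' (fun z => g (f z)) z)) :
    Function.Injective (mfderiv (𝓡 n) J f z) := by
  have e := mfderiv_comp z hg hf
  intro v w hvw
  refine h ?_
  exact (congrArg (fun L => L v) e).trans
    ((congrArg (mfderiv J J' g (f z)) hvw).trans (congrArg (fun L => L w) e).symm)

theorem mem_embPlus_comp {φ ψ : SelfMaps n x₀ ε} (hφ : φ ∈ EmbPlus o x₀ ε)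
    (hψ : ψ ∈ EmbPlus o x₀ ε) : φ.comp ψ ∈ EmbPlus o x₀ ε := by
  refine ⟨hφ.1.comp hψ.1, fun z v w hvw => ?_, fun z hz => hφ.2.2.1 _ (hψ.2.2.1 z hz),
    hφ.2.2.2.1.comp hψ.2.2.2.1, fun z v hv => ?_⟩
  · refine hψ.2.1 z (hφ.2.1 (ψ z) ?_)
    exact (mfderiv_comp_selfMap φ.contMDiff ψ z v).symm.trans
      (hvw.trans (mfderiv_comp_selfMap φ.contMDiff ψ z w))
  · have h1 := hψ.2.2.2.2 z v hv
    have e1 := fun i => mfderiv_comp_selfMap contMDiff_nbhd_val ψ z (v i)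
    simp only [e1] at h1
    have h2 := hφ.2.2.2.2 (ψ z) _ h1
    have e2 := fun i => mfderiv_comp_selfMap (contMDiff_val_comp φ) ψ z (v i)
    change 0 < o.form _ fun i => mfderiv (𝓡 n) (𝓡 n) (fun z => (φ (ψ z) : M)) z (v i)
    simp only [e2]
    exact h2

theorem mem_hcEmb_comp {φ : DiagMaps n x₀ ε} {ψ : SelfMaps n x₀ ε} (hφ : φ ∈ HCEmb o x₀ ε)
    (hψ : ψ ∈ EmbPlus o x₀ ε) : φ.comp ψ ∈ HCEmb o x₀ ε := by
  obtain ⟨x, hx, hx'⟩ := hφ.2.2.1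
  refine ⟨hφ.1.comp hψ.1, fun z v w hvw => ?_,
    ⟨x, fun z => hx _, fun z hz => hx' _ (hψ.2.2.1 z hz)⟩,
    hφ.2.2.2.1.comp hψ.2.2.2.1, fun z v hv => ?_⟩
  · refine hψ.2.1 z (hφ.2.1 (ψ z) ?_)
    exact (mfderiv_comp_selfMap φ.contMDiff ψ z v).symm.trans
      (hvw.trans (mfderiv_comp_selfMap φ.contMDiff ψ z w))
  · have h1 := hψ.2.2.2.2 z v hv
    have e1 := fun i => mfderiv_comp_selfMap contMDiff_nbhd_val ψ z (v i)
    simp only [e1] at h1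
    have h2 := hφ.2.2.2.2 (ψ z) _ h1
    have e2 := fun i => mfderiv_comp_selfMap (contMDiff_snd_comp φ) ψ z (v i)
    change 0 < o.form _ fun i => mfderiv (𝓡 n) (𝓡 n) (fun z => (φ (ψ z)).1.2) z (v i)
    simp only [e2]
    exact h2

theorem iotaMap_comp_mem_hcEmb {φ : SelfMaps n x₀ ε} (hφ : φ ∈ EmbPlus o x₀ ε) :
    (iotaMap x₀ ε : DiagMaps n x₀ ε).comp φ ∈ HCEmb o x₀ ε := by
  have hi : IsEmbedding (iotaMap x₀ ε : DiagMaps n x₀ ε) := by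
    refine IsEmbedding.of_comp (iotaMap x₀ ε : DiagMaps n x₀ ε).contMDiff.continuous
      (g := fun p : diagNbhd M ε => p.1.2) (by fun_prop) ?_
    exact IsEmbedding.subtypeVal
  refine ⟨hi.comp hφ.1, fun z => ?_, ⟨x₀, fun _ => rfl, fun z hz => hφ.2.2.1 z hz⟩,
    fun z hz => hφ.2.2.2.1 hz, hφ.2.2.2.2⟩
  have h1 : MDifferentiableAt ((𝓡 n).prod (𝓡 n)) (𝓡 n) (fun p : diagNbhd M ε => p.1.2)
      ((iotaMap x₀ ε : DiagMaps n x₀ ε).comp φ z) :=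
    (contMDiff_snd.comp contMDiff_subtype_val : ContMDiff ((𝓡 n).prod (𝓡 n)) (𝓡 n) ∞
      fun p : diagNbhd M ε => p.1.2).mdifferentiable (by simp) _
  refine injective_mfderiv_of_comp h1 (ContMDiffMap.mdifferentiableAt _) ?_
  have h2 := mfderiv_comp z (contMDiff_nbhd_val.mdifferentiable (by simp) (φ z)) (φ.mdifferentiableAt (x := z))
  have h3 := (injective_mfderiv_subtypeVal (n := n) (φ z)).comp (hφ.2.1 z)
  intro v w hvw
  exact h3 ((congrArg (fun L => L v) h2).symm.trans (hvw.trans (congrArg (fun L => L w) h2)))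

variable [RiemannianBundle (fun x : M => TangentSpace (𝓡 n) x)]

theorem iotaMap_comp_mem_hcsoEmb {φ : SelfMaps n x₀ ε} (hφ : φ ∈ SOEmb o x₀ ε) :
    (iotaMap x₀ ε : DiagMaps n x₀ ε).comp φ ∈ HCSOEmb o x₀ ε := by
  obtain ⟨h, L, hL, hL'⟩ := hφ
  exact ⟨iotaMap_comp_mem_hcEmb o h, x₀, fun _ => rfl, L, hL, hL'⟩

theorem thetaZero_mem (hε : 0 < ε) (hr : ENNReal.ofReal (2 * ε) < injRadius n M)
    (Θ : TransitiveDiffeoLift n M ε) (p : BasedLoops n x₀) : thetaZero Θ p ∈ EmbPlus o x₀ ε := by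
  refine ⟨IsEmbedding.of_comp (thetaZero (ε := ε) Θ p).contMDiff.continuous continuous_subtype_val
    (isEmbedding_lift Θ p.1), fun z => ?_, fun z hz => ?_, fun z hz => ?_,
    preservesOrientation_lift o Θ p.1⟩
  · exact injective_mfderiv_of_comp (contMDiff_nbhd_val.mdifferentiable (by simp) _) (ContMDiffMap.mdifferentiableAt _)
      (injective_mfderiv_lift Θ p.1 z)
  · have h := Θ.endpoint p.1
    rw [p.2.1, p.2.2] at h
    change Θ.toFun p.1 z = x₀
    rw [hz, h]
  · have h := dist_le_of_dist_le hε hr (Θ.toFun p.1).continuous (Θ.far p.1)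
      (z := (z : M)) (by rw [p.2.1]; exact hz)
    rw [p.2.2] at h
    exact h

theorem thetaOne_mem (hε : 0 < ε) (hr : ENNReal.ofReal (2 * ε) < injRadius n M)
    (Θ : TransitiveDiffeoLift n M ε) (p : PathsFrom n x₀) : thetaOne Θ p ∈ HCEmb o x₀ ε := by
  refine ⟨IsEmbedding.of_comp (thetaOne (ε := ε) Θ p).contMDiff.continuous
    (g := fun q : diagNbhd M ε => q.1.2) (by fun_prop) (isEmbedding_lift Θ p.1), fun z => ?_,
    ⟨p.1.tgt, fun _ => rfl, fun z hz => ?_⟩, fun z hz => ?_, preservesOrientation_lift o Θ p.1⟩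
  · exact injective_mfderiv_of_comp (g := fun q : diagNbhd M ε => q.1.2)
      ((contMDiff_snd.comp contMDiff_subtype_val : ContMDiff ((𝓡 n).prod (𝓡 n)) (𝓡 n) ∞
        fun p : diagNbhd M ε => p.1.2).mdifferentiable (by simp) _)
      (ContMDiffMap.mdifferentiableAt _) (injective_mfderiv_lift Θ p.1 z)
  · have h := Θ.endpoint p.1
    rw [p.2] at h
    change Θ.toFun p.1 z = p.1.tgt
    rw [hz, h]
  · exact dist_le_of_dist_le hε hr (Θ.toFun p.1).continuous (Θ.far p.1)
      (z := (z : M)) (by rw [p.2]; exact hz)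

end Membership

/-! ### Chains of monoids and of their actions -/

section Monoid

variable {X Ω : Type*} [TopologicalSpace X] [TopologicalSpace Ω] {mul : Ω → Ω → Ω} {one : Ω}

theorem crossChains_one {act : X → Ω → X} (hone : ∀ x, act x one = x) {A : Set X}
    (hA : ∀ x ∈ A, ∀ a, act x a ∈ A) (x : Chains A) :
    crossChains A A act hA x (cubeClass ∅ 0 fun _ => one) = x := by
  suffices h : (crossChains A A act hA).flip (cubeClass ∅ 0 fun _ => one) = LinearMap.id from
    LinearMap.congr_fun h x
  refine chains_hom_ext fun κ => ?_
  rw [LinearMap.flip_apply, cubeClass_of continuous_const fun _ _ _ => rfl, crossChains,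
    liftChains_cls, liftChains_cls, LinearMap.id_apply, ← κ.cubeClass_eq]
  congr 1
  funext v
  exact hone _

theorem one_crossChains (hone : ∀ a, mul one a = a)
    (hmul : ∀ x ∈ (∅ : Set Ω), ∀ y, mul x y ∈ (∅ : Set Ω)) (x : Chains (∅ : Set Ω)) :
    crossChains ∅ ∅ mul hmul (cubeClass ∅ 0 fun _ => one) x = x := by
  suffices h : crossChains ∅ ∅ mul hmul (cubeClass ∅ 0 fun _ => one) = LinearMap.id from
    LinearMap.congr_fun h x
  refine chains_hom_ext fun κ => ?_
  rw [cubeClass_of continuous_const fun _ _ _ => rfl, crossChains, liftChains_cls, liftChains_cls,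
    LinearMap.id_apply, ← κ.cubeClass_eq]
  rw [show 0 + κ.dim = κ.dim from zero_add _]
  congr 1
  funext v
  exact hone _

theorem isDGAlgebra_crossChains (hc : Continuous fun p : Ω × Ω => mul p.1 p.2)
    (hmul : ∀ x ∈ (∅ : Set Ω), ∀ y, mul x y ∈ (∅ : Set Ω))
    (hassoc : ∀ a b c, mul (mul a b) c = mul a (mul b c)) (h₁ : ∀ a, mul one a = a)
    (h₂ : ∀ a, mul a one = a) :
    IsDGAlgebra (chainsOfDegree ∅) (chainD ∅) (crossChains ∅ ∅ mul hmul)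
      (cubeClass ∅ 0 fun _ => one) where
  toIsComplex := isComplex_chains ∅
  one_mem := cubeClass_mem_chainsOfDegree ∅ 0 _
  mul_mem i j x hx y hy := crossChains_mem hmul i j x hx y hy
  one_mul := one_crossChains h₁ hmul
  mul_one := crossChains_one h₂ hmul
  mul_assoc := crossChains_assoc hc hc hc hc hmul hmul hmul hmul hassoc
  leibniz := crossChains_leibniz hc hmul

theorem isDGModule_crossChains (hc : Continuous fun p : Ω × Ω => mul p.1 p.2)
    (hmul : ∀ x ∈ (∅ : Set Ω), ∀ y, mul x y ∈ (∅ : Set Ω)) {act : X → Ω → X}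
    (hac : Continuous fun p : X × Ω => act p.1 p.2) {A : Set X} (hA : ∀ x ∈ A, ∀ a, act x a ∈ A)
    (h₁ : ∀ x, act x one = x) (h₂ : ∀ x a b, act (act x a) b = act x (mul a b)) :
    IsDGModule (chainsOfDegree ∅) (chainD ∅) (crossChains ∅ ∅ mul hmul)
      (cubeClass ∅ 0 fun _ => one) (chainsOfDegree A) (chainD A) (crossChains A A act hA) where
  toIsComplex := isComplex_chains A
  act_mem i j x hx y hy := crossChains_mem hA i j x hx y hy
  act_one := crossChains_one h₁ hA
  act_mul := crossChains_assoc hac hac hc hac hA hA hmul hA h₂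
  leibniz := crossChains_leibniz hac hA

theorem Cube.subset_or_subset_of_closed {C D : Set X} (hC : IsClosed C) (hD : IsClosed D)
    (hCD : Disjoint C D) (κ : Cube X) (h : ∀ v, κ.toFun v ∈ C ∪ D) :
    (∀ v, κ.toFun v ∈ C) ∨ ∀ v, κ.toFun v ∈ D := by
  have hr : IsPreconnected (range κ.toFun) := isPreconnected_range κ.continuous
  have := isPreconnected_iff_subset_of_disjoint_closed.1 hr C D hC hD
    (by rintro _ ⟨v, rfl⟩; exact h v) (by rw [hCD.inter_eq, inter_empty])
  exact this.imp (fun h v => h ⟨v, rfl⟩) fun h v => h ⟨v, rfl⟩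

theorem pushChains_cubeClass {Y : Type*} [TopologicalSpace Y] {A : Set X} {B : Set Y} {f : X → Y}
    (hf : MapsTo f A B) {k : ℕ} {g : (ℕ → I) → X} (hg : Continuous g)
    (hk : ∀ v w : ℕ → I, (∀ i < k, v i = w i) → g v = g w) :
    pushChains A B f hf (cubeClass A k g) = cubeClass B k fun v => f (g v) := by
  rw [cubeClass_of hg hk, pushChains_cls]

end Monoid

/-! ### The transport data of a transitive diffeomorphism lift -/

section Concrete

variable {n : ℕ} {M : Type u} [MetricSpace M] [ChartedSpace (EuclideanSpace ℝ (Fin n)) M]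
  [IsManifold (𝓡 n) ∞ M] {x₀ : M} {ε : ℝ}

theorem dist_evBased_of_mem_h {p : BasedPairs n x₀ ε} (hp : p ∈ hBased n x₀ ε) :
    dist x₀ (evBased p : M) = 0 := by
  change dist x₀ (p.1.2.1.toFun (p.1.1 * p.1.2.1.len)) = 0
  rw [dist_eq_zero]
  rcases hp with h | h | h
  · rw [h, Icc.coe_zero, zero_mul]
    exact p.1.2.2.1.symm
  · rw [h, Icc.coe_one, one_mul]
    exact p.1.2.2.2.symm
  · rw [h, mul_zero]
    exact p.1.2.2.1.symm

theorem dist_evFree_of_mem_h {p : FreePairs n M ε} (hp : p ∈ hFree n M ε) :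
    dist (evFree p).1.1 (evFree p).1.2 = 0 := by
  change dist p.1.2.1.src (p.1.2.1.toFun (p.1.1 * p.1.2.1.len)) = 0
  rw [dist_eq_zero]
  rcases hp with h | h | h
  · rw [h, Icc.coe_zero, zero_mul]
    rfl
  · rw [h, Icc.coe_one, one_mul]
    exact p.1.2.2
  · rw [h, mul_zero]
    rfl

/-- On `𝓗` the evaluation is the base point, at distance `0 < ε / 2`. So the two parts of the
relative subspace are disjoint closed sets, and a cube, being connected, lies in one of them. -/
theorem cube_aBased (hε : 0 < ε) (α : Cube (BasedPairs n x₀ ε))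
    (h : ∀ v, α.toFun v ∈ aBased n x₀ ε) :
    (∀ v, α.toFun v ∈ hBased n x₀ ε) ∨ ∀ v, evBased (α.toFun v) ∈ nbhdFar x₀ ε := by
  have ht : Continuous fun p : BasedPairs n x₀ ε => p.1.1 := by fun_prop
  have hl : Continuous fun p : BasedPairs n x₀ ε => p.1.2.1.len :=
    MoorePath.continuous_len.comp (by fun_prop)
  refine α.subset_or_subset_of_closed (D := evBased ⁻¹' nbhdFar x₀ ε) ?_ ?_ ?_ h
  · exact (isClosed_eq ht continuous_const).union
      ((isClosed_eq ht continuous_const).union (isClosed_eq hl continuous_const))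
  · exact (isClosed_le continuous_const (continuous_const.dist continuous_subtype_val)).preimage
      continuous_evBased
  · refine disjoint_left.2 fun p hp hp' => ?_
    have : ε / 2 ≤ dist x₀ (evBased p : M) := hp'
    rw [dist_evBased_of_mem_h hp] at this
    linarith

theorem cube_aFree (hε : 0 < ε) (α : Cube (FreePairs n M ε))
    (h : ∀ v, α.toFun v ∈ aFree n M ε) :
    (∀ v, α.toFun v ∈ hFree n M ε) ∨ ∀ v, evFree (α.toFun v) ∈ diagFar M ε := by
  have ht : Continuous fun p : FreePairs n M ε => p.1.1 := by fun_prop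
  have hl : Continuous fun p : FreePairs n M ε => p.1.2.1.len :=
    MoorePath.continuous_len.comp (by fun_prop)
  refine α.subset_or_subset_of_closed (D := evFree ⁻¹' diagFar M ε) ?_ ?_ ?_ h
  · exact (isClosed_eq ht continuous_const).union
      ((isClosed_eq ht continuous_const).union (isClosed_eq hl continuous_const))
  · exact (isClosed_le (f := fun _ : diagNbhd M ε => ε / 2) (g := fun p => dist p.1.1 p.1.2)
      continuous_const (by fun_prop)).preimage continuous_evFree
  · refine disjoint_left.2 fun p hp hp' => ?_
    have : ε / 2 ≤ dist (evFree p).1.1 (evFree p).1.2 := hp'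
    rw [dist_evFree_of_mem_h hp] at this
    linarith

variable [RiemannianBundle (fun x : M => TangentSpace (𝓡 n) x)]
  [IsContinuousRiemannianBundle (EuclideanSpace ℝ (Fin n)) (fun x : M => TangentSpace (𝓡 n) x)]
  [CompactSpace M] {o : OrientationForm n M} (hε : 0 < ε)
  (hr : ENNReal.ofReal (2 * ε) < injRadius n M) (Θ : TransitiveDiffeoLift n M ε)
  (H : EmbHomotopy o x₀ ε)

/-- The based loops acting on the pairs `(t, γ)` over `U_{x₀}`. -/
noncomputable def loopFibreData : FibreData (BasedPairs n x₀ ε) (BasedLoops n x₀) (nbhd x₀ ε)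
    {φ : SelfMaps n x₀ ε // φ ∈ EmbPlus o x₀ ε} where
  mul := loopMul
  one := loopOne x₀
  act := actLoop Θ
  e := evBased
  θ := fun a => ⟨thetaZero Θ a, thetaZero_mem o hε hr Θ a⟩
  ev := fun f u => f.1 u
  comp := fun f g => ⟨f.1.comp g.1, mem_embPlus_comp o f.2 g.2⟩
  id := ⟨ContMDiffMap.id, thetaZero_one Θ ▸ thetaZero_mem o hε hr Θ (loopOne x₀)⟩
  H := fun t f => ⟨H.toFun t f.1, H.mem t f.1 f.2⟩
  continuous_mul := continuous_loopMul
  continuous_act := continuous_actLoop Θ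
  continuous_e := continuous_evBased
  continuous_θ := (continuous_thetaZero Θ).subtype_mk _
  continuous_ev := continuous_smoothMap_eval.comp
    ((continuous_subtype_val.comp continuous_fst).prodMk continuous_snd)
  continuous_comp := (continuous_smoothMap_comp.comp ((continuous_subtype_val.comp
    continuous_fst).prodMk (continuous_subtype_val.comp continuous_snd))).subtype_mk _
  continuous_H := (H.continuousOn.comp_continuous (continuous_fst.prodMk
    (continuous_subtype_val.comp continuous_snd)) fun p => ⟨mem_univ _, p.2.2⟩).subtype_mk _
  mul_assoc := loopMul_assoc
  mul_one := loopMul_one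
  act_one := actLoop_one Θ
  act_mul := actLoop_actLoop Θ
  e_act := evBased_actLoop Θ
  θ_mul := fun a b => Subtype.ext (thetaZero_loopMul Θ a b)
  ev_id := fun _ => rfl
  ev_comp := fun _ _ _ => rfl
  id_comp := fun _ => rfl
  comp_id := fun _ => rfl
  comp_assoc := fun _ _ _ => rfl
  H_one := fun f => Subtype.ext (H.one f.1 f.2)
  H_comp := fun t f g => Subtype.ext (H.comp t f.1 f.2 g.1 g.2)

/-- The paths that start at `x₀`, which map the pairs `(t, γ)` over `U_{x₀}` to pairs over
`U_Δ`. -/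
noncomputable def loopPathData (K : HCHomotopy H) :
    PathData (loopFibreData hε hr Θ H) (PathsFrom n x₀) (FreePairs n M ε) (diagNbhd M ε)
      {φ : DiagMaps n x₀ ε // φ ∈ HCEmb o x₀ ε} where
  mul := loopPath
  act := actPath Θ
  e := evFree
  θ := fun p => ⟨thetaOne Θ p, thetaOne_mem o hε hr Θ p⟩
  ev := fun f u => f.1 u
  comp := fun f g => ⟨f.1.comp g.1, mem_hcEmb_comp o f.2 g.2⟩
  H := fun t f => ⟨K.toFun t f.1, K.mem t f.1 f.2⟩
  ι := iotaMap (n := n) x₀ ε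
  continuous_mul := continuous_loopPath
  continuous_act := continuous_actPath Θ
  continuous_e := continuous_evFree
  continuous_θ := (continuous_thetaOne Θ).subtype_mk _
  continuous_ev := continuous_smoothMap_eval.comp
    ((continuous_subtype_val.comp continuous_fst).prodMk continuous_snd)
  continuous_comp := (continuous_smoothMap_comp.comp ((continuous_subtype_val.comp
    continuous_fst).prodMk (continuous_subtype_val.comp continuous_snd))).subtype_mk _
  continuous_H := (K.continuousOn.comp_continuous (continuous_fst.prodMk
    (continuous_subtype_val.comp continuous_snd)) fun p => ⟨mem_univ _, p.2.2⟩).subtype_mk _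
  mul_assoc := loopPath_assoc
  one_mul := fun p => Subtype.ext (MoorePath.const_concat p.1 x₀ p.2.symm)
  act_mul := actPath_actLoop Θ
  e_act := evFree_actPath Θ
  θ_mul := fun a p => Subtype.ext (thetaOne_loopPath Θ a p)
  ev_comp := fun _ _ _ => rfl
  comp_id := fun _ => rfl
  comp_assoc := fun _ _ _ => rfl
  H_one := fun f => Subtype.ext (K.one f.1 f.2)
  H_comp := fun t f g => Subtype.ext (K.comp t f.1 f.2 g.1 g.2)

/-- The based loops among the paths that start at `x₀`. -/
noncomputable def loopRestriction (K : HCHomotopy H) :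
    (loopPathData hε hr Θ H K).Restriction where
  incl := pairIncl
  loop := loopToPath
  push := fun f => ⟨(iotaMap x₀ ε).comp f.1, iotaMap_comp_mem_hcEmb o f.2⟩
  continuous_incl := continuous_pairIncl
  continuous_loop := continuous_loopToPath
  e_incl := evFree_pairIncl
  act_loop := pairIncl_actLoop Θ
  mul_loop := fun _ _ => rfl
  θ_loop := fun a => Subtype.ext (thetaOne_loopToPath Θ a)
  comp_push := fun _ _ => rfl
  H_push := fun t f => Subtype.ext (K.extends_base t f.1 f.2)
  ev_push := fun _ _ => rfl

/-- The abstract recursion is the concrete one carried out in the subtype of embeddings; forgetting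
membership identifies them. -/
theorem homFront_loopFibreData (J : Finset ℕ) (s : ℕ) (L : List (Cube (BasedLoops n x₀)))
    (v : ℕ → I) : ((loopFibreData hε hr Θ H).homFront J s L v).1 =
      homotopyCube H (frontFaces Θ J s L) v := by
  induction L generalizing s v with
  | nil => rfl
  | cons κ L ih =>
    rw [frontFaces, homotopyCube, ← ih]
    rfl

theorem prodCoords_loopFibreData (L : List (Cube (BasedLoops n x₀))) (v : ℕ → I) :
    (loopFibreData hε hr Θ H).prodCoords L v = prodLoops L v := by
  induction L generalizing v with
  | nil => rfl
  | cons κ L ih =>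
    rw [prodLoops, ← ih]
    rfl

theorem homFront_loopPathData (K : HCHomotopy H) (J : Finset ℕ) (p : Cube (PathsFrom n x₀))
    (s : ℕ) (L : List (Cube (BasedLoops n x₀))) (v : ℕ → I) :
    ((loopPathData hε hr Θ H K).homFront J p s L v).1 = hcHomotopyCube K
      (fun w => thetaOne Θ (frontFace (block J (s + totalDim L) p.dim) p.toFun w))
      (frontFaces Θ J s L) v := by
  induction L generalizing s v with
  | nil => rfl
  | cons κ L ih =>
    rw [frontFaces, hcHomotopyCube, totalDim, ← add_assoc, ← ih]
    rfl

theorem prodCoords_loopPathData (K : HCHomotopy H) (p : Cube (PathsFrom n x₀))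
    (L : List (Cube (BasedLoops n x₀))) (v : ℕ → I) :
    (loopPathData hε hr Θ H K).prodCoords p L v = prodPath p L v := by
  induction L generalizing v with
  | nil => rfl
  | cons κ L ih =>
    rw [prodPath, ← ih]
    rfl

theorem higher_loopFibreData (τ : Chains (nbhdFar x₀ ε) →ₗ[ℝ] ℝ)
    (α : Cube (BasedPairs n x₀ ε)) (L : List (Cube (BasedLoops n x₀))) :
    (loopFibreData hε hr Θ H).higher τ (hBased n x₀ ε) α L = higherMap Θ H τ α L := by
  rw [FibreData.higher_eq_sum, higherMap]
  simp only [prodCoords_loopFibreData, ← homFront_loopFibreData hε hr Θ H]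
  rfl

theorem higher_loopPathData (K : HCHomotopy H) (τ : Chains (diagFar M ε) →ₗ[ℝ] ℝ)
    (α : Cube (BasedPairs n x₀ ε)) (L : List (Cube (BasedLoops n x₀)))
    (p : Cube (PathsFrom n x₀)) :
    (loopPathData hε hr Θ H K).higher τ (hFree n M ε) α L p = freeHigherMap Θ K τ α L p := by
  rw [PathData.higher_eq_sum, freeHigherMap]
  simp only [prodCoords_loopPathData, ← homFront_loopPathData hε hr Θ H, countBefore_append,
    sum_dims, signExponent_eq]
  rfl

/-- Composition with `ι` turns orthogonal embeddings into orthogonal half-constant ones, so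
invariance of the larger kind contains the smaller. -/
theorem IsHCInvariant.comp_pushChains {τ : Chains (diagFar M ε) →ₗ[ℝ] ℝ}
    (h : IsHCInvariant o (x₀ := x₀) τ) :
    IsSOInvariant o (τ ∘ₗ pushChains _ _ _ (mapsTo_iota (n := n) (x₀ := x₀) (ε := ε))) := by
  intro κ ψ hψ
  have hc : Continuous fun v : ℕ → I => ψ.toFun (shift κ.dim v) (κ.toFun v) :=
    continuous_smoothMap_eval.comp
      ((ψ.continuous.comp (continuous_shift _)).prodMk κ.continuous)
  have hd : ∀ v w : ℕ → I, (∀ i < κ.dim + ψ.dim, v i = w i) →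
      ψ.toFun (shift κ.dim v) (κ.toFun v) = ψ.toFun (shift κ.dim w) (κ.toFun w) := by
    intro v w hvw
    rw [κ.depends v w fun i hi => hvw i (by omega),
      ψ.depends (shift κ.dim v) (shift κ.dim w) fun i hi => hvw _ (by omega)]
  rw [LinearMap.comp_apply, LinearMap.comp_apply, pushChains_cubeClass _ hc hd,
    pushChains_cubeClass _ κ.continuous fun v w hvw => κ.depends v w fun i hi => hvw i (by omega)]
  exact h κ (ψ.map (fun φ => (iotaMap x₀ ε).comp φ) continuous_iotaMap_comp)
    fun v => iotaMap_comp_mem_hcsoEmb o (hψ v)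

theorem exists_loop_higher (τ : Chains (nbhdFar x₀ ε) →ₗ[ℝ] ℝ) (k : ℕ) :
    ∃ q : Chains (aBased n x₀ ε) →ₗ[ℝ]
        MultilinearMap ℝ (fun _ : Fin k => Chains (∅ : Set (BasedLoops n x₀)))
          (Chains (hBased n x₀ ε)),
      ∀ α l, q (α.cls _) (fun r => (l r).cls ∅) =
        (loopFibreData hε hr Θ H).higher τ (hBased n x₀ ε) α (List.ofFn l) :=
  (loopFibreData hε hr Θ H).exists_higher τ one_loopMul (cube_aBased hε) (actLoop_mem_h Θ)
    -- The component of membership in `EmbPlus` that says that the far set is preserved.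
    (fun f => f.2.2.2.2.1) k

theorem isAInfinityMorphism_loop {τ : Chains (nbhdFar x₀ ε) →ₗ[ℝ] ℝ} (hτ : IsRelCocycle n τ)
    (hinv : IsSOInvariant o τ)
    (q : ∀ k : ℕ, Chains (aBased n x₀ ε) →ₗ[ℝ]
        MultilinearMap ℝ (fun _ : Fin k => Chains (∅ : Set (BasedLoops n x₀)))
          (Chains (hBased n x₀ ε)))
    (hq : ∀ k α l, q k (α.cls _) (fun r => (l r).cls ∅) =
        (loopFibreData hε hr Θ H).higher τ (hBased n x₀ ε) α (List.ofFn l)) :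
    IsAInfinityMorphism (chainsOfDegree ∅) (chainD ∅) (loopMulC n x₀)
      (chainsOfDegree _) (chainD _) (actLoopA Θ hε hr)
      (chainsOfDegree _) (chainD _) (actLoopH Θ) (-n) q :=
  (loopFibreData hε hr Θ H).isAInfinityMorphism τ one_loopMul
    (S₀ := {f | f.1 ∈ SOEmb o x₀ ε}) (fun f => H.zero f.1 f.2)
    (fun κ ψ hψ => hinv κ (ψ.map Subtype.val continuous_subtype_val) hψ) hτ (fun _ h => h.elim)
    (actLoop_mem_a Θ hε hr) (actLoop_mem_h Θ) q hq

theorem loop_higher_zero {τ : Chains (nbhdFar x₀ ε) →ₗ[ℝ] ℝ}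
    {q : Chains (aBased n x₀ ε) →ₗ[ℝ]
        MultilinearMap ℝ (fun _ : Fin 0 => Chains (∅ : Set (BasedLoops n x₀)))
          (Chains (hBased n x₀ ε))}
    (hq : ∀ α l, q (α.cls _) (fun r => (l r).cls ∅) =
        (loopFibreData hε hr Θ H).higher τ (hBased n x₀ ε) α (List.ofFn l))
    (α : Cube (BasedPairs n x₀ ε)) :
    q (α.cls _) Fin.elim0 = capCube τ evBased (hBased n x₀ ε) α := by
  refine Eq.trans ?_ ((hq α Fin.elim0).trans ((loopFibreData hε hr Θ H).higher_nil τ α))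
  exact congrArg (q _) (funext fun r => r.elim0)

end Concrete


end LoopCap

open LoopCap

/-! ### Assembly of the three assertions -/

theorem mainTheorem5 {n : ℕ} {M : Type*} [MetricSpace M]
    [ChartedSpace (EuclideanSpace ℝ (Fin n)) M] [IsManifold (𝓡 n) ∞ M]
    [RiemannianBundle (fun x : M => TangentSpace (𝓡 n) x)]
    [IsContMDiffRiemannianBundle (𝓡 n) ∞ (EuclideanSpace ℝ (Fin n))
      (fun x : M => TangentSpace (𝓡 n) x)]
    [IsRiemannianManifold (𝓡 n) M] [CompactSpace M]
    (o : OrientationForm n M) (x₀ : M) (ε : ℝ) (hε : 0 < ε)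
    (hr : ENNReal.ofReal (2 * ε) < injRadius n M)
    (Θ : TransitiveDiffeoLift n M ε) (H : EmbHomotopy o x₀ ε) :
    -- `C_*(Ω)` is a differential graded algebra, and source and target are modules over it
    (IsDGAlgebra (chainsOfDegree ∅) (chainD ∅)
        (loopMulC n x₀) (loopOneC n x₀) ∧
      IsDGModule (chainsOfDegree ∅) (chainD ∅)
        (loopMulC n x₀) (loopOneC n x₀)
        (chainsOfDegree _) (chainD _) (actLoopA (x₀ := x₀) Θ hε hr) ∧
      IsDGModule (chainsOfDegree ∅) (chainD ∅)
        (loopMulC n x₀) (loopOneC n x₀)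
        (chainsOfDegree _) (chainD _) (actLoopH (x₀ := x₀) Θ)) ∧
    -- the maps `q_k` are well defined and form a morphism of modules up to homotopy
    (∀ τ : Chains (nbhdFar x₀ ε) →ₗ[ℝ] ℝ,
      IsRelCocycle n τ → IsSOInvariant o τ →
      ∃ q : ∀ k : ℕ, Chains (aBased n x₀ ε) →ₗ[ℝ]
          MultilinearMap ℝ (fun _ : Fin k => Chains (∅ : Set (BasedLoops n x₀)))
            (Chains (hBased n x₀ ε)),
        (∀ α : Cube (BasedPairs n x₀ ε), q 0 (α.cls _) Fin.elim0 =
          capCube τ evBased (hBased n x₀ ε) α) ∧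
        (∀ (k : ℕ) (α : Cube (BasedPairs n x₀ ε))
          (l : Fin (k + 1) → Cube (BasedLoops n x₀)),
          q (k + 1) (α.cls _) (fun i => (l i).cls ∅) =
            higherMap Θ H τ α (List.ofFn l)) ∧
        IsAInfinityMorphism (chainsOfDegree ∅) (chainD ∅)
          (loopMulC n x₀)
          (chainsOfDegree _) (chainD _) (actLoopA Θ hε hr)
          (chainsOfDegree _) (chainD _) (actLoopH Θ) (-n) q) ∧
    -- the version for the free loop space
    (∀ (K : HCHomotopy H) (τ : Chains (diagFar M ε) →ₗ[ℝ] ℝ),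
      IsRelCocycle n τ → IsHCInvariant o (x₀ := x₀) τ →
      ∃ (f : Chains (aFree n M ε) →ₗ[ℝ] Chains (hFree n M ε))
        (q : ∀ k : ℕ, Chains (aBased n x₀ ε) →ₗ[ℝ]
          MultilinearMap ℝ (fun _ : Fin k => Chains (∅ : Set (BasedLoops n x₀)))
            (Chains (hBased n x₀ ε)))
        (η : ∀ k : ℕ, Chains (aBased n x₀ ε) →ₗ[ℝ]
          MultilinearMap ℝ (fun _ : Fin k => Chains (∅ : Set (BasedLoops n x₀)))
            (Chains (∅ : Set (PathsFrom n x₀)) →ₗ[ℝ]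
              Chains (hFree n M ε))),
        (∀ α : Cube (FreePairs n M ε), f (α.cls _) =
          capCube τ evFree (hFree n M ε) α) ∧
        (∀ α : Cube (BasedPairs n x₀ ε), q 0 (α.cls _) Fin.elim0 =
          capCube (τ ∘ₗ pushChains _ _ _ (mapsTo_iota (n := n))) evBased
            (hBased n x₀ ε) α) ∧
        (∀ (k : ℕ) (α : Cube (BasedPairs n x₀ ε))
          (l : Fin (k + 1) → Cube (BasedLoops n x₀)),
          q (k + 1) (α.cls _) (fun i => (l i).cls ∅) =
            higherMap Θ H (τ ∘ₗ pushChains _ _ _ (mapsTo_iota (n := n))) α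
              (List.ofFn l)) ∧
        (∀ (k : ℕ) (α : Cube (BasedPairs n x₀ ε))
          (l : Fin k → Cube (BasedLoops n x₀))
          (p : Cube (PathsFrom n x₀)),
          η k (α.cls _) (fun i => (l i).cls ∅) (p.cls ∅) =
            freeHigherMap Θ K τ α (List.ofFn l) p) ∧
        IsAInfinityMorphism (chainsOfDegree ∅) (chainD ∅)
          (loopMulC n x₀)
          (chainsOfDegree _) (chainD _) (actLoopA Θ hε hr)
          (chainsOfDegree _) (chainD _) (actLoopH Θ) (-n) q ∧
        IsCoherentChainHomotopy (chainsOfDegree ∅) (chainD ∅)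
          (loopMulC n x₀) (chainsOfDegree ∅) (chainD ∅)
          (loopPathC n x₀) (loopToPathC n x₀)
          (chainsOfDegree _) (chainD _) (actLoopA Θ hε hr)
          (chainsOfDegree _) (chainD _) (actPathA Θ hε hr)
          (pushChains _ _ pairIncl mapsTo_pairIncl_a)
          (chainsOfDegree _) (chainD _) (actPathH Θ)
          (pushChains _ _ pairIncl mapsTo_pairIncl_h) (-n) f q η) := by
  -- A smooth metric is continuous. This makes the norm continuous on the tangent bundle, as the
  -- estimates behind continuity of the action need.
  have hRb : IsContinuousRiemannianBundle (EuclideanSpace ℝ (Fin n))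
    (fun x : M => TangentSpace (𝓡 n) x) := by
    obtain ⟨g, hg, hg'⟩ := IsContMDiffRiemannianBundle.exists_contMDiff (IB := 𝓡 n) (n := ∞)
      (F := EuclideanSpace ℝ (Fin n)) (E := fun x : M => TangentSpace (𝓡 n) x)
    exact ⟨g, hg.continuous, hg'⟩
  refine ⟨⟨isDGAlgebra_crossChains continuous_loopMul _ loopMul_assoc one_loopMul loopMul_one,
    isDGModule_crossChains continuous_loopMul _ (continuous_actLoop Θ) _ (actLoop_one Θ)
      (actLoop_actLoop Θ),
    isDGModule_crossChains continuous_loopMul _ (continuous_actLoop Θ) _ (actLoop_one Θ)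
      (actLoop_actLoop Θ)⟩, fun τ hτ hinv => ?_, fun K τ hτ hinv => ?_⟩
  · choose q hq using exists_loop_higher hε hr Θ H τ
    exact ⟨q, loop_higher_zero hε hr Θ H (hq 0),
      fun k α l => (hq (k + 1) α l).trans (higher_loopFibreData hε hr Θ H τ α _),
      isAInfinityMorphism_loop hε hr Θ H hτ hinv q hq⟩
  · choose q hq using exists_loop_higher hε hr Θ H
      (τ ∘ₗ pushChains _ _ _ (mapsTo_iota (n := n)))
    choose η hη using (loopPathData hε hr Θ H K).exists_higher τ (cube_aBased hε)
      (actPath_mem_h Θ) (fun f => f.2.2.2.2.1)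
    -- The based maps belong to the restricted cochain; `hτ.comp_pushChains` and
    -- `hinv.comp_pushChains` supply its cocycle property and its invariance.
    refine ⟨liftChains (aFree n M ε) (capCube τ evFree (hFree n M ε)) fun α hα =>
        PathData.capCube_eq_zero τ (cube_aFree hε) hα, q, η,
      liftChains_cls _ _ _, loop_higher_zero hε hr Θ H (hq 0),
      fun k α l => (hq (k + 1) α l).trans (higher_loopFibreData hε hr Θ H _ α _),
      fun k α l p => (hη k α l p).trans (higher_loopPathData hε hr Θ H K τ α _ p),
      isAInfinityMorphism_loop hε hr Θ H
        (hτ.comp_pushChains mapsTo_iota (iotaMap x₀ ε).contMDiff.continuous)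
        hinv.comp_pushChains q hq,
      (loopRestriction hε hr Θ H K).isCoherentChainHomotopy τ one_loopMul
        (T₀ := {f | f.1 ∈ HCSOEmb o x₀ ε}) (fun f => K.zero f.1 f.2)
        (fun κ ψ hψ => hinv κ (ψ.map Subtype.val continuous_subtype_val) hψ) hτ mapsTo_iota
        (fun _ h => h.elim) (fun _ h => h.elim) (fun _ h => h.elim) (actLoop_mem_a Θ hε hr)
        (actPath_mem_a Θ hε hr) mapsTo_pairIncl_a (actPath_mem_h Θ) mapsTo_pairIncl_h _
        (liftChains_cls _ _ _) q hq η hη⟩
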